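/- **Setting.** Let $\theta>0$, $\omega=2\pi/\theta$, and let $\mathcal H_B$ be the Bargmann space of holomorphic functions on $\mathbb C^2$ with scalar product $\langle\phi,\chi\rangle_B=\int\bar\phi\,\chi\,d\mu$, $d\mu=(\omega/\pi)^2e^{-\omega|z|^2}d^4z$. Let $\mathcal E\subset\mathcal H_B$ be the smooth Heisenberg module, i.e. the image of the Schwartz space $\mathcal S(\mathbb R^2)$ under the Bargmann transform. The noncommutative four-torus algebra $\mathcal A_\theta$ has generators $U_\gamma$, $\gamma=(m_i,n_i)_{i=1,2}\in\mathbb Z^4$, with $U_\gamma U_{\gamma'}=e^{-i\pi\Theta(\gamma,\gamma')}U_{\gamma+\gamma'}$, $\Theta(\gamma,\gamma')=\theta\sum_i(m_in_i'-n_im_i')$, and trace $\mathrm{Tr}_{\mathcal A_\theta}(\sum_\gamma a_\gamma U_\gamma)=a_0$. It acts on the right on $\mathcal E$ by $(\phi U_\gamma)(z)=e^{-\frac\omega2|v|^2-\omega\bar v z}\phi(z+v)$, where $v=\tfrac{\theta}{\sqrt2}(m+in)\in\mathbb C^2$, and $(\phi,\chi)=\sum_\gamma\langle\phi,\chi U_\gamma\rangle_B\,U_{-\gamma}$.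 Let $\mu_0,\lambda,\lambda'\in\mathbb R$ and consider the action $$S[\phi]=\mathrm{Tr}_{\mathcal A_\theta}[(\phi,H\phi)]+\tfrac\lambda2\,\mathrm{Tr}_{\mathcal A_\theta}\big[(\phi,\phi)^2\big]+\tfrac{\lambda'}2\big(\mathrm{Tr}_{\mathcal A_\theta}[(\phi,\phi)]\big)^2,$$ $$H=-\sum_{i=1}^{2}\big(\nabla_{1,i}^2+\nabla_{2,i}^2\big)+\mu_0^2=2\omega\sum_{i=1}^2\big(z_i\partial_i+\tfrac12\big)+\mu_0^2,$$ with the Heisenberg connection $\nabla_{1,i}=\frac1{i\sqrt2}(\partial_i+\omega z_i)$, $\nabla_{2,i}=\frac1{\sqrt2}(\partial_i-\omega z_i)$. Regularize the propagator by $H_\varepsilon^{-1}=\int_\varepsilon^\infty e^{-\beta H}d\beta$, $\varepsilon>0$. Regarding the complex field as a real one, let $V_\phi$ be the Hessian of the interaction (the sum of the $\lambda$ and $\lambda'$ terms) at the external field $\phi\in\mathcal E$; the Hessian of the quadratic part is $2H$. The regularized one-loop effective action is the formal series $\tfrac12\mathrm{Tr}\log\big(1+\tfrac12H_\varepsilon^{-1}V_\phi\big)=\sum_{N\ge1}\Gamma^{(1)}_{2N,\varepsilon}[\phi]$,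 with $$\Gamma^{(1)}_{2N,\varepsilon}[\phi]=\frac{(-1)^{N+1}}{2N}\,\mathrm{Tr}\Big[\big(\tfrac12H_\varepsilon^{-1}V_\phi\big)^N\Big],$$ the trace being computed in the eigenbasis of $H$. The functional $\Gamma^{(1)}_{2N,\varepsilon}$, homogeneous of degree $2N$ in $\phi$, is the one-loop one-particle irreducible $2N$-point function; it is the sum of all one-loop graphs with $2N$ external legs, planar and non-planar, with any mixture of the $\lambda$- and $\lambda'$-vertices. **Statement (one-loop renormalizability).** Let $\theta>0$ be irrational and satisfy the weak Diophantine condition: there are constants $C_1,C_2>0$ such that $\inf_{m\in\mathbb Z}|n\theta-m|\ge C_1e^{-C_2|n|}$ for all $n\in\mathbb Z\setminus\{0\}$ (this holds in particular if $\theta$ is Diophantine, i.e. $\inf_m|n\theta-m|\ge C|n|^{-(1+\delta)}$ for some $C,\delta>0$ and all $n\neq0$). Let $\mu_0,\lambda,\lambda'\in\mathbb R$. Then for all $\varepsilon>0$, $N\ge1$, $\phi\in\mathcal E$ the sum over basis vectors that defines $\Gamma^{(1)}_{2N,\varepsilon}[\phi]$ converges absolutely, and all one-loop divergences are absorbed by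 shifts of $\mu_0^2$, $\lambda$ and $\lambda'$: there are functions $\delta\mu^2(\varepsilon),\delta\lambda(\varepsilon),\delta\lambda'(\varepsilon)\in\mathbb R$, independent of the external field, such that for every $\phi\in\mathcal E$ the following have finite limits as $\varepsilon\to0^+$: 1. $\delta\mu^2(\varepsilon)\,\mathrm{Tr}_{\mathcal A_\theta}[(\phi,\phi)]+\Gamma^{(1)}_{2,\varepsilon}[\phi]$; 2. $\tfrac{\delta\lambda(\varepsilon)}2\mathrm{Tr}_{\mathcal A_\theta}[(\phi,\phi)^2]+\tfrac{\delta\lambda'(\varepsilon)}2\big(\mathrm{Tr}_{\mathcal A_\theta}[(\phi,\phi)]\big)^2+\Gamma^{(1)}_{4,\varepsilon}[\phi]$; 3. $\Gamma^{(1)}_{2N,\varepsilon}[\phi]$ for every $N\ge3$ (no counterterm is needed). In particular the model is one-loop renormalizable. -/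

import Mathlib

open MeasureTheory Filter Topology
open scoped SchwartzMap ComplexConjugate

namespace HeisenbergModel

noncomputable section

/-! ### Arithmetic conditions -/

/-- The ordinary Diophantine condition `‖n θ‖_𝕋 ≥ C |n|^{-(1+δ)}`, with `C, δ` uniform in `n`. -/
def IsDiophantine (θ : ℝ) : Prop :=
  Irrational θ ∧ ∃ C : ℝ, 0 < C ∧ ∃ δ : ℝ, 0 < δ ∧ ∀ n : ℤ, n ≠ 0 → ∀ m : ℤ,
    C * |(n : ℝ)| ^ (-(1 + δ)) ≤ |(n : ℝ) * θ - m|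

/-- The weak Diophantine condition `‖n θ‖_𝕋 ≥ C₁ exp (-C₂ |n|)`, with `C₁, C₂` uniform in `n`. -/
def IsWeakDiophantine (θ : ℝ) : Prop :=
  Irrational θ ∧ ∃ C₁ : ℝ, 0 < C₁ ∧ ∃ C₂ : ℝ, 0 < C₂ ∧ ∀ n : ℤ, n ≠ 0 → ∀ m : ℤ,
    C₁ * Real.exp (-C₂ * |(n : ℝ)|) ≤ |(n : ℝ) * θ - m|

theorem IsDiophantine.isWeakDiophantine {θ : ℝ} (h : IsDiophantine θ) : IsWeakDiophantine θ := by
  obtain ⟨hirr, C, hC, δ, hδ, h⟩ := h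
  refine ⟨hirr, C, hC, 1 + δ, by linarith, fun n hn m => le_trans ?_ (h n hn m)⟩
  have hn0 : 0 < |(n : ℝ)| := abs_pos.mpr (by exact_mod_cast hn)
  refine mul_le_mul_of_nonneg_left ?_ hC.le
  rw [Real.rpow_def_of_pos hn0]
  refine Real.exp_le_exp.mpr ?_
  have h1 : Real.log |(n : ℝ)| ≤ |(n : ℝ)| := (Real.log_le_sub_one_of_pos hn0).trans (by linarith)
  nlinarith

/-! ### The noncommutative four-torus

The lattice `Γ ≅ ℤ⁴` is indexed by `γ : Fin 2 → ℤ × ℤ`, `γ i = (mᵢ, nᵢ)`. An element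
`∑ a_γ U_γ` of the algebra is represented by its family of coefficients `a_γ`. -/

/-- The skew form `Θ(γ, γ') = θ ∑ᵢ (mᵢ nᵢ' - nᵢ mᵢ')`. -/
def thetaForm (θ : ℝ) (γ γ' : Fin 2 → ℤ × ℤ) : ℝ :=
  θ * ∑ i, (((γ i).1 : ℝ) * (γ' i).2 - ((γ i).2 : ℝ) * (γ' i).1)

/-- The product determined by `U_γ U_γ' = exp (-iπ Θ(γ, γ')) U_{γ + γ'}`. -/
def torusMul (θ : ℝ) (a b : (Fin 2 → ℤ × ℤ) → ℂ) : (Fin 2 → ℤ × ℤ) → ℂ := fun γ =>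
  ∑' γ' : Fin 2 → ℤ × ℤ,
    a γ' * b (γ - γ') * Complex.exp (-(Complex.I * Real.pi * thetaForm θ γ' (γ - γ')))

/-- The trace `Tr (∑ a_γ U_γ) = a_0`. -/
def torusTrace (a : (Fin 2 → ℤ × ℤ) → ℂ) : ℂ := a 0

/-! ### The Heisenberg module over it, in the holomorphic representation on `ℂ²` -/

/-- The frequency `ω = 2π / θ`. -/
def freq (θ : ℝ) : ℝ := 2 * Real.pi / θ

/-- The Bargmann scalar product `∫ conj φ χ dμ`, `dμ = (ω/π)² exp (-ω |z|²) d Re z d Im z`. -/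
def bargmannInner (θ : ℝ) (φ χ : (Fin 2 → ℂ) → ℂ) : ℂ :=
  ∫ z : Fin 2 → ℂ, conj (φ z) * χ z *
    (((freq θ / Real.pi) ^ 2 * Real.exp (-freq θ * ∑ i, ‖z i‖ ^ 2) : ℝ) : ℂ)

/-- The projective representation of the translations of `ℂ²`. -/
def weyl (θ : ℝ) (v : Fin 2 → ℂ) (φ : (Fin 2 → ℂ) → ℂ) : (Fin 2 → ℂ) → ℂ := fun z =>
  Complex.exp (-(freq θ / 2 * ∑ i, (‖v i‖ : ℂ) ^ 2) - freq θ * ∑ i, conj (v i) * z i) * φ (z + v)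

/-- The lattice points `(θ/√2) (m + i n) ∈ ℂ²`. -/
def latticePoint (θ : ℝ) (γ : Fin 2 → ℤ × ℤ) : Fin 2 → ℂ := fun i =>
  ((θ / √2 : ℝ) : ℂ) * ((γ i).1 + (γ i).2 * Complex.I)

/-- The right action `φ ↦ φ U_γ`. -/
def rightAct (θ : ℝ) (φ : (Fin 2 → ℂ) → ℂ) (γ : Fin 2 → ℤ × ℤ) : (Fin 2 → ℂ) → ℂ :=
  weyl θ (latticePoint θ γ) φ

/-- The algebra-valued scalar product `(φ, χ) = ∑_γ ⟨φ, χ U_γ⟩ U_{-γ}`. -/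
def pairing (θ : ℝ) (φ χ : (Fin 2 → ℂ) → ℂ) : (Fin 2 → ℤ × ℤ) → ℂ := fun γ =>
  bargmannInner θ φ (rightAct θ χ (-γ))

/-- The Bargmann transform `L²(ℝ²) → L²_hol(ℂ², dμ)`. -/
def bargmannTransform (θ : ℝ) (χ : EuclideanSpace ℝ (Fin 2) → ℂ) : (Fin 2 → ℂ) → ℂ := fun z =>
  (√(freq θ / Real.pi) : ℂ) * ∫ x : EuclideanSpace ℝ (Fin 2),
    Complex.exp (-(freq θ / 2 * ∑ i, ((x i : ℂ) ^ 2 + z i ^ 2)) +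
      √2 * freq θ * ∑ i, z i * x i) * χ x

/-- The smooth Heisenberg module: the image of the Schwartz space under the Bargmann transform. -/
def smoothModule (θ : ℝ) : Set ((Fin 2 → ℂ) → ℂ) :=
  Set.range fun χ : 𝓢(EuclideanSpace ℝ (Fin 2), ℂ) => bargmannTransform θ χ

/-! ### The action functional -/

/-- The covariant derivatives `∇₁ = (∂ᵢ + ω zᵢ) / (i√2)` in the two complex directions. -/
def nabla₁ (θ : ℝ) (i : Fin 2) (φ : (Fin 2 → ℂ) → ℂ) : (Fin 2 → ℂ) → ℂ := fun z =>
  (1 / (Complex.I * √2)) * (fderiv ℂ φ z (Pi.single i 1) + freq θ * z i * φ z)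

/-- The covariant derivatives `∇₂ = (∂ᵢ - ω zᵢ) / √2` in the two complex directions. -/
def nabla₂ (θ : ℝ) (i : Fin 2) (φ : (Fin 2 → ℂ) → ℂ) : (Fin 2 → ℂ) → ℂ := fun z =>
  (1 / (√2 : ℂ)) * (fderiv ℂ φ z (Pi.single i 1) - freq θ * z i * φ z)

/-- The operator `H = -∑ ∇_μ² + μ₀²` of the quadratic part `Tr (φ, H φ)` of the action. -/
def hamiltonian (θ μ₀ : ℝ) (φ : (Fin 2 → ℂ) → ℂ) : (Fin 2 → ℂ) → ℂ := fun z =>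
  -(∑ i, (nabla₁ θ i (nabla₁ θ i φ) z + nabla₂ θ i (nabla₂ θ i φ) z)) + (μ₀ : ℂ) ^ 2 * φ z

/-- `Tr (φ, φ)`. -/
def massTerm (θ : ℝ) (φ : (Fin 2 → ℂ) → ℂ) : ℝ := (torusTrace (pairing θ φ φ)).re

/-- `Tr ((φ, φ)²)`. -/
def quarticTerm (θ : ℝ) (φ : (Fin 2 → ℂ) → ℂ) : ℝ :=
  (torusTrace (torusMul θ (pairing θ φ φ) (pairing θ φ φ))).re

/-- `(Tr (φ, φ))²`. -/
def doubleTraceTerm (θ : ℝ) (φ : (Fin 2 → ℂ) → ℂ) : ℝ := massTerm θ φ ^ 2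

/-- The interaction `(λ/2) Tr ((φ, φ)²) + (λ'/2) (Tr (φ, φ))²`. The full action is
`Tr (φ, H φ)` plus this interaction. -/
def interaction (θ lam lam' : ℝ) (φ : (Fin 2 → ℂ) → ℂ) : ℝ :=
  lam / 2 * quarticTerm θ φ + lam' / 2 * doubleTraceTerm θ φ

/-! ### The regularized propagator -/

/-- The orthonormal basis `∏ᵢ (ω^{nᵢ} / nᵢ!)^{1/2} zᵢ^{nᵢ}` of `L²_hol(ℂ², dμ)`. -/
def fockBasis (θ : ℝ) (n : Fin 2 → ℕ) : (Fin 2 → ℂ) → ℂ := fun z =>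
  ∏ i, ((√(freq θ ^ n i / (n i).factorial) : ℝ) : ℂ) * z i ^ n i

/-- The eigenvalues `2ω (n₁ + n₂ + 1) + μ₀²` of `H`. -/
def energy (θ μ₀ : ℝ) (n : Fin 2 → ℕ) : ℝ := 2 * freq θ * ((∑ i, (n i : ℝ)) + 1) + μ₀ ^ 2

/-- `H = 2ω ∑ᵢ (zᵢ ∂ᵢ + 1/2) + μ₀²` on smooth holomorphic functions. -/
theorem hamiltonian_apply (θ μ₀ : ℝ) (φ : (Fin 2 → ℂ) → ℂ) (hφ : Differentiable ℂ φ)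
    (hφ' : Differentiable ℂ (fderiv ℂ φ)) (z : Fin 2 → ℂ) :
    hamiltonian θ μ₀ φ z = 2 * freq θ * (∑ i, (z i * fderiv ℂ φ z (Pi.single i 1) + φ z / 2)) +
      (μ₀ : ℂ) ^ 2 * φ z := by
  have key : ∀ i : Fin 2, nabla₁ θ i (nabla₁ θ i φ) z + nabla₂ θ i (nabla₂ θ i φ) z =
      -(2 * freq θ * (z i * fderiv ℂ φ z (Pi.single i 1) + φ z / 2)) := by
    intro i
    have hz : HasFDerivAt (fun w : Fin 2 → ℂ => w i)
        (ContinuousLinearMap.proj (R := ℂ) (φ := fun _ : Fin 2 => ℂ) i) z :=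
      (ContinuousLinearMap.proj (R := ℂ) (φ := fun _ : Fin 2 => ℂ) i).hasFDerivAt
    have hD : DifferentiableAt ℂ (fun w => fderiv ℂ φ w (Pi.single i 1)) z :=
      (hφ' z).clm_apply (differentiableAt_const _)
    have hM : HasFDerivAt (fun w : Fin 2 → ℂ => (freq θ : ℂ) * w i * φ w) _ z :=
      (hz.const_mul (freq θ : ℂ)).mul (hφ z).hasFDerivAt
    have h1 := ((hD.hasFDerivAt.add hM).const_mul (1 / (Complex.I * √2))).fderiv
    have h2 := ((hD.hasFDerivAt.sub hM).const_mul (1 / (√2 : ℂ))).fderiv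
    have e1 : nabla₁ θ i φ = fun w => (1 / (Complex.I * √2)) *
        (fderiv ℂ φ w (Pi.single i 1) + freq θ * w i * φ w) := rfl
    have e2 : nabla₂ θ i φ = fun w => (1 / (√2 : ℂ)) *
        (fderiv ℂ φ w (Pi.single i 1) - freq θ * w i * φ w) := rfl
    have hs : ((√2 : ℝ) : ℂ) ^ 2 = 2 := by
      rw [← Complex.ofReal_pow, Real.sq_sqrt (by norm_num)]; norm_num
    have hs0 : ((√2 : ℝ) : ℂ) ≠ 0 := by
      intro h; rw [h] at hs; norm_num at hs
    have hI : Complex.I ^ 2 = -1 := Complex.I_sq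
    have d1 := congrArg (fun L => L (Pi.single i 1)) h1
    have d2 := congrArg (fun L => L (Pi.single i 1)) h2
    rw [nabla₁, nabla₂, e1, e2]
    erw [d1, d2]
    simp only [smul_apply, add_apply,
      sub_apply, ContinuousLinearMap.proj_apply, Pi.single_eq_same,
      smul_eq_mul, one_div, mul_inv]
    have hs' : ((√2 : ℝ) : ℂ)⁻¹ ^ 2 = 1 / 2 := by rw [inv_pow, hs]; norm_num
    have hI' : Complex.I⁻¹ ^ 2 = -1 := by rw [inv_pow, hI]; norm_num
    generalize ((√2 : ℝ) : ℂ)⁻¹ = r at *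
    generalize Complex.I⁻¹ = j at *
    generalize (fderiv ℂ (fun w => fderiv ℂ φ w (Pi.single i 1)) z) (Pi.single i 1) = D2 at *
    generalize (fderiv ℂ φ z) (Pi.single i 1) = D1 at *
    linear_combination r ^ 2 * (D2 + 2 * freq θ * z i * D1 + freq θ * φ z +
      freq θ ^ 2 * z i ^ 2 * φ z) * hI' - (4 * freq θ * z i * D1 + 2 * freq θ * φ z) * hs'
  simp only [hamiltonian, key, Finset.sum_neg_distrib, neg_neg, Finset.mul_sum]

/-- The basis vectors are eigenvectors of `H`. -/
theorem hamiltonian_fockBasis (θ μ₀ : ℝ) (n : Fin 2 → ℕ) :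
    hamiltonian θ μ₀ (fockBasis θ n) = fun z => (energy θ μ₀ n : ℂ) * fockBasis θ n z := by
  have hC : ContDiff ℂ 2 (fockBasis θ n) := by
    unfold fockBasis
    fun_prop
  have hd : Differentiable ℂ (fockBasis θ n) := hC.differentiable (by norm_num)
  have hd' : Differentiable ℂ (fderiv ℂ (fockBasis θ n)) :=
    (hC.fderiv_right (m := 1) (by norm_num)).differentiable (by norm_num)
  funext z
  rw [hamiltonian_apply θ μ₀ _ hd hd' z]
  have euler : ∀ i : Fin 2, z i * fderiv ℂ (fockBasis θ n) z (Pi.single i 1) =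
      n i * fockBasis θ n z := by
    intro i
    have hpow : ∀ (k : ℕ) (w : ℂ), w * (k * w ^ (k - 1)) = k * w ^ k := by
      intro k w
      cases k with
      | zero => simp
      | succ k => simp only [Nat.add_sub_cancel]; ring
    have hp : ∀ k : Fin 2, HasFDerivAt (fun w : Fin 2 → ℂ => w k)
        (ContinuousLinearMap.proj (R := ℂ) (φ := fun _ : Fin 2 => ℂ) k) z := fun k =>
      (ContinuousLinearMap.proj (R := ℂ) (φ := fun _ : Fin 2 => ℂ) k).hasFDerivAt
    have h0 := ((hp 0).pow (n 0)).const_mul ((√(freq θ ^ n 0 / (n 0).factorial) : ℝ) : ℂ)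
    have h1 := ((hp 1).pow (n 1)).const_mul ((√(freq θ ^ n 1 / (n 1).factorial) : ℝ) : ℂ)
    have hf : fockBasis θ n = fun w => (((√(freq θ ^ n 0 / (n 0).factorial) : ℝ) : ℂ) * w 0 ^ n 0) *
        (((√(freq θ ^ n 1 / (n 1).factorial) : ℝ) : ℂ) * w 1 ^ n 1) := by
      funext w; simp [fockBasis, Fin.prod_univ_two]
    have hm := congrArg (fun L => L (Pi.single i 1)) (h0.mul h1).fderiv
    rw [hf]
    erw [hm]
    clear hm hf h0 h1 hp
    generalize ((√(freq θ ^ n 0 / (n 0).factorial) : ℝ) : ℂ) = c₀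
    generalize ((√(freq θ ^ n 1 / (n 1).factorial) : ℝ) : ℂ) = c₁
    fin_cases i
    · have := hpow (n 0) (z 0)
      simp
      linear_combination (c₀ * c₁ * z 1 ^ n 1) * this
    · have := hpow (n 1) (z 1)
      simp
      linear_combination (c₀ * c₁ * z 0 ^ n 0) * this
  simp only [euler, energy, Fin.sum_univ_two]
  push_cast
  ring

/-- The eigenvalue of `H_ε⁻¹ = ∫_ε^∞ exp (-β H) dβ` on the basis vector `n`. -/
def propagator (θ μ₀ ε : ℝ) (n : Fin 2 → ℕ) : ℝ :=
  ∫ β in Set.Ioi ε, Real.exp (-β * energy θ μ₀ n)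

/-! ### The one-loop effective action

The complex field is regarded as a real one, with the real basis `e_n, i e_n`. In it the Hessian of
the quadratic part `Tr (φ, H φ)` is diagonal with entries `2 E_n`, so that its regularized inverse
is `H_ε⁻¹ / 2`. With `V_φ` the Hessian of the interaction at the external field `φ`, the one-loop
effective action is `(1/2) Tr log (1 + (H_ε⁻¹ / 2) V_φ)`. Since `V_φ` is of degree two in `φ`, the
term of order `N` of the expansion of the logarithm is of degree `2N` in `φ`: it is the sum of all
one-loop one-particle irreducible graphs with `2N` external legs. -/

/-- The real basis of the field space: `e_n` for `(n, false)` and `i e_n` for `(n, true)`. -/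
def realBasis (θ : ℝ) (a : (Fin 2 → ℕ) × Bool) : (Fin 2 → ℂ) → ℂ := fun z =>
  (if a.2 then Complex.I else 1) * fockBasis θ a.1 z

/-- The second variation `∂_s ∂_t S[φ + s h + t k]` at `s = t = 0`. -/
def hessian (S : ((Fin 2 → ℂ) → ℂ) → ℝ) (φ h k : (Fin 2 → ℂ) → ℂ) : ℝ :=
  deriv (fun s : ℝ => deriv (fun t : ℝ => S (φ + s • h + t • k)) 0) 0

/-- The contribution of the closed chain of basis vectors `a₀, a₁, …, a_{N-1}, a₀` to the trace of
`((H_ε⁻¹ / 2) V_φ)^N`. -/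
def loopSummand (θ μ₀ lam lam' ε : ℝ) (φ : (Fin 2 → ℂ) → ℂ) (N : ℕ)
    (a : Fin N → (Fin 2 → ℕ) × Bool) : ℝ :=
  ∏ j, (propagator θ μ₀ ε (a j).1 / 2 *
    hessian (interaction θ lam lam') φ (realBasis θ (a j)) (realBasis θ (a (finRotate N j))))

/-- The one-loop one-particle irreducible `2N`-point function with all external fields equal to `φ`:
the term `(1/2) ((-1)^{N+1} / N) Tr (((H_ε⁻¹ / 2) V_φ)^N)` of the one-loop effective action. -/
def oneLoop (θ μ₀ lam lam' ε : ℝ) (N : ℕ) (φ : (Fin 2 → ℂ) → ℂ) : ℝ :=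
  1 / 2 * ((-1) ^ (N + 1) / N) * ∑' a, loopSummand θ μ₀ lam lam' ε φ N a

end

end HeisenbergModel

/-!
In the Bargmann representation the algebra acts through Weyl operators `W_v` (`weyl`), and the
vectors of the smooth module are entire functions whose weighted modulus decays rapidly (`Smooth`,
`smooth_of_mem_smoothModule`), so that all matrix coefficients `⟨f, W_v g⟩` decay rapidly in `v`.
Traces with one or two propagators become values and overlaps of the density of an average of Weyl
operators; longer loops need only a bound on the Hessian.

*Propagator.* The heat semigroup is a Gaussian average of Weyl operators. Hence the regularized
propagator is an average with the density `propDensity` (`Smooth.hasSum_propagator`), and its trace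
against `W_u` is a multiple of `propDensity θ μ₀ ε u` (`hasSum_trace_propagator`). As `ε → 0` the
density is bounded by `|η|⁻²` times a Gaussian.

*Hessian.* It is the sum of a complex linear part, an antilinear part and a rank one term
(`Smooth.hessian_interaction`, `hessMat_eq`). Poisson summation (`exists_poisson`) and the
orthogonality relations give the Janssen representation (`exists_janssen`), by which the linear part
is an absolutely summable series of Weyl operators over the lattice and the dual lattice
(`Smooth.hasSum_hessLin`). It also bounds the frame operator of `φ`, and hence the Hessian
(`Smooth.exists_hessOp`).

*At least three vertices.* The cube of `H⁻¹` is trace class on `L²(ℝ²)`, and a Hilbert–Schmidt bound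
dominates the traces uniformly in the cut-off (`exists_tendsto_tsum_loop`).

*One vertex.* Only the linear part has a divergent trace. Its Weyl operators contribute
`propDensity θ μ₀ ε v`, which diverges for `v = 0` only, with a coefficient proportional to `Tr (φ, φ)`
(`Smooth.exists_tendsto_oneLoop_one`).

*Two vertices.* The rank one term converges, and linear and antilinear part do not interfere
(`tsum_mainMat_eq`). What is left are overlaps of two densities at relative positions in the group
generated by the lattice and its dual. An overlap diverges logarithmically (`selfOverlap`) at
relative position zero; elsewhere it is bounded by the logarithm of the distance. For irrational `θ`
the relative position vanishes only for coinciding indices. The group is dense, but under the weak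
Diophantine condition the logarithm grows at most linearly in the index
(`IsWeakDiophantine.exists_log_le`), against rapidly decaying coefficients. The divergent
coefficients are combinations of `Tr (φ, φ)²` and `(Tr (φ, φ))²`: for the linear part by the Janssen
representation (`Smooth.tsum_symbolCoef_opposite`), for the antilinear part after Poisson summation
(`Smooth.exists_tendsto_antiPart`).
-/

namespace HeisenbergModel

section

/-! ### Entire functions of rapid decay in the Bargmann representation -/

/-- The modulus of `f` times the square root of the Gaussian weight `exp (-ω |z|²)`, without its
normalization. Weyl operators act on it by translations. -/
noncomputable def wt (θ : ℝ) (f : (Fin 2 → ℂ) → ℂ) (z : Fin 2 → ℂ) : ℝ :=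
  ‖f z‖ * Real.exp (-(freq θ / 2) * ∑ i, ‖z i‖ ^ 2)

/-- Entire functions whose weighted modulus decays faster than any power. The smooth module consists
of such functions; equality is not needed. -/
structure Smooth (θ : ℝ) (f : (Fin 2 → ℂ) → ℂ) : Prop where
  diff : Differentiable ℂ f
  decay : ∀ K : ℕ, ∃ C : ℝ, ∀ z, (1 + ‖z‖) ^ K * wt θ f z ≤ C

/-- The symplectic form in the composition law of the Weyl operators. -/
noncomputable def sig (θ : ℝ) (u v : Fin 2 → ℂ) : ℝ := freq θ * ∑ i, (conj (u i) * v i).im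

variable {θ : ℝ} {f g h : (Fin 2 → ℂ) → ℂ}

lemma wt_nonneg (f : (Fin 2 → ℂ) → ℂ) (z : Fin 2 → ℂ) : 0 ≤ wt θ f z := by
  unfold wt; positivity

lemma wt_weyl (v : Fin 2 → ℂ) (f : (Fin 2 → ℂ) → ℂ) (z : Fin 2 → ℂ) :
    wt θ (weyl θ v f) z = wt θ f (z + v) := by
  unfold wt weyl
  rw [norm_mul, Complex.norm_exp, mul_comm (Real.exp _), mul_assoc, ← Real.exp_add]
  congr 2
  simp only [Complex.sub_re, Complex.neg_re, Fin.sum_univ_two, Pi.add_apply,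
    ← Complex.normSq_eq_norm_sq, Complex.normSq_apply, Complex.add_re, Complex.add_im,
    Complex.mul_re, Complex.mul_im, Complex.conj_re, Complex.conj_im, ← Complex.ofReal_pow,
    Complex.ofReal_re, Complex.ofReal_im]
  have : ∀ r : ℝ, ((r : ℂ) / 2).re = r / 2 ∧ ((r : ℂ) / 2).im = 0 := by
    intro r
    have : (r : ℂ) / 2 = ((r / 2 : ℝ) : ℂ) := by push_cast; rfl
    rw [this]; simp
  rw [(this _).1, (this _).2]
  ring

lemma weyl_zero (f : (Fin 2 → ℂ) → ℂ) : weyl θ 0 f = f := by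
  funext z; simp [weyl]

lemma weyl_weyl (u v : Fin 2 → ℂ) (f : (Fin 2 → ℂ) → ℂ) :
    weyl θ u (weyl θ v f) = fun z => Complex.exp (Complex.I * sig θ u v) * weyl θ (u + v) f z := by
  funext z
  unfold weyl sig
  rw [← mul_assoc, ← mul_assoc, ← Complex.exp_add, ← Complex.exp_add, add_assoc z]
  congr 2
  simp only [Fin.sum_univ_two, Pi.add_apply, ← Complex.ofReal_pow,
    ← Complex.normSq_eq_norm_sq, ← Complex.mul_conj, map_add]
  have him : ∀ w : ℂ, ((w.im : ℝ) : ℂ) = (w - conj w) / (2 * Complex.I) := fun w => by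
    rw [Complex.sub_conj]; field_simp; push_cast; ring
  push_cast
  rw [him, him]
  simp only [map_mul, Complex.conj_conj]
  field_simp
  ring

lemma Smooth.add (hf : Smooth θ f) (hg : Smooth θ g) : Smooth θ (f + g) := by
  refine ⟨hf.diff.add hg.diff, fun K => ?_⟩
  obtain ⟨C, hC⟩ := hf.decay K
  obtain ⟨D, hD⟩ := hg.decay K
  refine ⟨C + D, fun z => le_trans ?_ (add_le_add (hC z) (hD z))⟩
  rw [← mul_add]
  refine mul_le_mul_of_nonneg_left ?_ (by positivity)
  unfold wt
  rw [← add_mul]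
  exact mul_le_mul_of_nonneg_right (norm_add_le _ _) (Real.exp_nonneg _)

lemma Smooth.const_mul (c : ℂ) (hf : Smooth θ f) : Smooth θ (fun z => c * f z) := by
  refine ⟨hf.diff.const_mul c, fun K => ?_⟩
  obtain ⟨C, hC⟩ := hf.decay K
  refine ⟨‖c‖ * C, fun z => le_trans (le_of_eq ?_) (mul_le_mul_of_nonneg_left (hC z) (norm_nonneg c))⟩
  unfold wt
  rw [norm_mul]; ring

lemma Smooth.smul (s : ℝ) (hf : Smooth θ f) : Smooth θ (s • f) := by
  have : s • f = fun z => (s : ℂ) * f z := by funext z; simp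
  rw [this]; exact hf.const_mul _

lemma one_add_norm_le (z v : Fin 2 → ℂ) : 1 + ‖z‖ ≤ (1 + ‖v‖) * (1 + ‖z + v‖) := by
  have : ‖z‖ ≤ ‖z + v‖ + ‖v‖ := by
    simpa using norm_sub_le (z + v) v
  nlinarith [norm_nonneg v, norm_nonneg (z + v)]

lemma Smooth.map_weyl (v : Fin 2 → ℂ) (hf : Smooth θ f) : Smooth θ (weyl θ v f) := by
  refine ⟨?_, fun K => ?_⟩
  · have := hf.diff
    unfold weyl
    fun_prop
  · obtain ⟨C, hC⟩ := hf.decay K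
    refine ⟨(1 + ‖v‖) ^ K * C, fun z => ?_⟩
    rw [wt_weyl]
    calc (1 + ‖z‖) ^ K * wt θ f (z + v) ≤ ((1 + ‖v‖) * (1 + ‖z + v‖)) ^ K * wt θ f (z + v) := by
          have := one_add_norm_le z v
          have := wt_nonneg (θ := θ) f (z + v)
          gcongr
      _ = (1 + ‖v‖) ^ K * ((1 + ‖z + v‖) ^ K * wt θ f (z + v)) := by
          rw [mul_pow]; ring
      _ ≤ _ := mul_le_mul_of_nonneg_left (hC _) (by positivity)

lemma Smooth.exists_le (hf : Smooth θ f) (K : ℕ) :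
    ∃ C : ℝ, 0 ≤ C ∧ ∀ z, wt θ f z ≤ C * ((1 + ‖z‖) ^ K)⁻¹ := by
  obtain ⟨C, hC⟩ := hf.decay K
  refine ⟨C, le_trans (by have := wt_nonneg (θ := θ) f 0; positivity) (hC 0), fun z => ?_⟩
  have h1 : 0 < (1 + ‖z‖) ^ K := by positivity
  rw [← div_eq_mul_inv, le_div_iff₀ h1, mul_comm]
  exact hC z

lemma Smooth.continuous_wt (hf : Smooth θ f) : Continuous (wt θ f) := by
  have := hf.diff.continuous
  unfold wt
  fun_prop

lemma integrable_inv_pow : Integrable (fun z : Fin 2 → ℂ => ((1 + ‖z‖) ^ 5)⁻¹) := by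
  have h := integrable_one_add_norm (E := Fin 2 → ℂ) (μ := volume) (r := 5) (by
    rw [Module.finrank_pi_fintype]; simp [Complex.finrank_real_complex]; norm_num)
  refine h.congr (Eventually.of_forall fun z => ?_)
  simp only []
  rw [Real.rpow_neg (by positivity)]
  norm_cast

lemma Smooth.integrable_wt (hf : Smooth θ f) : Integrable (wt θ f) := by
  obtain ⟨C, hC0, hC⟩ := hf.exists_le 5
  refine (integrable_inv_pow.const_mul C).mono' hf.continuous_wt.aestronglyMeasurable
    (Eventually.of_forall fun z => ?_)
  rw [Real.norm_of_nonneg (wt_nonneg _ _)]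
  exact hC z

lemma Smooth.bdd_wt (hf : Smooth θ f) : ∃ C : ℝ, 0 ≤ C ∧ ∀ z, wt θ f z ≤ C := by
  obtain ⟨C, hC0, hC⟩ := hf.exists_le 0
  exact ⟨C, hC0, fun z => by simpa using hC z⟩

lemma Smooth.integrable_wt_mul (hf : Smooth θ f) (hg : Smooth θ g) :
    Integrable (fun z => wt θ f z * wt θ g z) := by
  obtain ⟨C, hC0, hC⟩ := hg.bdd_wt
  refine (hf.integrable_wt.mul_const C).mono'
    (hf.continuous_wt.mul hg.continuous_wt).aestronglyMeasurable (Eventually.of_forall fun z => ?_)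
  rw [Real.norm_of_nonneg (mul_nonneg (wt_nonneg _ _) (wt_nonneg _ _))]
  exact mul_le_mul_of_nonneg_left (hC z) (wt_nonneg _ _)

/-! ### The Bargmann scalar product -/

/-- The function `f` times the square root of the Gaussian density. -/
noncomputable def emb (θ : ℝ) (f : (Fin 2 → ℂ) → ℂ) (z : Fin 2 → ℂ) : ℂ :=
  ((freq θ / Real.pi * Real.exp (-(freq θ / 2) * ∑ i, ‖z i‖ ^ 2) : ℝ) : ℂ) * f z

lemma norm_emb (f : (Fin 2 → ℂ) → ℂ) (z : Fin 2 → ℂ) :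
    ‖emb θ f z‖ = |freq θ / Real.pi| * wt θ f z := by
  unfold emb wt
  rw [norm_mul, Complex.norm_real, Real.norm_eq_abs, abs_mul, Real.abs_exp]
  ring

lemma bargmann_integrand (f g : (Fin 2 → ℂ) → ℂ) (z : Fin 2 → ℂ) :
    conj (f z) * g z *
      (((freq θ / Real.pi) ^ 2 * Real.exp (-freq θ * ∑ i, ‖z i‖ ^ 2) : ℝ) : ℂ) =
    conj (emb θ f z) * emb θ g z := by
  unfold emb
  have : Real.exp (-freq θ * ∑ i, ‖z i‖ ^ 2) = Real.exp (-(freq θ / 2) * ∑ i, ‖z i‖ ^ 2) ^ 2 := by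
    rw [← Real.exp_nat_mul]; congr 1; push_cast; ring
  rw [this, map_mul, Complex.conj_ofReal]
  push_cast
  ring

lemma bargmannInner_eq (f g : (Fin 2 → ℂ) → ℂ) :
    bargmannInner θ f g = ∫ z, conj (emb θ f z) * emb θ g z := by
  unfold bargmannInner
  exact integral_congr_ae (Eventually.of_forall fun z => bargmann_integrand f g z)

lemma Smooth.continuous_emb (hf : Smooth θ f) : Continuous (emb θ f) := by
  have := hf.diff.continuous
  unfold emb
  fun_prop

lemma norm_conj_emb_mul (f g : (Fin 2 → ℂ) → ℂ) (z : Fin 2 → ℂ) :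
    ‖conj (emb θ f z) * emb θ g z‖ = (freq θ / Real.pi) ^ 2 * (wt θ f z * wt θ g z) := by
  rw [norm_mul, RCLike.norm_conj, norm_emb, norm_emb, ← sq_abs (freq θ / Real.pi)]
  ring

lemma Smooth.integrable_emb (hf : Smooth θ f) (hg : Smooth θ g) :
    Integrable (fun z => conj (emb θ f z) * emb θ g z) := by
  have hc := hf.continuous_emb
  have hc' := hg.continuous_emb
  refine ((hf.integrable_wt_mul hg).const_mul ((freq θ / Real.pi) ^ 2)).mono'
    (by fun_prop) (Eventually.of_forall fun z => ?_)
  rw [norm_conj_emb_mul]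

lemma norm_bargmannInner_le (f g : (Fin 2 → ℂ) → ℂ) :
    ‖bargmannInner θ f g‖ ≤ (freq θ / Real.pi) ^ 2 * ∫ z, wt θ f z * wt θ g z := by
  rw [bargmannInner_eq, ← integral_const_mul]
  refine (norm_integral_le_integral_norm _).trans (le_of_eq ?_)
  exact integral_congr_ae (Eventually.of_forall fun z => norm_conj_emb_mul f g z)

lemma Smooth.memLp (hf : Smooth θ f) : MemLp (emb θ f) 2 := by
  rw [memLp_two_iff_integrable_sq_norm hf.continuous_emb.aestronglyMeasurable]
  refine ((hf.integrable_wt_mul hf).const_mul ((freq θ / Real.pi) ^ 2)).congr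
    (Eventually.of_forall fun z => ?_)
  simp only [norm_emb, mul_pow, sq_abs]
  ring

/-- The element of `L²(ℂ²)` represented by `f`. -/
noncomputable def Smooth.vec (hf : Smooth θ f) : Lp ℂ 2 (volume : Measure (Fin 2 → ℂ)) := hf.memLp.toLp

lemma Smooth.inner_vec (hf : Smooth θ f) (hg : Smooth θ g) :
    inner ℂ hf.vec hg.vec = bargmannInner θ f g := by
  rw [MeasureTheory.L2.inner_def, bargmannInner_eq]
  refine integral_congr_ae ?_
  filter_upwards [hf.memLp.coeFn_toLp, hg.memLp.coeFn_toLp] with z h1 h2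
  rw [Smooth.vec, Smooth.vec, h1, h2, RCLike.inner_apply, mul_comm]

lemma bargmannInner_conj (f g : (Fin 2 → ℂ) → ℂ) :
    conj (bargmannInner θ f g) = bargmannInner θ g f := by
  rw [bargmannInner_eq, bargmannInner_eq, ← integral_conj]
  congr 1; funext z
  simp [mul_comm]

lemma Smooth.inner_add_right (hf : Smooth θ f) (hg : Smooth θ g) (hh : Smooth θ h) :
    bargmannInner θ f (g + h) = bargmannInner θ f g + bargmannInner θ f h := by
  simp only [bargmannInner_eq]
  rw [← integral_add (hf.integrable_emb hg) (hf.integrable_emb hh)]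
  congr 1; funext z
  simp only [emb, Pi.add_apply]; ring

lemma Smooth.inner_add_left (hf : Smooth θ f) (hg : Smooth θ g) (hh : Smooth θ h) :
    bargmannInner θ (f + g) h = bargmannInner θ f h + bargmannInner θ g h := by
  rw [← bargmannInner_conj, hh.inner_add_right hf hg, map_add, bargmannInner_conj,
    bargmannInner_conj]

lemma inner_const_mul_right (c : ℂ) (f g : (Fin 2 → ℂ) → ℂ) :
    bargmannInner θ f (fun z => c * g z) = c * bargmannInner θ f g := by
  simp only [bargmannInner_eq]
  rw [← integral_const_mul]
  congr 1; funext z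
  simp only [emb]; ring

lemma inner_const_mul_left (c : ℂ) (f g : (Fin 2 → ℂ) → ℂ) :
    bargmannInner θ (fun z => c * f z) g = conj c * bargmannInner θ f g := by
  rw [← bargmannInner_conj, inner_const_mul_right, map_mul, bargmannInner_conj]

lemma weyl_add (v : Fin 2 → ℂ) (f g : (Fin 2 → ℂ) → ℂ) :
    weyl θ v (f + g) = weyl θ v f + weyl θ v g := by
  funext z; simp only [weyl, Pi.add_apply]; ring

lemma weyl_const_mul (v : Fin 2 → ℂ) (c : ℂ) (f : (Fin 2 → ℂ) → ℂ) :
    weyl θ v (fun z => c * f z) = fun z => c * weyl θ v f z := by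
  funext z; simp only [weyl]; ring

/-- The translation of the Gaussian-weighted function underlying the unitarity of `weyl`. -/
lemma emb_weyl_mul (v : Fin 2 → ℂ) (f g : (Fin 2 → ℂ) → ℂ) (z : Fin 2 → ℂ) :
    conj (emb θ (weyl θ v f) z) * emb θ (weyl θ v g) z =
      conj (emb θ f (z + v)) * emb θ g (z + v) := by
  have key : ∀ w : Fin 2 → ℂ, conj (emb θ f w) * emb θ g w = (((freq θ / Real.pi) ^ 2 *
      Real.exp (-(freq θ / 2) * ∑ i, ‖w i‖ ^ 2) ^ 2 : ℝ) : ℂ) * (conj (f w) * g w) := by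
    intro w; simp only [emb, map_mul, Complex.conj_ofReal]; push_cast; ring
  have h1 : wt θ (weyl θ v 1) z = wt θ 1 (z + v) := wt_weyl v 1 z
  rw [key]
  simp only [emb, weyl, map_mul, Complex.conj_ofReal]
  simp only [wt, weyl, Pi.one_apply, mul_one, norm_one, one_mul] at h1
  set E := Complex.exp (-(freq θ / 2 * ∑ i, (‖v i‖ : ℂ) ^ 2) - freq θ * ∑ i, conj (v i) * z i)
  rw [← h1]
  have h2 : conj E * E = ((‖E‖ ^ 2 : ℝ) : ℂ) := by
    rw [mul_comm, Complex.mul_conj, Complex.normSq_eq_norm_sq]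
  push_cast at h2 ⊢
  linear_combination (freq θ / Real.pi : ℂ) ^ 2 *
    (Complex.exp (-(freq θ / 2) * ∑ i, (‖z i‖ : ℂ) ^ 2)) ^ 2 * conj (f (z + v)) * g (z + v) * h2

lemma inner_weyl_weyl (v : Fin 2 → ℂ) (f g : (Fin 2 → ℂ) → ℂ) :
    bargmannInner θ (weyl θ v f) (weyl θ v g) = bargmannInner θ f g := by
  simp only [bargmannInner_eq, emb_weyl_mul]
  exact integral_add_right_eq_self (fun z => conj (emb θ f z) * emb θ g z) v

lemma sig_self (v : Fin 2 → ℂ) : sig θ v v = 0 := by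
  simp [sig, mul_comm]

lemma sig_neg_left (u v : Fin 2 → ℂ) : sig θ (-u) v = -sig θ u v := by
  simp [sig]; ring

lemma sig_neg_right (u v : Fin 2 → ℂ) : sig θ u (-v) = -sig θ u v := by
  simp [sig]; ring

lemma sig_add_left (u v w : Fin 2 → ℂ) : sig θ (u + v) w = sig θ u w + sig θ v w := by
  simp [sig]; ring

lemma sig_add_right (u v w : Fin 2 → ℂ) : sig θ u (v + w) = sig θ u v + sig θ u w := by
  simp [sig]; ring

lemma sig_symm (u v : Fin 2 → ℂ) : sig θ u v = -sig θ v u := by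
  simp [sig]; ring

lemma weyl_neg_weyl (v : Fin 2 → ℂ) (f : (Fin 2 → ℂ) → ℂ) : weyl θ (-v) (weyl θ v f) = f := by
  rw [weyl_weyl, sig_neg_left, sig_self]
  simp [weyl_zero]

lemma inner_weyl_left (v : Fin 2 → ℂ) (f g : (Fin 2 → ℂ) → ℂ) :
    bargmannInner θ (weyl θ v f) g = bargmannInner θ f (weyl θ (-v) g) := by
  rw [← inner_weyl_weyl (-v) (weyl θ v f) g, weyl_neg_weyl]

lemma inner_weyl_weyl' (u v : Fin 2 → ℂ) (f g : (Fin 2 → ℂ) → ℂ) :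
    bargmannInner θ f (weyl θ u (weyl θ v g)) =
      Complex.exp (Complex.I * sig θ u v) * bargmannInner θ f (weyl θ (u + v) g) := by
  rw [weyl_weyl, inner_const_mul_right]

lemma norm_exp_I_mul (x : ℝ) : ‖Complex.exp (Complex.I * x)‖ = 1 := by
  rw [mul_comm]; exact Complex.norm_exp_ofReal_mul_I x

lemma Smooth.norm_inner_le (hf : Smooth θ f) (hg : Smooth θ g) :
    ‖bargmannInner θ f g‖ ≤ ‖hf.vec‖ * ‖hg.vec‖ := by
  rw [← hf.inner_vec hg]; exact norm_inner_le_norm _ _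

lemma Smooth.norm_vec_weyl (hf : Smooth θ f) (v : Fin 2 → ℂ) : ‖(hf.map_weyl v).vec‖ = ‖hf.vec‖ := by
  have h1 : inner ℂ (hf.map_weyl v).vec (hf.map_weyl v).vec = inner ℂ hf.vec hf.vec := by
    rw [Smooth.inner_vec, Smooth.inner_vec, inner_weyl_weyl]
  rw [inner_self_eq_norm_sq_to_K, inner_self_eq_norm_sq_to_K] at h1
  have h2 : ‖(hf.map_weyl v).vec‖ ^ 2 = ‖hf.vec‖ ^ 2 := by exact_mod_cast h1
  exact (pow_left_inj₀ (norm_nonneg _) (norm_nonneg _) two_ne_zero).1 h2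

/-- The matrix coefficients `v ↦ ⟨f, W_v g⟩` decay rapidly. -/
lemma Smooth.inner_weyl_decay (hf : Smooth θ f) (hg : Smooth θ g) (K : ℕ) :
    ∃ C : ℝ, 0 ≤ C ∧ ∀ v, ‖bargmannInner θ f (weyl θ v g)‖ ≤
      C * ((1 + ‖v‖) ^ K)⁻¹ := by
  obtain ⟨A, hA0, hA⟩ := hf.exists_le (K + 5)
  obtain ⟨B, hB0, hB⟩ := hg.exists_le K
  set J : ℝ := ∫ z : Fin 2 → ℂ, ((1 + ‖z‖) ^ 5)⁻¹
  have hJ : 0 ≤ J := integral_nonneg fun z => by positivity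
  refine ⟨(freq θ / Real.pi) ^ 2 * (A * B * J), by positivity, fun v => ?_⟩
  refine (norm_bargmannInner_le f _).trans ?_
  rw [mul_assoc]
  refine mul_le_mul_of_nonneg_left ?_ (by positivity)
  have hle : ∀ z, wt θ f z * wt θ (weyl θ v g) z ≤
      (A * B * ((1 + ‖v‖) ^ K)⁻¹) * ((1 + ‖z‖) ^ 5)⁻¹ := by
    intro z
    rw [wt_weyl]
    have h1 : ((1 + ‖z‖) ^ K)⁻¹ * ((1 + ‖z + v‖) ^ K)⁻¹ ≤ ((1 + ‖v‖) ^ K)⁻¹ := by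
      rw [← mul_inv, ← mul_pow]
      refine inv_anti₀ (by positivity) (pow_le_pow_left₀ (by positivity) ?_ K)
      have : ‖v‖ ≤ ‖z + v‖ + ‖z‖ := by simpa using norm_sub_le (z + v) z
      nlinarith [norm_nonneg z, norm_nonneg (z + v)]
    calc wt θ f z * wt θ g (z + v)
        ≤ (A * ((1 + ‖z‖) ^ (K + 5))⁻¹) * (B * ((1 + ‖z + v‖) ^ K)⁻¹) :=
          mul_le_mul (hA z) (hB _) (wt_nonneg _ _) (by positivity)
      _ = A * B * ((1 + ‖z‖) ^ 5)⁻¹ * (((1 + ‖z‖) ^ K)⁻¹ * ((1 + ‖z + v‖) ^ K)⁻¹) := by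
          rw [pow_add, mul_inv]; ring
      _ ≤ A * B * ((1 + ‖z‖) ^ 5)⁻¹ * ((1 + ‖v‖) ^ K)⁻¹ := by gcongr
      _ = _ := by ring
  calc ∫ z, wt θ f z * wt θ (weyl θ v g) z
      ≤ ∫ z, (A * B * ((1 + ‖v‖) ^ K)⁻¹) * ((1 + ‖z‖) ^ 5)⁻¹ :=
        integral_mono (hf.integrable_wt_mul (hg.map_weyl v)) (integrable_inv_pow.const_mul _) hle
    _ = _ := by rw [integral_const_mul]; ring

lemma Smooth.continuous_inner_weyl (hf : Smooth θ f) (hg : Smooth θ g) :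
    Continuous fun v => bargmannInner θ f (weyl θ v g) := by
  simp only [bargmannInner_eq]
  obtain ⟨B, hB0, hB⟩ := hg.bdd_wt
  refine continuous_of_dominated (bound := fun z => (freq θ / Real.pi) ^ 2 * (wt θ f z * B))
    (fun v => ((hf.integrable_emb (hg.map_weyl v)).aestronglyMeasurable)) (fun v => ?_)
    ((hf.integrable_wt.mul_const B).const_mul _) (Eventually.of_forall fun z => ?_)
  · refine Eventually.of_forall fun z => ?_
    rw [norm_conj_emb_mul, wt_weyl]
    have := wt_nonneg (θ := θ) f z
    have := hB (z + v)
    gcongr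
  · have := hg.diff.continuous
    unfold emb weyl
    fun_prop

end

section

/-! ### Gaussian mean values and the reproducing formula -/

lemma integral_gaussian_phase {b : ℝ} (hb : 0 < b) :
    ∫ z : Fin 2 → ℂ, Real.exp (-b * ∑ i, ‖z i‖ ^ 2) = (Real.pi / b) ^ 2 := by
  have h1 : ∀ z : Fin 2 → ℂ, Real.exp (-b * ∑ i, ‖z i‖ ^ 2) =
      ∏ i, Real.exp (-b * ‖z i‖ ^ 2) := by
    intro z; rw [Finset.mul_sum, Real.exp_sum]
  simp only [h1]
  rw [integral_fintype_prod_volume_eq_prod (fun (_ : Fin 2) (w : ℂ) => Real.exp (-b * ‖w‖ ^ 2))]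
  have h2 := GaussianFourier.integral_rexp_neg_mul_sq_norm (V := ℂ) hb
  rw [Complex.finrank_real_complex] at h2
  simp only [h2]
  simp [div_pow]

lemma measurePreserving_rotation (c : Circle) :
    MeasurePreserving (fun (z : Fin 2 → ℂ) i => (c : ℂ) * z i) := by
  have := volume_preserving_pi (fun (_ : Fin 2) => (rotation c).measurePreserving)
  simpa using! this

lemma norm_circle_smul (c : Circle) (z : Fin 2 → ℂ) :
    ∑ i, ‖(c : ℂ) * z i‖ ^ 2 = ∑ i, ‖z i‖ ^ 2 := by
  simp only [norm_mul, Circle.norm_coe, one_mul]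

/-- Averaging over the rotations `z ↦ e^{it} z` reduces the Gaussian integral of an entire function
to its value at the origin. -/
lemma integral_gaussian_of_entire {b : ℝ} (hb : 0 < b) {g : (Fin 2 → ℂ) → ℂ}
    (hg : Differentiable ℂ g)
    (hint : Integrable fun z => g z * ((Real.exp (-b * ∑ i, ‖z i‖ ^ 2) : ℝ) : ℂ)) :
    ∫ z, g z * ((Real.exp (-b * ∑ i, ‖z i‖ ^ 2) : ℝ) : ℂ) = (Real.pi / b) ^ 2 * g 0 := by
  set w : (Fin 2 → ℂ) → ℂ := fun z => ((Real.exp (-b * ∑ i, ‖z i‖ ^ 2) : ℝ) : ℂ) with hw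
  set G : (Fin 2 → ℂ) → ℂ := fun z => g z * w z with hG
  have hgc := hg.continuous
  have hwc : Continuous w := by simp only [hw]; fun_prop
  have hGc : Continuous G := hgc.mul hwc
  have hrot : ∀ t : ℝ, MeasurePreserving (fun (z : Fin 2 → ℂ) i => (Circle.exp t : ℂ) * z i) :=
    fun t => measurePreserving_rotation _
  have hemb : ∀ t : ℝ, MeasurableEmbedding
      (fun (z : Fin 2 → ℂ) i => (Circle.exp t : ℂ) * z i) := by
    intro t
    refine (Continuous.measurableEmbedding (by fun_prop) fun z z' h => ?_)
    funext i
    have := congrFun h i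
    simpa using this
  have h1 : ∀ t : ℝ, ∫ z : Fin 2 → ℂ, G (fun i => (Circle.exp t : ℂ) * z i) = ∫ z, G z :=
    fun t => (hrot t).integral_comp (hemb t) G
  have hrad : ∀ (t : ℝ) (z : Fin 2 → ℂ), w (fun i => (Circle.exp t : ℂ) * z i) = w z := by
    intro t z; simp only [hw, norm_circle_smul]
  -- Fubini over `(0, 2π]` and the whole space
  have hprod : Integrable (Function.uncurry fun (t : ℝ) (z : Fin 2 → ℂ) =>
      G (fun i => (Circle.exp t : ℂ) * z i))
      ((volume.restrict (Set.Ioc 0 (2 * Real.pi))).prod volume) := by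
    refine (integrable_prod_iff ?_).2 ⟨?_, ?_⟩
    · refine Continuous.aestronglyMeasurable ?_
      change Continuous fun p : ℝ × (Fin 2 → ℂ) => G (fun i => (Circle.exp p.1 : ℂ) * p.2 i)
      refine hGc.comp (continuous_pi fun i => ?_)
      fun_prop
    · exact Eventually.of_forall fun t => (hrot t).integrable_comp_of_integrable hint
    · have : ∀ t : ℝ, ∫ z, ‖Function.uncurry (fun (t : ℝ) (z : Fin 2 → ℂ) =>
          G (fun i => (Circle.exp t : ℂ) * z i)) (t, z)‖ = ∫ z, ‖G z‖ :=
        fun t => (hrot t).integral_comp (hemb t) (fun z => ‖G z‖)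
      simp only [this]
      exact integrable_const _
  have hswap := integral_integral_swap hprod
  simp only [h1] at hswap
  -- the mean value property on the circle `ζ ↦ ζ z`
  have hmean : ∀ z : Fin 2 → ℂ, ∫ t in Set.Ioc 0 (2 * Real.pi),
      G (fun i => (Circle.exp t : ℂ) * z i) = (2 * Real.pi : ℝ) * g 0 * w z := by
    intro z
    simp only [hG, hrad]
    rw [integral_mul_const]
    congr 1
    have hd : DiffContOnCl ℂ (fun ζ : ℂ => g (fun i => ζ * z i)) (Metric.ball 0 |1|) := by
      refine Differentiable.diffContOnCl (hg.comp ?_)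
      fun_prop
    have := hd.circleAverage
    rw [Real.circleAverage, intervalIntegral.integral_of_le (by positivity)] at this
    simp only [zero_mul, circleMap, zero_add, Complex.ofReal_one, one_mul] at this
    rw [← show (fun _ : Fin 2 => (0 : ℂ)) = 0 from rfl, ← this]
    simp only [Circle.coe_exp]
    rw [Complex.real_smul, ← mul_assoc, ← Complex.ofReal_mul,
      mul_inv_cancel₀ (by positivity), Complex.ofReal_one, one_mul]
  simp only [hmean] at hswap
  rw [integral_const, integral_const_mul] at hswap
  have hw1 : ∫ z, w z = ((Real.pi / b) ^ 2 : ℝ) := by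
    rw [← integral_gaussian_phase hb]; exact integral_ofReal
  rw [hw1] at hswap
  simp only [MeasurableSet.univ, measureReal_restrict_apply, Set.univ_inter, Real.volume_real_Ioc,
    sub_zero] at hswap
  rw [max_eq_left (by positivity), Complex.real_smul] at hswap
  have h2 : ((2 * Real.pi : ℝ) : ℂ) ≠ 0 := by
    exact_mod_cast (by positivity : (2 * Real.pi) ≠ 0)
  have h3 := mul_left_cancel₀ h2 (hswap.trans (mul_assoc _ _ _))
  rw [h3]; push_cast; ring

/-- The reproducing property of the coherent states, for an arbitrary Gaussian width. -/
lemma reproducing {b : ℝ} (hb : 0 < b) {g : (Fin 2 → ℂ) → ℂ} (hg : Differentiable ℂ g)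
    (s : Fin 2 → ℂ)
    (hint : Integrable fun z => Complex.exp (b * ∑ i, conj (z i) * s i) * g z *
      ((Real.exp (-b * ∑ i, ‖z i‖ ^ 2) : ℝ) : ℂ)) :
    ∫ z, Complex.exp (b * ∑ i, conj (z i) * s i) * g z *
      ((Real.exp (-b * ∑ i, ‖z i‖ ^ 2) : ℝ) : ℂ) = (Real.pi / b) ^ 2 * g s := by
  -- the translation by `s` removes the antiholomorphic factor
  have hsub : ∀ u : Fin 2 → ℂ, Complex.exp (b * ∑ i, conj ((u + s) i) * s i) * g (u + s) *
      ((Real.exp (-b * ∑ i, ‖(u + s) i‖ ^ 2) : ℝ) : ℂ) =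
      (Complex.exp (-(b * ∑ i, conj (s i) * u i)) * g (u + s)) *
      ((Real.exp (-b * ∑ i, ‖u i‖ ^ 2) : ℝ) : ℂ) := by
    intro u
    have hE : Complex.exp (b * ∑ i, conj ((u + s) i) * s i) *
        ((Real.exp (-b * ∑ i, ‖(u + s) i‖ ^ 2) : ℝ) : ℂ) =
        Complex.exp (-(b * ∑ i, conj (s i) * u i)) *
        ((Real.exp (-b * ∑ i, ‖u i‖ ^ 2) : ℝ) : ℂ) := by
      rw [Complex.ofReal_exp, Complex.ofReal_exp, ← Complex.exp_add, ← Complex.exp_add]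
      congr 1
      push_cast
      simp only [Fin.sum_univ_two, ← Complex.ofReal_pow, ← Complex.normSq_eq_norm_sq,
        ← Complex.mul_conj, Pi.add_apply, map_add]
      ring
    linear_combination g (u + s) * hE
  rw [← integral_add_right_eq_self _ s]
  have hint' := hint.comp_add_right s
  simp only [hsub] at hint' ⊢
  rw [integral_gaussian_of_entire hb (by fun_prop) hint']
  simp

/-! ### The Fock basis -/

lemma exists_pow_mul_exp_le {c : ℝ} (hc : 0 < c) (N : ℕ) :
    ∃ C : ℝ, ∀ x : ℝ, 0 ≤ x → (1 + x) ^ N * Real.exp (-c * x ^ 2) ≤ C := by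
  refine ⟨N.factorial * Real.exp (1 + 1 / (4 * c)), fun x hx => ?_⟩
  have h1 := Real.pow_div_factorial_le_exp (1 + x) (by positivity) N
  rw [div_le_iff₀ (by positivity)] at h1
  calc (1 + x) ^ N * Real.exp (-c * x ^ 2)
      ≤ (Real.exp (1 + x) * N.factorial) * Real.exp (-c * x ^ 2) := by gcongr
    _ = N.factorial * Real.exp (1 + x + -c * x ^ 2) := by rw [Real.exp_add (1 + x)]; ring
    _ ≤ _ := by
      have : x + -c * x ^ 2 ≤ 1 / (4 * c) := by
        rw [le_div_iff₀ (by positivity)]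
        nlinarith [sq_nonneg (2 * c * x - 1)]
      exact mul_le_mul_of_nonneg_left (Real.exp_le_exp.2 (by linarith)) (by positivity)

lemma sq_norm_le_sum (z : Fin 2 → ℂ) : ‖z‖ ^ 2 ≤ ∑ i, ‖z i‖ ^ 2 := by
  have h : ‖z‖ ≤ √(∑ i, ‖z i‖ ^ 2) := by
    refine (pi_norm_le_iff_of_nonneg (by positivity)).2 fun i => ?_
    refine Real.le_sqrt_of_sq_le ?_
    exact Finset.single_le_sum (f := fun i => ‖z i‖ ^ 2) (fun i _ => by positivity)
      (Finset.mem_univ i)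
  calc ‖z‖ ^ 2 ≤ √(∑ i, ‖z i‖ ^ 2) ^ 2 := by gcongr
    _ = _ := Real.sq_sqrt (Finset.sum_nonneg fun i _ => by positivity)

lemma sum_le_sq_norm (z : Fin 2 → ℂ) : ∑ i, ‖z i‖ ^ 2 ≤ 2 * ‖z‖ ^ 2 := by
  rw [Fin.sum_univ_two]
  have h0 := norm_le_pi_norm z 0
  have h1 := norm_le_pi_norm z 1
  nlinarith [norm_nonneg (z 0), norm_nonneg (z 1)]

variable {θ : ℝ} {f g : (Fin 2 → ℂ) → ℂ}

lemma freq_pos (hθ : 0 < θ) : 0 < freq θ := by unfold freq; positivity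

lemma smooth_fockBasis (hθ : 0 < θ) (n : Fin 2 → ℕ) : Smooth θ (fockBasis θ n) := by
  have hω := freq_pos hθ
  refine ⟨?_, fun K => ?_⟩
  · unfold fockBasis; fun_prop
  · obtain ⟨C, hC⟩ := exists_pow_mul_exp_le (c := freq θ / 2) (by positivity) (K + n 0 + n 1)
    set c0 : ℝ := √(freq θ ^ n 0 / (n 0).factorial)
    set c1 : ℝ := √(freq θ ^ n 1 / (n 1).factorial)
    have h0 : 0 ≤ c0 := Real.sqrt_nonneg _
    have h1 : 0 ≤ c1 := Real.sqrt_nonneg _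
    refine ⟨c0 * c1 * C, fun z => ?_⟩
    have hle : ‖fockBasis θ n z‖ ≤ c0 * c1 * (1 + ‖z‖) ^ (n 0 + n 1) := by
      have hn : ‖fockBasis θ n z‖ = c0 * ‖z 0‖ ^ n 0 * (c1 * ‖z 1‖ ^ n 1) := by
        rw [fockBasis, Fin.prod_univ_two, norm_mul, norm_mul, norm_mul, norm_pow, norm_pow,
          Complex.norm_real, Complex.norm_real, Real.norm_of_nonneg h0, Real.norm_of_nonneg h1]
      rw [hn]
      have e0 : ‖z 0‖ ≤ 1 + ‖z‖ := by linarith [norm_le_pi_norm z 0]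
      have e1 : ‖z 1‖ ≤ 1 + ‖z‖ := by linarith [norm_le_pi_norm z 1]
      calc c0 * ‖z 0‖ ^ n 0 * (c1 * ‖z 1‖ ^ n 1)
          ≤ c0 * (1 + ‖z‖) ^ n 0 * (c1 * (1 + ‖z‖) ^ n 1) := by gcongr
        _ = _ := by rw [pow_add]; ring
    calc (1 + ‖z‖) ^ K * wt θ (fockBasis θ n) z
        ≤ (1 + ‖z‖) ^ K * ((c0 * c1 * (1 + ‖z‖) ^ (n 0 + n 1)) *
          Real.exp (-(freq θ / 2) * ‖z‖ ^ 2)) := by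
          unfold wt
          have : Real.exp (-(freq θ / 2) * ∑ i, ‖z i‖ ^ 2) ≤
              Real.exp (-(freq θ / 2) * ‖z‖ ^ 2) := by
            refine Real.exp_le_exp.2 ?_
            have := sq_norm_le_sum z
            nlinarith
          gcongr
      _ = c0 * c1 * ((1 + ‖z‖) ^ (K + n 0 + n 1) * Real.exp (-(freq θ / 2) * ‖z‖ ^ 2)) := by
          rw [pow_add, pow_add, pow_add]; ring
      _ ≤ _ := mul_le_mul_of_nonneg_left (hC _ (norm_nonneg _)) (by positivity)

/-- Orthogonality of the monomials under a rotation invariant Gaussian. -/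
lemma integral_monomials {b : ℝ} (hb : 0 < b) (m n : ℕ) :
    ∫ z : ℂ, conj z ^ m * z ^ n * ((Real.exp (-b * ‖z‖ ^ 2) : ℝ) : ℂ) =
      if m = n then ((Real.pi / b * (n.factorial / b ^ n) : ℝ) : ℂ) else 0 := by
  split_ifs with h
  · subst h
    have h1 := Complex.integral_rpow_mul_exp_neg_mul_rpow (p := 2) (q := 2 * m) (b := b)
      (by norm_num) (by linarith [(Nat.cast_nonneg m : (0 : ℝ) ≤ m)]) hb
    have h2 : ∀ z : ℂ, conj z ^ m * z ^ m * ((Real.exp (-b * ‖z‖ ^ 2) : ℝ) : ℂ) =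
        ((‖z‖ ^ (2 * (m : ℝ)) * Real.exp (-b * ‖z‖ ^ (2 : ℝ)) : ℝ) : ℂ) := by
      intro z
      rw [← mul_pow, mul_comm (conj z), Complex.mul_conj, Complex.normSq_eq_norm_sq]
      have : ‖z‖ ^ (2 * (m : ℝ)) = (‖z‖ ^ 2) ^ m := by
        rw [← pow_mul, ← Real.rpow_natCast]; push_cast; rfl
      rw [this, Real.rpow_two]
      push_cast; ring
    simp only [h2]
    rw [integral_complex_ofReal, h1]
    congr 1
    have e1 : (2 * (m : ℝ) + 2) / 2 = m + 1 := by ring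
    rw [e1, show -(2 * (m : ℝ) + 2) / 2 = -((m + 1 : ℕ) : ℝ) by push_cast; ring,
      Real.rpow_neg hb.le, Real.rpow_natCast, Real.Gamma_nat_eq_factorial]
    field_simp
    ring
  · set c : Circle := Circle.exp (Real.pi / ((n : ℝ) - m)) with hc
    have hmn : ((n : ℝ) - m) ≠ 0 := by
      rw [sub_ne_zero]; exact_mod_cast Ne.symm h
    have hrot := (rotation c).measurePreserving.integral_comp
      (rotation c).toHomeomorph.measurableEmbedding
      (fun z : ℂ => conj z ^ m * z ^ n * ((Real.exp (-b * ‖z‖ ^ 2) : ℝ) : ℂ))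
    have hcc : conj (c : ℂ) ^ m * (c : ℂ) ^ n = -1 := by
      rw [hc, Circle.coe_exp, ← Complex.exp_conj, ← Complex.exp_nat_mul, ← Complex.exp_nat_mul,
        ← Complex.exp_add, ← Complex.exp_pi_mul_I]
      congr 1
      have hmn' : ((n : ℂ) - m) ≠ 0 := by exact_mod_cast hmn
      simp only [map_mul, Complex.conj_ofReal, Complex.conj_I]
      push_cast
      field_simp
      ring
    have hpt : ∀ z : ℂ, conj (rotation c z) ^ m * (rotation c z) ^ n *
        ((Real.exp (-b * ‖rotation c z‖ ^ 2) : ℝ) : ℂ) =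
        -(conj z ^ m * z ^ n * ((Real.exp (-b * ‖z‖ ^ 2) : ℝ) : ℂ)) := by
      intro z
      rw [LinearIsometryEquiv.norm_map, rotation_apply, map_mul, mul_pow, mul_pow]
      linear_combination (conj z ^ m * z ^ n * ((Real.exp (-b * ‖z‖ ^ 2) : ℝ) : ℂ)) * hcc
    simp only [hpt, integral_neg] at hrot
    exact self_eq_neg.1 hrot.symm

lemma inner_fockBasis (hθ : 0 < θ) (m n : Fin 2 → ℕ) :
    bargmannInner θ (fockBasis θ m) (fockBasis θ n) = if m = n then 1 else 0 := by
  have hω := freq_pos hθ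
  have hpt : ∀ z : Fin 2 → ℂ, conj (fockBasis θ m z) * fockBasis θ n z *
      (((freq θ / Real.pi) ^ 2 * Real.exp (-freq θ * ∑ i, ‖z i‖ ^ 2) : ℝ) : ℂ) =
      ∏ i, (((freq θ / Real.pi * (√(freq θ ^ m i / (m i).factorial) *
        √(freq θ ^ n i / (n i).factorial)) : ℝ) : ℂ) *
        (conj (z i) ^ m i * z i ^ n i * ((Real.exp (-freq θ * ‖z i‖ ^ 2) : ℝ) : ℂ))) := by
    intro z
    simp only [fockBasis, Fin.prod_univ_two, Fin.sum_univ_two, mul_add, Real.exp_add, map_mul,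
      map_pow, Complex.conj_ofReal]
    push_cast
    ring
  unfold bargmannInner
  simp only [hpt]
  rw [integral_fintype_prod_volume_eq_prod (fun (i : Fin 2) (w : ℂ) =>
    (((freq θ / Real.pi * (√(freq θ ^ m i / (m i).factorial) *
        √(freq θ ^ n i / (n i).factorial)) : ℝ) : ℂ) *
        (conj w ^ m i * w ^ n i * ((Real.exp (-freq θ * ‖w‖ ^ 2) : ℝ) : ℂ))))]
  simp only [integral_const_mul, integral_monomials hω]
  split_ifs with h
  · subst h
    refine Finset.prod_eq_one fun i _ => ?_
    rw [if_pos rfl, ← Complex.ofReal_mul, Real.mul_self_sqrt (by positivity)]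
    rw [← Complex.ofReal_one]
    congr 1
    have := Real.pi_ne_zero
    have : ((m i).factorial : ℝ) ≠ 0 := by positivity
    field_simp
  · obtain ⟨i, hi⟩ := Function.ne_iff.1 h
    refine Finset.prod_eq_zero (Finset.mem_univ i) ?_
    rw [if_neg hi, mul_zero]

/-- The Fock basis as a family of vectors of `L²(ℂ²)`. -/
noncomputable def fockVec (hθ : 0 < θ) (n : Fin 2 → ℕ) : Lp ℂ 2 (volume : Measure (Fin 2 → ℂ)) :=
  (smooth_fockBasis hθ n).vec

lemma orthonormal_fockVec (hθ : 0 < θ) : Orthonormal ℂ (fockVec hθ) := by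
  classical
  rw [orthonormal_iff_ite]
  intro m n
  rw [fockVec, fockVec, Smooth.inner_vec, inner_fockBasis hθ]

lemma norm_vec_fockBasis (hθ : 0 < θ) (n : Fin 2 → ℕ) : ‖(smooth_fockBasis hθ n).vec‖ = 1 :=
  (orthonormal_fockVec hθ).1 n

/-! ### Lipschitz continuity of matrix coefficients at the identity -/

/-- Cauchy's estimate on a disc of radius `(1 + |w|)⁻¹`, on which the Gaussian is comparable to its
value at the centre. -/
lemma Smooth.exists_fderiv_le (hθ : 0 < θ) (hf : Smooth θ f) :
    ∃ C : ℝ, 0 ≤ C ∧ ∀ w v : Fin 2 → ℂ,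
      ‖fderiv ℂ f w v‖ * Real.exp (-(freq θ / 2) * ∑ i, ‖w i‖ ^ 2) ≤ C * ‖v‖ := by
  have hω := freq_pos hθ
  obtain ⟨B, hB0, hB⟩ := hf.exists_le 1
  refine ⟨2 * B * Real.exp (3 * freq θ), by positivity, fun w v => ?_⟩
  rcases eq_or_ne v 0 with rfl | hv
  · simp
  have hv' : 0 < ‖v‖ := norm_pos_iff.2 hv
  set r : ℝ := ((1 + ‖w‖) * ‖v‖)⁻¹ with hr
  have hr0 : 0 < r := by positivity
  have hrv : r * ‖v‖ = (1 + ‖w‖)⁻¹ := by rw [hr, mul_inv, mul_assoc, inv_mul_cancel₀ hv'.ne', mul_one]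
  have hd : HasDerivAt (fun ζ : ℂ => f (w + ζ • v)) (fderiv ℂ f w v) 0 := by
    have h1 : HasFDerivAt f (fderiv ℂ f w) (w + (0 : ℂ) • v) := by
      rw [zero_smul, add_zero]; exact (hf.diff w).hasFDerivAt
    have h2 : HasDerivAt (fun ζ : ℂ => w + ζ • v) v 0 := by
      simpa using ((hasDerivAt_id (0 : ℂ)).smul_const v).const_add w
    exact h1.comp_hasDerivAt 0 h2
  have hbound : ∀ ζ ∈ Metric.sphere (0 : ℂ) r, ‖f (w + ζ • v)‖ ≤
      2 * B * Real.exp (3 * freq θ) * Real.exp ((freq θ / 2) * ∑ i, ‖w i‖ ^ 2) *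
        (1 + ‖w‖)⁻¹ := by
    intro ζ hζ
    have hζ' : ‖ζ‖ = r := by simpa using hζ
    have hn : ‖ζ • v‖ = (1 + ‖w‖)⁻¹ := by rw [norm_smul, hζ', hrv]
    have hle1 : (1 + ‖w‖)⁻¹ ≤ 1 := inv_le_one_of_one_le₀ (by linarith [norm_nonneg w])
    have hwn : ‖w‖ * (1 + ‖w‖)⁻¹ ≤ 1 := by
      rw [← div_eq_mul_inv, div_le_one (by positivity)]; linarith
    have h1 := hB (w + ζ • v)
    unfold wt at h1
    have hsum : ∑ i, ‖(w + ζ • v) i‖ ^ 2 ≤ ∑ i, ‖w i‖ ^ 2 + 6 := by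
      simp only [Fin.sum_univ_two]
      have hi : ∀ i, ‖(w + ζ • v) i‖ ^ 2 ≤ ‖w i‖ ^ 2 + 3 := by
        intro i
        have a1 : ‖(w + ζ • v) i‖ ≤ ‖w i‖ + (1 + ‖w‖)⁻¹ := by
          refine (norm_add_le _ _).trans ?_
          have := norm_le_pi_norm (ζ • v) i
          rw [hn] at this
          linarith
        have a2 := norm_le_pi_norm w i
        have a3 : 0 ≤ (1 + ‖w‖)⁻¹ := by positivity
        have a4 : ‖w i‖ * (1 + ‖w‖)⁻¹ ≤ 1 := le_trans (by gcongr) hwn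
        nlinarith [norm_nonneg ((w + ζ • v) i), norm_nonneg (w i)]
      linarith [hi 0, hi 1]
    have hden : ((1 + ‖w + ζ • v‖) ^ 1)⁻¹ ≤ 2 * (1 + ‖w‖)⁻¹ := by
      rw [pow_one, ← div_eq_mul_inv, ← one_div, div_le_div_iff₀ (by positivity) (by positivity)]
      have : ‖w‖ ≤ ‖w + ζ • v‖ + ‖ζ • v‖ := by simpa using norm_sub_le (w + ζ • v) (ζ • v)
      rw [hn] at this
      linarith [norm_nonneg (w + ζ • v)]
    have hE : 1 = Real.exp (-(freq θ / 2) * ∑ i, ‖(w + ζ • v) i‖ ^ 2) *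
        Real.exp ((freq θ / 2) * ∑ i, ‖(w + ζ • v) i‖ ^ 2) := by
      rw [← Real.exp_add]; simp
    calc ‖f (w + ζ • v)‖ = (‖f (w + ζ • v)‖ *
          Real.exp (-(freq θ / 2) * ∑ i, ‖(w + ζ • v) i‖ ^ 2)) *
          Real.exp ((freq θ / 2) * ∑ i, ‖(w + ζ • v) i‖ ^ 2) := by rw [mul_assoc, ← hE, mul_one]
      _ ≤ (B * (2 * (1 + ‖w‖)⁻¹)) * Real.exp ((freq θ / 2) * (∑ i, ‖w i‖ ^ 2 + 6)) := by
          refine mul_le_mul (h1.trans (by gcongr)) ?_ (by positivity) (by positivity)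
          exact Real.exp_le_exp.2 (by gcongr)
      _ = _ := by
          rw [mul_add (freq θ / 2), Real.exp_add, show freq θ / 2 * 6 = 3 * freq θ by ring]; ring
  have hC := Complex.norm_deriv_le_of_forall_mem_sphere_norm_le (c := 0) hr0
    (f := fun ζ : ℂ => f (w + ζ • v))
    (Differentiable.diffContOnCl (hf.diff.comp (by fun_prop))) hbound
  rw [hd.deriv] at hC
  have hE : Real.exp ((freq θ / 2) * ∑ i, ‖w i‖ ^ 2) *
      Real.exp (-(freq θ / 2) * ∑ i, ‖w i‖ ^ 2) = 1 := by
    rw [← Real.exp_add]; simp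
  calc ‖fderiv ℂ f w v‖ * Real.exp (-(freq θ / 2) * ∑ i, ‖w i‖ ^ 2)
      ≤ (2 * B * Real.exp (3 * freq θ) * Real.exp ((freq θ / 2) * ∑ i, ‖w i‖ ^ 2) *
        (1 + ‖w‖)⁻¹ / r) * Real.exp (-(freq θ / 2) * ∑ i, ‖w i‖ ^ 2) := by gcongr
    _ = 2 * B * Real.exp (3 * freq θ) * ((1 + ‖w‖)⁻¹ / r) * (Real.exp ((freq θ / 2) *
        ∑ i, ‖w i‖ ^ 2) * Real.exp (-(freq θ / 2) * ∑ i, ‖w i‖ ^ 2)) := by ring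
    _ = _ := by
        rw [hE, ← hrv]; field_simp

lemma weyl_exponent_smul (t : ℝ) (v z : Fin 2 → ℂ) :
    (-(freq θ / 2 * ∑ i, (‖(t • v) i‖ : ℂ) ^ 2) - freq θ * ∑ i, conj ((t • v) i) * z i : ℂ) =
      -(freq θ / 2 * (t ^ 2 * ∑ i, (‖v i‖ : ℂ) ^ 2)) - freq θ * (t * ∑ i, conj (v i) * z i) := by
  have : ∀ x : ℂ, (‖(t : ℂ) * x‖ : ℂ) ^ 2 = (t : ℂ) ^ 2 * (‖x‖ : ℂ) ^ 2 := by
    intro x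
    rw [← Complex.ofReal_pow, norm_mul, Complex.norm_real, mul_pow, Real.norm_eq_abs, sq_abs]
    push_cast; ring
  simp only [Fin.sum_univ_two, Pi.smul_apply, Complex.real_smul, map_mul, Complex.conj_ofReal]
  rw [this, this]; ring

/-- Lipschitz bound from the derivative of `t ↦ W_{tv} f` and the decay of `f` and of its gradient.
-/
lemma Smooth.exists_weyl_sub_le (hθ : 0 < θ) (hf : Smooth θ f) :
    ∃ C : ℝ, 0 ≤ C ∧ ∀ v z : Fin 2 → ℂ,
      ‖weyl θ v f z - f z‖ * Real.exp (-(freq θ / 2) * ∑ i, ‖z i‖ ^ 2) ≤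
        C * ‖v‖ := by
  have hω := freq_pos hθ
  obtain ⟨C, hC0, hC⟩ := hf.exists_fderiv_le hθ
  obtain ⟨B, hB0, hB⟩ := hf.exists_le 1
  refine ⟨2 * freq θ * B + C, by positivity, fun v z => ?_⟩
  -- along the segment the operator is explicit, and its derivative is again a weighted entire
  -- function
  have hW : ∀ t : ℝ, weyl θ (t • v) f z =
      Complex.exp (-(freq θ / 2 * (t ^ 2 * ∑ i, (‖v i‖ : ℂ) ^ 2)) -
        freq θ * (t * ∑ i, conj (v i) * z i)) * f (z + (t : ℂ) • v) := by
    intro t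
    unfold weyl
    rw [weyl_exponent_smul]
    rfl
  set S : ℂ := ∑ i, conj (v i) * z i with hS
  set N : ℂ := ∑ i, (‖v i‖ : ℂ) ^ 2 with hN
  have hderiv : ∀ t : ℝ, HasDerivAt (fun t : ℝ => weyl θ (t • v) f z)
      (Complex.exp (-(freq θ / 2 * (t ^ 2 * N)) - freq θ * (t * S)) *
        (-(freq θ * (t * N + S)) * f (z + (t : ℂ) • v) + fderiv ℂ f (z + (t : ℂ) • v) v)) t := by
    intro t
    have ht : HasDerivAt (fun t : ℝ => (t : ℂ)) 1 t := Complex.ofRealCLM.hasDerivAt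
    have h1 : HasDerivAt (fun t : ℝ => f (z + (t : ℂ) • v)) (fderiv ℂ f (z + (t : ℂ) • v) v) t := by
      have h2 : HasDerivAt (fun t : ℝ => z + (t : ℂ) • v) v t := by
        simpa using (ht.smul_const v).const_add z
      exact ((hf.diff _).hasFDerivAt.restrictScalars ℝ).comp_hasDerivAt t h2
    have h3 : HasDerivAt (fun t : ℝ => Complex.exp (-(freq θ / 2 * ((t : ℂ) ^ 2 * N)) -
        freq θ * (t * S))) (Complex.exp (-(freq θ / 2 * ((t : ℂ) ^ 2 * N)) - freq θ * (t * S)) *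
        (-(freq θ * (t * N + S)))) t := by
      have h4 := (((ht.pow 2).mul_const N).const_mul ((freq θ : ℂ) / 2)).neg.sub
        ((ht.mul_const S).const_mul (freq θ : ℂ))
      have h5 : HasDerivAt (fun t : ℝ => -(freq θ / 2 * ((t : ℂ) ^ 2 * N)) - freq θ * (t * S))
          (-(freq θ * (t * N + S))) t := by
        refine h4.congr_deriv ?_
        push_cast; ring
      exact h5.cexp
    refine ((h3.mul h1).congr_of_eventuallyEq (Eventually.of_forall fun t => hW t)).congr_deriv ?_
    ring
  have hnorm : ∀ t : ℝ, ‖Complex.exp (-(freq θ / 2 * (t ^ 2 * N)) - freq θ * (t * S))‖ *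
      Real.exp (-(freq θ / 2) * ∑ i, ‖z i‖ ^ 2) =
      Real.exp (-(freq θ / 2) * ∑ i, ‖(z + (t : ℂ) • v) i‖ ^ 2) := by
    intro t
    have h1 := wt_weyl (θ := θ) (t • v) 1 z
    unfold wt weyl at h1
    simp only [Pi.one_apply, mul_one, norm_one, one_mul] at h1
    rw [weyl_exponent_smul] at h1
    exact h1
  set e := Real.exp (-(freq θ / 2) * ∑ i, ‖z i‖ ^ 2) with he
  have he0 : 0 < e := Real.exp_pos _
  have hb : ∀ t : ℝ, ‖Complex.exp (-(freq θ / 2 * (t ^ 2 * N)) - freq θ * (t * S)) *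
        (-(freq θ * (t * N + S)) * f (z + (t : ℂ) • v) + fderiv ℂ f (z + (t : ℂ) • v) v)‖ ≤
        (2 * freq θ * B + C) * ‖v‖ / e := by
    intro t
    rw [le_div_iff₀ he0, norm_mul, mul_right_comm, hnorm t]
    set w := z + (t : ℂ) • v with hw
    have hvw : (t * N + S : ℂ) = ∑ i, conj (v i) * w i := by
      simp only [hS, hN, hw, Fin.sum_univ_two, Pi.add_apply, Pi.smul_apply, smul_eq_mul,
        ← Complex.ofReal_pow, ← Complex.normSq_eq_norm_sq, ← Complex.mul_conj]
      ring
    have hvw' : ‖(t * N + S : ℂ)‖ ≤ 2 * ‖v‖ * ‖w‖ := by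
      rw [hvw, Fin.sum_univ_two]
      refine (norm_add_le _ _).trans ?_
      rw [norm_mul, norm_mul, RCLike.norm_conj, RCLike.norm_conj]
      have a0 := mul_le_mul (norm_le_pi_norm v 0) (norm_le_pi_norm w 0) (norm_nonneg _)
        (norm_nonneg v)
      have a1 := mul_le_mul (norm_le_pi_norm v 1) (norm_le_pi_norm w 1) (norm_nonneg _)
        (norm_nonneg v)
      linarith
    have hwB : ‖w‖ * wt θ f w ≤ B := by
      have := hB w
      rw [pow_one, ← div_eq_mul_inv, le_div_iff₀ (by positivity)] at this
      nlinarith [wt_nonneg (θ := θ) f w]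
    have hfd := hC w v
    unfold wt at hwB
    set E := Real.exp (-(freq θ / 2) * ∑ i, ‖w i‖ ^ 2)
    have hE0 : 0 ≤ E := Real.exp_nonneg _
    calc E * ‖-(freq θ * (t * N + S)) * f w + fderiv ℂ f w v‖
        ≤ E * (freq θ * (2 * ‖v‖ * ‖w‖) * ‖f w‖ + ‖fderiv ℂ f w v‖) := by
          gcongr
          refine (norm_add_le _ _).trans ?_
          rw [norm_mul, norm_neg, norm_mul, Complex.norm_real, Real.norm_of_nonneg hω.le]
          gcongr
      _ = 2 * freq θ * ‖v‖ * (‖w‖ * (‖f w‖ * E)) + ‖fderiv ℂ f w v‖ * E := by ring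
      _ ≤ 2 * freq θ * ‖v‖ * B + C * ‖v‖ := by gcongr
      _ = _ := by ring
  -- the mean value inequality on `[0, 1]`
  have hmv := norm_image_sub_le_of_norm_deriv_le_segment_01'
    (f := fun t : ℝ => weyl θ (t • v) f z)
    (fun t _ => (hderiv t).hasDerivWithinAt) (fun t _ => hb t)
  simp only [one_smul, zero_smul, weyl_zero] at hmv
  rwa [le_div_iff₀ he0] at hmv

/-- Lipschitz continuity is what makes the difference between an overlap and its value at coinciding
points integrable. -/
lemma Smooth.exists_inner_weyl_sub_le (hθ : 0 < θ) (hf : Smooth θ f) (hg : Smooth θ g) :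
    ∃ C : ℝ, 0 ≤ C ∧ ∀ v : Fin 2 → ℂ,
      ‖bargmannInner θ f (weyl θ v g) - bargmannInner θ f g‖ ≤ C * ‖v‖ := by
  obtain ⟨C, hC0, hC⟩ := hg.exists_weyl_sub_le hθ
  refine ⟨(freq θ / Real.pi) ^ 2 * ((∫ z, wt θ f z) * C),
    mul_nonneg (sq_nonneg _) (mul_nonneg (integral_nonneg fun z => wt_nonneg _ _) hC0),
    fun v => ?_⟩
  have hd : bargmannInner θ f (weyl θ v g) - bargmannInner θ f g =
      bargmannInner θ f (weyl θ v g - g) := by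
    have : weyl θ v g - g =
        weyl θ v g + fun z => (-1 : ℂ) * g z := by
      funext z; simp [sub_eq_add_neg]
    rw [this, hf.inner_add_right (hg.map_weyl v) (hg.const_mul (-1)), inner_const_mul_right]
    ring
  rw [hd]
  refine (norm_bargmannInner_le _ _).trans ?_
  rw [mul_assoc, mul_assoc]
  refine mul_le_mul_of_nonneg_left ?_ (sq_nonneg _)
  rw [← integral_mul_const]
  refine integral_mono_of_nonneg
    (Eventually.of_forall fun z => mul_nonneg (wt_nonneg _ _) (wt_nonneg _ _))
    (hf.integrable_wt.mul_const _) (Eventually.of_forall fun z => ?_)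
  exact mul_le_mul_of_nonneg_left (hC v z) (wt_nonneg _ _)

end

section

/-! ### The Bargmann transform of a Schwartz function -/

/-- The kernel of the Bargmann transform. -/
noncomputable def bargmannKernel (θ : ℝ) (z : Fin 2 → ℂ) (x : EuclideanSpace ℝ (Fin 2)) : ℂ :=
  Complex.exp (-(freq θ / 2 * ∑ i, ((x i : ℂ) ^ 2 + z i ^ 2)) + √2 * freq θ * ∑ i, z i * x i)

variable {θ : ℝ}

/-- Completing the square: the kernel is a Gaussian wave packet. -/
lemma norm_bargmannKernel_le (hθ : 0 < θ) (z : Fin 2 → ℂ) (x : EuclideanSpace ℝ (Fin 2)) :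
    ‖bargmannKernel θ z x‖ ≤ Real.exp (freq θ / 2 * ∑ i, ‖z i‖ ^ 2) := by
  have hω := freq_pos hθ
  unfold bargmannKernel
  rw [Complex.norm_exp]
  refine Real.exp_le_exp.2 ?_
  have hs : √2 ^ 2 = (2 : ℝ) := Real.sq_sqrt (by norm_num)
  have hhalf : ((freq θ : ℂ) / 2) = ((freq θ / 2 : ℝ) : ℂ) := by push_cast; rfl
  have hsq : ((√2 : ℝ) : ℂ) * freq θ = ((√2 * freq θ : ℝ) : ℂ) := by push_cast; rfl
  rw [hhalf, hsq]
  simp only [Fin.sum_univ_two, Complex.add_re, Complex.neg_re,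
    ← Complex.ofReal_pow, Complex.ofReal_re, ← Complex.normSq_eq_norm_sq, Complex.normSq_apply,
    pow_two (z 0), pow_two (z 1), Complex.mul_re, Complex.ofReal_im, zero_mul, mul_zero, sub_zero]
  have h0 : 0 ≤ freq θ / 2 * ((x 0 - √2 * (z 0).re) ^ 2 + (x 1 - √2 * (z 1).re) ^ 2) := by positivity
  linear_combination h0 + freq θ / 2 * ((z 0).re ^ 2 + (z 1).re ^ 2) * hs

lemma continuous_bargmannKernel (z : Fin 2 → ℂ) : Continuous (bargmannKernel θ z) := by
  unfold bargmannKernel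
  fun_prop

lemma integrable_bargmannKernel_mul (hθ : 0 < θ) (z : Fin 2 → ℂ)
    {F : EuclideanSpace ℝ (Fin 2) → ℂ} (hF : Integrable F) :
    Integrable fun x => bargmannKernel θ z x * F x :=
  hF.bdd_mul (continuous_bargmannKernel z).aestronglyMeasurable
    (Eventually.of_forall fun x => norm_bargmannKernel_le hθ z x)

lemma bargmannTransform_eq (χ : EuclideanSpace ℝ (Fin 2) → ℂ) (z : Fin 2 → ℂ) :
    bargmannTransform θ χ z = (√(freq θ / Real.pi) : ℂ) * ∫ x, bargmannKernel θ z x * χ x := rfl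

lemma hasFDerivAt_bargmannKernel (z : Fin 2 → ℂ) (x : EuclideanSpace ℝ (Fin 2)) (i : Fin 2) :
    DifferentiableAt ℝ (bargmannKernel θ z) x ∧
    fderiv ℝ (bargmannKernel θ z) x (EuclideanSpace.single i 1) =
      (-(freq θ * x i) + √2 * freq θ * z i) * bargmannKernel θ z x := by
  have hc : ∀ j : Fin 2, HasFDerivAt (fun x : EuclideanSpace ℝ (Fin 2) => ((x j : ℝ) : ℂ))
      (Complex.ofRealCLM.comp (EuclideanSpace.proj j : EuclideanSpace ℝ (Fin 2) →L[ℝ] ℝ)) x :=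
    fun j => (Complex.ofRealCLM.comp
      (EuclideanSpace.proj j : EuclideanSpace ℝ (Fin 2) →L[ℝ] ℝ)).hasFDerivAt
  have h : HasFDerivAt (fun x : EuclideanSpace ℝ (Fin 2) =>
      (-(freq θ / 2 * (((x 0 : ℝ) : ℂ) ^ 2 + z 0 ^ 2 + (((x 1 : ℝ) : ℂ) ^ 2 + z 1 ^ 2))) +
        √2 * freq θ * (z 0 * x 0 + z 1 * x 1) : ℂ)) _ x :=
    (((((hc 0).pow 2).add_const (z 0 ^ 2)).add (((hc 1).pow 2).add_const (z 1 ^ 2))).const_mul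
      ((freq θ : ℂ) / 2)).neg.add
      ((((hc 0).const_mul (z 0)).add ((hc 1).const_mul (z 1))).const_mul (√2 * freq θ : ℂ))
  have hk : bargmannKernel θ z = fun x : EuclideanSpace ℝ (Fin 2) => Complex.exp
      (-(freq θ / 2 * (((x 0 : ℝ) : ℂ) ^ 2 + z 0 ^ 2 + (((x 1 : ℝ) : ℂ) ^ 2 + z 1 ^ 2))) +
        √2 * freq θ * (z 0 * x 0 + z 1 * x 1) : ℂ) := by
    funext x; simp only [bargmannKernel, Fin.sum_univ_two]
  have h' := h.cexp
  rw [← hk] at h'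
  refine ⟨h'.differentiableAt, ?_⟩
  rw [h'.fderiv, ← congrFun hk x]
  fin_cases i
  · simp
    ring
  · simp
    ring

/-- The creation operators: multiplication by `z i` is the Bargmann transform of the first order
operator `χ ↦ (x i χ - ω⁻¹ ∂ᵢ χ) / √2`. -/
lemma exists_mul_bargmannTransform (hθ : 0 < θ) (χ : 𝓢(EuclideanSpace ℝ (Fin 2), ℂ)) (i : Fin 2) :
    ∃ χ' : 𝓢(EuclideanSpace ℝ (Fin 2), ℂ), ∀ z : Fin 2 → ℂ,
      z i * bargmannTransform θ χ z = bargmannTransform θ χ' z := by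
  have hω := freq_pos hθ
  have hω' : (freq θ : ℂ) ≠ 0 := by exact_mod_cast hω.ne'
  have hs0 : ((√2 : ℝ) : ℂ) ≠ 0 := by
    exact_mod_cast (Real.sqrt_pos.2 (by norm_num : (0 : ℝ) < 2)).ne'
  set X : 𝓢(EuclideanSpace ℝ (Fin 2), ℂ) := SchwartzMap.smulLeftCLM ℂ
    (fun x : EuclideanSpace ℝ (Fin 2) => ((x i : ℝ) : ℂ)) χ with hX
  have hXa : ∀ x, X x = (x i : ℂ) * χ x := by
    intro x
    have hg : (fun x : EuclideanSpace ℝ (Fin 2) => ((x i : ℝ) : ℂ)).HasTemperateGrowth :=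
      (Complex.ofRealCLM.comp
        (EuclideanSpace.proj i : EuclideanSpace ℝ (Fin 2) →L[ℝ] ℝ)).hasTemperateGrowth
    rw [hX, SchwartzMap.smulLeftCLM_apply_apply hg, smul_eq_mul]
  set D : 𝓢(EuclideanSpace ℝ (Fin 2), ℂ) :=
    LineDeriv.lineDerivOp (EuclideanSpace.single i (1 : ℝ)) χ with hD
  have hDa : ∀ x, D x = fderiv ℝ χ x (EuclideanSpace.single i 1) := fun x =>
    SchwartzMap.lineDerivOp_apply_eq_fderiv _ _ _
  refine ⟨((√2 : ℝ) : ℂ)⁻¹ • X - (((√2 : ℝ) : ℂ) * freq θ)⁻¹ • D, fun z => ?_⟩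
  have iχ : Integrable fun x => bargmannKernel θ z x * χ x :=
    integrable_bargmannKernel_mul hθ z χ.integrable
  have iX : Integrable fun x => bargmannKernel θ z x * X x :=
    integrable_bargmannKernel_mul hθ z X.integrable
  have iD : Integrable fun x => bargmannKernel θ z x * D x :=
    integrable_bargmannKernel_mul hθ z D.integrable
  have hpt : ∀ x, fderiv ℝ (bargmannKernel θ z) x (EuclideanSpace.single i 1) * χ x =
      -(freq θ : ℂ) * (bargmannKernel θ z x * X x) +
        (√2 * freq θ * z i) * (bargmannKernel θ z x * χ x) := by
    intro x
    rw [(hasFDerivAt_bargmannKernel z x i).2, hXa]; ring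
  have hparts := integral_mul_fderiv_eq_neg_fderiv_mul_of_integrable (μ := volume)
    (f := bargmannKernel θ z) (g := χ) (v := EuclideanSpace.single i (1 : ℝ))
    (by
      simp only [hpt]
      exact (iX.const_mul _).add (iχ.const_mul _))
    (by simpa only [hDa] using iD) iχ
    (fun x _ => (hasFDerivAt_bargmannKernel z x i).1) (fun x _ => χ.differentiableAt)
  simp only [hpt, ← hDa] at hparts
  rw [integral_add (iX.const_mul _) (iχ.const_mul _), integral_const_mul, integral_const_mul]
    at hparts
  have hsplit : ∫ x, bargmannKernel θ z x *
      (((√2 : ℝ) : ℂ)⁻¹ • X - (((√2 : ℝ) : ℂ) * freq θ)⁻¹ • D : 𝓢(EuclideanSpace ℝ (Fin 2), ℂ)) x =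
      ((√2 : ℝ) : ℂ)⁻¹ * (∫ x, bargmannKernel θ z x * X x) -
        (((√2 : ℝ) : ℂ) * freq θ)⁻¹ * ∫ x, bargmannKernel θ z x * D x := by
    rw [← integral_const_mul, ← integral_const_mul,
      ← integral_sub (iX.const_mul _) (iD.const_mul _)]
    congr 1; funext x
    simp only [sub_apply, smul_apply, smul_eq_mul]
    ring
  rw [bargmannTransform_eq, bargmannTransform_eq, hsplit, hparts]
  field_simp
  ring

/-- The modulus of the kernel is at most the inverse of the weight, by `norm_bargmannKernel_le`. -/
lemma wt_bargmannTransform_le (hθ : 0 < θ) (χ : 𝓢(EuclideanSpace ℝ (Fin 2), ℂ)) (z : Fin 2 → ℂ) :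
    wt θ (bargmannTransform θ χ) z ≤ √(freq θ / Real.pi) * ∫ x, ‖χ x‖ := by
  unfold wt
  rw [bargmannTransform_eq, norm_mul, Complex.norm_real, Real.norm_of_nonneg (Real.sqrt_nonneg _),
    mul_assoc]
  refine mul_le_mul_of_nonneg_left ?_ (Real.sqrt_nonneg _)
  have h1 : ‖∫ x, bargmannKernel θ z x * χ x‖ ≤
      Real.exp (freq θ / 2 * ∑ i, ‖z i‖ ^ 2) * ∫ x, ‖χ x‖ := by
    rw [← integral_const_mul]
    refine norm_integral_le_of_norm_le (χ.integrable.norm.const_mul _)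
      (Eventually.of_forall fun x => ?_)
    rw [norm_mul]
    exact mul_le_mul_of_nonneg_right (norm_bargmannKernel_le hθ z x) (norm_nonneg _)
  calc _ ≤ (Real.exp (freq θ / 2 * ∑ i, ‖z i‖ ^ 2) * ∫ x, ‖χ x‖) *
        Real.exp (-(freq θ / 2) * ∑ i, ‖z i‖ ^ 2) := by gcongr
    _ = (Real.exp (freq θ / 2 * ∑ i, ‖z i‖ ^ 2) * Real.exp (-(freq θ / 2) * ∑ i, ‖z i‖ ^ 2)) *
        ∫ x, ‖χ x‖ := by ring
    _ = _ := by rw [← Real.exp_add]; simp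

/-- Differentiation under the integral, with a bound on the unit ball around `z₀` that is integrable
because `χ` is Schwartz. -/
lemma differentiable_bargmannTransform (hθ : 0 < θ) (χ : 𝓢(EuclideanSpace ℝ (Fin 2), ℂ)) :
    Differentiable ℂ (bargmannTransform θ χ) := by
  have hω := freq_pos hθ
  intro z₀
  set F' : (Fin 2 → ℂ) → EuclideanSpace ℝ (Fin 2) → (Fin 2 → ℂ) →L[ℂ] ℂ := fun z x =>
    (bargmannKernel θ z x * χ x) • ∑ i, (-(freq θ * z i) + √2 * freq θ * x i : ℂ) •
      ContinuousLinearMap.proj (R := ℂ) (φ := fun _ : Fin 2 => ℂ) i with hF'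
  set R : ℝ := ‖z₀‖ + 1 with hR
  have hder : ∀ x z, HasFDerivAt (fun z => bargmannKernel θ z x * χ x) (F' z x) z := by
    intro x z
    have hp : ∀ k : Fin 2, HasFDerivAt (fun w : Fin 2 → ℂ => w k)
        (ContinuousLinearMap.proj (R := ℂ) (φ := fun _ : Fin 2 => ℂ) k) z := fun k =>
      (ContinuousLinearMap.proj (R := ℂ) (φ := fun _ : Fin 2 => ℂ) k).hasFDerivAt
    have h : HasFDerivAt (fun z : Fin 2 → ℂ =>
        (-(freq θ / 2 * ((((x 0 : ℝ) : ℂ) ^ 2 + z 0 ^ 2) + (((x 1 : ℝ) : ℂ) ^ 2 + z 1 ^ 2))) +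
          √2 * freq θ * (z 0 * x 0 + z 1 * x 1) : ℂ)) _ z :=
      (((((hp 0).pow 2).const_add (((x 0 : ℝ) : ℂ) ^ 2)).add
        (((hp 1).pow 2).const_add (((x 1 : ℝ) : ℂ) ^ 2))).const_mul ((freq θ : ℂ) / 2)).neg.add
        ((((hp 0).mul_const (x 0 : ℂ)).add ((hp 1).mul_const (x 1 : ℂ))).const_mul
          (√2 * freq θ : ℂ))
    have h' := (h.cexp).mul_const (χ x)
    have hk : (fun z => bargmannKernel θ z x * χ x) = fun z : Fin 2 → ℂ => Complex.exp
        (-(freq θ / 2 * ((((x 0 : ℝ) : ℂ) ^ 2 + z 0 ^ 2) + (((x 1 : ℝ) : ℂ) ^ 2 + z 1 ^ 2))) +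
          √2 * freq θ * (z 0 * x 0 + z 1 * x 1) : ℂ) * χ x := by
      funext z; simp only [bargmannKernel, Fin.sum_univ_two]
    rw [hk]
    refine h'.congr_fderiv ?_
    ext v
    simp [hF', bargmannKernel, Fin.sum_univ_two]
    ring
  have hxi : ∀ (x : EuclideanSpace ℝ (Fin 2)) (i : Fin 2), |x i| ≤ ‖x‖ := fun x i =>
    PiLp.norm_apply_le x i
  have hbound : ∀ x, ∀ z ∈ Metric.ball z₀ 1, ‖F' z x‖ ≤
      (Real.exp (freq θ * R ^ 2) * (2 * freq θ * R)) * ‖χ x‖ +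
      (Real.exp (freq θ * R ^ 2) * (2 * (√2 * freq θ))) * (‖x‖ ^ 1 * ‖χ x‖) := by
    intro x z hz
    have hzR : ‖z‖ ≤ R := by
      have := norm_le_norm_add_norm_sub' z z₀
      rw [mem_ball_iff_norm] at hz
      linarith
    have hk : ‖bargmannKernel θ z x‖ ≤ Real.exp (freq θ * R ^ 2) := by
      refine (norm_bargmannKernel_le hθ z x).trans (Real.exp_le_exp.2 ?_)
      have h1 := sum_le_sq_norm z
      have h2 : ‖z‖ ^ 2 ≤ R ^ 2 := by gcongr
      nlinarith
    have hpr : ∀ i : Fin 2,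
        ‖ContinuousLinearMap.proj (R := ℂ) (φ := fun _ : Fin 2 => ℂ) i‖ ≤ 1 := fun i =>
      ContinuousLinearMap.opNorm_le_bound _ zero_le_one fun v => by
        simpa using norm_le_pi_norm v i
    have hi : ∀ i : Fin 2, ‖(-(freq θ * z i) + √2 * freq θ * x i : ℂ) •
        ContinuousLinearMap.proj (R := ℂ) (φ := fun _ : Fin 2 => ℂ) i‖ ≤
        freq θ * R + √2 * freq θ * ‖x‖ := by
      intro i
      rw [norm_smul]
      refine (mul_le_of_le_one_right (norm_nonneg _) (hpr i)).trans ?_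
      refine (norm_add_le _ _).trans ?_
      rw [norm_neg, norm_mul, norm_mul, norm_mul, Complex.norm_real, Complex.norm_real,
        Complex.norm_real, Real.norm_of_nonneg hω.le, Real.norm_of_nonneg (Real.sqrt_nonneg _),
        Real.norm_eq_abs]
      have := hxi x i
      have := (norm_le_pi_norm z i).trans hzR
      gcongr
    rw [hF', norm_smul, norm_mul, Fin.sum_univ_two]
    calc _ ≤ Real.exp (freq θ * R ^ 2) * ‖χ x‖ *
          ((freq θ * R + √2 * freq θ * ‖x‖) + (freq θ * R + √2 * freq θ * ‖x‖)) := by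
          gcongr
          exact (norm_add_le _ _).trans (add_le_add (hi 0) (hi 1))
      _ = _ := by ring
  have hmeas : AEStronglyMeasurable (F' z₀) := by
    refine Continuous.aestronglyMeasurable ?_
    have := continuous_bargmannKernel (θ := θ) z₀
    have := χ.continuous
    simp only [hF']
    fun_prop
  have := hasFDerivAt_integral_of_dominated_of_fderiv_le (𝕜 := ℂ) (μ := volume)
    (F := fun z x => bargmannKernel θ z x * χ x) (F' := F') (x₀ := z₀)
    (Metric.ball_mem_nhds z₀ one_pos)
    (Eventually.of_forall fun z =>
      (integrable_bargmannKernel_mul hθ z χ.integrable).aestronglyMeasurable)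
    (integrable_bargmannKernel_mul hθ z₀ χ.integrable) hmeas
    (Eventually.of_forall hbound)
    ((χ.integrable.norm.const_mul _).add ((χ.integrable_pow_mul volume 1).const_mul _))
    (Eventually.of_forall fun x z _ => hder x z)
  exact (this.const_mul (√(freq θ / Real.pi) : ℂ)).differentiableAt

/-- Each factor `‖z‖` is traded for a creation operator, which maps the Schwartz space to itself. -/
lemma smooth_bargmannTransform (hθ : 0 < θ) (χ : 𝓢(EuclideanSpace ℝ (Fin 2), ℂ)) :
    Smooth θ (bargmannTransform θ χ) := by
  refine ⟨differentiable_bargmannTransform hθ χ, fun K => ?_⟩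
  induction K generalizing χ with
  | zero => exact ⟨_, fun z => by simpa using wt_bargmannTransform_le hθ χ z⟩
  | succ K ih =>
    obtain ⟨χ₀, h₀⟩ := exists_mul_bargmannTransform hθ χ 0
    obtain ⟨χ₁, h₁⟩ := exists_mul_bargmannTransform hθ χ 1
    obtain ⟨C, hC⟩ := ih χ
    obtain ⟨C₀, hC₀⟩ := ih χ₀
    obtain ⟨C₁, hC₁⟩ := ih χ₁
    refine ⟨C + C₀ + C₁, fun z => ?_⟩
    have hz : ‖z‖ ≤ ‖z 0‖ + ‖z 1‖ := by
      refine (pi_norm_le_iff_of_nonneg (by positivity)).2 fun i => ?_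
      fin_cases i
      · simp
      · simp
    have hw : ∀ (i : Fin 2) (ψ : 𝓢(EuclideanSpace ℝ (Fin 2), ℂ)),
        (z i * bargmannTransform θ χ z = bargmannTransform θ ψ z) →
        ‖z i‖ * wt θ (bargmannTransform θ χ) z = wt θ (bargmannTransform θ ψ) z := by
      intro i ψ h
      unfold wt
      rw [← h, norm_mul]; ring
    have hw₀ := hw 0 χ₀ (h₀ z)
    have hw₁ := hw 1 χ₁ (h₁ z)
    calc (1 + ‖z‖) ^ (K + 1) * wt θ (bargmannTransform θ χ) z
        ≤ (1 + ‖z‖) ^ K * (1 + (‖z 0‖ + ‖z 1‖)) * wt θ (bargmannTransform θ χ) z := by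
          rw [pow_succ]
          have := wt_nonneg (θ := θ) (bargmannTransform θ χ) z
          gcongr
      _ = (1 + ‖z‖) ^ K * wt θ (bargmannTransform θ χ) z +
          (1 + ‖z‖) ^ K * (‖z 0‖ * wt θ (bargmannTransform θ χ) z) +
          (1 + ‖z‖) ^ K * (‖z 1‖ * wt θ (bargmannTransform θ χ) z) := by ring
      _ ≤ _ := by
          rw [hw₀, hw₁]
          exact add_le_add (add_le_add (hC z) (hC₀ z)) (hC₁ z)

lemma smooth_of_mem_smoothModule (hθ : 0 < θ) {φ : (Fin 2 → ℂ) → ℂ} (hφ : φ ∈ smoothModule θ) :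
    Smooth θ φ := by
  obtain ⟨χ, rfl⟩ := hφ
  exact smooth_bargmannTransform hθ χ

end

section

variable {θ : ℝ} {f g : (Fin 2 → ℂ) → ℂ}

/-! ### The heat semigroup as a Gaussian average of Weyl operators -/

/-- The exponent of the Gaussian weight with which `W_η` occurs in `q ^ N`, `N` the number operator:
`(ω / 2) (1 + q) / (1 - q)`. -/
noncomputable def width (θ q : ℝ) : ℝ := freq θ / 2 * ((1 + q) / (1 - q))

lemma width_pos (hθ : 0 < θ) {q : ℝ} (h0 : 0 < q) (h1 : q < 1) : 0 < width θ q := by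
  have := freq_pos hθ
  have : 0 < 1 - q := by linarith
  unfold width; positivity

lemma summable_pow_fin_two {q : ℝ} (h0 : 0 ≤ q) (h1 : q < 1) :
    Summable fun n : Fin 2 → ℕ => q ^ (n 0 + n 1) := by
  have h := (summable_geometric_of_lt_one h0 h1).mul_of_nonneg
    (summable_geometric_of_lt_one h0 h1) (fun n => by positivity) (fun n => by positivity)
  refine ((finTwoArrowEquiv ℕ).summable_iff.2 h).congr fun n => ?_
  simp [pow_add]

lemma hasSum_of_eq {ι : Type*} {F : ι → ℂ} {a b : ℂ} (h : HasSum F a) (e : b = a) : HasSum F b :=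
  e ▸ h

lemma hasSum_mul_prod {F G : ℕ → ℂ} {a b : ℂ} (h : HasSum F a) (h' : HasSum G b) :
    HasSum (fun p : ℕ × ℕ => F p.1 * G p.2) (a * b) := by
  have := summable_mul_of_summable_norm h.summable.norm h'.summable.norm
  exact HasSum.mul h h' this

lemma hasSum_pow_div_factorial (a : ℂ) :
    HasSum (fun k : ℕ => a ^ k / (k.factorial : ℂ)) (Complex.exp a) := by
  rw [Complex.exp_eq_exp_ℂ]
  exact NormedSpace.expSeries_div_hasSum_exp a

lemma hasSum_exp_mul_exp (a b : ℂ) :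
    HasSum (fun p : ℕ × ℕ => a ^ p.1 / (p.1.factorial : ℂ) * (b ^ p.2 / (p.2.factorial : ℂ)))
      (Complex.exp (a + b)) := by
  rw [Complex.exp_add]
  exact hasSum_mul_prod (F := fun k => a ^ k / (k.factorial : ℂ))
    (G := fun k => b ^ k / (k.factorial : ℂ)) (hasSum_pow_div_factorial a)
    (hasSum_pow_div_factorial b)

/-- The generating function of the Fock basis. -/
lemma hasSum_fockBasis_mul (hθ : 0 < θ) (q : ℝ) (z w : Fin 2 → ℂ) :
    HasSum (fun n : Fin 2 → ℕ => (q : ℂ) ^ (n 0 + n 1) * (fockBasis θ n z * conj (fockBasis θ n w)))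
      (Complex.exp (freq θ * q * ∑ i, z i * conj (w i))) := by
  have hω := freq_pos hθ
  have he : (freq θ * q * ∑ i, z i * conj (w i) : ℂ) =
      freq θ * q * (z 0 * conj (w 0)) + freq θ * q * (z 1 * conj (w 1)) := by
    rw [Fin.sum_univ_two]; ring
  rw [he]
  have hsq : ∀ k : ℕ, ((√(freq θ ^ k / k.factorial) : ℝ) : ℂ) ^ 2 =
      (freq θ : ℂ) ^ k / k.factorial := by
    intro k
    rw [← Complex.ofReal_pow, Real.sq_sqrt (by positivity)]
    push_cast; rfl
  have hfun : (fun n : Fin 2 → ℕ =>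
      (q : ℂ) ^ (n 0 + n 1) * (fockBasis θ n z * conj (fockBasis θ n w))) =
      (fun p : ℕ × ℕ => (freq θ * q * (z 0 * conj (w 0)) : ℂ) ^ p.1 / (p.1.factorial : ℂ) *
        ((freq θ * q * (z 1 * conj (w 1)) : ℂ) ^ p.2 / (p.2.factorial : ℂ))) ∘
        finTwoArrowEquiv ℕ := by
    funext n
    have e0 := hsq (n 0)
    have e1 := hsq (n 1)
    rw [Function.comp_apply, show finTwoArrowEquiv ℕ n = (n 0, n 1) from rfl]
    simp only [fockBasis, Fin.prod_univ_two, map_mul,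
      map_pow, Complex.conj_ofReal]
    set c₀ := ((√(freq θ ^ n 0 / (n 0).factorial) : ℝ) : ℂ)
    set c₁ := ((√(freq θ ^ n 1 / (n 1).factorial) : ℝ) : ℂ)
    have : ∀ A B : ℂ, c₀ * z 0 ^ n 0 * (c₁ * z 1 ^ n 1) * (c₀ * A * (c₁ * B)) =
        c₀ ^ 2 * c₁ ^ 2 * (z 0 ^ n 0 * z 1 ^ n 1 * (A * B)) := by intros; ring
    rw [this, e0, e1]
    simp only [mul_pow, pow_add, div_eq_mul_inv]
    ring
  rw [hfun]
  exact (finTwoArrowEquiv ℕ).hasSum_iff.2 (hasSum_exp_mul_exp _ _)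

lemma summable_norm_fockBasis_mul (hθ : 0 < θ) (q : ℝ) (z w : Fin 2 → ℂ) :
    Summable (fun n : Fin 2 → ℕ =>
      ‖(q : ℂ) ^ (n 0 + n 1) * (fockBasis θ n z * conj (fockBasis θ n w))‖) :=
  (hasSum_fockBasis_mul hθ q z w).summable.norm

lemma integral_wt_sq (f : (Fin 2 → ℂ) → ℂ) :
    (freq θ / Real.pi) ^ 2 * ∫ z, wt θ f z * wt θ f z = (bargmannInner θ f f).re := by
  have : bargmannInner θ f f =
      (((freq θ / Real.pi) ^ 2 * ∫ z, wt θ f z * wt θ f z : ℝ) : ℂ) := by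
    rw [bargmannInner_eq, ← integral_const_mul, ← integral_complex_ofReal]
    congr 1; funext z
    rw [← norm_conj_emb_mul, norm_mul, RCLike.norm_conj, mul_comm, Complex.mul_conj,
      Complex.normSq_eq_norm_sq, pow_two]
  rw [this, Complex.ofReal_re]

/-- The `L¹` norm of `f e_n` is bounded uniformly in `n`. -/
lemma Smooth.exists_integral_wt_fockBasis_le (hθ : 0 < θ) (hf : Smooth θ f) :
    ∃ C : ℝ, 0 ≤ C ∧ ∀ n, ∫ z, wt θ f z * wt θ (fockBasis θ n) z ≤ C := by
  have hω := freq_pos hθ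
  set A : ℝ := ∫ z, wt θ f z * wt θ f z
  set B : ℝ := ((freq θ / Real.pi) ^ 2)⁻¹ with hB
  refine ⟨(A + B) / 2, ?_, fun n => ?_⟩
  · have : 0 ≤ A := integral_nonneg fun z => mul_self_nonneg _
    positivity
  · have hn := smooth_fockBasis hθ n
    have h1 := integral_wt_sq (θ := θ) (fockBasis θ n)
    rw [inner_fockBasis hθ, if_pos rfl, Complex.one_re] at h1
    have h2 : ∫ z, wt θ (fockBasis θ n) z * wt θ (fockBasis θ n) z = B := by
      rw [hB]; exact (inv_eq_of_mul_eq_one_right h1).symm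
    rw [← h2, ← integral_add (hf.integrable_wt_mul hf) (hn.integrable_wt_mul hn), ← integral_div]
    refine integral_mono (hf.integrable_wt_mul hn)
      (((hf.integrable_wt_mul hf).add (hn.integrable_wt_mul hn)).div_const 2) fun z => ?_
    beta_reduce
    -- `a b ≤ (a² + b²) / 2`
    nlinarith [sq_nonneg (wt θ f z - wt θ (fockBasis θ n) z)]

/-- The number operator acts by dilation: `∑ q ^ |n| e_n(z) ⟨e_n, g⟩ = g(q z)`. -/
lemma Smooth.hasSum_dilation (hθ : 0 < θ) (hg : Smooth θ g) {q : ℝ} (h0 : 0 < q) (h1 : q < 1)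
    (z : Fin 2 → ℂ) :
    HasSum (fun n : Fin 2 → ℕ => (q : ℂ) ^ (n 0 + n 1) *
      (fockBasis θ n z * bargmannInner θ (fockBasis θ n) g)) (g (q • z)) := by
  have hω := freq_pos hθ
  have hω0 : (freq θ : ℂ) ≠ 0 := by exact_mod_cast hω.ne'
  obtain ⟨C, hC0, hC⟩ := hg.exists_integral_wt_fockBasis_le hθ
  set F : (Fin 2 → ℕ) → (Fin 2 → ℂ) → ℂ := fun n w =>
    (q : ℂ) ^ (n 0 + n 1) * fockBasis θ n z * (conj (emb θ (fockBasis θ n) w) * emb θ g w) with hF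
  have hint : ∀ n, Integrable (F n) := fun n =>
    ((smooth_fockBasis hθ n).integrable_emb hg).const_mul _
  have hsumz : Summable fun n : Fin 2 → ℕ => ‖(q : ℂ) ^ (n 0 + n 1) * fockBasis θ n z‖ := by
    set r := √q with hr
    have hr2 : r ^ 2 = q := Real.sq_sqrt h0.le
    have hr0 : 0 < r := Real.sqrt_pos.2 h0
    have hr1 : r < 1 := by nlinarith
    have hA := summable_norm_fockBasis_mul hθ q z z
    have hB := summable_pow_fin_two h0.le h1
    refine Summable.of_nonneg_of_le (fun n => norm_nonneg _) (fun n => ?_) (hA.add hB)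
    rw [norm_mul, norm_mul, norm_mul, RCLike.norm_conj, norm_pow, Complex.norm_real,
      Real.norm_of_nonneg h0.le]
    have hqn : 0 < q ^ (n 0 + n 1) := by positivity
    nlinarith [sq_nonneg (‖fockBasis θ n z‖ - 1 / 2), norm_nonneg (fockBasis θ n z)]
  -- absolute convergence allows to sum under the integral
  have hsum : Summable fun n => ∫ w, ‖F n w‖ := by
    refine Summable.of_nonneg_of_le (fun n => integral_nonneg fun w => norm_nonneg _) (fun n => ?_)
      (hsumz.mul_right ((freq θ / Real.pi) ^ 2 * C))
    simp only [hF, norm_mul _ (conj (emb θ _ _) * emb θ _ _), norm_conj_emb_mul]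
    rw [integral_const_mul, integral_const_mul]
    refine mul_le_mul_of_nonneg_left (mul_le_mul_of_nonneg_left ?_ (by positivity)) (norm_nonneg _)
    refine le_trans (le_of_eq ?_) (hC n)
    congr 1; funext w; ring
  have hmain := hasSum_integral_of_summable_integral_norm hint hsum
  -- the sum over the basis is a coherent state centred at `q z`
  have hpt : ∀ w, ∑' n, F n w = ((freq θ / Real.pi) ^ 2 : ℝ) * (Complex.exp ((freq θ : ℝ) *
      ∑ i, conj (w i) * (q • z) i) * g w * ((Real.exp (-freq θ * ∑ i, ‖w i‖ ^ 2) : ℝ) : ℂ)) := by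
    intro w
    have h := (hasSum_fockBasis_mul hθ q z w).mul_right (g w *
      (((freq θ / Real.pi) ^ 2 * Real.exp (-freq θ * ∑ i, ‖w i‖ ^ 2) : ℝ) : ℂ))
    have h' : HasSum (fun n => F n w) (Complex.exp (freq θ * q * ∑ i, z i * conj (w i)) * (g w *
      (((freq θ / Real.pi) ^ 2 * Real.exp (-freq θ * ∑ i, ‖w i‖ ^ 2) : ℝ) : ℂ))) := by
      refine h.congr_fun fun n => ?_
      simp only [hF, ← bargmann_integrand]
      ring
    rw [h'.tsum_eq]
    have he : (freq θ * q * ∑ i, z i * conj (w i) : ℂ) =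
        (freq θ : ℝ) * ∑ i, conj (w i) * (q • z) i := by
      simp only [Fin.sum_univ_two, Pi.smul_apply, Complex.real_smul]; ring
    rw [he]; push_cast; ring
  have hlhs : ∀ n, ∫ w, F n w = (q : ℂ) ^ (n 0 + n 1) *
      (fockBasis θ n z * bargmannInner θ (fockBasis θ n) g) := by
    intro n
    simp only [hF]
    rw [integral_const_mul, ← bargmannInner_eq, mul_assoc]
  simp only [hpt, hlhs] at hmain
  rw [integral_const_mul, reproducing hω hg.diff] at hmain
  · refine hasSum_of_eq hmain ?_
    have := Real.pi_ne_zero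
    have hp : (Real.pi : ℂ) ≠ 0 := by exact_mod_cast this
    push_cast
    field_simp
  · obtain ⟨B, hB0, hB⟩ := hg.bdd_wt
    have hwn := hg.integrable_wt
    set s : Fin 2 → ℂ := q • z
    have hs : ∀ w : Fin 2 → ℂ, ‖Complex.exp ((freq θ : ℝ) * ∑ i, conj (w i) * s i) * g w *
        ((Real.exp (-freq θ * ∑ i, ‖w i‖ ^ 2) : ℝ) : ℂ)‖ ≤
        Real.exp (freq θ / 2 * ∑ i, ‖s i‖ ^ 2) * wt θ g w := by
      intro w
      unfold wt
      rw [norm_mul, norm_mul, Complex.norm_exp, Complex.norm_real, Real.norm_of_nonneg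
        (Real.exp_nonneg _), mul_right_comm, ← Real.exp_add, mul_left_comm, ← mul_comm ‖g w‖,
        ← Real.exp_add]
      refine mul_le_mul_of_nonneg_left (Real.exp_le_exp.2 ?_) (norm_nonneg _)
      rw [Complex.re_ofReal_mul]
      have key : ∀ i, (conj (w i) * s i).re ≤ (‖w i‖ ^ 2 + ‖s i‖ ^ 2) / 2 := by
        intro i
        have := Complex.re_le_norm (conj (w i) * s i)
        rw [norm_mul, RCLike.norm_conj] at this
        nlinarith [sq_nonneg (‖w i‖ - ‖s i‖)]
      simp only [Fin.sum_univ_two, Complex.add_re]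
      have k0 := key 0
      have k1 := key 1
      nlinarith
    have hgc := hg.diff.continuous
    exact (hwn.const_mul _).mono' (by fun_prop) (Eventually.of_forall hs)

/-- The dilation by `q` as a Gaussian average of Weyl operators. -/
lemma Smooth.dilation_eq_integral (hθ : 0 < θ) (hg : Smooth θ g) {q : ℝ} (h0 : 0 < q) (h1 : q < 1)
    (z : Fin 2 → ℂ) :
    g (q • z) = (freq θ / (1 - q) / Real.pi : ℝ) ^ 2 * ∫ η,
      ((Real.exp (-width θ q * ∑ i, ‖η i‖ ^ 2) : ℝ) : ℂ) * weyl θ η g z := by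
  have hω := freq_pos hθ
  have hq : 0 < 1 - q := by linarith
  have hb : 0 < freq θ / (1 - q) := by positivity
  have hw := width_pos hθ h0 h1
  have hba : freq θ / (1 - q) = width θ q + freq θ / 2 := by
    unfold width; field_simp; ring
  set s : Fin 2 → ℂ := -((1 - q) • z) with hs
  have hpt : ∀ η : Fin 2 → ℂ, ((Real.exp (-width θ q * ∑ i, ‖η i‖ ^ 2) : ℝ) : ℂ) *
      weyl θ η g z = Complex.exp ((freq θ / (1 - q) : ℝ) *
      ∑ i, conj (η i) * s i) * g (z + η) *
      ((Real.exp (-(freq θ / (1 - q)) * ∑ i, ‖η i‖ ^ 2) : ℝ) : ℂ) := by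
    intro η
    unfold weyl
    have hE : ((Real.exp (-width θ q * ∑ i, ‖η i‖ ^ 2) : ℝ) : ℂ) *
        Complex.exp (-(freq θ / 2 * ∑ i, (‖η i‖ : ℂ) ^ 2) - freq θ * ∑ i, conj (η i) * z i) =
        Complex.exp ((freq θ / (1 - q) : ℝ) * ∑ i, conj (η i) * s i) *
        ((Real.exp (-(freq θ / (1 - q)) * ∑ i, ‖η i‖ ^ 2) : ℝ) : ℂ) := by
      have hs1 : ((freq θ / (1 - q) : ℝ) * ∑ i, conj (η i) * s i : ℂ) =
          -(freq θ * ∑ i, conj (η i) * z i) := by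
        have hq' : (1 - q : ℂ) ≠ 0 := by exact_mod_cast hq.ne'
        simp only [hs, Fin.sum_univ_two, Pi.neg_apply, Pi.smul_apply, Complex.real_smul]
        push_cast
        field_simp
        ring
      rw [hs1, hba, Complex.ofReal_exp, Complex.ofReal_exp, ← Complex.exp_add, ← Complex.exp_add]
      congr 1
      push_cast
      ring
    linear_combination g (z + η) * hE
  have hgc := hg.diff
  have hint : Integrable fun η : Fin 2 → ℂ => Complex.exp ((freq θ / (1 - q) : ℝ) *
      ∑ i, conj (η i) * s i) * g (z + η) *
      ((Real.exp (-(freq θ / (1 - q)) * ∑ i, ‖η i‖ ^ 2) : ℝ) : ℂ) := by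
    have hwi := (hg.integrable_wt.comp_add_left z).const_mul
      (Real.exp (freq θ / 2 * ∑ i, ‖z i‖ ^ 2))
    have hgc' := hg.diff.continuous
    refine hwi.mono' (by fun_prop) (Eventually.of_forall fun η => ?_)
    rw [← hpt, norm_mul, Complex.norm_real, Real.norm_of_nonneg (Real.exp_nonneg _)]
    have hn : ‖weyl θ η g z‖ =
        Real.exp (freq θ / 2 * ∑ i, ‖z i‖ ^ 2) * wt θ g (z + η) := by
      rw [← wt_weyl, wt, mul_left_comm, ← Real.exp_add]
      simp
    rw [hn]
    refine mul_le_of_le_one_left (mul_nonneg (Real.exp_nonneg _) (wt_nonneg _ _)) ?_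
    refine Real.exp_le_one_iff.2 ?_
    have : 0 ≤ ∑ i, ‖η i‖ ^ 2 := by positivity
    nlinarith
  have hrep := reproducing hb (g := fun η => g (z + η)) (by fun_prop) s hint
  simp only [hpt]
  rw [hrep]
  have hzs : z + s = q • z := by
    rw [hs, sub_smul, one_smul]; abel
  rw [hzs]
  have hp : (Real.pi : ℂ) ≠ 0 := by exact_mod_cast Real.pi_ne_zero
  have hω' : (freq θ : ℂ) ≠ 0 := by exact_mod_cast hω.ne'
  have hq' : (1 - q : ℂ) ≠ 0 := by exact_mod_cast hq.ne'
  push_cast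
  field_simp

lemma integrable_gaussian_phase {a : ℝ} (ha : 0 < a) :
    Integrable fun η : Fin 2 → ℂ => Real.exp (-a * ∑ i, ‖η i‖ ^ 2) := by
  by_contra h
  have h1 := integral_gaussian_phase ha
  rw [integral_undef h] at h1
  have : 0 < (Real.pi / a) ^ 2 := by have := Real.pi_pos; positivity
  linarith

lemma Smooth.exists_norm_inner_weyl_le (hf : Smooth θ f) (hg : Smooth θ g) :
    ∃ C : ℝ, 0 ≤ C ∧ ∀ v, ‖bargmannInner θ f (weyl θ v g)‖ ≤ C := by
  obtain ⟨C, h0, h⟩ := hf.inner_weyl_decay hg 0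
  exact ⟨C, h0, fun v => by simpa using h v⟩

/-- Matrix elements of `q ^ N` between rapidly decaying functions. -/
lemma Smooth.hasSum_pow_number (hθ : 0 < θ) (hf : Smooth θ f) (hg : Smooth θ g) {q : ℝ} (h0 : 0 < q)
    (h1 : q < 1) :
    HasSum (fun n : Fin 2 → ℕ => (q : ℂ) ^ (n 0 + n 1) *
      (bargmannInner θ f (fockBasis θ n) * bargmannInner θ (fockBasis θ n) g))
      ((freq θ / (1 - q) / Real.pi : ℝ) ^ 2 * ∫ η,
        ((Real.exp (-width θ q * ∑ i, ‖η i‖ ^ 2) : ℝ) : ℂ) *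
          bargmannInner θ f (weyl θ η g)) := by
  have hw := width_pos hθ h0 h1
  obtain ⟨C, hC0, hC⟩ := hf.exists_integral_wt_fockBasis_le hθ
  have hgn : ∀ n, ‖bargmannInner θ (fockBasis θ n) g‖ ≤ ‖hg.vec‖ := by
    intro n
    have := (smooth_fockBasis hθ n).norm_inner_le hg
    rwa [norm_vec_fockBasis hθ, one_mul] at this
  set F : (Fin 2 → ℕ) → (Fin 2 → ℂ) → ℂ := fun n z => (q : ℂ) ^ (n 0 + n 1) *
    bargmannInner θ (fockBasis θ n) g * (conj (emb θ f z) * emb θ (fockBasis θ n) z) with hF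
  have hint : ∀ n, Integrable (F n) := fun n =>
    (hf.integrable_emb (smooth_fockBasis hθ n)).const_mul _
  have hsum : Summable fun n => ∫ w, ‖F n w‖ := by
    refine Summable.of_nonneg_of_le (fun n => integral_nonneg fun w => norm_nonneg _) (fun n => ?_)
      ((summable_pow_fin_two h0.le h1).mul_right (‖hg.vec‖ * ((freq θ / Real.pi) ^ 2 * C)))
    simp only [hF, norm_mul _ (conj (emb θ _ _) * emb θ _ _), norm_conj_emb_mul]
    rw [integral_const_mul, integral_const_mul, norm_mul, norm_pow, Complex.norm_real,
      Real.norm_of_nonneg h0.le, mul_assoc]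
    have a1 := hgn n
    have a2 := hC n
    have a3 : 0 ≤ ∫ z, wt θ f z * wt θ (fockBasis θ n) z :=
      integral_nonneg fun z => mul_nonneg (wt_nonneg _ _) (wt_nonneg _ _)
    gcongr
  have hmain := hasSum_integral_of_summable_integral_norm hint hsum
  have hlhs : ∀ n, ∫ w, F n w = (q : ℂ) ^ (n 0 + n 1) *
      (bargmannInner θ f (fockBasis θ n) * bargmannInner θ (fockBasis θ n) g) := by
    intro n
    simp only [hF]
    rw [integral_const_mul, ← bargmannInner_eq]; ring
  have hpt : ∀ z, ∑' n, F n z = conj (emb θ f z) * (((freq θ / Real.pi *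
      Real.exp (-(freq θ / 2) * ∑ i, ‖z i‖ ^ 2) : ℝ) : ℂ) * g (q • z)) := by
    intro z
    have h := (hg.hasSum_dilation hθ h0 h1 z).mul_left (conj (emb θ f z) *
      ((freq θ / Real.pi * Real.exp (-(freq θ / 2) * ∑ i, ‖z i‖ ^ 2) : ℝ) : ℂ))
    rw [← mul_assoc, ← h.tsum_eq]
    congr 1; funext n
    simp only [hF, emb]; ring
  simp only [hlhs, hpt] at hmain
  refine hasSum_of_eq hmain ?_
  simp only [hg.dilation_eq_integral hθ h0 h1]
  obtain ⟨B, hB0, hB⟩ := hg.bdd_wt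
  have hfc := hf.continuous_emb
  have hgc := hg.diff.continuous
  have hprod : Integrable (Function.uncurry fun (η z : Fin 2 → ℂ) =>
      ((Real.exp (-width θ q * ∑ i, ‖η i‖ ^ 2) : ℝ) : ℂ) *
        (conj (emb θ f z) * emb θ (weyl θ η g) z))
      ((volume : Measure (Fin 2 → ℂ)).prod volume) := by
    have hdom := (integrable_gaussian_phase hw).mul_prod
      (hf.integrable_wt.const_mul ((freq θ / Real.pi) ^ 2 * B))
    refine hdom.mono' (Continuous.aestronglyMeasurable ?_) (Eventually.of_forall fun p => ?_)
    · have hfc' := hf.diff.continuous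
      unfold Function.uncurry emb weyl
      fun_prop
    · simp only [Function.uncurry]
      rw [norm_mul, Complex.norm_real, Real.norm_of_nonneg (Real.exp_nonneg _), norm_conj_emb_mul,
        wt_weyl]
      have a1 := hB (p.2 + p.1)
      have a2 := wt_nonneg (θ := θ) f p.2
      refine mul_le_mul_of_nonneg_left ?_ (Real.exp_nonneg _)
      rw [mul_assoc]
      refine mul_le_mul_of_nonneg_left ?_ (sq_nonneg _)
      nlinarith
  have hswap := integral_integral_swap hprod
  have hL : ∫ η, ((Real.exp (-width θ q * ∑ i, ‖η i‖ ^ 2) : ℝ) : ℂ) *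
      bargmannInner θ f (weyl θ η g) =
      ∫ η, ∫ z, ((Real.exp (-width θ q * ∑ i, ‖η i‖ ^ 2) : ℝ) : ℂ) *
        (conj (emb θ f z) * emb θ (weyl θ η g) z) := by
    congr 1; funext η
    rw [bargmannInner_eq, ← integral_const_mul]
  rw [hL, hswap, ← integral_const_mul]
  congr 1; funext z
  rw [← integral_const_mul, ← integral_const_mul, ← integral_const_mul, ← integral_const_mul]
  congr 1; funext η
  simp only [emb]; ring

/-- The trace of `q ^ N W_u`. -/
lemma hasSum_trace_pow_number (hθ : 0 < θ) (u : Fin 2 → ℂ) {q : ℝ} (h0 : 0 < q) (h1 : q < 1) :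
    HasSum (fun n : Fin 2 → ℕ => (q : ℂ) ^ (n 0 + n 1) *
      bargmannInner θ (fockBasis θ n) (weyl θ u (fockBasis θ n)))
      (((1 - q)⁻¹ ^ 2 * Real.exp (-width θ q * ∑ i, ‖u i‖ ^ 2) : ℝ) : ℂ) := by
  have hω := freq_pos hθ
  have hq : 0 < 1 - q := by linarith
  have hb : 0 < freq θ * (1 - q) := by positivity
  set F : (Fin 2 → ℕ) → (Fin 2 → ℂ) → ℂ := fun n z => (q : ℂ) ^ (n 0 + n 1) *
    (conj (emb θ (fockBasis θ n) z) * emb θ (weyl θ u (fockBasis θ n)) z) with hF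
  have hint : ∀ n, Integrable (F n) := fun n =>
    ((smooth_fockBasis hθ n).integrable_emb ((smooth_fockBasis hθ n).map_weyl u)).const_mul _
  have hsum : Summable fun n => ∫ w, ‖F n w‖ := by
    refine Summable.of_nonneg_of_le (fun n => integral_nonneg fun w => norm_nonneg _) (fun n => ?_)
      (summable_pow_fin_two h0.le h1)
    simp only [hF, norm_mul _ (conj (emb θ _ _) * emb θ _ _)]
    rw [integral_const_mul, norm_pow, Complex.norm_real, Real.norm_of_nonneg h0.le]
    refine mul_le_of_le_one_right (by positivity) ?_
    have hn := smooth_fockBasis hθ n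
    have hu := hn.map_weyl u
    have e1 := integral_wt_sq (θ := θ) (fockBasis θ n)
    rw [inner_fockBasis hθ, if_pos rfl, Complex.one_re] at e1
    have e2 := integral_wt_sq (θ := θ) (weyl θ u (fockBasis θ n))
    rw [inner_weyl_weyl, inner_fockBasis hθ, if_pos rfl, Complex.one_re] at e2
    have e3 : ∫ z, ‖conj (emb θ (fockBasis θ n) z) * emb θ (weyl θ u (fockBasis θ n)) z‖ ≤
        ∫ z, ((freq θ / Real.pi) ^ 2 * (wt θ (fockBasis θ n) z * wt θ (fockBasis θ n) z) / 2 +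
          (freq θ / Real.pi) ^ 2 * (wt θ (weyl θ u (fockBasis θ n)) z *
            wt θ (weyl θ u (fockBasis θ n)) z) / 2) := by
      refine integral_mono (hn.integrable_emb hu).norm
        ((((hn.integrable_wt_mul hn).const_mul _).div_const 2).add
          (((hu.integrable_wt_mul hu).const_mul _).div_const 2)) fun z => ?_
      rw [norm_conj_emb_mul, ← add_div, ← mul_add, mul_div_assoc]
      refine mul_le_mul_of_nonneg_left ?_ (sq_nonneg _)
      nlinarith [sq_nonneg (wt θ (fockBasis θ n) z - wt θ (weyl θ u (fockBasis θ n)) z)]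
    refine e3.trans (le_of_eq ?_)
    rw [integral_add (((hn.integrable_wt_mul hn).const_mul _).div_const 2)
          (((hu.integrable_wt_mul hu).const_mul _).div_const 2), integral_div, integral_div,
      integral_const_mul, integral_const_mul, e1, e2]
    norm_num
  have hmain := hasSum_integral_of_summable_integral_norm hint hsum
  have hlhs : ∀ n, ∫ w, F n w = (q : ℂ) ^ (n 0 + n 1) *
      bargmannInner θ (fockBasis θ n) (weyl θ u (fockBasis θ n)) := by
    intro n
    simp only [hF]
    rw [integral_const_mul, ← bargmannInner_eq]
  -- completing the square centres the coherent state at `q u / (1 - q)`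
  set s : Fin 2 → ℂ := (q / (1 - q)) • u with hs
  have hpt : ∀ z, ∑' n, F n z = (((freq θ / Real.pi) ^ 2 *
      Real.exp (-(freq θ / 2) * ∑ i, ‖u i‖ ^ 2) : ℝ) : ℂ) *
      (Complex.exp ((freq θ * (1 - q) : ℝ) * ∑ i, conj (z i) * s i) *
        Complex.exp (-(freq θ * ∑ i, conj (u i) * z i)) *
      ((Real.exp (-(freq θ * (1 - q)) * ∑ i, ‖z i‖ ^ 2) : ℝ) : ℂ)) := by
    intro z
    set A : ℂ := (((freq θ / Real.pi) ^ 2 * Real.exp (-freq θ * ∑ i, ‖z i‖ ^ 2) : ℝ) : ℂ) *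
      Complex.exp (-(freq θ / 2 * ∑ i, (‖u i‖ : ℂ) ^ 2) - freq θ * ∑ i, conj (u i) * z i) with hA
    have hfun : (fun n => F n z) = fun n : Fin 2 → ℕ => A * ((q : ℂ) ^ (n 0 + n 1) *
        (fockBasis θ n (z + u) * conj (fockBasis θ n z))) := by
      funext n
      simp only [hF, ← bargmann_integrand, weyl, hA]
      ring
    rw [hfun, ((hasSum_fockBasis_mul hθ q (z + u) z).mul_left A).tsum_eq, hA]
    have hE : ((Real.exp (-freq θ * ∑ i, ‖z i‖ ^ 2) : ℝ) : ℂ) *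
      Complex.exp (-(freq θ / 2 * ∑ i, (‖u i‖ : ℂ) ^ 2) - freq θ * ∑ i, conj (u i) * z i) *
      Complex.exp (freq θ * q * ∑ i, (z + u) i * conj (z i)) =
      ((Real.exp (-(freq θ / 2) * ∑ i, ‖u i‖ ^ 2) : ℝ) : ℂ) *
      (Complex.exp ((freq θ * (1 - q) : ℝ) * ∑ i, conj (z i) * s i) *
        Complex.exp (-(freq θ * ∑ i, conj (u i) * z i)) *
      ((Real.exp (-(freq θ * (1 - q)) * ∑ i, ‖z i‖ ^ 2) : ℝ) : ℂ)) := by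
      simp only [Complex.ofReal_exp, ← Complex.exp_add]
      congr 1
      have hq' : (1 - q : ℂ) ≠ 0 := by exact_mod_cast hq.ne'
      simp only [hs, Fin.sum_univ_two, Pi.add_apply, Pi.smul_apply, Complex.real_smul]
      push_cast
      simp only [← Complex.ofReal_pow, ← Complex.normSq_eq_norm_sq, ← Complex.mul_conj]
      field_simp
      ring
    push_cast at hE ⊢
    linear_combination ((freq θ : ℂ) / Real.pi) ^ 2 * hE
  simp only [hlhs, hpt] at hmain
  rw [integral_const_mul, reproducing hb (g := fun z => Complex.exp (-(freq θ *
    ∑ i, conj (u i) * z i))) (by fun_prop)] at hmain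
  · refine hasSum_of_eq hmain ?_
    have hE : Complex.exp (-(freq θ * ∑ i, conj (u i) * s i)) =
        ((Real.exp (-(freq θ * (q / (1 - q))) * ∑ i, ‖u i‖ ^ 2) : ℝ) : ℂ) := by
      rw [Complex.ofReal_exp]
      congr 1
      simp only [hs, Fin.sum_univ_two, Pi.smul_apply, Complex.real_smul]
      push_cast
      simp only [← Complex.ofReal_pow, ← Complex.normSq_eq_norm_sq, ← Complex.mul_conj]
      ring
    have hwid : -width θ q * ∑ i, ‖u i‖ ^ 2 = -(freq θ / 2) * ∑ i, ‖u i‖ ^ 2 +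
        -(freq θ * (q / (1 - q))) * ∑ i, ‖u i‖ ^ 2 := by
      unfold width; field_simp; ring
    rw [hE, hwid, Real.exp_add]
    have hp := Real.pi_ne_zero
    have : (((1 - q)⁻¹ ^ 2 * (Real.exp (-(freq θ / 2) * ∑ i, ‖u i‖ ^ 2) *
        Real.exp (-(freq θ * (q / (1 - q))) * ∑ i, ‖u i‖ ^ 2)) : ℝ)) =
        ((freq θ / Real.pi) ^ 2 * Real.exp (-(freq θ / 2) * ∑ i, ‖u i‖ ^ 2)) *
        ((Real.pi / (freq θ * (1 - q))) ^ 2 *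
          Real.exp (-(freq θ * (q / (1 - q))) * ∑ i, ‖u i‖ ^ 2)) := by
      field_simp
    rw [this]
    push_cast
    ring
  · -- the integrand is dominated by a Gaussian with a quarter of the exponent
    have hdom := (integrable_gaussian_phase (a := freq θ * (1 - q) / 4) (by positivity)).const_mul
      (Real.exp (freq θ * (1 - q) * ∑ i, ‖s i‖ ^ 2 + freq θ / (1 - q) * ∑ i, ‖u i‖ ^ 2))
    refine hdom.mono' (by fun_prop) (Eventually.of_forall fun z => ?_)
    rw [norm_mul, norm_mul, Complex.norm_exp, Complex.norm_exp, Complex.norm_real,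
      Real.norm_of_nonneg (Real.exp_nonneg _), ← Real.exp_add, ← Real.exp_add, ← Real.exp_add]
    refine Real.exp_le_exp.2 ?_
    rw [Complex.re_ofReal_mul, Complex.neg_re, Complex.re_ofReal_mul]
    set b := freq θ * (1 - q) with hbdef
    have key : ∀ i, b * (conj (z i) * s i).re + -(freq θ * (conj (u i) * z i).re) +
        -b * ‖z i‖ ^ 2 ≤ b * ‖s i‖ ^ 2 + freq θ / (1 - q) * ‖u i‖ ^ 2 + -(b / 4) * ‖z i‖ ^ 2 := by
      intro i
      have t1 := Complex.re_le_norm (conj (z i) * s i)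
      have t2 := (abs_le.1 (Complex.abs_re_le_norm (conj (u i) * z i))).1
      rw [norm_mul, RCLike.norm_conj] at t1 t2
      have t3 : freq θ / (1 - q) * ‖u i‖ ^ 2 + b / 4 * ‖z i‖ ^ 2 - freq θ * (‖u i‖ * ‖z i‖) =
          freq θ / (1 - q) * (‖u i‖ - (1 - q) / 2 * ‖z i‖) ^ 2 := by
        rw [hbdef]; field_simp; ring
      have t4 : 0 ≤ freq θ / (1 - q) * (‖u i‖ - (1 - q) / 2 * ‖z i‖) ^ 2 := by positivity
      have t5 : 0 ≤ b * (‖s i‖ - ‖z i‖ / 2) ^ 2 := by positivity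
      nlinarith [mul_le_mul_of_nonneg_left t1 hb.le, mul_le_mul_of_nonneg_left t2 hω.le,
        mul_nonneg hb.le (sq_nonneg ‖z i‖)]
    have k0 := key 0
    have k1 := key 1
    simp only [Fin.sum_univ_two, Complex.add_re]
    linarith

end

section

variable {θ μ₀ ε : ℝ} {f g : (Fin 2 → ℂ) → ℂ}

/-! ### The propagator in the Fock basis -/

lemma energy_pos (hθ : 0 < θ) (n : Fin 2 → ℕ) : 0 < energy θ μ₀ n := by
  have := freq_pos hθ
  unfold energy
  positivity

lemma propagator_eq (hθ : 0 < θ) (ε : ℝ) (n : Fin 2 → ℕ) :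
    propagator θ μ₀ ε n = Real.exp (-ε * energy θ μ₀ n) / energy θ μ₀ n := by
  have h := integral_exp_mul_Ioi (a := -energy θ μ₀ n) (neg_lt_zero.2 (energy_pos hθ n)) ε
  unfold propagator
  simp only [neg_mul, ← mul_neg] at h ⊢
  simp only [mul_neg] at h ⊢
  simp only [mul_comm (energy θ μ₀ n)] at h
  rw [h, neg_div_neg_eq]

lemma propagator_pos (hθ : 0 < θ) (ε : ℝ) (n : Fin 2 → ℕ) : 0 < propagator θ μ₀ ε n := by
  rw [propagator_eq hθ]
  have := energy_pos (μ₀ := μ₀) hθ n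
  positivity

lemma propagator_le (hθ : 0 < θ) (hε : 0 ≤ ε) (n : Fin 2 → ℕ) :
    propagator θ μ₀ ε n ≤ propagator θ μ₀ 0 n := by
  have hE := energy_pos (μ₀ := μ₀) hθ n
  rw [propagator_eq hθ, propagator_eq hθ]
  refine div_le_div_of_nonneg_right (Real.exp_le_exp.2 ?_) hE.le
  nlinarith

lemma propagator_zero_le (hθ : 0 < θ) (n : Fin 2 → ℕ) :
    propagator θ μ₀ 0 n ≤ (2 * freq θ)⁻¹ * ((n 0 : ℝ) + n 1 + 1)⁻¹ := by
  have := freq_pos hθ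
  rw [propagator_eq hθ, ← mul_inv, neg_zero, zero_mul, Real.exp_zero, one_div]
  refine inv_anti₀ (by positivity) ?_
  simp only [energy, Fin.sum_univ_two]
  nlinarith [sq_nonneg μ₀]

lemma propagator_le_const (hθ : 0 < θ) (hε : 0 ≤ ε) (n : Fin 2 → ℕ) :
    propagator θ μ₀ ε n ≤ (2 * freq θ)⁻¹ := by
  have := freq_pos hθ
  refine (propagator_le hθ hε n).trans ((propagator_zero_le hθ n).trans ?_)
  refine mul_le_of_le_one_right (by positivity) (inv_le_one_of_one_le₀ ?_)
  have : (0 : ℝ) ≤ (n 0 : ℝ) + n 1 := by positivity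
  linarith

lemma tendsto_propagator (hθ : 0 < θ) (n : Fin 2 → ℕ) :
    Tendsto (fun ε => propagator θ μ₀ ε n) (𝓝[>] 0) (𝓝 (propagator θ μ₀ 0 n)) := by
  simp only [propagator_eq hθ]
  have : Continuous fun ε : ℝ => Real.exp (-ε * energy θ μ₀ n) / energy θ μ₀ n := by fun_prop
  exact this.continuousAt.continuousWithinAt

/-- The regularized propagator is trace class. -/
lemma summable_propagator (hθ : 0 < θ) (hε : 0 < ε) : Summable (propagator θ μ₀ ε) := by
  have hω := freq_pos hθ
  have hq1 : Real.exp (-(ε * (2 * freq θ))) < 1 := Real.exp_lt_one_iff.2 (by nlinarith)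
  refine Summable.of_nonneg_of_le (fun n => (propagator_pos hθ ε n).le) (fun n => ?_)
    ((summable_pow_fin_two (Real.exp_nonneg _) hq1).mul_right (2 * freq θ)⁻¹)
  have hE := energy_pos (μ₀ := μ₀) hθ n
  rw [propagator_eq hθ, div_eq_mul_inv]
  refine mul_le_mul ?_ ?_ (by positivity) (by positivity)
  · rw [← Real.exp_nat_mul]
    refine Real.exp_le_exp.2 ?_
    simp only [energy, Fin.sum_univ_two]
    push_cast
    nlinarith [mul_pos hε hω, mul_nonneg hε.le (sq_nonneg μ₀)]
  · refine inv_anti₀ (by positivity) ?_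
    simp only [energy, Fin.sum_univ_two]
    nlinarith [sq_nonneg μ₀, mul_nonneg hω.le (add_nonneg (Nat.cast_nonneg (α := ℝ) (n 0))
      (Nat.cast_nonneg (n 1)))]

/-- In two complex dimensions the third power of the propagator is trace class. -/
lemma summable_propagator_cube (hθ : 0 < θ) : Summable fun n => propagator θ μ₀ 0 n ^ 3 := by
  have hω := freq_pos hθ
  have h1 : Summable fun k : ℕ => (((k : ℝ) + 1) ^ (3 / 2 : ℝ))⁻¹ := by
    have := (summable_nat_add_iff 1).2
      (Real.summable_nat_rpow_inv.2 (by norm_num : (1 : ℝ) < 3 / 2))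
    simpa using this
  have h2 := h1.mul_of_nonneg h1 (fun n => by positivity) (fun n => by positivity)
  have h3 := ((finTwoArrowEquiv ℕ).summable_iff.2 h2).mul_left ((2 * freq θ)⁻¹ ^ 3)
  refine Summable.of_nonneg_of_le (fun n => by have := propagator_pos (μ₀ := μ₀) hθ 0 n; positivity)
    (fun n => ?_) h3
  have hp := propagator_zero_le (μ₀ := μ₀) hθ n
  have hp0 := (propagator_pos (μ₀ := μ₀) hθ 0 n).le
  have hab : ((((n 0 : ℝ) + n 1 + 1))⁻¹) ^ 3 ≤
      (((n 0 : ℝ) + 1) ^ (3 / 2 : ℝ))⁻¹ * (((n 1 : ℝ) + 1) ^ (3 / 2 : ℝ))⁻¹ := by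
    rw [← mul_inv, inv_pow]
    refine inv_anti₀ (by positivity) ?_
    rw [← Real.mul_rpow (by positivity) (by positivity)]
    have hs : ((n 0 : ℝ) + n 1 + 1) ^ 3 = (((n 0 : ℝ) + n 1 + 1) ^ 2) ^ (3 / 2 : ℝ) := by
      rw [← Real.rpow_natCast _ 2, ← Real.rpow_mul (by positivity), ← Real.rpow_natCast _ 3]
      norm_num
    rw [hs]
    refine Real.rpow_le_rpow (by positivity) ?_ (by norm_num)
    have a : (0 : ℝ) ≤ n 0 := Nat.cast_nonneg _
    have b : (0 : ℝ) ≤ n 1 := Nat.cast_nonneg _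
    nlinarith [mul_nonneg a b]
  calc propagator θ μ₀ 0 n ^ 3 ≤ ((2 * freq θ)⁻¹ * ((n 0 : ℝ) + n 1 + 1)⁻¹) ^ 3 := by gcongr
    _ = (2 * freq θ)⁻¹ ^ 3 * (((n 0 : ℝ) + n 1 + 1)⁻¹) ^ 3 := by rw [mul_pow]
    _ ≤ _ := mul_le_mul_of_nonneg_left hab (by positivity)

/-! ### The propagator as an average of Weyl operators -/

/-- The weight of `W_η` in `exp (-β H)`. -/
noncomputable def heatDensity (θ μ₀ β : ℝ) (η : Fin 2 → ℂ) : ℝ :=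
  Real.exp (-β * μ₀ ^ 2) * Real.exp (-(2 * freq θ * β)) *
    (freq θ / (1 - Real.exp (-(2 * freq θ * β))) / Real.pi) ^ 2 *
    Real.exp (-width θ (Real.exp (-(2 * freq θ * β))) * ∑ i, ‖η i‖ ^ 2)

/-- The weight of `W_η` in the regularized propagator. It is integrable in `η` uniformly in the
cut-off, and `|η|⁻²` at the origin without it. -/
noncomputable def propDensity (θ μ₀ ε : ℝ) (η : Fin 2 → ℂ) : ℝ :=
  ∫ β in Set.Ioi ε, heatDensity θ μ₀ β η

lemma heatDensity_nonneg (β : ℝ) (η : Fin 2 → ℂ) : 0 ≤ heatDensity θ μ₀ β η := by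
  unfold heatDensity; positivity

lemma propDensity_nonneg (ε : ℝ) (η : Fin 2 → ℂ) : 0 ≤ propDensity θ μ₀ ε η :=
  integral_nonneg fun β => heatDensity_nonneg β η

lemma measurable_heatDensity :
    Measurable (Function.uncurry (heatDensity θ μ₀)) := by
  unfold Function.uncurry heatDensity width
  fun_prop

/-- A bound uniform in `0 < β`; it rests on `sinh x ≥ x`, `coth x ≥ 1` and `coth x ≥ (2 x)⁻¹` for `x
= ω β`. -/
lemma heatDensity_le (hθ : 0 < θ) {β : ℝ} (hβ : 0 < β) (η : Fin 2 → ℂ) :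
    heatDensity θ μ₀ β η ≤ (4 * Real.pi ^ 2)⁻¹ * Real.exp (-(freq θ / 4) * ‖η‖ ^ 2) *
      ((β ^ 2)⁻¹ * Real.exp (-(‖η‖ ^ 2 / 8) / β)) := by
  have hω := freq_pos hθ
  have hπ := Real.pi_pos
  set x := freq θ * β with hx
  have hx0 : 0 < x := by positivity
  have hq : Real.exp (-(2 * freq θ * β)) = Real.exp (-x) ^ 2 := by
    rw [← Real.exp_nat_mul]; congr 1; push_cast; rw [hx]; ring
  set q := Real.exp (-(2 * freq θ * β)) with hqdef
  have hq0 : 0 < q := Real.exp_pos _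
  have hq1 : q < 1 := Real.exp_lt_one_iff.2 (by nlinarith)
  have h1q : 0 < 1 - q := by linarith
  have hsinh : 2 * x * Real.exp (-x) ≤ 1 - q := by
    have h := Real.self_le_sinh_iff.2 hx0.le
    rw [Real.sinh_eq] at h
    have he : Real.exp x * Real.exp (-x) = 1 := by rw [← Real.exp_add]; simp
    rw [hq]
    nlinarith [Real.exp_pos (-x)]
  have hpre : q * (freq θ / (1 - q) / Real.pi) ^ 2 ≤ (4 * Real.pi ^ 2)⁻¹ * (β ^ 2)⁻¹ := by
    have h2 : (2 * x * Real.exp (-x)) ^ 2 ≤ (1 - q) ^ 2 := by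
      gcongr
    rw [mul_pow, mul_pow, ← hq] at h2
    rw [← mul_inv, div_pow, div_pow, ← one_div, div_div, mul_div_assoc', div_le_div_iff₀
      (by positivity) (by positivity)]
    have : q * freq θ ^ 2 * (4 * Real.pi ^ 2 * β ^ 2) = Real.pi ^ 2 * (2 ^ 2 * x ^ 2 * q) := by
      rw [hx]; ring
    rw [this]
    nlinarith [sq_nonneg Real.pi]
  have hwid : freq θ / 4 + 1 / (8 * β) ≤ width θ q := by
    unfold width
    have e1 : 1 ≤ (1 + q) / (1 - q) := by rw [le_div_iff₀ h1q]; linarith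
    have e2 : 1 / (2 * x) ≤ (1 + q) / (1 - q) := by
      rw [div_le_div_iff₀ (by positivity) h1q]
      have := Real.add_one_le_exp (-(2 * freq θ * β))
      rw [← hqdef] at this
      have h2x : 2 * freq θ * β = 2 * x := by rw [hx]; ring
      rw [h2x] at this
      nlinarith
    have e3 : freq θ / 4 + 1 / (8 * β) = freq θ / 2 * ((1 + 1 / (2 * x)) / 2) := by
      rw [hx]; field_simp; ring
    rw [e3]
    refine mul_le_mul_of_nonneg_left ?_ (by positivity)
    linarith
  have hexp : Real.exp (-width θ q * ∑ i, ‖η i‖ ^ 2) ≤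
      Real.exp (-(freq θ / 4) * ‖η‖ ^ 2) * Real.exp (-(‖η‖ ^ 2 / 8) / β) := by
    rw [← Real.exp_add]
    refine Real.exp_le_exp.2 ?_
    have h1 := sq_norm_le_sum η
    have h2 : (freq θ / 4 + 1 / (8 * β)) * ‖η‖ ^ 2 ≤ width θ q * ∑ i, ‖η i‖ ^ 2 :=
      mul_le_mul hwid h1 (by positivity) (width_pos hθ hq0 hq1).le
    have h3 : -(freq θ / 4) * ‖η‖ ^ 2 + -(‖η‖ ^ 2 / 8) / β =
        -((freq θ / 4 + 1 / (8 * β)) * ‖η‖ ^ 2) := by field_simp; ring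
    rw [h3]; linarith
  have hμ : Real.exp (-β * μ₀ ^ 2) ≤ 1 := by
    refine Real.exp_le_one_iff.2 ?_
    nlinarith [sq_nonneg μ₀]
  unfold heatDensity
  rw [← hqdef]
  calc Real.exp (-β * μ₀ ^ 2) * q * (freq θ / (1 - q) / Real.pi) ^ 2 *
      Real.exp (-width θ q * ∑ i, ‖η i‖ ^ 2)
      ≤ 1 * q * (freq θ / (1 - q) / Real.pi) ^ 2 *
        (Real.exp (-(freq θ / 4) * ‖η‖ ^ 2) * Real.exp (-(‖η‖ ^ 2 / 8) / β)) := by gcongr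
    _ ≤ ((4 * Real.pi ^ 2)⁻¹ * (β ^ 2)⁻¹) *
        (Real.exp (-(freq θ / 4) * ‖η‖ ^ 2) * Real.exp (-(‖η‖ ^ 2 / 8) / β)) := by
        rw [one_mul]; gcongr
    _ = _ := by ring

lemma integral_inv_sq_mul_exp {r : ℝ} (hr : 0 < r) :
    IntegrableOn (fun β : ℝ => (β ^ 2)⁻¹ * Real.exp (-r / β)) (Set.Ioi 0) ∧
    ∫ β in Set.Ioi (0 : ℝ), (β ^ 2)⁻¹ * Real.exp (-r / β) = r⁻¹ := by
  set F : ℝ → ℝ := fun β => if β ≤ 0 then 0 else Real.exp (-r / β) / r with hF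
  have hd : ∀ x ∈ Set.Ioi (0 : ℝ), HasDerivAt F ((x ^ 2)⁻¹ * Real.exp (-r / x)) x := by
    intro x hx
    have hx' : x ≠ 0 := (ne_of_gt hx)
    have h1 : HasDerivAt (fun β : ℝ => Real.exp (-r / β) / r) ((x ^ 2)⁻¹ * Real.exp (-r / x)) x := by
      have h2 : HasDerivAt (fun β : ℝ => -r / β) (r / x ^ 2) x := by
        have := (hasDerivAt_inv hx').const_mul (-r)
        simp only [← div_eq_mul_inv] at this
        refine this.congr_deriv ?_
        field_simp
      refine (h2.exp.div_const r).congr_deriv ?_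
      field_simp
    refine h1.congr_of_eventuallyEq ?_
    filter_upwards [Ioi_mem_nhds hx] with y hy
    simp [hF, not_le.2 (show 0 < y from hy)]
  have hc : ContinuousWithinAt F (Set.Ici 0) 0 := by
    have h0 : F 0 = 0 := by simp [hF]
    rw [ContinuousWithinAt, h0, ← Set.Ioi_insert, nhdsWithin_insert]
    refine Tendsto.sup ?_ ?_
    · rw [tendsto_pure_left]
      intro s hs
      rw [h0]
      exact mem_of_mem_nhds hs
    · have h1 : Tendsto (fun β : ℝ => Real.exp (-r / β) / r) (𝓝[>] 0) (𝓝 0) := by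
        have h2 : Tendsto (fun β : ℝ => -r / β) (𝓝[>] 0) atBot := by
          simp only [div_eq_mul_inv]
          exact tendsto_inv_nhdsGT_zero.const_mul_atTop_of_neg (neg_lt_zero.2 hr)
        simpa using (Real.tendsto_exp_atBot.comp h2).div_const r
      refine h1.congr' ?_
      filter_upwards [self_mem_nhdsWithin] with y hy
      simp [hF, not_le.2 (show 0 < y from hy)]
  have ht : Tendsto F atTop (𝓝 (1 / r)) := by
    have h1 : Tendsto (fun β : ℝ => Real.exp (-r / β) / r) atTop (𝓝 (1 / r)) := by
      have h2 : Tendsto (fun β : ℝ => -r / β) atTop (𝓝 0) := tendsto_const_nhds.div_atTop tendsto_id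
      have := ((Real.continuous_exp.tendsto 0).comp h2).div_const r
      simpa using this
    refine h1.congr' ?_
    filter_upwards [eventually_gt_atTop 0] with y hy
    simp [hF, not_le.2 hy]
  have hnn : ∀ x ∈ Set.Ioi (0 : ℝ), 0 ≤ (x ^ 2)⁻¹ * Real.exp (-r / x) := fun x _ => by positivity
  refine ⟨integrableOn_Ioi_deriv_of_nonneg hc hd hnn ht, ?_⟩
  rw [integral_Ioi_of_hasDerivAt_of_nonneg hc hd hnn ht]
  simp [hF]

lemma integrableOn_heatDensity (hθ : 0 < θ) {η : Fin 2 → ℂ} (hη : η ≠ 0) :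
    IntegrableOn (fun β => heatDensity θ μ₀ β η) (Set.Ioi 0) := by
  have hn : 0 < ‖η‖ := norm_pos_iff.2 hη
  have h := ((integral_inv_sq_mul_exp (r := ‖η‖ ^ 2 / 8) (by positivity)).1).const_mul
    ((4 * Real.pi ^ 2)⁻¹ * Real.exp (-(freq θ / 4) * ‖η‖ ^ 2))
  refine Integrable.mono' h
    (measurable_heatDensity.comp (measurable_id.prodMk measurable_const)).aestronglyMeasurable ?_
  filter_upwards [self_mem_ae_restrict measurableSet_Ioi] with β hβ
  rw [Real.norm_of_nonneg (heatDensity_nonneg _ _)]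
  exact heatDensity_le hθ hβ η

/-- The dominating function of the densities of the regularized propagators. -/
noncomputable def propBound (θ : ℝ) (η : Fin 2 → ℂ) : ℝ :=
  2 * (Real.pi ^ 2)⁻¹ * ((‖η‖ ^ 2)⁻¹ * Real.exp (-(freq θ / 4) * ‖η‖ ^ 2))

lemma propDensity_le (hθ : 0 < θ) (hε : 0 ≤ ε) {η : Fin 2 → ℂ} (hη : η ≠ 0) :
    propDensity θ μ₀ ε η ≤ propBound θ η := by
  have hn : 0 < ‖η‖ := norm_pos_iff.2 hη
  have hI := integral_inv_sq_mul_exp (r := ‖η‖ ^ 2 / 8) (by positivity)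
  calc propDensity θ μ₀ ε η ≤ ∫ β in Set.Ioi 0, heatDensity θ μ₀ β η :=
        setIntegral_mono_set (integrableOn_heatDensity hθ hη)
          (Eventually.of_forall fun β => heatDensity_nonneg β η)
          (Set.Ioi_subset_Ioi hε).eventuallyLE
    _ ≤ ∫ β in Set.Ioi 0, ((4 * Real.pi ^ 2)⁻¹ * Real.exp (-(freq θ / 4) * ‖η‖ ^ 2)) *
        ((β ^ 2)⁻¹ * Real.exp (-(‖η‖ ^ 2 / 8) / β)) :=
        setIntegral_mono_on (integrableOn_heatDensity hθ hη) (hI.1.const_mul _) measurableSet_Ioi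
          fun β hβ => heatDensity_le hθ hβ η
    _ = _ := by
        rw [integral_const_mul, hI.2, propBound]
        field_simp
        norm_num

lemma tendsto_propDensity (hθ : 0 < θ) {η : Fin 2 → ℂ} (hη : η ≠ 0) :
    Tendsto (fun ε => propDensity θ μ₀ ε η) (𝓝[>] 0) (𝓝 (propDensity θ μ₀ 0 η)) := by
  have hi := integrableOn_heatDensity (μ₀ := μ₀) hθ hη
  have heq : ∀ ε, 0 < ε → propDensity θ μ₀ ε η = ∫ β in Set.Ioi 0,
      (Set.Ioi ε).indicator (fun β => heatDensity θ μ₀ β η) β := by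
    intro ε hε
    rw [setIntegral_indicator measurableSet_Ioi, Set.inter_eq_self_of_subset_right
      (Set.Ioi_subset_Ioi hε.le), propDensity]
  refine Tendsto.congr' (f₁ := fun ε => ∫ β in Set.Ioi 0,
      (Set.Ioi ε).indicator (fun β => heatDensity θ μ₀ β η) β) ?_ ?_
  · filter_upwards [self_mem_nhdsWithin] with ε hε
    exact (heq ε hε).symm
  · refine tendsto_integral_filter_of_dominated_convergence (fun β => heatDensity θ μ₀ β η) ?_ ?_
      hi ?_
    · exact Eventually.of_forall fun ε => hi.aestronglyMeasurable.indicator measurableSet_Ioi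
    · refine Eventually.of_forall fun ε => Eventually.of_forall fun β => ?_
      refine (norm_indicator_le_norm_self _ _).trans ?_
      rw [Real.norm_of_nonneg (heatDensity_nonneg _ _)]
    · filter_upwards [self_mem_ae_restrict measurableSet_Ioi] with β hβ
      refine tendsto_const_nhds.congr' ?_
      filter_upwards [nhdsWithin_le_nhds (Iio_mem_nhds hβ)] with ε hε
      rw [Set.indicator_of_mem (show β ∈ Set.Ioi ε from hε)]

lemma integrableOn_inv_sq (hε : 0 < ε) : IntegrableOn (fun β : ℝ => (β ^ 2)⁻¹) (Set.Ioi ε) := by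
  refine (integrableOn_Ioi_rpow_of_lt (a := -2) (by norm_num) hε).congr_fun (fun β hβ => ?_)
    measurableSet_Ioi
  have : 0 < β := lt_trans hε hβ
  change β ^ (-2 : ℝ) = _
  rw [Real.rpow_neg this.le, Real.rpow_two]

lemma heatDensity_le' (hθ : 0 < θ) {β : ℝ} (hβ : 0 < β) (η : Fin 2 → ℂ) :
    heatDensity θ μ₀ β η ≤ (4 * Real.pi ^ 2)⁻¹ * (β ^ 2)⁻¹ *
      Real.exp (-(freq θ / 4) * ‖η‖ ^ 2) := by
  refine (heatDensity_le hθ hβ η).trans ?_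
  have : Real.exp (-(‖η‖ ^ 2 / 8) / β) ≤ 1 := by
    refine Real.exp_le_one_iff.2 ?_
    rw [neg_div]
    exact neg_nonpos.2 (by positivity)
  rw [mul_right_comm, mul_assoc _ (β ^ 2)⁻¹]
  have h0 : 0 ≤ (4 * Real.pi ^ 2)⁻¹ := by positivity
  calc _ ≤ (4 * Real.pi ^ 2)⁻¹ * ((β ^ 2)⁻¹ * 1) * Real.exp (-(freq θ / 4) * ‖η‖ ^ 2) := by gcongr
    _ = _ := by ring

/-- With the cut-off the density is bounded by a Gaussian. -/
lemma exists_propDensity_le (hθ : 0 < θ) (hε : 0 < ε) : ∃ C : ℝ, 0 ≤ C ∧ ∀ η,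
    propDensity θ μ₀ ε η ≤ C * Real.exp (-(freq θ / 4) * ‖η‖ ^ 2) := by
  refine ⟨∫ β in Set.Ioi ε, (4 * Real.pi ^ 2)⁻¹ * (β ^ 2)⁻¹,
    integral_nonneg fun β => by positivity, fun η => ?_⟩
  rw [← integral_mul_const]
  refine integral_mono_of_nonneg (Eventually.of_forall fun β => heatDensity_nonneg β η)
    (((integrableOn_inv_sq hε).const_mul _).mul_const _) ?_
  filter_upwards [self_mem_ae_restrict measurableSet_Ioi] with β hβ
  exact heatDensity_le' hθ (hε.trans hβ) η

lemma continuous_propDensity (hθ : 0 < θ) (hε : 0 < ε) : Continuous (propDensity θ μ₀ ε) := by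
  refine continuous_of_dominated (bound := fun β => (4 * Real.pi ^ 2)⁻¹ * (β ^ 2)⁻¹) (fun η =>
    (measurable_heatDensity.comp (measurable_id.prodMk measurable_const)).aestronglyMeasurable)
    (fun η => ?_) ((integrableOn_inv_sq hε).const_mul _) ?_
  · filter_upwards [self_mem_ae_restrict measurableSet_Ioi] with β hβ
    rw [Real.norm_of_nonneg (heatDensity_nonneg _ _)]
    refine (heatDensity_le' hθ (hε.trans hβ) η).trans (mul_le_of_le_one_right (by positivity) ?_)
    refine Real.exp_le_one_iff.2 ?_
    have := freq_pos hθ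
    nlinarith [sq_nonneg ‖η‖]
  · refine Eventually.of_forall fun β => ?_
    unfold heatDensity
    fun_prop

lemma integrable_exp_neg_sq_norm {c : ℝ} (hc : 0 < c) :
    Integrable fun η : Fin 2 → ℂ => Real.exp (-c * ‖η‖ ^ 2) := by
  refine (integrable_gaussian_phase (a := c / 2) (by positivity)).mono' (by fun_prop)
    (Eventually.of_forall fun η => ?_)
  rw [Real.norm_of_nonneg (Real.exp_nonneg _)]
  refine Real.exp_le_exp.2 ?_
  have := sum_le_sq_norm η
  nlinarith

lemma integrable_propDensity (hθ : 0 < θ) (hε : 0 < ε) : Integrable (propDensity θ μ₀ ε) := by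
  have hω := freq_pos hθ
  obtain ⟨C, hC0, hC⟩ := exists_propDensity_le (μ₀ := μ₀) hθ hε
  refine ((integrable_exp_neg_sq_norm (c := freq θ / 4) (by positivity)).const_mul C).mono'
    (continuous_propDensity hθ hε).aestronglyMeasurable (Eventually.of_forall fun η => ?_)
  rw [Real.norm_of_nonneg (propDensity_nonneg _ _)]
  exact hC η

lemma exp_energy (β : ℝ) (n : Fin 2 → ℕ) : Real.exp (-β * energy θ μ₀ n) =
    Real.exp (-β * μ₀ ^ 2) * Real.exp (-(2 * freq θ * β)) *
      Real.exp (-(2 * freq θ * β)) ^ (n 0 + n 1) := by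
  rw [← Real.exp_nat_mul, ← Real.exp_add, ← Real.exp_add]
  congr 1
  simp only [energy, Fin.sum_univ_two]
  push_cast; ring

lemma hasSum_propagator_mul (hθ : 0 < θ) (hε : 0 < ε) {c : (Fin 2 → ℕ) → ℂ} {C : ℝ}
    (hc : ∀ n, ‖c n‖ ≤ C) {G : ℝ → ℂ} (hG : ∀ β, ε < β → HasSum (fun n : Fin 2 → ℕ =>
      (Real.exp (-(2 * freq θ * β)) : ℂ) ^ (n 0 + n 1) * c n) (G β)) :
    HasSum (fun n => (propagator θ μ₀ ε n : ℂ) * c n) (∫ β in Set.Ioi ε,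
      ((Real.exp (-β * μ₀ ^ 2) * Real.exp (-(2 * freq θ * β)) : ℝ) : ℂ) * G β) := by
  have hexp : ∀ n, IntegrableOn (fun β => Real.exp (-β * energy θ μ₀ n)) (Set.Ioi ε) := by
    intro n
    refine (integrableOn_exp_mul_Ioi (neg_lt_zero.2 (energy_pos (μ₀ := μ₀) hθ n)) ε).congr_fun
      (fun β _ => ?_) measurableSet_Ioi
    beta_reduce
    congr 1; ring
  set F : (Fin 2 → ℕ) → ℝ → ℂ := fun n β => (Real.exp (-β * energy θ μ₀ n) : ℂ) * c n with hF
  have hint : ∀ n, Integrable (F n) (volume.restrict (Set.Ioi ε)) := fun n =>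
    ((hexp n).ofReal (𝕜 := ℂ)).mul_const _
  have hnorm : ∀ n, ∫ β in Set.Ioi ε, ‖F n β‖ = propagator θ μ₀ ε n * ‖c n‖ := by
    intro n
    rw [propagator, ← integral_mul_const]
    congr 1; funext β
    simp only [hF, norm_mul, Complex.norm_real, Real.norm_of_nonneg (Real.exp_nonneg _)]
  have hsum : Summable fun n => ∫ β in Set.Ioi ε, ‖F n β‖ := by
    simp only [hnorm]
    refine Summable.of_nonneg_of_le (fun n => mul_nonneg (propagator_pos hθ ε n).le (norm_nonneg _))
      (fun n => ?_) ((summable_propagator (μ₀ := μ₀) hθ hε).mul_right C)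
    exact mul_le_mul_of_nonneg_left (hc n) (propagator_pos hθ ε n).le
  have hmain := hasSum_integral_of_summable_integral_norm hint hsum
  have hlhs : ∀ n, ∫ β in Set.Ioi ε, F n β = (propagator θ μ₀ ε n : ℂ) * c n := by
    intro n
    simp only [hF]
    rw [integral_mul_const, propagator, ← integral_complex_ofReal]
  simp only [hlhs] at hmain
  refine hasSum_of_eq hmain (setIntegral_congr_fun measurableSet_Ioi fun β hβ => ?_)
  have h := (hG β hβ).mul_left
    ((Real.exp (-β * μ₀ ^ 2) * Real.exp (-(2 * freq θ * β)) : ℝ) : ℂ)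
  rw [← h.tsum_eq]
  congr 1; funext n
  simp only [hF, exp_energy]
  push_cast; ring

/-- The regularized propagator, between rapidly decaying functions, is the average of the Weyl
operators with weight `propDensity`. -/
lemma Smooth.hasSum_propagator (hθ : 0 < θ) (hε : 0 < ε) (hf : Smooth θ f) (hg : Smooth θ g) :
    HasSum (fun n => (propagator θ μ₀ ε n : ℂ) *
      (bargmannInner θ f (fockBasis θ n) * bargmannInner θ (fockBasis θ n) g))
      (∫ η, (propDensity θ μ₀ ε η : ℂ) * bargmannInner θ f (weyl θ η g)) := by
  have hω := freq_pos hθ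
  have hc : ∀ n, ‖bargmannInner θ f (fockBasis θ n) * bargmannInner θ (fockBasis θ n) g‖ ≤
      ‖hf.vec‖ * ‖hg.vec‖ := by
    intro n
    have h1 := hf.norm_inner_le (smooth_fockBasis hθ n)
    have h2 := (smooth_fockBasis hθ n).norm_inner_le hg
    rw [norm_vec_fockBasis hθ] at h1 h2
    rw [norm_mul]
    rw [mul_one] at h1
    rw [one_mul] at h2
    gcongr
  have h := hasSum_propagator_mul (μ₀ := μ₀) hθ hε hc (fun β hβ => by
    exact hf.hasSum_pow_number hθ hg (Real.exp_pos _)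
      (Real.exp_lt_one_iff.2 (by have : 0 < β := hε.trans hβ; nlinarith [mul_pos hω this])))
  refine hasSum_of_eq h ?_
  obtain ⟨C, hC0, hC⟩ := hf.exists_norm_inner_weyl_le hg
  have hcont := hf.continuous_inner_weyl hg
  have hprod : Integrable (Function.uncurry fun (η : Fin 2 → ℂ) (β : ℝ) =>
      (heatDensity θ μ₀ β η : ℂ) * bargmannInner θ f (weyl θ η g))
      ((volume : Measure (Fin 2 → ℂ)).prod (volume.restrict (Set.Ioi ε))) := by
    have hdom := ((integrable_exp_neg_sq_norm (c := freq θ / 4) (by positivity)).const_mul C).mul_prod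
      ((integrableOn_inv_sq hε).const_mul ((4 * Real.pi ^ 2)⁻¹))
    refine hdom.mono' ?_ ?_
    · refine Measurable.aestronglyMeasurable ?_
      have h1 := (measurable_heatDensity (θ := θ) (μ₀ := μ₀)).comp measurable_swap
        (α := (Fin 2 → ℂ) × ℝ)
      have h2 := (hcont.measurable.comp measurable_fst :
        Measurable fun p : (Fin 2 → ℂ) × ℝ => bargmannInner θ f (weyl θ p.1 g))
      exact (Complex.measurable_ofReal.comp h1).mul h2
    · have hs : ∀ᵐ p ∂((volume : Measure (Fin 2 → ℂ)).prod (volume.restrict (Set.Ioi ε))),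
          ε < p.2 := by
        have := Measure.quasiMeasurePreserving_snd (μ := (volume : Measure (Fin 2 → ℂ)))
          (ν := volume.restrict (Set.Ioi ε))
        exact this.ae (self_mem_ae_restrict measurableSet_Ioi)
      filter_upwards [hs] with p hp
      simp only [Function.uncurry]
      rw [norm_mul, Complex.norm_real, Real.norm_of_nonneg (heatDensity_nonneg _ _)]
      have h1 := heatDensity_le' (μ₀ := μ₀) hθ (hε.trans hp) p.1
      calc _ ≤ ((4 * Real.pi ^ 2)⁻¹ * (p.2 ^ 2)⁻¹ * Real.exp (-(freq θ / 4) * ‖p.1‖ ^ 2)) * C :=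
            mul_le_mul h1 (hC _) (norm_nonneg _) (by positivity)
        _ = _ := by ring
  have hswap := integral_integral_swap hprod
  have hL : ∀ η, (propDensity θ μ₀ ε η : ℂ) * bargmannInner θ f (weyl θ η g) =
      ∫ β in Set.Ioi ε, (heatDensity θ μ₀ β η : ℂ) *
        bargmannInner θ f (weyl θ η g) := by
    intro η
    rw [integral_mul_const, propDensity, ← integral_complex_ofReal]
  simp only [hL]
  rw [hswap]
  refine setIntegral_congr_fun measurableSet_Ioi fun β hβ => ?_
  rw [← integral_const_mul, ← integral_const_mul]
  congr 1; funext η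
  simp only [heatDensity]
  push_cast; ring

/-- The trace of the regularized propagator times a Weyl operator. -/
lemma hasSum_trace_propagator (hθ : 0 < θ) (hε : 0 < ε) (u : Fin 2 → ℂ) :
    HasSum (fun n => (propagator θ μ₀ ε n : ℂ) *
      bargmannInner θ (fockBasis θ n) (weyl θ u (fockBasis θ n)))
      (((Real.pi / freq θ) ^ 2 * propDensity θ μ₀ ε u : ℝ) : ℂ) := by
  have hω := freq_pos hθ
  have hc : ∀ n, ‖bargmannInner θ (fockBasis θ n) (weyl θ u (fockBasis θ n))‖ ≤ 1 := by
    intro n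
    have h1 := (smooth_fockBasis hθ n).norm_inner_le ((smooth_fockBasis hθ n).map_weyl u)
    rwa [(smooth_fockBasis hθ n).norm_vec_weyl, norm_vec_fockBasis hθ, one_mul] at h1
  have h := hasSum_propagator_mul (μ₀ := μ₀) hθ hε hc (fun β hβ => by
    exact hasSum_trace_pow_number hθ u (Real.exp_pos _)
      (Real.exp_lt_one_iff.2 (by have : 0 < β := hε.trans hβ; nlinarith [mul_pos hω this])))
  refine hasSum_of_eq h ?_
  rw [propDensity, ← integral_const_mul, ← integral_complex_ofReal]
  refine setIntegral_congr_fun measurableSet_Ioi fun β hβ => ?_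
  have hq1 : Real.exp (-(2 * freq θ * β)) < 1 :=
    Real.exp_lt_one_iff.2 (by have : 0 < β := hε.trans hβ; nlinarith [mul_pos hω this])
  have hq : 1 - Real.exp (-(2 * freq θ * β)) ≠ 0 := by linarith
  have hπ := Real.pi_ne_zero
  simp only [heatDensity]
  rw [← Complex.ofReal_mul]
  congr 1
  field_simp

end

section

variable {θ μ₀ ε : ℝ}

/-! ### Overlaps of propagator densities -/

/-- The singularity of the propagator at coinciding points, with a Gaussian cut-off at infinity. -/
noncomputable def singKernel (c : ℝ) (η : Fin 2 → ℂ) : ℝ :=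
  (‖η‖ ^ 2)⁻¹ * Real.exp (-c * ‖η‖ ^ 2)

lemma singKernel_nonneg (c : ℝ) (η : Fin 2 → ℂ) : 0 ≤ singKernel c η := by
  unfold singKernel; positivity

lemma measurable_singKernel (c : ℝ) : Measurable (singKernel c) := by
  unfold singKernel; fun_prop

lemma finrank_config : Module.finrank ℝ (Fin 2 → ℂ) = 4 := by
  rw [Module.finrank_pi_fintype]; simp [Complex.finrank_real_complex]

lemma integrable_norm_mul_singKernel_sq {c : ℝ} (hc : 0 < c) :
    Integrable fun η : Fin 2 → ℂ => ‖η‖ * singKernel c η ^ 2 := by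
  have h := (integrable_fun_norm_addHaar (μ := (volume : Measure (Fin 2 → ℂ)))
    (f := fun y : ℝ => y * ((y ^ 2)⁻¹ * Real.exp (-c * y ^ 2)) ^ 2)).2 (by
    rw [finrank_config]
    refine ((integrable_exp_neg_mul_sq (b := 2 * c) (by positivity)).integrableOn
      (s := Set.Ioi 0)).congr_fun (fun y hy => ?_) measurableSet_Ioi
    have hy' : y ≠ 0 := ne_of_gt hy
    simp only [smul_eq_mul]
    rw [mul_pow, ← Real.exp_nat_mul, show -(2 * c) * y ^ 2 = ((2 : ℕ) : ℝ) * (-c * y ^ 2) by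
      push_cast; ring]
    field_simp)
  exact h

lemma integrableOn_radial {b c : ℝ} (hb : 0 < b) (hc : 0 < c) :
    IntegrableOn (fun y : ℝ => 2 * y / (y ^ 2 + b ^ 2) * Real.exp (-c * y ^ 2)) (Set.Ioi 0) := by
  refine (((integrable_mul_exp_neg_mul_sq hc).const_mul (2 / b ^ 2)).integrableOn
    (s := Set.Ioi 0)).mono' ?_ ?_
  · refine Measurable.aestronglyMeasurable ?_
    fun_prop
  · filter_upwards [self_mem_ae_restrict measurableSet_Ioi] with y hy
    have hy' : 0 < y := hy
    rw [Real.norm_of_nonneg (by positivity), ← mul_assoc]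
    refine mul_le_mul_of_nonneg_right ?_ (Real.exp_nonneg _)
    rw [div_mul_eq_mul_div]
    refine div_le_div_of_nonneg_left (by positivity) (by positivity) ?_
    nlinarith [sq_nonneg y]

lemma integral_radial_le {b c : ℝ} (hb : 0 < b) (hc : 0 < c) :
    ∫ y in Set.Ioi (0 : ℝ), 2 * y / (y ^ 2 + b ^ 2) * Real.exp (-c * y ^ 2) ≤
      Real.log (1 + 1 / b ^ 2) + ∫ y in Set.Ioi (1 : ℝ), 2 * (y * Real.exp (-c * y ^ 2)) := by
  have hi := integrableOn_radial hb hc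
  have hU : Set.Ioi (0 : ℝ) = Set.Ioc 0 1 ∪ Set.Ioi 1 :=
    (Set.Ioc_union_Ioi_eq_Ioi zero_le_one).symm
  have hi' := hi
  rw [hU] at hi'
  rw [hU, setIntegral_union (Set.Ioc_disjoint_Ioi le_rfl) measurableSet_Ioi hi'.left_of_union
    hi'.right_of_union]
  refine add_le_add ?_ ?_
  · have hd : ∀ y ∈ Set.uIcc (0 : ℝ) 1, HasDerivAt (fun y : ℝ => Real.log (y ^ 2 + b ^ 2))
        (2 * y / (y ^ 2 + b ^ 2)) y := by
      intro y _
      have h1 : HasDerivAt (fun y : ℝ => y ^ 2 + b ^ 2) (2 * y) y := by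
        simpa using (hasDerivAt_pow 2 y).add_const (b ^ 2)
      exact h1.log (by positivity)
    have hcont : Continuous fun y : ℝ => 2 * y / (y ^ 2 + b ^ 2) :=
      (by fun_prop : Continuous fun y : ℝ => 2 * y).div (by fun_prop) fun y => by positivity
    have hint := hcont.intervalIntegrable (μ := volume) 0 1
    have hFTC := intervalIntegral.integral_eq_sub_of_hasDerivAt hd hint
    rw [intervalIntegral.integral_of_le zero_le_one] at hFTC
    have hval : Real.log (1 ^ 2 + b ^ 2) - Real.log (0 ^ 2 + b ^ 2) = Real.log (1 + 1 / b ^ 2) := by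
      rw [← Real.log_div (by positivity) (by positivity)]
      congr 1
      field_simp
      ring
    rw [hval] at hFTC
    rw [← hFTC]
    refine setIntegral_mono_on hi'.left_of_union
      ((intervalIntegrable_iff_integrableOn_Ioc_of_le zero_le_one).1 hint) measurableSet_Ioc
      fun y hy => ?_
    have hy0 : 0 < y := hy.1
    refine mul_le_of_le_one_right (by positivity) (Real.exp_le_one_iff.2 ?_)
    nlinarith [sq_nonneg y]
  · refine setIntegral_mono_on hi'.right_of_union
      (((integrable_mul_exp_neg_mul_sq hc).const_mul 2).integrableOn) measurableSet_Ioi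
      fun y hy => ?_
    have hy0 : 1 < y := hy
    rw [← mul_assoc]
    refine mul_le_mul_of_nonneg_right ?_ (Real.exp_nonneg _)
    refine div_le_self (by positivity) ?_
    nlinarith [sq_nonneg b]

/-- The convolution square of the singular kernel diverges only logarithmically at the origin. -/
lemma exists_integral_singKernel_le {c : ℝ} (hc : 0 < c) : ∃ C : ℝ, 0 ≤ C ∧
    ∀ u : Fin 2 → ℂ, u ≠ 0 →
      Integrable (fun η => singKernel c η * singKernel c (η + u)) ∧
      ∫ η, singKernel c η * singKernel c (η + u) ≤ C * (1 + Real.log (1 + 4 / ‖u‖ ^ 2)) := by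
  set V : ℝ := (volume : Measure (Fin 2 → ℂ)).real (Metric.ball 0 1) with hV
  have hV0 : 0 ≤ V := measureReal_nonneg
  set R : ℝ := ∫ y in Set.Ioi (1 : ℝ), 2 * (y * Real.exp (-c * y ^ 2)) with hR
  have hR0 : 0 ≤ R := setIntegral_nonneg measurableSet_Ioi fun y hy => by
    have : (1 : ℝ) < y := hy
    positivity
  refine ⟨2 * (4 * (V * (1 + R))), by positivity, fun u hu => ?_⟩
  set b : ℝ := ‖u‖ / 2 with hb
  have hb0 : 0 < b := by have := norm_pos_iff.2 hu; positivity
  set g : ℝ → ℝ := fun y => (y ^ 2)⁻¹ * (2 / (y ^ 2 + b ^ 2)) * Real.exp (-c * y ^ 2) with hg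
  have hrad : ∀ y ∈ Set.Ioi (0 : ℝ), 2 * y / (y ^ 2 + b ^ 2) * Real.exp (-c * y ^ 2) =
      y ^ (Module.finrank ℝ (Fin 2 → ℂ) - 1) • g y := by
    intro y hy
    have hy' : y ≠ 0 := ne_of_gt hy
    rw [finrank_config, hg, smul_eq_mul]
    field_simp
  have hgi : Integrable fun η : Fin 2 → ℂ => g ‖η‖ :=
    (integrable_fun_norm_addHaar (μ := (volume : Measure (Fin 2 → ℂ))) (f := g)).2
      ((integrableOn_radial hb0 hc).congr_fun hrad measurableSet_Ioi)
  have hgI : ∫ η : Fin 2 → ℂ, g ‖η‖ ≤ 4 * (V * (Real.log (1 + 4 / ‖u‖ ^ 2) + R)) := by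
    rw [integral_fun_norm_addHaar, ← setIntegral_congr_fun measurableSet_Ioi hrad, finrank_config,
      smul_eq_mul, nsmul_eq_mul]
    push_cast
    have h := integral_radial_le hb0 hc
    rw [show 1 / b ^ 2 = 4 / ‖u‖ ^ 2 by rw [hb]; field_simp; norm_num] at h
    gcongr
  have hg' : Integrable fun η : Fin 2 → ℂ => g ‖η + u‖ := hgi.comp_add_right u
  have hle : ∀ η : Fin 2 → ℂ, singKernel c η * singKernel c (η + u) ≤ g ‖η‖ + g ‖η + u‖ := by
    -- the closer of the two singularities is the only one seen at `η`
    have key : ∀ x y : ℝ, 0 ≤ x → x ≤ y → b ≤ y →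
        (x ^ 2)⁻¹ * Real.exp (-c * x ^ 2) * ((y ^ 2)⁻¹ * Real.exp (-c * y ^ 2)) ≤ g x := by
      intro x y hx hxy hby
      have h1 : (y ^ 2)⁻¹ ≤ 2 / (x ^ 2 + b ^ 2) := by
        rw [← one_div, div_le_div_iff₀ (by have := hb0.trans_le hby; positivity) (by positivity)]
        nlinarith [mul_self_le_mul_self hx hxy, mul_self_le_mul_self hb0.le hby]
      have h2 : Real.exp (-c * y ^ 2) ≤ 1 := Real.exp_le_one_iff.2 (by nlinarith [sq_nonneg y])
      have h3 : (y ^ 2)⁻¹ * Real.exp (-c * y ^ 2) ≤ 2 / (x ^ 2 + b ^ 2) := by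
        calc _ ≤ (y ^ 2)⁻¹ * 1 := by gcongr
          _ ≤ _ := by rw [mul_one]; exact h1
      calc _ ≤ (x ^ 2)⁻¹ * Real.exp (-c * x ^ 2) * (2 / (x ^ 2 + b ^ 2)) := by gcongr
        _ = _ := by rw [hg]; ring
    have hg0 : ∀ y, 0 ≤ g y := fun y => by simp only [hg]; positivity
    intro η
    have htri : ‖u‖ ≤ ‖η‖ + ‖η + u‖ := by
      have := norm_sub_le (η + u) η
      rw [add_sub_cancel_left] at this
      linarith
    unfold singKernel
    rcases le_total ‖η‖ ‖η + u‖ with h | h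
    · have := key _ _ (norm_nonneg η) h (by linarith)
      linarith [hg0 ‖η + u‖]
    · have := key _ _ (norm_nonneg (η + u)) h (by linarith)
      linarith [hg0 ‖η‖]
  have hint : Integrable fun η => singKernel c η * singKernel c (η + u) := by
    refine (hgi.add hg').mono' ?_ (Eventually.of_forall fun η => ?_)
    · exact ((measurable_singKernel c).mul
        ((measurable_singKernel c).comp (measurable_add_const u))).aestronglyMeasurable
    · rw [Real.norm_of_nonneg (mul_nonneg (singKernel_nonneg _ _) (singKernel_nonneg _ _))]
      exact hle η
  refine ⟨hint, ?_⟩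
  have hlog : 0 ≤ Real.log (1 + 4 / ‖u‖ ^ 2) := Real.log_nonneg (by
    have : 0 ≤ 4 / ‖u‖ ^ 2 := by positivity
    linarith)
  calc _ ≤ ∫ η : Fin 2 → ℂ, (g ‖η‖ + g ‖η + u‖) := integral_mono hint (hgi.add hg') hle
    _ = 2 * ∫ η : Fin 2 → ℂ, g ‖η‖ := by
        rw [integral_add hgi hg', integral_add_right_eq_self (fun η : Fin 2 → ℂ => g ‖η‖)]; ring
    _ ≤ 2 * (4 * (V * (Real.log (1 + 4 / ‖u‖ ^ 2) + R))) := by gcongr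
    _ ≤ _ := by
        have : Real.log (1 + 4 / ‖u‖ ^ 2) + R ≤ (1 + R) * (1 + Real.log (1 + 4 / ‖u‖ ^ 2)) := by
          nlinarith [mul_nonneg hR0 hlog]
        calc _ ≤ 2 * (4 * (V * ((1 + R) * (1 + Real.log (1 + 4 / ‖u‖ ^ 2))))) := by gcongr
          _ = _ := by ring

/-- The overlap of two propagator densities at relative position `u`, weighted by `A`. -/
noncomputable def overlap (θ μ₀ ε : ℝ) (u : Fin 2 → ℂ) (A : (Fin 2 → ℂ) → ℂ) : ℂ :=
  ∫ ξ, ((propDensity θ μ₀ ε ξ * propDensity θ μ₀ ε (ξ + u) : ℝ) : ℂ) * A ξ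

lemma propBound_eq (θ : ℝ) (η : Fin 2 → ℂ) :
    propBound θ η = 2 * (Real.pi ^ 2)⁻¹ * singKernel (freq θ / 4) η := rfl

/-- Polynomial factors are absorbed by the Gaussian. -/
lemma exists_propBound_mul_le (hθ : 0 < θ) (K : ℕ) : ∃ C : ℝ, 0 ≤ C ∧ ∀ u ξ : Fin 2 → ℂ,
    propBound θ ξ * propBound θ (ξ + u) * (1 + ‖ξ‖) ^ K ≤
      C * (singKernel (freq θ / 8) ξ * singKernel (freq θ / 8) (ξ + u)) := by
  have hω := freq_pos hθ
  obtain ⟨C, hC⟩ := exists_pow_mul_exp_le (c := freq θ / 8) (by positivity) K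
  have hC0 : 0 ≤ C := le_trans (by positivity) (hC 0 le_rfl)
  refine ⟨(2 * (Real.pi ^ 2)⁻¹) ^ 2 * C, by positivity, fun u ξ => ?_⟩
  have h1 : singKernel (freq θ / 4) ξ * (1 + ‖ξ‖) ^ K ≤ C * singKernel (freq θ / 8) ξ := by
    have := hC ‖ξ‖ (norm_nonneg _)
    unfold singKernel
    rw [show -(freq θ / 4) * ‖ξ‖ ^ 2 = -(freq θ / 8) * ‖ξ‖ ^ 2 + -(freq θ / 8) * ‖ξ‖ ^ 2 by ring,
      Real.exp_add]
    calc _ = (‖ξ‖ ^ 2)⁻¹ * Real.exp (-(freq θ / 8) * ‖ξ‖ ^ 2) *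
          ((1 + ‖ξ‖) ^ K * Real.exp (-(freq θ / 8) * ‖ξ‖ ^ 2)) := by ring
      _ ≤ (‖ξ‖ ^ 2)⁻¹ * Real.exp (-(freq θ / 8) * ‖ξ‖ ^ 2) * C := by gcongr
      _ = _ := by ring
  have h2 : singKernel (freq θ / 4) (ξ + u) ≤ singKernel (freq θ / 8) (ξ + u) := by
    unfold singKernel
    refine mul_le_mul_of_nonneg_left (Real.exp_le_exp.2 ?_) (by positivity)
    nlinarith [sq_nonneg ‖ξ + u‖]
  rw [propBound_eq, propBound_eq]
  have h3 := singKernel_nonneg (freq θ / 4) (ξ + u)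
  have h4 := singKernel_nonneg (freq θ / 8) ξ
  calc _ = (2 * (Real.pi ^ 2)⁻¹) ^ 2 * ((singKernel (freq θ / 4) ξ * (1 + ‖ξ‖) ^ K) *
        singKernel (freq θ / 4) (ξ + u)) := by ring
    _ ≤ (2 * (Real.pi ^ 2)⁻¹) ^ 2 * ((C * singKernel (freq θ / 8) ξ) *
        singKernel (freq θ / 8) (ξ + u)) := by gcongr
    _ = _ := by ring

lemma norm_overlap_integrand_le (hθ : 0 < θ) (hε : 0 ≤ ε) {u ξ : Fin 2 → ℂ} (hξ : ξ ≠ 0)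
    (hξu : ξ + u ≠ 0) {a : ℂ} {B : ℝ} (ha : ‖a‖ ≤ B) :
    ‖((propDensity θ μ₀ ε ξ * propDensity θ μ₀ ε (ξ + u) : ℝ) : ℂ) * a‖ ≤
      propBound θ ξ * propBound θ (ξ + u) * B := by
  have h0 := propDensity_nonneg (θ := θ) (μ₀ := μ₀) ε ξ
  have h1 := propDensity_nonneg (θ := θ) (μ₀ := μ₀) ε (ξ + u)
  have h2 := propDensity_le (μ₀ := μ₀) hθ hε hξ
  have h3 := propDensity_le (μ₀ := μ₀) hθ hε hξu
  rw [norm_mul, Complex.norm_real, Real.norm_of_nonneg (mul_nonneg h0 h1)]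
  have := h0.trans h2
  have := h1.trans h3
  gcongr

lemma ae_ne (a : Fin 2 → ℂ) : ∀ᵐ ξ : Fin 2 → ℂ, ξ ≠ a := by
  simp [ae_iff]

lemma ae_add_ne_zero (u : Fin 2 → ℂ) : ∀ᵐ ξ : Fin 2 → ℂ, ξ + u ≠ 0 := by
  filter_upwards [ae_ne (-u)] with ξ hξ h
  exact hξ (eq_neg_of_add_eq_zero_left h)

/-- Away from coinciding points the overlap is bounded uniformly in the cut-off. -/
lemma exists_norm_overlap_le (hθ : 0 < θ) (K : ℕ) : ∃ C : ℝ, 0 ≤ C ∧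
    ∀ ε, 0 ≤ ε → ∀ u : Fin 2 → ℂ, u ≠ 0 → ∀ (A : (Fin 2 → ℂ) → ℂ) (B : ℝ), 0 ≤ B →
      (∀ ξ, ‖A ξ‖ ≤ B * (1 + ‖ξ‖) ^ K) →
      ‖overlap θ μ₀ ε u A‖ ≤ C * B * (1 + Real.log (1 + 4 / ‖u‖ ^ 2)) := by
  have hω := freq_pos hθ
  obtain ⟨C₁, hC₁0, hC₁⟩ := exists_propBound_mul_le hθ K
  obtain ⟨C₂, hC₂0, hC₂⟩ := exists_integral_singKernel_le (c := freq θ / 8) (by positivity)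
  refine ⟨C₁ * C₂, by positivity, fun ε hε u hu A B hB hA => ?_⟩
  obtain ⟨hi, hI⟩ := hC₂ u hu
  refine (norm_integral_le_of_norm_le (hi.const_mul (C₁ * B)) ?_).trans ?_
  · filter_upwards [ae_ne 0, ae_add_ne_zero u] with ξ h1 h2
    refine (norm_overlap_integrand_le hθ hε h1 h2 (hA ξ)).trans ?_
    calc _ = propBound θ ξ * propBound θ (ξ + u) * (1 + ‖ξ‖) ^ K * B := by ring
      _ ≤ C₁ * (singKernel (freq θ / 8) ξ * singKernel (freq θ / 8) (ξ + u)) * B :=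
          mul_le_mul_of_nonneg_right (hC₁ u ξ) hB
      _ = _ := by ring
  · rw [integral_const_mul]
    calc _ ≤ C₁ * B * (C₂ * (1 + Real.log (1 + 4 / ‖u‖ ^ 2))) := by gcongr
      _ = _ := by ring

lemma tendsto_overlap (hθ : 0 < θ) {u : Fin 2 → ℂ} (hu : u ≠ 0) {A : (Fin 2 → ℂ) → ℂ}
    (hAc : Continuous A) {B : ℝ} (hB : 0 ≤ B) {K : ℕ} (hA : ∀ ξ, ‖A ξ‖ ≤ B * (1 + ‖ξ‖) ^ K) :
    Tendsto (fun ε => overlap θ μ₀ ε u A) (𝓝[>] 0) (𝓝 (overlap θ μ₀ 0 u A)) := by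
  have hω := freq_pos hθ
  obtain ⟨C₁, hC₁0, hC₁⟩ := exists_propBound_mul_le hθ K
  obtain ⟨C₂, hC₂0, hC₂⟩ := exists_integral_singKernel_le (c := freq θ / 8) (by positivity)
  obtain ⟨hi, hI⟩ := hC₂ u hu
  refine tendsto_integral_filter_of_dominated_convergence _ ?_ ?_ (hi.const_mul (C₁ * B)) ?_
  · filter_upwards [self_mem_nhdsWithin] with ε hε
    have hc := continuous_propDensity (μ₀ := μ₀) hθ hε
    have : Continuous fun ξ => ((propDensity θ μ₀ ε ξ * propDensity θ μ₀ ε (ξ + u) : ℝ) : ℂ) :=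
      by fun_prop
    exact (this.mul hAc).aestronglyMeasurable
  · filter_upwards [self_mem_nhdsWithin] with ε hε
    filter_upwards [ae_ne 0, ae_add_ne_zero u] with ξ h1 h2
    refine (norm_overlap_integrand_le hθ (le_of_lt hε) h1 h2 (hA ξ)).trans ?_
    calc _ = propBound θ ξ * propBound θ (ξ + u) * (1 + ‖ξ‖) ^ K * B := by ring
      _ ≤ C₁ * (singKernel (freq θ / 8) ξ * singKernel (freq θ / 8) (ξ + u)) * B :=
          mul_le_mul_of_nonneg_right (hC₁ u ξ) hB
      _ = _ := by ring
  · filter_upwards [ae_ne 0, ae_add_ne_zero u] with ξ h1 h2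
    exact ((Complex.continuous_ofReal.tendsto _).comp
      ((tendsto_propDensity hθ h1).mul (tendsto_propDensity hθ h2))).mul_const _

/-- The divergent constant: the overlap of the density with itself. -/
noncomputable def selfOverlap (θ μ₀ ε : ℝ) : ℝ := ∫ ξ, propDensity θ μ₀ ε ξ ^ 2

lemma integrable_propDensity_sq (hθ : 0 < θ) (hε : 0 < ε) :
    Integrable fun ξ => propDensity θ μ₀ ε ξ ^ 2 := by
  have hω := freq_pos hθ
  obtain ⟨C, hC0, hC⟩ := exists_propDensity_le (μ₀ := μ₀) hθ hε
  refine ((integrable_propDensity (μ₀ := μ₀) hθ hε).const_mul C).mono'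
    ((continuous_propDensity hθ hε).pow 2).aestronglyMeasurable (Eventually.of_forall fun η => ?_)
  have h0 := propDensity_nonneg (θ := θ) (μ₀ := μ₀) ε η
  rw [Real.norm_of_nonneg (by positivity), sq]
  refine mul_le_mul_of_nonneg_right ((hC η).trans (mul_le_of_le_one_right hC0 ?_)) h0
  exact Real.exp_le_one_iff.2 (by nlinarith [sq_nonneg ‖η‖])

/-- At coinciding points the overlap is a multiple of `selfOverlap` up to a term that converges. -/
lemma exists_norm_overlap_zero_le (hθ : 0 < θ) : ∃ C : ℝ, 0 ≤ C ∧
    ∀ (A : (Fin 2 → ℂ) → ℂ) (B : ℝ), Continuous A → (∀ ξ, ‖A ξ - A 0‖ ≤ B * ‖ξ‖) →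
      (∀ ε, 0 < ε → ‖overlap θ μ₀ ε 0 A - selfOverlap θ μ₀ ε * A 0‖ ≤ C * B) ∧
      ∃ l, Tendsto (fun ε => overlap θ μ₀ ε 0 A - selfOverlap θ μ₀ ε * A 0) (𝓝[>] 0) (𝓝 l) := by
  have hω := freq_pos hθ
  have hi := integrable_norm_mul_singKernel_sq (c := freq θ / 4) (by positivity)
  refine ⟨(2 * (Real.pi ^ 2)⁻¹) ^ 2 * ∫ η : Fin 2 → ℂ, ‖η‖ * singKernel (freq θ / 4) η ^ 2,
    mul_nonneg (by positivity) (integral_nonneg fun η => by positivity), fun A B hAc hA => ?_⟩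
  have hAm : ∀ ε, 0 < ε → AEStronglyMeasurable
      (fun ξ => ((propDensity θ μ₀ ε ξ * propDensity θ μ₀ ε (ξ + 0) : ℝ) : ℂ) * (A ξ - A 0)) := by
    intro ε hε
    have hc := continuous_propDensity (μ₀ := μ₀) hθ hε
    have : Continuous fun ξ => ((propDensity θ μ₀ ε ξ * propDensity θ μ₀ ε (ξ + 0) : ℝ) : ℂ) :=
      by fun_prop
    exact (this.mul (hAc.sub continuous_const)).aestronglyMeasurable
  have hbd : ∀ ε, 0 < ε → ∀ᵐ ξ, ‖((propDensity θ μ₀ ε ξ * propDensity θ μ₀ ε (ξ + 0) : ℝ) : ℂ) *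
      (A ξ - A 0)‖ ≤ (2 * (Real.pi ^ 2)⁻¹) ^ 2 * B * (‖ξ‖ * singKernel (freq θ / 4) ξ ^ 2) := by
    intro ε hε
    filter_upwards [ae_ne 0] with ξ h1
    refine (norm_overlap_integrand_le hθ hε.le h1 (by simpa using h1) (hA ξ)).trans (le_of_eq ?_)
    rw [add_zero, propBound_eq]
    ring
  have heq : ∀ ε, 0 < ε → overlap θ μ₀ ε 0 A - selfOverlap θ μ₀ ε * A 0 =
      ∫ ξ, ((propDensity θ μ₀ ε ξ * propDensity θ μ₀ ε (ξ + 0) : ℝ) : ℂ) * (A ξ - A 0) := by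
    intro ε hε
    have h1 : Integrable fun ξ => ((propDensity θ μ₀ ε ξ * propDensity θ μ₀ ε (ξ + 0) : ℝ) : ℂ) *
        (A ξ - A 0) := (hi.const_mul _).mono' (hAm ε hε) (hbd ε hε)
    have h2 : Integrable fun ξ => ((propDensity θ μ₀ ε ξ * propDensity θ μ₀ ε (ξ + 0) : ℝ) : ℂ) *
        A 0 := by
      have := ((integrable_propDensity_sq (μ₀ := μ₀) hθ hε).ofReal (𝕜 := ℂ)).mul_const (A 0)
      simp only [add_zero, ← sq]
      exact this
    have h3 : selfOverlap θ μ₀ ε * A 0 =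
        ∫ ξ, ((propDensity θ μ₀ ε ξ * propDensity θ μ₀ ε (ξ + 0) : ℝ) : ℂ) * A 0 := by
      rw [integral_mul_const, integral_complex_ofReal]
      simp only [add_zero, ← sq, selfOverlap]
    rw [h3, overlap, sub_eq_iff_eq_add, ← integral_add h1 h2]
    congr 1; funext ξ; ring
  refine ⟨fun ε hε => ?_, ?_⟩
  · rw [heq ε hε]
    refine (norm_integral_le_of_norm_le (hi.const_mul _) (hbd ε hε)).trans (le_of_eq ?_)
    rw [integral_const_mul]; ring
  · refine ⟨∫ ξ, ((propDensity θ μ₀ 0 ξ * propDensity θ μ₀ 0 (ξ + 0) : ℝ) : ℂ) * (A ξ - A 0), ?_⟩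
    refine Tendsto.congr' (f₁ := fun ε => ∫ ξ, ((propDensity θ μ₀ ε ξ *
      propDensity θ μ₀ ε (ξ + 0) : ℝ) : ℂ) * (A ξ - A 0)) ?_ ?_
    · filter_upwards [self_mem_nhdsWithin] with ε hε
      exact (heq ε hε).symm
    · refine tendsto_integral_filter_of_dominated_convergence _ ?_ ?_ (hi.const_mul
        ((2 * (Real.pi ^ 2)⁻¹) ^ 2 * B)) ?_
      · filter_upwards [self_mem_nhdsWithin] with ε hε using hAm ε hε
      · filter_upwards [self_mem_nhdsWithin] with ε hε using hbd ε hε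
      · filter_upwards [ae_ne 0] with ξ h1
        exact ((Complex.continuous_ofReal.tendsto _).comp
          ((tendsto_propDensity hθ h1).mul (tendsto_propDensity hθ (by simpa using h1)))).mul_const _

end

section

variable {θ μ₀ ε : ℝ}

/-! ### The Poisson summation formula -/

/-- The lattice `(ℤ + iℤ)² / √2`, which is dual to the lattice of the points `latticePoint θ γ` with
respect to the phase `exp (2 i sig)`. -/
noncomputable def dualPoint (κ : Fin 2 → ℤ × ℤ) : Fin 2 → ℂ := fun i =>
  ((1 / √2 : ℝ) : ℂ) * ((κ i).1 + (κ i).2 * Complex.I)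

lemma summable_int_inv_sq : Summable fun k : ℤ => ((1 + |(k : ℝ)|) ^ 2)⁻¹ := by
  have h : Summable fun k : ℕ => ((1 + (k : ℝ)) ^ 2)⁻¹ := by
    have := (summable_nat_add_iff 1).2 (Real.summable_nat_pow_inv.2 (by norm_num : 1 < 2))
    refine this.congr fun k => ?_
    push_cast; ring
  refine Summable.of_nat_of_neg ?_ ?_
  · simpa using h
  · simpa using h

/-- Negative eighth powers of the norm are summable over the lattice. -/
lemma summable_lattice : Summable fun γ : Fin 2 → ℤ × ℤ => ((1 + ‖γ‖) ^ 8)⁻¹ := by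
  have h1 := summable_int_inv_sq.mul_of_nonneg summable_int_inv_sq (fun k => by positivity)
    (fun k => by positivity)
  have h2 := h1.mul_of_nonneg h1 (fun k => by positivity) (fun k => by positivity)
  refine Summable.of_nonneg_of_le (fun γ => by positivity) (fun γ => ?_)
    ((finTwoArrowEquiv (ℤ × ℤ)).summable_iff.2 h2)
  have ha : ∀ i, |((γ i).1 : ℝ)| ≤ ‖γ‖ := fun i =>
    (Int.norm_eq_abs _).symm.le.trans ((norm_fst_le (γ i)).trans (norm_le_pi_norm γ i))
  have hb : ∀ i, |((γ i).2 : ℝ)| ≤ ‖γ‖ := fun i =>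
    (Int.norm_eq_abs _).symm.le.trans ((norm_snd_le (γ i)).trans (norm_le_pi_norm γ i))
  simp only [Function.comp, finTwoArrowEquiv_apply]
  rw [← mul_inv, ← mul_inv, ← mul_inv]
  refine inv_anti₀ (by positivity) ?_
  calc _ ≤ ((1 + ‖γ‖) ^ 2 * (1 + ‖γ‖) ^ 2) * ((1 + ‖γ‖) ^ 2 * (1 + ‖γ‖) ^ 2) := by
        have := ha 0; have := ha 1; have := hb 0; have := hb 1
        gcongr <;> assumption
    _ = _ := by ring

lemma norm_int_le (k : ℤ × ℤ) : ‖k‖ ≤ ‖((k.1 : ℂ) + k.2 * Complex.I)‖ := by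
  have h1 : |(k.1 : ℝ)| ≤ ‖((k.1 : ℂ) + k.2 * Complex.I)‖ := by
    simpa using Complex.abs_re_le_norm ((k.1 : ℂ) + k.2 * Complex.I)
  have h2 : |(k.2 : ℝ)| ≤ ‖((k.1 : ℂ) + k.2 * Complex.I)‖ := by
    simpa using Complex.abs_im_le_norm ((k.1 : ℂ) + k.2 * Complex.I)
  rw [Prod.norm_def]
  exact max_le (by rwa [Int.norm_eq_abs]) (by rwa [Int.norm_eq_abs])

lemma norm_le_norm_latticePoint (hθ : 0 < θ) (γ : Fin 2 → ℤ × ℤ) :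
    θ / √2 * ‖γ‖ ≤ ‖latticePoint θ γ‖ := by
  have h0 : 0 < θ / √2 := by positivity
  rw [← le_div_iff₀' h0]
  refine (pi_norm_le_iff_of_nonneg (by positivity)).2 fun i => ?_
  rw [le_div_iff₀' h0]
  refine le_trans ?_ (norm_le_pi_norm (latticePoint θ γ) i)
  rw [latticePoint, norm_mul, Complex.norm_real, Real.norm_of_nonneg h0.le]
  exact mul_le_mul_of_nonneg_left (norm_int_le _) h0.le

lemma norm_le_norm_dualPoint (κ : Fin 2 → ℤ × ℤ) : 1 / √2 * ‖κ‖ ≤ ‖dualPoint κ‖ :=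
  norm_le_norm_latticePoint (θ := 1) one_pos κ

/-- Comparison of decay in two sizes with `c * x ≤ y`; it turns rapid decay on `ℂ²` into rapid decay
along a lattice. -/
lemma exists_inv_pow_le {c : ℝ} (hc : 0 < c) (K : ℕ) : ∃ C : ℝ, 0 ≤ C ∧ ∀ x y : ℝ, 0 ≤ x → c * x ≤ y →
    ((1 + y) ^ K)⁻¹ ≤ C * ((1 + x) ^ K)⁻¹ := by
  refine ⟨((min 1 c) ^ K)⁻¹, by positivity, fun x y hx hxy => ?_⟩
  have hm : 0 < min 1 c := lt_min one_pos hc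
  rw [← mul_inv, ← mul_pow]
  refine inv_anti₀ (by positivity) ?_
  refine pow_le_pow_left₀ (by positivity) ?_ K
  have h1 : min 1 c ≤ 1 := min_le_left _ _
  have h2 : min 1 c * x ≤ c * x := mul_le_mul_of_nonneg_right (min_le_right _ _) hx
  nlinarith

/-- Real coordinates on `ℂ²` in which the dual lattice is `ℤ⁴`. -/
noncomputable def coordEquiv : (Fin 2 ⊕ Fin 2 → ℝ) ≃ₗ[ℝ] (Fin 2 → ℂ) where
  toFun x := fun i => ((1 / √2 : ℝ) : ℂ) * ((x (Sum.inl i) : ℂ) + x (Sum.inr i) * Complex.I)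
  invFun z := Sum.elim (fun i => √2 * (z i).re) (fun i => √2 * (z i).im)
  map_add' x y := by funext i; simp; ring
  map_smul' c x := by funext i; simp; ring
  left_inv x := by
    funext i
    have h : √2 * (1 / √2) = (1 : ℝ) := by field_simp
    rcases i with i | i <;> simp [-one_div, ← mul_assoc, h]
  right_inv z := by
    funext i
    have h : 1 / √2 * √2 = (1 : ℝ) := by field_simp
    apply Complex.ext <;> simp [-one_div, ← mul_assoc, h]

/-- The lattice index with given real coordinates. -/
def latticeEquiv : (Fin 2 ⊕ Fin 2 → ℤ) ≃ (Fin 2 → ℤ × ℤ) where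
  toFun k := fun i => (k (Sum.inl i), k (Sum.inr i))
  invFun γ := Sum.elim (fun i => (γ i).1) (fun i => (γ i).2)
  left_inv k := by funext i; rcases i with i | i <;> rfl
  right_inv γ := rfl

/-- The character of `ℤ⁴` that corresponds to the lattice point `γ`. -/
def charEquiv : (Fin 2 ⊕ Fin 2 → ℤ) ≃ (Fin 2 → ℤ × ℤ) where
  toFun k := fun i => (-k (Sum.inr i), k (Sum.inl i))
  invFun γ := Sum.elim (fun i => (γ i).2) (fun i => -(γ i).1)
  left_inv k := by funext i; rcases i with i | i <;> simp
  right_inv γ := by funext i; simp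

lemma coordEquiv_intCast (k : Fin 2 ⊕ Fin 2 → ℤ) :
    coordEquiv (fun i => (k i : ℝ)) = dualPoint (latticeEquiv k) := by
  funext i
  change _ = ((1 / √2 : ℝ) : ℂ) * ((k (Sum.inl i) : ℂ) + (k (Sum.inr i) : ℂ) * Complex.I)
  simp [coordEquiv]

lemma continuous_coordEquiv : Continuous coordEquiv :=
  LinearMap.continuous_of_finiteDimensional (coordEquiv : (Fin 2 ⊕ Fin 2 → ℝ) →ₗ[ℝ] (Fin 2 → ℂ))

lemma two_mul_sig_coordEquiv (hθ : 0 < θ) (x : Fin 2 ⊕ Fin 2 → ℝ) (k : Fin 2 ⊕ Fin 2 → ℤ) :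
    2 * sig θ (coordEquiv x) (latticePoint θ (charEquiv k)) = 2 * Real.pi * ∑ i, k i * x i := by
  have h2 : (√2)⁻¹ * (√2)⁻¹ = (1 / 2 : ℝ) := by
    rw [← mul_inv, Real.mul_self_sqrt (by norm_num)]; norm_num
  simp only [sig, coordEquiv, latticePoint, charEquiv, freq, Fin.sum_univ_two,
    Fintype.sum_sum_type, LinearEquiv.coe_mk, LinearMap.coe_mk, AddHom.coe_mk, Equiv.coe_fn_mk,
    map_mul, map_add, Complex.conj_ofReal, Complex.conj_I, Complex.mul_im, Complex.mul_re,
    Complex.add_re, Complex.add_im, Complex.ofReal_re, Complex.ofReal_im, Complex.I_re,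
    Complex.I_im, Complex.neg_re, Complex.neg_im, Complex.intCast_re, Complex.intCast_im]
  push_cast
  rw [one_div, div_eq_mul_inv θ]
  field_simp
  ring_nf
  norm_num
  ring

lemma mFourier_neg_apply (hθ : 0 < θ) (x : Fin 2 ⊕ Fin 2 → ℝ) (k : Fin 2 ⊕ Fin 2 → ℤ) :
    UnitAddTorus.mFourier (-k) (fun i => (x i : UnitAddCircle)) =
      Complex.exp (Complex.I *
        ((-(2 * sig θ (coordEquiv x) (latticePoint θ (charEquiv k))) : ℝ) : ℂ)) := by
  rw [two_mul_sig_coordEquiv hθ]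
  simp only [UnitAddTorus.mFourier, ContinuousMap.coe_mk, fourier_coe_apply, Pi.neg_apply]
  rw [← Complex.exp_sum]
  congr 1
  push_cast
  rw [Finset.mul_sum, ← Finset.sum_neg_distrib, Finset.mul_sum]
  refine Finset.sum_congr rfl fun i _ => ?_
  ring

/-- The unit cell with lower corner `k`. -/
def unitCell (k : Fin 2 ⊕ Fin 2 → ℤ) : Set (Fin 2 ⊕ Fin 2 → ℝ) :=
  {x | ∀ i, x i ∈ Set.Ioc (k i : ℝ) (k i + 1)}

lemma measurableSet_unitCell (k : Fin 2 ⊕ Fin 2 → ℤ) : MeasurableSet (unitCell k) :=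
  MeasurableSet.univ_pi' fun _ => measurableSet_Ioc

lemma pairwise_disjoint_unitCell : Pairwise (Function.onFun Disjoint unitCell) := by
  intro k l hkl
  refine Set.disjoint_left.2 fun x hk hl => hkl (funext fun i => ?_)
  have h1 := hk i
  have h2 := hl i
  have h3 : (k i : ℝ) < l i + 1 := h1.1.trans_le h2.2
  have h4 : (l i : ℝ) < k i + 1 := h2.1.trans_le h1.2
  have h3' : k i < l i + 1 := by exact_mod_cast h3
  have h4' : l i < k i + 1 := by exact_mod_cast h4
  omega

lemma iUnion_unitCell : ⋃ k, unitCell k = Set.univ := by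
  refine Set.eq_univ_of_forall fun x => Set.mem_iUnion.2 ⟨fun i => ⌈x i⌉ - 1, fun i => ?_⟩
  have h1 := Int.le_ceil (x i)
  have h2 := Int.ceil_lt_add_one (x i)
  constructor
  · push_cast; linarith
  · push_cast; linarith

lemma setIntegral_unitCell {E : Type*} [NormedAddCommGroup E] [NormedSpace ℝ E]
    (G : (Fin 2 ⊕ Fin 2 → ℝ) → E) (k : Fin 2 ⊕ Fin 2 → ℤ) :
    ∫ x in unitCell k, G x = ∫ x in unitCell 0, G (x + fun i => (k i : ℝ)) := by
  have h := (measurePreserving_add_right (volume : Measure (Fin 2 ⊕ Fin 2 → ℝ))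
    (fun i => (k i : ℝ))).setIntegral_preimage_emb (measurableEmbedding_addRight _) G (unitCell k)
  rw [← h]
  congr 2
  ext x
  simp [unitCell, add_comm]

/-- Unfolding of the integral of a periodization. -/
lemma integral_unitCell_tsum {G : (Fin 2 ⊕ Fin 2 → ℝ) → ℂ} (hG : Integrable G) :
    ∫ x in unitCell 0, ∑' k : Fin 2 ⊕ Fin 2 → ℤ, G (x + fun i => (k i : ℝ)) = ∫ x, G x := by
  have hn := hasSum_integral_iUnion measurableSet_unitCell pairwise_disjoint_unitCell
    (f := fun x => ‖G x‖) (μ := volume) hG.norm.integrableOn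
  simp only [setIntegral_unitCell (fun x => ‖G x‖)] at hn
  have h := hasSum_integral_iUnion measurableSet_unitCell pairwise_disjoint_unitCell
    (f := G) (μ := volume) hG.integrableOn
  rw [iUnion_unitCell, setIntegral_univ] at h
  simp only [setIntegral_unitCell G] at h
  rw [← h.tsum_eq]
  exact (integral_tsum_of_summable_integral_norm
    (F := fun (k : Fin 2 ⊕ Fin 2 → ℤ) x => G (x + fun i => (k i : ℝ)))
    (fun k => (hG.comp_add_right _).integrableOn) hn.summable).symm

lemma isOpenQuotientMap_torus : IsOpenQuotientMap
    (Pi.map fun (_ : Fin 2 ⊕ Fin 2) (x : ℝ) => (x : UnitAddCircle)) :=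
  IsOpenQuotientMap.piMap fun _ => QuotientAddGroup.isOpenQuotientMap_mk

/-- Polynomial decay that suffices for summability over the lattice and integrability. -/
def HasDecay (F : (Fin 2 → ℂ) → ℂ) : Prop := ∃ C : ℝ, 0 ≤ C ∧ ∀ x, ‖F x‖ ≤ C * ((1 + ‖x‖) ^ 8)⁻¹

lemma HasDecay.integrable {F : (Fin 2 → ℂ) → ℂ} (h : HasDecay F) (hc : Continuous F) :
    Integrable F := by
  obtain ⟨C, hC0, hC⟩ := h
  refine (integrable_inv_pow.const_mul C).mono' hc.aestronglyMeasurable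
    (Eventually.of_forall fun x => (hC x).trans ?_)
  refine mul_le_mul_of_nonneg_left (inv_anti₀ (by positivity) ?_) hC0
  exact pow_le_pow_right₀ (by linarith [norm_nonneg x]) (by norm_num)

lemma inv_pow_add_le (x y : Fin 2 → ℂ) (K : ℕ) :
    ((1 + ‖x + y‖) ^ K)⁻¹ ≤ (1 + ‖x‖) ^ K * ((1 + ‖y‖) ^ K)⁻¹ := by
  have h := one_add_norm_le y x
  rw [add_comm y x] at h
  rw [← div_eq_mul_inv, ← one_div, div_le_div_iff₀ (by positivity) (by positivity), one_mul,
    ← mul_pow]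
  exact pow_le_pow_left₀ (by positivity) h K

lemma HasDecay.exists_translate_le {F : (Fin 2 → ℂ) → ℂ} (h : HasDecay F) :
    ∃ C : ℝ, 0 ≤ C ∧ ∀ x κ, ‖F (x + dualPoint κ)‖ ≤ C * (1 + ‖x‖) ^ 8 * ((1 + ‖κ‖) ^ 8)⁻¹ := by
  obtain ⟨C, hC0, hC⟩ := h
  obtain ⟨C', hC'0, hC'⟩ := exists_inv_pow_le (c := 1 / √2) (by positivity) 8
  refine ⟨C * C', by positivity, fun x κ => ?_⟩
  calc _ ≤ C * ((1 + ‖x + dualPoint κ‖) ^ 8)⁻¹ := hC _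
    _ ≤ C * ((1 + ‖x‖) ^ 8 * ((1 + ‖dualPoint κ‖) ^ 8)⁻¹) := by
        gcongr; exact inv_pow_add_le _ _ _
    _ ≤ C * ((1 + ‖x‖) ^ 8 * (C' * ((1 + ‖κ‖) ^ 8)⁻¹)) := by
        gcongr; exact hC' _ _ (norm_nonneg _) (norm_le_norm_dualPoint κ)
    _ = _ := by ring

lemma HasDecay.continuous_periodization {F : (Fin 2 → ℂ) → ℂ} (h : HasDecay F)
    (hc : Continuous F) : Continuous fun x => ∑' κ, F (x + dualPoint κ) := by
  obtain ⟨C, hC0, hC⟩ := h.exists_translate_le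
  refine continuous_iff_continuousAt.2 fun x₀ => ?_
  have hon : ContinuousOn (fun x => ∑' κ, F (x + dualPoint κ)) (Metric.ball x₀ 1) := by
    refine continuousOn_tsum (u := fun κ => C * (1 + (‖x₀‖ + 1)) ^ 8 * ((1 + ‖κ‖) ^ 8)⁻¹)
      (fun κ => (hc.comp (continuous_id.add continuous_const)).continuousOn)
      (summable_lattice.mul_left _) fun κ x hx => (hC x κ).trans ?_
    have : ‖x‖ ≤ ‖x₀‖ + 1 := by
      have h1 := norm_le_norm_add_norm_sub' x x₀
      have h2 : ‖x - x₀‖ < 1 := by simpa [dist_eq_norm] using hx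
      linarith
    gcongr
  exact hon.continuousAt (Metric.ball_mem_nhds x₀ one_pos)

/-- The Poisson summation formula for the lattice of the noncommutative torus. The constant is the
covolume of the dual lattice. -/
theorem exists_poisson (hθ : 0 < θ) : ∃ c : ℝ, ∀ F : (Fin 2 → ℂ) → ℂ, Continuous F → HasDecay F →
    Summable (fun γ => ∫ x, F x *
      Complex.exp (Complex.I * ((-(2 * sig θ x (latticePoint θ γ)) : ℝ) : ℂ))) →
    ∑' γ, ∫ x, F x * Complex.exp (Complex.I * ((-(2 * sig θ x (latticePoint θ γ)) : ℝ) : ℂ)) =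
      c * ∑' κ, F (dualPoint κ) := by
  set L : (Fin 2 ⊕ Fin 2 → ℝ) ≃L[ℝ] (Fin 2 → ℂ) := coordEquiv.toContinuousLinearEquiv with hL
  have hLapp : ∀ x, L x = coordEquiv x := fun x => rfl
  set ν : Measure (Fin 2 → ℂ) := Measure.map L volume with hν
  have : ν.IsAddHaarMeasure := L.isAddHaarMeasure_map volume
  -- the ratio of the Haar measures, that is the covolume
  set c := Measure.addHaarScalarFactor (volume : Measure (Fin 2 → ℂ)) ν with hcdef
  have hvol : (volume : Measure (Fin 2 → ℂ)) = c • ν :=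
    Measure.isAddLeftInvariant_eq_smul _ _
  have hint : ∀ G : (Fin 2 → ℂ) → ℂ, ∫ x, G x = (c : ℝ) * ∫ x, G (coordEquiv x) := by
    intro G
    conv_lhs => rw [hvol]
    have h := L.toHomeomorph.measurableEmbedding.integral_map (μ := volume) G
    rw [integral_smul_nnreal_measure, hν]
    erw [h]
    rw [NNReal.smul_def, Complex.real_smul]
    rfl
  refine ⟨c, fun F hFc hF hsum => ?_⟩
  -- the periodization of `F` over the dual lattice descends to the torus
  set P : (Fin 2 → ℂ) → ℂ := fun x => ∑' κ, F (x + dualPoint κ) with hP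
  have hPk : ∀ x, P (coordEquiv x) =
      ∑' k : Fin 2 ⊕ Fin 2 → ℤ, F (coordEquiv (x + fun i => (k i : ℝ))) := by
    intro x
    simp only [hP]
    rw [← latticeEquiv.tsum_eq]
    simp only [map_add, coordEquiv_intCast]
  have hper : ∀ x (l : Fin 2 ⊕ Fin 2 → ℤ),
      P (coordEquiv (x + fun i => (l i : ℝ))) = P (coordEquiv x) := by
    intro x l
    rw [hPk, hPk, ← (Equiv.addRight l).tsum_eq
      (fun k : Fin 2 ⊕ Fin 2 → ℤ => F (coordEquiv (x + fun i => (k i : ℝ))))]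
    refine tsum_congr fun k => ?_
    congr 2
    funext i
    simp only [Pi.add_apply, Equiv.coe_addRight, Int.cast_add]
    ring
  set q : (Fin 2 ⊕ Fin 2 → ℝ) → UnitAddTorus (Fin 2 ⊕ Fin 2) :=
    Pi.map fun _ (x : ℝ) => (x : UnitAddCircle) with hq
  have hqs : Function.Surjective q := isOpenQuotientMap_torus.surjective
  set f₀ : UnitAddTorus (Fin 2 ⊕ Fin 2) → ℂ := fun t => P (coordEquiv (Function.surjInv hqs t))
    with hf₀
  have hfq : ∀ x, f₀ (q x) = P (coordEquiv x) := by
    intro x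
    have h1 : q (Function.surjInv hqs (q x)) = q x := Function.surjInv_eq hqs _
    have h2 : ∀ i, ∃ n : ℤ, (n : ℝ) = Function.surjInv hqs (q x) i - x i := by
      intro i
      have h3 := congrFun h1 i
      simp only [hq, Pi.map_apply] at h3
      have h4 := (QuotientAddGroup.eq_iff_sub_mem.1 h3)
      obtain ⟨n, hn⟩ := AddSubgroup.mem_zmultiples_iff.1 h4
      exact ⟨n, by simpa using hn⟩
    choose n hn using h2
    simp only [hf₀]
    rw [← hper x n]
    congr 2
    funext i
    simp [hn]
  have hPc : Continuous P := hF.continuous_periodization hFc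
  have hf₀c : Continuous f₀ := by
    refine isOpenQuotientMap_torus.isQuotientMap.continuous_iff.2 ?_
    exact (hPc.comp continuous_coordEquiv).congr fun x => (hfq x).symm
  set f : C(UnitAddTorus (Fin 2 ⊕ Fin 2), ℂ) := ⟨f₀, hf₀c⟩ with hf
  have hFi : Integrable F := hF.integrable hFc
  have hFLi : Integrable fun x => F (coordEquiv x) := by
    have h1 : Integrable F ν := by
      obtain ⟨C, hC0, hC⟩ := hF
      have hcν : ν = (Measure.addHaarScalarFactor ν volume) • volume :=
        Measure.isAddLeftInvariant_eq_smul _ _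
      rw [hcν]
      exact hFi.smul_measure_nnreal
    exact (L.toHomeomorph.measurableEmbedding.integrable_map_iff).1 h1
  -- the Fourier coefficients of the periodization, unfolded to integrals over `ℂ²`
  have hcoeff : ∀ k, (c : ℝ) * UnitAddTorus.mFourierCoeff f k = ∫ x, F x * Complex.exp
      (Complex.I * ((-(2 * sig θ x (latticePoint θ (charEquiv k))) : ℝ) : ℂ)) := by
    intro k
    rw [hint, UnitAddTorus.mFourierCoeff_eq_integral f k 0]
    congr 1
    have hG : Integrable fun x => F (coordEquiv x) * Complex.exp
        (Complex.I * ((-(2 * sig θ (coordEquiv x) (latticePoint θ (charEquiv k))) : ℝ) : ℂ)) := by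
      refine hFLi.norm.mono' ?_ (Eventually.of_forall fun x => ?_)
      · have h1 : Continuous fun x => F (coordEquiv x) := hFc.comp continuous_coordEquiv
        have h2 : Continuous fun x : Fin 2 ⊕ Fin 2 → ℝ => Complex.exp (Complex.I *
            ((-(2 * sig θ (coordEquiv x) (latticePoint θ (charEquiv k))) : ℝ) : ℂ)) := by
          simp only [two_mul_sig_coordEquiv hθ]
          fun_prop
        exact (h1.mul h2).aestronglyMeasurable
      · rw [norm_mul, norm_exp_I_mul, mul_one]
    rw [← integral_unitCell_tsum hG]
    have hset : unitCell 0 = {x : Fin 2 ⊕ Fin 2 → ℝ |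
        ∀ i, x i ∈ Set.Ioc ((0 : Fin 2 ⊕ Fin 2 → ℝ) i) ((0 : Fin 2 ⊕ Fin 2 → ℝ) i + 1)} := by
      simp [unitCell]
    rw [hset]
    congr 1; funext x
    have hx : f (fun i => (x i : UnitAddCircle)) = P (coordEquiv x) := hfq x
    rw [hx, hPk, smul_eq_mul, ← tsum_mul_left]
    refine tsum_congr fun l => ?_
    rw [mul_comm, ← mFourier_neg_apply hθ]
    congr 2
    funext i
    simp only [Pi.add_apply]
    have : ((l i : ℝ) : UnitAddCircle) = 0 := by
      rw [AddCircle.coe_eq_zero_iff]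
      exact ⟨l i, by simp⟩
    rw [AddCircle.coe_add, this, add_zero]
  rw [← charEquiv.summable_iff] at hsum
  rw [← charEquiv.tsum_eq]
  simp only [Function.comp_def, ← hcoeff] at hsum ⊢
  by_cases hc0 : (c : ℝ) = 0
  · simp [hc0]
  have hsum' : Summable (UnitAddTorus.mFourierCoeff f) :=
    (summable_mul_left_iff (by exact_mod_cast hc0)).1 hsum
  rw [tsum_mul_left]
  congr 1
  have h := (UnitAddTorus.hasSum_mFourier_series_apply_of_summable hsum' (q 0)).tsum_eq
  have h0 : f (q 0) = ∑' κ, F (dualPoint κ) := by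
    have := hfq 0
    simp only [map_zero, hP, zero_add] at this
    exact this
  rw [← h0, ← h]
  refine tsum_congr fun k => ?_
  have : UnitAddTorus.mFourier k (q 0) = 1 := by
    simp [UnitAddTorus.mFourier, hq]
  rw [this, smul_eq_mul, mul_one]

end

section

variable {θ μ₀ ε : ℝ} {f g h k φ : (Fin 2 → ℂ) → ℂ}

/-! ### Orthogonality relations and the Janssen representation -/

/-- The integrand of the orthogonality relations. -/
noncomputable def schurIntegrand (θ : ℝ) (f k g h : (Fin 2 → ℂ) → ℂ) (η : Fin 2 → ℂ)
    (p : (Fin 2 → ℂ) × (Fin 2 → ℂ)) : ℂ :=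
  (conj (emb θ (weyl θ η g) p.1) * emb θ h p.1) * (conj (emb θ f p.2) * emb θ (weyl θ η k) p.2)

lemma norm_schurIntegrand (f k g h : (Fin 2 → ℂ) → ℂ) (η : Fin 2 → ℂ)
    (p : (Fin 2 → ℂ) × (Fin 2 → ℂ)) : ‖schurIntegrand θ f k g h η p‖ = (freq θ / Real.pi) ^ 4 *
      (wt θ g (p.1 + η) * wt θ h p.1 * (wt θ f p.2 * wt θ k (p.2 + η))) := by
  rw [schurIntegrand, norm_mul, norm_conj_emb_mul, norm_conj_emb_mul, wt_weyl, wt_weyl]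
  ring

lemma continuous_schurIntegrand (hf : Smooth θ f) (hk : Smooth θ k) (hg : Smooth θ g) (hh : Smooth θ h) :
    Continuous (Function.uncurry (schurIntegrand θ f k g h)) := by
  have h1 := hf.diff.continuous
  have h2 := hk.diff.continuous
  have h3 := hg.diff.continuous
  have h4 := hh.diff.continuous
  unfold Function.uncurry schurIntegrand emb weyl
  fun_prop

lemma integral_schurIntegrand (f k g h : (Fin 2 → ℂ) → ℂ) (η : Fin 2 → ℂ) :
    ∫ p : (Fin 2 → ℂ) × (Fin 2 → ℂ), schurIntegrand θ f k g h η p =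
      bargmannInner θ f (weyl θ η k) * bargmannInner θ (weyl θ η g) h := by
  rw [mul_comm, bargmannInner_eq, bargmannInner_eq]
  simp only [schurIntegrand]
  exact integral_prod_mul (μ := (volume : Measure (Fin 2 → ℂ)))
    (ν := (volume : Measure (Fin 2 → ℂ)))
    (fun w => conj (emb θ (weyl θ η g) w) * emb θ h w)
    (fun z => conj (emb θ f z) * emb θ (weyl θ η k) z)

lemma schurIntegrand_sub (f k g h : (Fin 2 → ℂ) → ℂ) (u w z : Fin 2 → ℂ) :
    schurIntegrand θ f k g h (u - z) (w, z) = (freq θ / Real.pi : ℂ) ^ 4 *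
      (conj (Complex.exp (freq θ * ∑ i, conj (z i) * w i) *
        (f z * g (w + (u - z)) * Complex.exp (freq θ * ∑ i, conj (u i) * z i)) *
        ((Real.exp (-freq θ * ∑ i, ‖z i‖ ^ 2) : ℝ) : ℂ)) *
      (k u * h w * Complex.exp (-(freq θ * ∑ i, u i * conj (w i))) *
        ((Real.exp (-freq θ * ∑ i, ‖u i‖ ^ 2) : ℝ) : ℂ) *
        ((Real.exp (-freq θ * ∑ i, ‖w i‖ ^ 2) : ℝ) : ℂ))) := by
  have hz : z + (u - z) = u := by abel
  have hE : ∀ v : Fin 2 → ℂ, ((Real.exp (-freq θ * ∑ i, ‖v i‖ ^ 2) : ℝ) : ℂ) =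
      Complex.exp (-freq θ * ∑ i, conj (v i) * v i) := by
    intro v; simp only [Complex.conj_mul']; push_cast; rfl
  have hE' : ∀ v : Fin 2 → ℂ, ((Real.exp (-(freq θ / 2) * ∑ i, ‖v i‖ ^ 2) : ℝ) : ℂ) =
      Complex.exp (-(freq θ / 2) * ∑ i, conj (v i) * v i) := by
    intro v; simp only [Complex.conj_mul']; push_cast; rfl
  have hN : ∀ a : ℂ, (‖a‖ : ℂ) ^ 2 = conj a * a := fun a => (Complex.conj_mul' a).symm
  simp only [schurIntegrand, emb, weyl, hz, Complex.ofReal_mul, hE, hE', hN, map_mul,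
    Complex.conj_ofReal, ← Complex.exp_conj]
  simp only [Fin.sum_univ_two, Pi.sub_apply]
  simp only [map_mul, map_neg, map_sub, map_add, map_div₀, Complex.conj_conj, Complex.conj_ofReal,
    map_ofNat]
  have hcomb : ∀ a b c d e x1 x2 x3 x4 x5 x6 y1 y2 y3 y4 y5 y6 : ℂ,
      x1 + x2 + x3 + x4 + x5 + x6 = y1 + y2 + y3 + y4 + y5 + y6 →
      (a * Complex.exp x1 * (Complex.exp x2 * b) * (a * Complex.exp x3 * c)) *
        (a * Complex.exp x4 * d * (a * Complex.exp x5 * (Complex.exp x6 * e))) =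
      a ^ 4 * (Complex.exp y1 * (d * b * Complex.exp y2) * Complex.exp y3 *
        (e * c * Complex.exp y4 * Complex.exp y5 * Complex.exp y6)) := by
    intro a b c d e x1 x2 x3 x4 x5 x6 y1 y2 y3 y4 y5 y6 hxy
    have h0 : Complex.exp x1 * Complex.exp x2 * Complex.exp x3 * Complex.exp x4 *
        Complex.exp x5 * Complex.exp x6 = Complex.exp y1 * Complex.exp y2 * Complex.exp y3 *
        Complex.exp y4 * Complex.exp y5 * Complex.exp y6 := by
      simp only [← Complex.exp_add, hxy]
    linear_combination a ^ 4 * b * c * d * e * h0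
  push_cast
  refine hcomb _ _ _ _ _ _ _ _ _ _ _ _ _ _ _ _ _ ?_
  ring

attribute [irreducible] schurIntegrand

/-- The inner integral is evaluated by the reproducing property of the Gaussian measure. -/
lemma integral_schurIntegrand_sub (hθ : 0 < θ) (hf : Smooth θ f) (hg : Smooth θ g)
    (k h : (Fin 2 → ℂ) → ℂ) (u w : Fin 2 → ℂ) :
    ∫ z, schurIntegrand θ f k g h (u - z) (w, z) = (freq θ / Real.pi : ℂ) ^ 4 *
      (Real.pi / freq θ) ^ 2 * ((conj (f w) * h w * ((Real.exp (-freq θ * ∑ i, ‖w i‖ ^ 2) : ℝ) : ℂ)) *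
        (conj (g u) * k u * ((Real.exp (-freq θ * ∑ i, ‖u i‖ ^ 2) : ℝ) : ℂ))) := by
  have hω := freq_pos hθ
  simp only [schurIntegrand_sub]
  rw [integral_const_mul, integral_mul_const, integral_conj, reproducing hω]
  · have h1 : conj (Complex.exp (freq θ * ∑ i, conj (u i) * w i)) *
        Complex.exp (-(freq θ * ∑ i, u i * conj (w i))) = 1 := by
      rw [← Complex.exp_conj, ← Complex.exp_add, ← Complex.exp_zero]
      congr 1
      simp only [map_mul, map_sum, Complex.conj_conj, Complex.conj_ofReal]
      ring
    have h2 : w + (u - w) = u := by abel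
    rw [h2]
    simp only [map_mul, map_pow, map_div₀, Complex.conj_ofReal]
    linear_combination (freq θ / Real.pi : ℂ) ^ 4 * ((Real.pi / freq θ) ^ 2 *
      (conj (f w) * conj (g u)) * (k u * h w *
        ((Real.exp (-freq θ * ∑ i, ‖u i‖ ^ 2) : ℝ) : ℂ) *
        ((Real.exp (-freq θ * ∑ i, ‖w i‖ ^ 2) : ℝ) : ℂ))) * h1
  · have h1 := hf.diff
    have h2 := hg.diff
    fun_prop
  · obtain ⟨B, hB0, hB⟩ := hg.bdd_wt
    have h1 := hf.diff.continuous
    have h2 := hg.diff.continuous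
    refine ((hf.integrable_wt.mul_const B).mul_const
      (Real.exp (freq θ / 2 * ∑ i, ‖w i + u i‖ ^ 2))).mono' (by fun_prop)
      (Eventually.of_forall fun z => ?_)
    have hnorm : ‖Complex.exp (freq θ * ∑ i, conj (z i) * w i) *
        (f z * g (w + (u - z)) * Complex.exp (freq θ * ∑ i, conj (u i) * z i)) *
        ((Real.exp (-freq θ * ∑ i, ‖z i‖ ^ 2) : ℝ) : ℂ)‖ = wt θ f z * wt θ g (w + (u - z)) *
          Real.exp (freq θ / 2 * ∑ i, ‖w i + u i‖ ^ 2) := by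
      unfold wt
      rw [norm_mul, norm_mul, norm_mul, norm_mul, Complex.norm_real, Complex.norm_exp,
        Complex.norm_exp, Real.norm_of_nonneg (Real.exp_nonneg _)]
      have h0 : Real.exp (freq θ * ∑ i, conj (z i) * w i).re *
          Real.exp (freq θ * ∑ i, conj (u i) * z i).re * Real.exp (-freq θ * ∑ i, ‖z i‖ ^ 2) =
          Real.exp (-(freq θ / 2) * ∑ i, ‖z i‖ ^ 2) *
          Real.exp (-(freq θ / 2) * ∑ i, ‖(w + (u - z)) i‖ ^ 2) *
          Real.exp (freq θ / 2 * ∑ i, ‖w i + u i‖ ^ 2) := by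
        simp only [← Real.exp_add]
        congr 1
        simp only [Fin.sum_univ_two, ← Complex.normSq_eq_norm_sq, Complex.normSq_apply,
          Complex.add_re, Complex.add_im, Complex.mul_re, Complex.mul_im, Complex.conj_re,
          Complex.conj_im, Complex.ofReal_re, Complex.ofReal_im, Pi.add_apply, Pi.sub_apply,
          Complex.sub_re, Complex.sub_im]
        ring
      linear_combination ‖f z‖ * ‖g (w + (u - z))‖ * h0
    rw [hnorm]
    have := wt_nonneg (θ := θ) f z
    have := hB (w + (u - z))
    gcongr

lemma integrable_schurIntegrand (hf : Smooth θ f) (hk : Smooth θ k) (hg : Smooth θ g) (hh : Smooth θ h) :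
    Integrable (Function.uncurry (schurIntegrand θ f k g h)) := by
  obtain ⟨B, hB0, hB⟩ := hg.bdd_wt
  obtain ⟨A, hA0, hA⟩ := hf.exists_le 10
  obtain ⟨D, hD0, hD⟩ := hk.exists_le 5
  have hdom := (integrable_inv_pow.mul_prod (hh.integrable_wt.mul_prod integrable_inv_pow)).const_mul
    ((freq θ / Real.pi) ^ 4 * (B * (A * D)))
  refine hdom.mono' (continuous_schurIntegrand hf hk hg hh).aestronglyMeasurable
    (Eventually.of_forall fun x => ?_)
  obtain ⟨η, w, z⟩ := x
  have hfk : wt θ f z * wt θ k (z + η) ≤ A * D * (((1 + ‖z‖) ^ 5)⁻¹ * ((1 + ‖η‖) ^ 5)⁻¹) := by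
    have h1 : wt θ k (z + η) ≤ D * ((1 + ‖z‖) ^ 5 * ((1 + ‖η‖) ^ 5)⁻¹) :=
      (hD _).trans (mul_le_mul_of_nonneg_left (inv_pow_add_le _ _ _) hD0)
    have h2 : ((1 + ‖z‖) ^ 10)⁻¹ * (1 + ‖z‖) ^ 5 = ((1 + ‖z‖) ^ 5)⁻¹ := by
      have : 1 + ‖z‖ ≠ 0 := by positivity
      rw [show (1 + ‖z‖) ^ 10 = (1 + ‖z‖) ^ 5 * (1 + ‖z‖) ^ 5 by ring]
      field_simp
    calc _ ≤ (A * ((1 + ‖z‖) ^ 10)⁻¹) * (D * ((1 + ‖z‖) ^ 5 * ((1 + ‖η‖) ^ 5)⁻¹)) :=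
          mul_le_mul (hA z) h1 (wt_nonneg _ _) (by positivity)
      _ = A * D * ((((1 + ‖z‖) ^ 10)⁻¹ * (1 + ‖z‖) ^ 5) * ((1 + ‖η‖) ^ 5)⁻¹) := by ring
      _ = _ := by rw [h2]
  change ‖schurIntegrand θ f k g h η (w, z)‖ ≤ (freq θ / Real.pi) ^ 4 * (B * (A * D)) *
    (((1 + ‖η‖) ^ 5)⁻¹ * (wt θ h w * ((1 + ‖z‖) ^ 5)⁻¹))
  rw [norm_schurIntegrand, mul_assoc ((freq θ / Real.pi) ^ 4)]
  refine mul_le_mul_of_nonneg_left ?_ (by positivity)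
  calc _ ≤ (B * wt θ h w) * (A * D * (((1 + ‖z‖) ^ 5)⁻¹ * ((1 + ‖η‖) ^ 5)⁻¹)) :=
        mul_le_mul (mul_le_mul_of_nonneg_right (hB _) (wt_nonneg h w)) hfk
          (mul_nonneg (wt_nonneg f z) (wt_nonneg k _)) (mul_nonneg hB0 (wt_nonneg h w))
    _ = _ := by ring

lemma exists_norm_schurIntegrand_sub_le (f k h : (Fin 2 → ℂ) → ℂ) (hg : Smooth θ g) :
    ∃ B : ℝ, ∀ u w z : Fin 2 → ℂ, ‖schurIntegrand θ f k g h (u - z) (w, z)‖ ≤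
      B * (wt θ h w * wt θ f z * wt θ k u) := by
  obtain ⟨B, hB0, hB⟩ := hg.bdd_wt
  refine ⟨(freq θ / Real.pi) ^ 4 * B, fun u w z => ?_⟩
  have h0 : 0 ≤ wt θ h w * wt θ f z * wt θ k u :=
    mul_nonneg (mul_nonneg (wt_nonneg h w) (wt_nonneg f z)) (wt_nonneg k u)
  rw [norm_schurIntegrand, mul_assoc ((freq θ / Real.pi) ^ 4)]
  refine mul_le_mul_of_nonneg_left ?_ (by positivity)
  have h1 : z + (u - z) = u := by abel
  simp only [h1]
  calc _ = wt θ g (w + (u - z)) * (wt θ h w * wt θ f z * wt θ k u) := by ring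
    _ ≤ _ := mul_le_mul_of_nonneg_right (hB _) h0

lemma integrable_schurIntegrand_sub (hf : Smooth θ f) (hk : Smooth θ k) (hg : Smooth θ g)
    (hh : Smooth θ h) :
    Integrable (Function.uncurry fun (p : (Fin 2 → ℂ) × (Fin 2 → ℂ)) (u : Fin 2 → ℂ) =>
      schurIntegrand θ f k g h (u - p.2) p) := by
  obtain ⟨B, hB⟩ := exists_norm_schurIntegrand_sub_le f k h hg
  refine (((hh.integrable_wt.mul_prod hf.integrable_wt).mul_prod hk.integrable_wt).const_mul
    B).mono' ?_ (Eventually.of_forall fun x => hB x.2 x.1.1 x.1.2)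
  refine Continuous.aestronglyMeasurable ?_
  exact (continuous_schurIntegrand hf hk hg hh).comp (by fun_prop : Continuous fun x :
    ((Fin 2 → ℂ) × (Fin 2 → ℂ)) × (Fin 2 → ℂ) => (x.2 - x.1.2, x.1))

lemma integrable_schurIntegrand_sub_right (hf : Smooth θ f) (hk : Smooth θ k) (hg : Smooth θ g)
    (hh : Smooth θ h) (u : Fin 2 → ℂ) : Integrable fun p : (Fin 2 → ℂ) × (Fin 2 → ℂ) =>
      schurIntegrand θ f k g h (u - p.2) p := by
  obtain ⟨B, hB⟩ := exists_norm_schurIntegrand_sub_le f k h hg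
  refine (((hh.integrable_wt.mul_prod hf.integrable_wt).mul_const (wt θ k u)).const_mul
    B).mono' ?_ (Eventually.of_forall fun x => hB u x.1 x.2)
  refine Continuous.aestronglyMeasurable ?_
  exact (continuous_schurIntegrand hf hk hg hh).comp (by fun_prop : Continuous fun x :
    (Fin 2 → ℂ) × (Fin 2 → ℂ) => (u - x.2, x))

/-- The orthogonality relations for the matrix coefficients of the Weyl operators. -/
theorem Smooth.integral_inner_weyl_mul (hθ : 0 < θ) (hf : Smooth θ f) (hk : Smooth θ k) (hg : Smooth θ g)
    (hh : Smooth θ h) :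
    ∫ η, bargmannInner θ f (weyl θ η k) *
      bargmannInner θ (weyl θ η g) h =
      (Real.pi / freq θ : ℂ) ^ 2 * (bargmannInner θ f h * bargmannInner θ g k) := by
  have hω := freq_pos hθ
  have hint1 := integrable_schurIntegrand hf hk hg hh
  have hint2 := integrable_schurIntegrand_sub hf hk hg hh
  have hint3 := integrable_schurIntegrand_sub_right hf hk hg hh
  simp only [← integral_schurIntegrand]
  rw [integral_integral_swap hint1]
  -- substitute `u = η + z`, where `z` is the variable of the first scalar product
  have e2 : ∀ p : (Fin 2 → ℂ) × (Fin 2 → ℂ), ∫ η, schurIntegrand θ f k g h η p =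
      ∫ u, schurIntegrand θ f k g h (u - p.2) p := fun p =>
    (integral_sub_right_eq_self (fun η => schurIntegrand θ f k g h η p) p.2).symm
  simp only [e2]
  rw [integral_integral_swap hint2]
  have e3 : ∀ u, ∫ p : (Fin 2 → ℂ) × (Fin 2 → ℂ), schurIntegrand θ f k g h (u - p.2) p =
      (Real.pi / freq θ : ℂ) ^ 2 * (bargmannInner θ f h * (conj (g u) * k u *
        (((freq θ / Real.pi) ^ 2 * Real.exp (-freq θ * ∑ i, ‖u i‖ ^ 2) : ℝ) : ℂ))) := by
    intro u
    rw [show (volume : Measure ((Fin 2 → ℂ) × (Fin 2 → ℂ))) = volume.prod volume from rfl,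
      integral_prod _ (hint3 u)]
    simp only [integral_schurIntegrand_sub hθ hf hg]
    rw [bargmannInner, ← integral_mul_const, ← integral_const_mul]
    congr 1; funext w
    push_cast
    ring
  simp only [e3]
  rw [integral_const_mul, integral_const_mul]
  rfl

lemma weyl_comm (u v : Fin 2 → ℂ) (f : (Fin 2 → ℂ) → ℂ) : weyl θ u (weyl θ v f) =
    fun z => Complex.exp (Complex.I * ((2 * sig θ u v : ℝ) : ℂ)) * weyl θ v (weyl θ u f) z := by
  rw [weyl_weyl, weyl_weyl, sig_symm v u, add_comm v u]
  funext z
  rw [← mul_assoc, ← Complex.exp_add]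
  congr 2
  push_cast; ring

lemma Smooth.hasDecay_inner_weyl (hf : Smooth θ f) (hg : Smooth θ g) :
    HasDecay fun η => bargmannInner θ f (weyl θ η g) :=
  hf.inner_weyl_decay hg 8

/-- Matrix coefficients decay rapidly along the lattice. -/
lemma Smooth.inner_lattice_decay (hθ : 0 < θ) (hf : Smooth θ f) (hg : Smooth θ g) (K : ℕ) :
    ∃ C : ℝ, 0 ≤ C ∧ ∀ γ, ‖bargmannInner θ f (weyl θ (latticePoint θ γ) g)‖ ≤
      C * ((1 + ‖γ‖) ^ K)⁻¹ := by
  obtain ⟨C, hC0, hC⟩ := hf.inner_weyl_decay hg K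
  obtain ⟨C', hC'0, hC'⟩ := exists_inv_pow_le (c := θ / √2) (by positivity) K
  refine ⟨C * C', by positivity, fun γ => (hC _).trans ?_⟩
  rw [mul_assoc]
  exact mul_le_mul_of_nonneg_left (hC' _ _ (norm_nonneg _) (norm_le_norm_latticePoint hθ γ)) hC0

lemma Smooth.inner_dual_decay (hf : Smooth θ f) (hg : Smooth θ g) (K : ℕ) :
    ∃ C : ℝ, 0 ≤ C ∧ ∀ κ, ‖bargmannInner θ f (weyl θ (dualPoint κ) g)‖ ≤
      C * ((1 + ‖κ‖) ^ K)⁻¹ := by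
  obtain ⟨C, hC0, hC⟩ := hf.inner_weyl_decay hg K
  obtain ⟨C', hC'0, hC'⟩ := exists_inv_pow_le (c := 1 / √2) (by positivity) K
  refine ⟨C * C', by positivity, fun γ => (hC _).trans ?_⟩
  rw [mul_assoc]
  exact mul_le_mul_of_nonneg_left (hC' _ _ (norm_nonneg _) (norm_le_norm_dualPoint γ)) hC0

lemma Smooth.inner_weyl_swap (v : Fin 2 → ℂ) (f g : (Fin 2 → ℂ) → ℂ) :
    bargmannInner θ (weyl θ v f) g =
      conj (bargmannInner θ g (weyl θ v f)) := (bargmannInner_conj _ _).symm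

lemma Smooth.summable_inner_lattice (hθ : 0 < θ) (hf : Smooth θ f) (hg : Smooth θ g) :
    Summable fun γ => ‖bargmannInner θ f (weyl θ (latticePoint θ γ) g)‖ := by
  obtain ⟨C, hC0, hC⟩ := hf.inner_lattice_decay hθ hg 8
  exact Summable.of_nonneg_of_le (fun γ => norm_nonneg _) hC (summable_lattice.mul_left C)

lemma Smooth.summable_inner_dual (hf : Smooth θ f) (hg : Smooth θ g) :
    Summable fun κ => ‖bargmannInner θ f (weyl θ (dualPoint κ) g)‖ := by
  obtain ⟨C, hC0, hC⟩ := hf.inner_dual_decay hg 8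
  exact Summable.of_nonneg_of_le (fun γ => norm_nonneg _) hC (summable_lattice.mul_left C)

lemma Smooth.norm_inner_weyl_le (hf : Smooth θ f) (hg : Smooth θ g) (v : Fin 2 → ℂ) :
    ‖bargmannInner θ f (weyl θ v g)‖ ≤ ‖hf.vec‖ * ‖hg.vec‖ := by
  have := hf.norm_inner_le (hg.map_weyl v)
  rwa [hg.norm_vec_weyl] at this

/-- The frame operator of the lattice orbit of `φ` is a superposition of the Weyl operators of the
dual lattice. -/
theorem exists_janssen (hθ : 0 < θ) : ∃ c : ℝ, ∀ φ f k : (Fin 2 → ℂ) → ℂ, Smooth θ φ → Smooth θ f →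
    Smooth θ k →
    ∑' γ, bargmannInner θ f (weyl θ (latticePoint θ γ) φ) *
      bargmannInner θ (weyl θ (latticePoint θ γ) φ) k =
    c * ∑' κ, bargmannInner θ (weyl θ (dualPoint κ) φ) φ *
      bargmannInner θ f (weyl θ (dualPoint κ) k) := by
  have hω := freq_pos hθ
  have hπ := Real.pi_pos
  obtain ⟨c, hc⟩ := exists_poisson hθ
  refine ⟨(freq θ / Real.pi) ^ 2 * c, fun φ f k hφ hf hk => ?_⟩
  set F : (Fin 2 → ℂ) → ℂ := fun x => bargmannInner θ (weyl θ x φ) φ *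
    bargmannInner θ f (weyl θ x k) with hF
  have hFc : Continuous F := by
    refine Continuous.mul ?_ (hf.continuous_inner_weyl hk)
    simp only [Smooth.inner_weyl_swap]
    exact Complex.continuous_conj.comp (hφ.continuous_inner_weyl hφ)
  have hFd : HasDecay F := by
    obtain ⟨C, hC0, hC⟩ := hf.hasDecay_inner_weyl hk
    refine ⟨‖hφ.vec‖ * ‖hφ.vec‖ * C, by positivity, fun x => ?_⟩
    simp only [hF]
    rw [norm_mul, Smooth.inner_weyl_swap, RCLike.norm_conj, mul_assoc]
    exact mul_le_mul (hφ.norm_inner_weyl_le hφ x) (hC x) (norm_nonneg _) (by positivity)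
  -- the Fourier transform of `F`, from the orthogonality relations for `k` and `W_v φ`
  have hFhat : ∀ γ, ∫ x, F x *
      Complex.exp (Complex.I * ((-(2 * sig θ x (latticePoint θ γ)) : ℝ) : ℂ)) =
      (Real.pi / freq θ : ℂ) ^ 2 * (bargmannInner θ f (weyl θ (latticePoint θ γ) φ) *
        bargmannInner θ (weyl θ (latticePoint θ γ) φ) k) := by
    intro γ
    set v := latticePoint θ γ
    rw [← hf.integral_inner_weyl_mul hθ hk (hφ.map_weyl v) (hφ.map_weyl v)]
    congr 1; funext x
    rw [weyl_comm x v φ, inner_const_mul_left, inner_weyl_weyl, ← Complex.exp_conj]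
    simp only [hF, map_mul, Complex.conj_I, Complex.conj_ofReal]
    rw [show -Complex.I * ((2 * sig θ x v : ℝ) : ℂ) = Complex.I * ((-(2 * sig θ x v) : ℝ) : ℂ) by
      push_cast; ring]
    ring
  have hsum : Summable fun γ => bargmannInner θ f (weyl θ (latticePoint θ γ) φ) *
      bargmannInner θ (weyl θ (latticePoint θ γ) φ) k := by
    refine Summable.of_norm_bounded ((hf.summable_inner_lattice hθ hφ).mul_right
      (‖hk.vec‖ * ‖hφ.vec‖)) fun γ => ?_
    rw [norm_mul, Smooth.inner_weyl_swap _ φ k, RCLike.norm_conj]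
    exact mul_le_mul_of_nonneg_left (hk.norm_inner_weyl_le hφ _) (norm_nonneg _)
  have h := hc F hFc hFd (by simp only [hFhat]; exact hsum.mul_left _)
  simp only [hFhat] at h
  rw [tsum_mul_left] at h
  have hω' : (freq θ : ℂ) ≠ 0 := by exact_mod_cast hω.ne'
  have hπ' : (Real.pi : ℂ) ≠ 0 := by exact_mod_cast hπ.ne'
  have h1 : (freq θ / Real.pi : ℂ) ^ 2 * (Real.pi / freq θ) ^ 2 = 1 := by field_simp
  push_cast
  rw [mul_assoc, ← h, ← mul_assoc, h1, one_mul]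

/-! ### Small denominators -/

/-- The points of the group generated by the lattice and its dual. -/
noncomputable def mixedPoint (θ : ℝ) (p : (Fin 2 → ℤ × ℤ) × (Fin 2 → ℤ × ℤ)) : Fin 2 → ℂ :=
  latticePoint θ p.1 + dualPoint p.2

lemma latticePoint_add (γ γ' : Fin 2 → ℤ × ℤ) :
    latticePoint θ (γ + γ') = latticePoint θ γ + latticePoint θ γ' := by
  funext i
  simp only [latticePoint, Pi.add_apply, Prod.fst_add, Prod.snd_add]
  push_cast; ring

lemma latticePoint_neg (γ : Fin 2 → ℤ × ℤ) : latticePoint θ (-γ) = -latticePoint θ γ := by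
  funext i
  simp only [latticePoint, Pi.neg_apply, Prod.fst_neg, Prod.snd_neg]
  push_cast; ring

lemma latticePoint_zero : latticePoint θ 0 = 0 := by
  funext i; simp [latticePoint]

lemma dualPoint_add (γ γ' : Fin 2 → ℤ × ℤ) :
    dualPoint (γ + γ') = dualPoint γ + dualPoint γ' := latticePoint_add (θ := 1) γ γ'

lemma dualPoint_neg (γ : Fin 2 → ℤ × ℤ) : dualPoint (-γ) = -dualPoint γ :=
  latticePoint_neg (θ := 1) γ

lemma dualPoint_zero : dualPoint 0 = 0 := latticePoint_zero (θ := 1)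

lemma mixedPoint_add (p q : (Fin 2 → ℤ × ℤ) × (Fin 2 → ℤ × ℤ)) :
    mixedPoint θ (p + q) = mixedPoint θ p + mixedPoint θ q := by
  simp only [mixedPoint, Prod.fst_add, Prod.snd_add, latticePoint_add, dualPoint_add]
  abel

lemma mixedPoint_zero : mixedPoint θ 0 = 0 := by
  simp [mixedPoint, latticePoint_zero, dualPoint_zero]

/-- The weak Diophantine condition bounds the distance between the lattice and its dual. -/
lemma IsWeakDiophantine.exists_le_norm_mixedPoint (hd : IsWeakDiophantine θ) :
    ∃ c : ℝ, 0 < c ∧ ∃ C : ℝ, 0 < C ∧ ∀ p : (Fin 2 → ℤ × ℤ) × (Fin 2 → ℤ × ℤ), p ≠ 0 →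
      c * Real.exp (-C * ‖p.1‖) ≤ ‖mixedPoint θ p‖ := by
  obtain ⟨-, C₁, hC₁, C₂, hC₂, h⟩ := hd
  refine ⟨1 / √2 * min C₁ 1, by positivity, C₂, hC₂, fun p hp => ?_⟩
  obtain ⟨γ, κ⟩ := p
  -- one coordinate of the two indices is nonzero, and suffices
  have key : ∀ m a : ℤ, (m ≠ 0 ∨ a ≠ 0) → |(m : ℝ)| ≤ ‖γ‖ →
      min C₁ 1 * Real.exp (-C₂ * ‖γ‖) ≤ |(m : ℝ) * θ + a| := by
    intro m a hma hm
    have hexp : Real.exp (-C₂ * ‖γ‖) ≤ 1 := Real.exp_le_one_iff.2 (by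
      nlinarith [norm_nonneg γ])
    by_cases hm0 : m = 0
    · have ha : a ≠ 0 := hma.resolve_left (not_not.2 hm0)
      have h1 : (1 : ℝ) ≤ |(a : ℝ)| := by exact_mod_cast Int.one_le_abs ha
      rw [hm0, Int.cast_zero, zero_mul, zero_add]
      have h2 : min C₁ 1 * Real.exp (-C₂ * ‖γ‖) ≤ 1 * 1 := by gcongr; exact min_le_right _ _
      linarith
    · have h1 := h m hm0 (-a)
      rw [Int.cast_neg, sub_neg_eq_add] at h1
      refine le_trans ?_ h1
      have h2 : Real.exp (-C₂ * ‖γ‖) ≤ Real.exp (-C₂ * |(m : ℝ)|) :=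
        Real.exp_le_exp.2 (by nlinarith)
      gcongr
      exact min_le_left _ _
  have hfst : ∀ i, |((γ i).1 : ℝ)| ≤ ‖γ‖ := fun i =>
    (Int.norm_eq_abs _).symm.le.trans ((norm_fst_le (γ i)).trans (norm_le_pi_norm γ i))
  have hsnd : ∀ i, |((γ i).2 : ℝ)| ≤ ‖γ‖ := fun i =>
    (Int.norm_eq_abs _).symm.le.trans ((norm_snd_le (γ i)).trans (norm_le_pi_norm γ i))
  have hcomp : ∀ i, mixedPoint θ (γ, κ) i = ((1 / √2 : ℝ) : ℂ) *
      ((((γ i).1 : ℝ) * θ + (κ i).1 : ℝ) + (((γ i).2 : ℝ) * θ + (κ i).2 : ℝ) * Complex.I) := by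
    intro i
    simp only [mixedPoint, Pi.add_apply, latticePoint, dualPoint]
    push_cast; ring
  have hre : ∀ i, 1 / √2 * |((γ i).1 : ℝ) * θ + (κ i).1| ≤ ‖mixedPoint θ (γ, κ)‖ := by
    intro i
    refine le_trans ?_ (norm_le_pi_norm (mixedPoint θ (γ, κ)) i)
    rw [hcomp, norm_mul, Complex.norm_real, Real.norm_of_nonneg (by positivity)]
    refine mul_le_mul_of_nonneg_left ?_ (by positivity)
    refine le_trans (le_of_eq ?_) (Complex.abs_re_le_norm _)
    simp
  have him : ∀ i, 1 / √2 * |((γ i).2 : ℝ) * θ + (κ i).2| ≤ ‖mixedPoint θ (γ, κ)‖ := by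
    intro i
    refine le_trans ?_ (norm_le_pi_norm (mixedPoint θ (γ, κ)) i)
    rw [hcomp, norm_mul, Complex.norm_real, Real.norm_of_nonneg (by positivity)]
    refine mul_le_mul_of_nonneg_left ?_ (by positivity)
    refine le_trans (le_of_eq ?_) (Complex.abs_im_le_norm _)
    simp
  have hex : ∃ i, ((γ i).1 ≠ 0 ∨ (κ i).1 ≠ 0) ∨ ((γ i).2 ≠ 0 ∨ (κ i).2 ≠ 0) := by
    by_contra hcon
    push Not at hcon
    refine hp (Prod.ext (funext fun i => ?_) (funext fun i => ?_))
    · exact Prod.ext (hcon i).1.1 (hcon i).2.1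
    · exact Prod.ext (hcon i).1.2 (hcon i).2.2
  obtain ⟨i, hi | hi⟩ := hex
  · refine le_trans ?_ (hre i)
    rw [mul_assoc]
    exact mul_le_mul_of_nonneg_left (key _ _ hi (hfst i)) (by positivity)
  · refine le_trans ?_ (him i)
    rw [mul_assoc]
    exact mul_le_mul_of_nonneg_left (key _ _ hi (hsnd i)) (by positivity)

lemma IsWeakDiophantine.mixedPoint_ne_zero (hd : IsWeakDiophantine θ)
    {p : (Fin 2 → ℤ × ℤ) × (Fin 2 → ℤ × ℤ)} (hp : p ≠ 0) : mixedPoint θ p ≠ 0 := by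
  obtain ⟨c, hc, C, hC, h⟩ := hd.exists_le_norm_mixedPoint
  have h1 := h p hp
  intro h0
  rw [h0, norm_zero] at h1
  exact absurd h1 (not_le.2 (by positivity))

/-- The small denominators grow at most linearly under the logarithm. -/
lemma IsWeakDiophantine.exists_log_le (hd : IsWeakDiophantine θ) : ∃ C : ℝ, 0 ≤ C ∧
    ∀ p : (Fin 2 → ℤ × ℤ) × (Fin 2 → ℤ × ℤ), p ≠ 0 →
      1 + Real.log (1 + 4 / ‖mixedPoint θ p‖ ^ 2) ≤ C * (1 + ‖p.1‖) := by
  obtain ⟨c, hc, C, hC, h⟩ := hd.exists_le_norm_mixedPoint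
  have hl : 0 ≤ Real.log (1 + 4 / c ^ 2) := Real.log_nonneg (by
    have : 0 ≤ 4 / c ^ 2 := by positivity
    linarith)
  refine ⟨1 + Real.log (1 + 4 / c ^ 2) + 2 * C, by positivity, fun p hp => ?_⟩
  have h1 := h p hp
  have h2 : 4 / ‖mixedPoint θ p‖ ^ 2 ≤ 4 / c ^ 2 * Real.exp (2 * C * ‖p.1‖) := by
    calc _ ≤ 4 / (c * Real.exp (-C * ‖p.1‖)) ^ 2 := by gcongr
      _ = _ := by
        rw [mul_pow, ← Real.exp_nat_mul, div_mul_eq_div_div, div_eq_mul_inv (4 / c ^ 2),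
          ← Real.exp_neg]
        congr 2; push_cast; ring
  have h3 : 1 ≤ Real.exp (2 * C * ‖p.1‖) := Real.one_le_exp (by positivity)
  have h4 : Real.log (1 + 4 / ‖mixedPoint θ p‖ ^ 2) ≤ Real.log (1 + 4 / c ^ 2) + 2 * C * ‖p.1‖ := by
    have h5 := Real.log_exp (2 * C * ‖p.1‖)
    rw [← h5, ← Real.log_mul (by positivity) (by positivity)]
    refine Real.log_le_log (by positivity) ?_
    nlinarith
  nlinarith [norm_nonneg p.1]

end

section

/-! ### Matrices on real sequence space -/

variable {ι : Type*}

/-- Square-summable real families. -/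
abbrev RealSeq (ι : Type*) := lp (fun _ : ι => ℝ) 2

lemma two_toReal_pos : 0 < (2 : ENNReal).toReal := by norm_num

lemma hasSum_sq_norm (x : RealSeq ι) : HasSum (fun a => x a ^ 2) (‖x‖ ^ 2) := by
  have h := lp.hasSum_norm two_toReal_pos x
  simpa using h

lemma memℓp_of_sum_le {f : ι → ℝ} {C : ℝ} (h : ∀ s : Finset ι, ∑ i ∈ s, f i ^ 2 ≤ C) :
    Memℓp f 2 := by
  refine memℓp_gen' (C := C) fun s => ?_
  simpa using h s

lemma norm_le_of_sum_sq_le {x : RealSeq ι} {C : ℝ} (hC : 0 ≤ C)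
    (h : ∀ s : Finset ι, ∑ i ∈ s, x i ^ 2 ≤ C ^ 2) : ‖x‖ ≤ C := by
  refine lp.norm_le_of_forall_sum_le two_toReal_pos hC fun s => ?_
  simpa using h s

lemma sum_sq_le_norm (x : RealSeq ι) (s : Finset ι) : ∑ i ∈ s, x i ^ 2 ≤ ‖x‖ ^ 2 := by
  have h := lp.sum_rpow_le_norm_rpow two_toReal_pos x s
  simpa using h

lemma hasSum_mul_inner (x y : RealSeq ι) : HasSum (fun a => x a * y a) (inner ℝ x y) := by
  have h := lp.hasSum_inner (𝕜 := ℝ) x y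
  simpa [mul_comm] using h

lemma sum_sq_mul_le {D : ι → ℝ} {B : ℝ} (h : ∀ a, |D a| ≤ B) (x : RealSeq ι) (s : Finset ι) :
    ∑ i ∈ s, (D i * x i) ^ 2 ≤ (|B| * ‖x‖) ^ 2 := by
  calc ∑ i ∈ s, (D i * x i) ^ 2 ≤ ∑ i ∈ s, B ^ 2 * x i ^ 2 :=
        Finset.sum_le_sum fun i _ => by
          rw [mul_pow]
          exact mul_le_mul_of_nonneg_right (sq_le_sq' (by linarith [neg_abs_le (D i), h i])
            ((le_abs_self _).trans (h i))) (sq_nonneg _)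
    _ ≤ _ := by
        rw [← Finset.mul_sum, mul_pow, sq_abs]
        exact mul_le_mul_of_nonneg_left (sum_sq_le_norm x s) (sq_nonneg _)

open Classical in
/-- The diagonal operator with entries `D a`, for bounded `D`, and zero otherwise. -/
noncomputable def diagOp (D : ι → ℝ) : RealSeq ι →L[ℝ] RealSeq ι :=
  if h : ∃ B, ∀ a, |D a| ≤ B then
    LinearMap.mkContinuous
      { toFun := fun x => ⟨fun a => D a * x a, memℓp_of_sum_le (sum_sq_mul_le h.choose_spec x)⟩
        map_add' := fun x y => by
          ext a
          exact mul_add (D a) (x a) (y a)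
        map_smul' := fun c x => by
          ext a
          exact mul_left_comm (D a) c (x a) }
      (|h.choose|) fun x => norm_le_of_sum_sq_le (by positivity) (sum_sq_mul_le h.choose_spec x)
  else 0

lemma diagOp_apply {D : ι → ℝ} {B : ℝ} (h : ∀ a, |D a| ≤ B) (x : RealSeq ι) (a : ι) :
    diagOp D x a = D a * x a := by
  have h' : ∃ B, ∀ a, |D a| ≤ B := ⟨B, h⟩
  rw [diagOp, dif_pos h']
  rfl

lemma norm_diagOp_apply_le {D D' : ι → ℝ} {B : ℝ} (h : ∀ a, |D a| ≤ D' a) (h' : ∀ a, |D' a| ≤ B)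
    (x : RealSeq ι) : ‖diagOp D x‖ ≤ ‖diagOp D' x‖ := by
  refine norm_le_of_sum_sq_le (norm_nonneg _) fun s => ?_
  refine le_trans ?_ (sum_sq_le_norm _ s)
  refine Finset.sum_le_sum fun a _ => ?_
  have hB : ∀ a, |D a| ≤ B := fun a => (h a).trans ((le_abs_self _).trans (h' a))
  rw [diagOp_apply hB, diagOp_apply h', mul_pow, mul_pow]
  refine mul_le_mul_of_nonneg_right ?_ (sq_nonneg _)
  exact sq_le_sq' (by linarith [neg_abs_le (D a), h a]) ((le_abs_self _).trans (h a))

lemma norm_diagOp_le {D : ι → ℝ} {B : ℝ} (hB : 0 ≤ B) (h : ∀ a, |D a| ≤ B) (x : RealSeq ι) :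
    ‖diagOp D x‖ ≤ B * ‖x‖ := by
  refine norm_le_of_sum_sq_le (by positivity) fun s => ?_
  have h1 := sum_sq_mul_le h x s
  rw [abs_of_nonneg hB] at h1
  simpa only [diagOp_apply h] using h1

lemma inner_diagOp {D : ι → ℝ} {B : ℝ} (h : ∀ a, |D a| ≤ B) (x y : RealSeq ι) :
    inner ℝ x (diagOp D y) = inner ℝ (diagOp D x) y := by
  rw [← (hasSum_mul_inner x _).tsum_eq, ← (hasSum_mul_inner _ y).tsum_eq]
  refine tsum_congr fun a => ?_
  rw [diagOp_apply h, diagOp_apply h]; ring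

/-- Diagonal operators converge strongly when their entries converge boundedly. -/
lemma tendsto_diagOp {l : Filter ℝ} {D : ℝ → ι → ℝ} {D₀ : ι → ℝ} {B : ℝ}
    (hD₀ : ∀ a, |D₀ a| ≤ B) (hD : ∀ᶠ t in l, ∀ a, |D t a| ≤ B)
    (hlim : ∀ a, Tendsto (fun t => D t a) l (𝓝 (D₀ a))) (x : RealSeq ι) :
    Tendsto (fun t => diagOp (D t) x) l (𝓝 (diagOp D₀ x)) := by
  rw [tendsto_iff_norm_sub_tendsto_zero]
  have hsq : Tendsto (fun t => ‖diagOp (D t) x - diagOp D₀ x‖ ^ 2) l (𝓝 0) := by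
    have h1 : ∀ᶠ t in l, ∑' a, ((D t a - D₀ a) * x a) ^ 2 = ‖diagOp (D t) x - diagOp D₀ x‖ ^ 2 := by
      filter_upwards [hD] with t ht
      rw [← (hasSum_sq_norm _).tsum_eq]
      refine tsum_congr fun a => ?_
      change _ = (diagOp (D t) x a - diagOp D₀ x a) ^ 2
      rw [diagOp_apply ht, diagOp_apply hD₀]; ring
    refine Tendsto.congr' h1 ?_
    have h2 : (0 : ℝ) = ∑' a : ι, (0 : ℝ) := by simp
    rw [h2]
    refine tendsto_tsum_of_dominated_convergence (bound := fun a => (2 * B) ^ 2 * x a ^ 2)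
      ((hasSum_sq_norm x).summable.mul_left _) (fun a => ?_) ?_
    · have h3 := (((hlim a).sub_const (D₀ a)).mul_const (x a)).pow 2
      simpa using h3
    · filter_upwards [hD] with t ht a
      have h4 := abs_le.1 (ht a)
      have h5 := abs_le.1 (hD₀ a)
      rw [Real.norm_of_nonneg (sq_nonneg _), mul_pow]
      exact mul_le_mul_of_nonneg_right (sq_le_sq' (by linarith) (by linarith)) (sq_nonneg _)
  have h3 := hsq.sqrt
  simpa using h3

/-- The `b`-th unit vector. -/
noncomputable def unitVec [DecidableEq ι] (b : ι) : RealSeq ι := lp.single 2 b 1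

/-! ### Closed chains and traces -/

lemma summable_pi_prod {g : ι → ℝ} (hg : Summable g) (h0 : ∀ a, 0 ≤ g a) (n : ℕ) :
    Summable fun c : Fin n → ι => ∏ j, g (c j) := by
  induction n with
  | zero => exact Summable.of_finite
  | succ n ih =>
    rw [← (Fin.consEquiv fun _ : Fin (n + 1) => ι).summable_iff]
    refine (hg.mul_of_nonneg ih h0 fun c => Finset.prod_nonneg fun j _ => h0 _).congr fun p => ?_
    simp [Fin.consEquiv, Fin.prod_univ_succ]

/-- The product of a kernel along the chain from `a` to `b` through the points `c`. -/
def chainProd (κ : ι → ι → ℝ) : (n : ℕ) → ι → (Fin n → ι) → ι → ℝ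
  | 0, a, _, b => κ a b
  | n + 1, a, c, b => κ a (c 0) * chainProd κ n (c 0) (Fin.tail c) b

lemma prod_mul_eq_chainProd (κ : ι → ι → ℝ) (n : ℕ) (a : Fin (n + 1) → ι) (b : ι) :
    (∏ j : Fin n, κ (a j.castSucc) (a j.succ)) * κ (a (Fin.last n)) b =
      chainProd κ n (a 0) (Fin.tail a) b := by
  induction n with
  | zero => simp [chainProd]
  | succ n ih =>
    rw [Fin.prod_univ_succ, chainProd, mul_assoc]
    exact congrArg _ (ih (Fin.tail a))

lemma prod_finRotate (κ : ι → ι → ℝ) (n : ℕ) (a : Fin (n + 1) → ι) :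
    ∏ j, κ (a j) (a (finRotate (n + 1) j)) = chainProd κ n (a 0) (Fin.tail a) (a 0) := by
  rw [← prod_mul_eq_chainProd, Fin.prod_univ_castSucc, finRotate_last]
  congr 1
  refine Finset.prod_congr rfl fun j _ => ?_
  congr 2
  rw [finRotate_apply, Fin.coeSucc_eq_succ]

lemma abs_chainProd_le {D : ι → ℝ} {M : ι → ι → ℝ} {C : ℝ} (hD : ∀ a, 0 ≤ D a)
    (hM : ∀ a b, |M a b| ≤ C) (n : ℕ) (a : ι) (c : Fin n → ι) (b : ι) :
    |chainProd (fun a b => D a * M a b) n a c b| ≤ D a * C * ∏ j, (D (c j) * C) := by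
  have hC : 0 ≤ C := (abs_nonneg _).trans (hM a a)
  have hκ : ∀ a b, |D a * M a b| ≤ D a * C := fun a b => by
    rw [abs_mul, abs_of_nonneg (hD a)]
    exact mul_le_mul_of_nonneg_left (hM a b) (hD a)
  induction n generalizing a with
  | zero => simpa [chainProd] using hκ a b
  | succ n ih =>
    rw [chainProd, abs_mul, Fin.prod_univ_succ]
    exact mul_le_mul (hκ _ _) (ih (c 0) (Fin.tail c)) (abs_nonneg _)
      (mul_nonneg (hD a) hC)

/-- Closed chains of a trace class operator times a bounded one are absolutely summable. -/
lemma summable_loop {D : ι → ℝ} {M : ι → ι → ℝ} {C : ℝ} (hD : ∀ a, 0 ≤ D a) (hDs : Summable D)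
    (hM : ∀ a b, |M a b| ≤ C) (n : ℕ) :
    Summable fun a : Fin (n + 1) → ι => ∏ j, (D (a j) * M (a j) (a (finRotate (n + 1) j))) := by
  by_cases hι : Nonempty ι
  · obtain ⟨a₀⟩ := hι
    have hC : 0 ≤ C := (abs_nonneg _).trans (hM a₀ a₀)
    refine Summable.of_norm_bounded (summable_pi_prod (hDs.mul_right C)
      (fun a => mul_nonneg (hD a) hC) (n + 1)) fun a => ?_
    rw [Real.norm_eq_abs, Finset.abs_prod]
    refine Finset.prod_le_prod (fun j _ => abs_nonneg _) fun j _ => ?_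
    rw [abs_mul, abs_of_nonneg (hD _)]
    exact mul_le_mul_of_nonneg_left (hM _ _) (hD _)
  · rw [not_nonempty_iff] at hι
    have : IsEmpty (Fin (n + 1) → ι) := ⟨fun a => hι.elim (a 0)⟩
    exact summable_empty

/-- For a matrix with bounded rows and columns, summability of `D³` controls the Hilbert–Schmidt
type sums with weights `D` and `D²` at the two ends. -/
lemma summable_weighted {D : ι → ℝ} (hD : ∀ a, 0 ≤ D a) (h3 : Summable fun a => D a ^ 3)
    {m : ι → ι → ℝ} {c r : ι → ℝ} {K : ℝ} (hc : ∀ b, HasSum (fun a => m b a ^ 2) (c b))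
    (hr : ∀ a, HasSum (fun b => m b a ^ 2) (r a)) (hcK : ∀ b, c b ≤ K) (hrK : ∀ a, r a ≤ K) :
    Summable fun p : ι × ι => D p.1 * (D p.2 ^ 2 * m p.1 p.2 ^ 2) := by
  have hG1 : Summable fun p : ι × ι => D p.1 ^ 3 * m p.1 p.2 ^ 2 := by
    refine (summable_prod_of_nonneg fun p => mul_nonneg (pow_nonneg (hD _) _) (sq_nonneg _)).2
      ⟨fun b => (hc b).summable.mul_left (D b ^ 3), ?_⟩
    refine Summable.of_nonneg_of_le (fun b => tsum_nonneg fun a => mul_nonneg (pow_nonneg (hD _) _)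
      (sq_nonneg _)) (fun b => ?_) (h3.mul_right K)
    simp only []
    rw [tsum_mul_left, (hc b).tsum_eq]
    exact mul_le_mul_of_nonneg_left (hcK b) (pow_nonneg (hD _) _)
  have hG2' : Summable fun p : ι × ι => D p.1 ^ 3 * m p.2 p.1 ^ 2 := by
    refine (summable_prod_of_nonneg fun p => mul_nonneg (pow_nonneg (hD _) _) (sq_nonneg _)).2
      ⟨fun b => (hr b).summable.mul_left (D b ^ 3), ?_⟩
    refine Summable.of_nonneg_of_le (fun b => tsum_nonneg fun a => mul_nonneg (pow_nonneg (hD _) _)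
      (sq_nonneg _)) (fun b => ?_) (h3.mul_right K)
    simp only []
    rw [tsum_mul_left, (hr b).tsum_eq]
    exact mul_le_mul_of_nonneg_left (hrK b) (pow_nonneg (hD _) _)
  have hG2 : Summable fun p : ι × ι => D p.2 ^ 3 * m p.1 p.2 ^ 2 :=
    (Equiv.prodComm ι ι).summable_iff.2 hG2'
  refine Summable.of_nonneg_of_le (fun p => mul_nonneg (hD _) (by positivity)) (fun p => ?_)
    (hG1.add hG2)
  have hx := hD p.1
  have hy := hD p.2
  -- `x y² ≤ x³ + y³`
  have key : D p.1 * D p.2 ^ 2 ≤ D p.1 ^ 3 + D p.2 ^ 3 := by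
    rcases le_total (D p.1) (D p.2) with h | h
    · nlinarith [pow_nonneg hx 3, mul_le_mul_of_nonneg_right h (sq_nonneg (D p.2))]
    · nlinarith [pow_nonneg hy 3, mul_le_mul_of_nonneg_left (mul_self_le_mul_self hy h) hx]
  calc _ = D p.1 * D p.2 ^ 2 * m p.1 p.2 ^ 2 := by ring
    _ ≤ (D p.1 ^ 3 + D p.2 ^ 3) * m p.1 p.2 ^ 2 :=
        mul_le_mul_of_nonneg_right key (sq_nonneg _)
    _ = _ := by ring

variable [DecidableEq ι]

lemma unitVec_apply (b a : ι) : unitVec b a = if a = b then 1 else 0 := by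
  rw [unitVec, lp.single_apply]
  by_cases h : a = b
  · subst h; simp
  · simp [h]

lemma inner_unitVec (b : ι) (x : RealSeq ι) : inner ℝ (unitVec b) x = x b := by
  rw [unitVec, lp.inner_single_left]; simp

lemma norm_unitVec (b : ι) : ‖(unitVec b : RealSeq ι)‖ = 1 := by
  have h := inner_unitVec b (unitVec b)
  rw [real_inner_self_eq_norm_sq, unitVec_apply, if_pos rfl] at h
  exact (pow_eq_one_iff_of_nonneg (norm_nonneg _) two_ne_zero).1 h

lemma apply_eq_inner (T : RealSeq ι →L[ℝ] RealSeq ι) (x : RealSeq ι) (a : ι) :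
    T x a = inner ℝ (ContinuousLinearMap.adjoint T (unitVec a)) x := by
  rw [ContinuousLinearMap.adjoint_inner_left, inner_unitVec]

lemma adjoint_unitVec_apply (T : RealSeq ι →L[ℝ] RealSeq ι) (a b : ι) :
    ContinuousLinearMap.adjoint T (unitVec a) b = T (unitVec b) a := by
  rw [apply_eq_inner T, real_inner_comm, inner_unitVec]

lemma hasSum_apply (T : RealSeq ι →L[ℝ] RealSeq ι) (x : RealSeq ι) (a : ι) :
    HasSum (fun b => T (unitVec b) a * x b) (T x a) := by
  have h := hasSum_mul_inner (ContinuousLinearMap.adjoint T (unitVec a)) x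
  simp only [adjoint_unitVec_apply] at h
  rwa [← apply_eq_inner] at h

lemma abs_entry_le (T : RealSeq ι →L[ℝ] RealSeq ι) (a b : ι) : |T (unitVec b) a| ≤ ‖T‖ := by
  have h1 := lp.norm_apply_le_norm (p := 2) two_ne_zero (T (unitVec b)) a
  have h2 := T.le_opNorm (unitVec b)
  rw [norm_unitVec, mul_one] at h2
  exact h1.trans h2

/-- A matrix whose bilinear form is bounded on finitely supported vectors is the matrix of a bounded
operator. -/
lemma exists_operator {M : ι → ι → ℝ} {C : ℝ} (hC : 0 ≤ C)
    (hM : ∀ (s t : Finset ι) (x y : ι → ℝ), |∑ a ∈ s, ∑ b ∈ t, x a * M a b * y b| ≤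
      C * √(∑ a ∈ s, x a ^ 2) * √(∑ b ∈ t, y b ^ 2)) :
    ∃ T : RealSeq ι →L[ℝ] RealSeq ι, ∀ a b, T (unitVec b) a = M a b := by
  -- a square root that is bounded by a multiple of itself
  have hroot : ∀ S c : ℝ, 0 ≤ S → 0 ≤ c → S ≤ c * √S → S ≤ c ^ 2 := by
    intro S c hS hc h
    have h1 := Real.sq_sqrt hS
    have h2 := Real.sqrt_nonneg S
    nlinarith [sq_nonneg (c - √S)]
  -- test against the combination of rows itself
  have hcomb : ∀ (s t : Finset ι) (x : ι → ℝ),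
      ∑ b ∈ t, (∑ a ∈ s, x a * M a b) ^ 2 ≤ (C * √(∑ a ∈ s, x a ^ 2)) ^ 2 := by
    intro s t x
    refine hroot _ _ (Finset.sum_nonneg fun b _ => sq_nonneg _) (by positivity) ?_
    refine le_trans (le_of_eq ?_) ((le_abs_self _).trans
      (hM s t x (fun b => ∑ a ∈ s, x a * M a b)))
    rw [Finset.sum_comm]
    refine Finset.sum_congr rfl fun b _ => ?_
    rw [sq, Finset.sum_mul]
  have hrow : ∀ a, Memℓp (M a) 2 := fun a => memℓp_of_sum_le (C := C ^ 2) fun t => by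
    simpa using hcomb {a} t (fun _ => 1)
  set row : ι → RealSeq ι := fun a => ⟨M a, hrow a⟩ with hrowdef
  -- the same test for the coordinates of the image of `x`
  have hbound : ∀ (x : RealSeq ι) (s : Finset ι),
      ∑ a ∈ s, (inner ℝ (row a) x) ^ 2 ≤ (C * ‖x‖) ^ 2 := by
    intro x s
    set y : ι → ℝ := fun a => inner ℝ (row a) x with hy
    set w : RealSeq ι := ∑ a ∈ s, y a • row a with hw
    have hwa : ∀ b, w b = ∑ a ∈ s, y a * M a b := by
      intro b
      have h1 : inner ℝ (unitVec b) w = ∑ a ∈ s, y a * M a b := by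
        rw [hw, inner_sum]
        refine Finset.sum_congr rfl fun a _ => ?_
        rw [real_inner_smul_right, inner_unitVec]
      rw [← h1, inner_unitVec]
    have hwn : ‖w‖ ≤ C * √(∑ a ∈ s, y a ^ 2) := by
      refine norm_le_of_sum_sq_le (by positivity) fun t => ?_
      simp only [hwa]
      exact hcomb s t y
    refine hroot _ _ (Finset.sum_nonneg fun b _ => sq_nonneg _) (by positivity) ?_
    have hS : ∑ a ∈ s, y a ^ 2 = inner ℝ w x := by
      rw [hw, sum_inner]
      refine Finset.sum_congr rfl fun a _ => ?_
      rw [real_inner_smul_left, sq]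
    calc ∑ a ∈ s, y a ^ 2 = inner ℝ w x := hS
      _ ≤ ‖w‖ * ‖x‖ := real_inner_le_norm _ _
      _ ≤ C * √(∑ a ∈ s, y a ^ 2) * ‖x‖ := by gcongr
      _ = _ := by ring
  refine ⟨LinearMap.mkContinuous
    { toFun := fun x => ⟨fun a => inner ℝ (row a) x, memℓp_of_sum_le (hbound x)⟩
      map_add' := fun x y => by
        ext a
        exact inner_add_right (row a) x y
      map_smul' := fun c x => by
        ext a
        exact real_inner_smul_right (row a) x c } C
    fun x => norm_le_of_sum_sq_le (by positivity) (hbound x), fun a b => ?_⟩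
  change inner ℝ (row a) (unitVec b) = M a b
  rw [real_inner_comm, inner_unitVec]

/-- Sums over chains are matrix elements of powers. -/
lemma hasSum_chainProd {D : ι → ℝ} {B : ℝ} (hD : ∀ a, 0 ≤ D a) (hB : ∀ a, |D a| ≤ B)
    (hDs : Summable D) (T : RealSeq ι →L[ℝ] RealSeq ι) (n : ℕ) (a b : ι) :
    HasSum (fun c => chainProd (fun a b => D a * T (unitVec b) a) n a c b)
      (((diagOp D ∘L T) ^ (n + 1)) (unitVec b) a) := by
  set κ : ι → ι → ℝ := fun a b => D a * T (unitVec b) a with hκ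
  have hsum : ∀ n a, Summable fun c => chainProd κ n a c b := fun n a =>
    Summable.of_norm_bounded ((summable_pi_prod (hDs.mul_right ‖T‖)
      (fun a => mul_nonneg (hD a) (norm_nonneg T)) n).mul_left (D a * ‖T‖))
      fun c => abs_chainProd_le hD (fun a b => abs_entry_le T a b) n a c b
  induction n generalizing a with
  | zero =>
    have h : ((diagOp D ∘L T) ^ (0 + 1)) (unitVec b) a = κ a b := by
      rw [zero_add, pow_one, ContinuousLinearMap.comp_apply, diagOp_apply hB]
    rw [h]
    exact hasSum_unique (fun c : Fin 0 → ι => chainProd κ 0 a c b)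
  | succ n ih =>
    have hs := (hsum (n + 1) a)
    rw [← (Fin.consEquiv fun _ : Fin (n + 1) => ι).summable_iff] at hs
    have h1 := (hsum (n + 1) a).hasSum
    have h2 : ∑' c, chainProd κ (n + 1) a c b =
        ((diagOp D ∘L T) ^ (n + 1 + 1)) (unitVec b) a := by
      rw [← (Fin.consEquiv fun _ : Fin (n + 1) => ι).tsum_eq]
      refine (Summable.tsum_prod hs).trans ?_
      have h3 : ∀ c₀, ∑' c : Fin n → ι, chainProd κ (n + 1) a
          ((Fin.consEquiv fun _ : Fin (n + 1) => ι) (c₀, c)) b =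
          κ a c₀ * ((diagOp D ∘L T) ^ (n + 1)) (unitVec b) c₀ := by
        intro c₀
        rw [← (ih c₀).tsum_eq, ← tsum_mul_left]
        rfl
      refine (tsum_congr h3).trans ?_
      rw [pow_succ' _ (n + 1), mul_apply_eq_comp,
        ContinuousLinearMap.comp_apply, diagOp_apply hB, ← (hasSum_apply T _ a).tsum_eq,
        ← tsum_mul_left]
      refine tsum_congr fun c => ?_
      simp only [hκ]; ring
    rwa [h2] at h1

lemma tsum_loop {D : ι → ℝ} {B : ℝ} (hD : ∀ a, 0 ≤ D a) (hB : ∀ a, |D a| ≤ B)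
    (hDs : Summable D) (T : RealSeq ι →L[ℝ] RealSeq ι) (n : ℕ) :
    ∑' a : Fin (n + 1) → ι, ∏ j, (D (a j) * T (unitVec (a (finRotate (n + 1) j))) (a j)) =
      ∑' b, ((diagOp D ∘L T) ^ (n + 1)) (unitVec b) b := by
  have hs := summable_loop hD hDs (M := fun a b => T (unitVec b) a)
    (fun a b => abs_entry_le T a b) n
  rw [← (Fin.consEquiv fun _ : Fin (n + 1) => ι).tsum_eq]
  rw [← (Fin.consEquiv fun _ : Fin (n + 1) => ι).summable_iff] at hs
  refine (Summable.tsum_prod hs).trans (tsum_congr fun b => ?_)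
  rw [← (hasSum_chainProd hD hB hDs T n b b).tsum_eq]
  refine tsum_congr fun c => ?_
  exact prod_finRotate (fun a b => D a * T (unitVec b) a) n _

/-- The Hilbert-Schmidt bound behind the convergence of the loops with at least three
propagators. -/
lemma summable_mul_norm_sq {D : ι → ℝ} {B : ℝ} (hD : ∀ a, 0 ≤ D a) (hB : ∀ a, |D a| ≤ B)
    (h3 : Summable fun a => D a ^ 3) (T : RealSeq ι →L[ℝ] RealSeq ι) :
    Summable fun b => D b * ‖diagOp D (T (unitVec b))‖ ^ 2 := by
  have hcol : ∀ b, ‖T (unitVec b)‖ ^ 2 ≤ ‖T‖ ^ 2 := fun b => by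
    have h := T.le_opNorm (unitVec b)
    rw [norm_unitVec, mul_one] at h
    exact pow_le_pow_left₀ (norm_nonneg _) h 2
  have hrow : ∀ a, ‖ContinuousLinearMap.adjoint T (unitVec a)‖ ^ 2 ≤ ‖T‖ ^ 2 := fun a => by
    have h := (ContinuousLinearMap.adjoint T).le_opNorm (unitVec a)
    rw [norm_unitVec, mul_one, LinearIsometryEquiv.norm_map] at h
    exact pow_le_pow_left₀ (norm_nonneg _) h 2
  have hr : ∀ a, HasSum (fun b => T (unitVec b) a ^ 2)
      (‖ContinuousLinearMap.adjoint T (unitVec a)‖ ^ 2) := fun a => by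
    have h := hasSum_sq_norm (ContinuousLinearMap.adjoint T (unitVec a))
    simp only [adjoint_unitVec_apply] at h
    exact h
  have hG := summable_weighted hD h3 (m := fun b a => T (unitVec b) a)
    (fun b => hasSum_sq_norm (T (unitVec b))) hr hcol hrow
  refine hG.prod.congr fun b => ?_
  have h1 := hasSum_sq_norm (diagOp D (T (unitVec b)))
  simp only [diagOp_apply hB, mul_pow] at h1
  rw [← h1.tsum_eq]
  exact tsum_mul_left (a := D b) (f := fun a => D a ^ 2 * T (unitVec b) a ^ 2)

lemma tendsto_apply_of_strong {l : Filter ℝ} {E : Type*} [NormedAddCommGroup E] [NormedSpace ℝ E]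
    {S : ℝ → E →L[ℝ] E} {S₀ : E →L[ℝ] E} {x : ℝ → E} {x₀ : E} {C : ℝ}
    (hS : ∀ y, Tendsto (fun t => S t y) l (𝓝 (S₀ y))) (hC : ∀ᶠ t in l, ∀ y, ‖S t y‖ ≤ C * ‖y‖)
    (hx : Tendsto x l (𝓝 x₀)) : Tendsto (fun t => S t (x t)) l (𝓝 (S₀ x₀)) := by
  have h1 : Tendsto (fun t => S t (x t - x₀)) l (𝓝 0) := by
    refine squeeze_zero_norm' (a := fun t => C * ‖x t - x₀‖) (hC.mono fun t ht => ht _) ?_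
    have := (tendsto_iff_norm_sub_tendsto_zero.1 hx).const_mul C
    simpa using this
  have h2 := h1.add (hS x₀)
  simpa using h2

/-- The trace of `(D T)ⁿ` for `n ≥ 3` converges with the diagonal operator `D`, provided that `D³` is
trace class in the limit. -/
theorem exists_tendsto_tsum_loop {D : ℝ → ι → ℝ} {D₀ : ι → ℝ} {B : ℝ} (hD₀ : ∀ a, |D₀ a| ≤ B)
    (h3 : Summable fun a => D₀ a ^ 3) (hpos : ∀ t, 0 < t → ∀ a, 0 ≤ D t a)
    (hle : ∀ t, 0 < t → ∀ a, D t a ≤ D₀ a) (hsum : ∀ t, 0 < t → Summable (D t))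
    (hlim : ∀ a, Tendsto (fun t => D t a) (𝓝[>] 0) (𝓝 (D₀ a)))
    (T : RealSeq ι →L[ℝ] RealSeq ι) (n : ℕ) :
    ∃ L, Tendsto (fun t => ∑' a : Fin (n + 2 + 1) → ι,
      ∏ j, (D t (a j) * T (unitVec (a (finRotate (n + 2 + 1) j))) (a j))) (𝓝[>] 0) (𝓝 L) := by
  have habs : ∀ t, 0 < t → ∀ a, |D t a| ≤ D₀ a := fun t ht a => by
    rw [abs_of_nonneg (hpos t ht a)]; exact hle t ht a
  have hbd : ∀ t, 0 < t → ∀ a, |D t a| ≤ B := fun t ht a =>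
    (habs t ht a).trans ((le_abs_self _).trans (hD₀ a))
  have hD₀0 : ∀ a, 0 ≤ D₀ a := fun a => (hpos 1 one_pos a).trans (hle 1 one_pos a)
  by_cases hι : Nonempty ι
  swap
  · rw [not_nonempty_iff] at hι
    have : IsEmpty (Fin (n + 2 + 1) → ι) := ⟨fun a => hι.elim (a 0)⟩
    simp only [tsum_empty]
    exact ⟨0, tendsto_const_nhds⟩
  have hB : 0 ≤ B := (abs_nonneg _).trans (hD₀ hι.some)
  set A : ℝ → RealSeq ι →L[ℝ] RealSeq ι := fun t => diagOp (D t) ∘L T with hA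
  set A₀ : RealSeq ι →L[ℝ] RealSeq ι := diagOp D₀ ∘L T with hA₀
  set R := ContinuousLinearMap.adjoint T with hR
  -- one propagator is kept in front and one moved to each side of the scalar product, so that the
  -- diagonal entry is dominated by Hilbert–Schmidt sums
  have hform : ∀ t, 0 < t → ∀ b, (A t ^ (n + 2 + 1)) (unitVec b) b =
      D t b * inner ℝ (diagOp (D t) (R (unitVec b)))
        (T ((A t ^ n) (diagOp (D t) (T (unitVec b))))) := by
    intro t ht b
    have h1 : (A t ^ (n + 2 + 1)) (unitVec b) = A t (A t ((A t ^ n) (A t (unitVec b)))) := by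
      rw [pow_succ' _ (n + 2), pow_succ' _ (n + 1), pow_succ _ n]
      rfl
    rw [h1, hA]
    simp only [ContinuousLinearMap.comp_apply]
    rw [diagOp_apply (hbd t ht), apply_eq_inner T, inner_diagOp (hbd t ht)]
  have hAn : ∀ t, 0 < t → ∀ y, ‖A t y‖ ≤ B * ‖T‖ * ‖y‖ := fun t ht y => by
    calc _ ≤ B * ‖T y‖ := norm_diagOp_le hB (hbd t ht) _
      _ ≤ B * (‖T‖ * ‖y‖) := by gcongr; exact T.le_opNorm y
      _ = _ := by ring
  have hApow : ∀ t, 0 < t → ∀ m y, ‖(A t ^ m) y‖ ≤ (B * ‖T‖) ^ m * ‖y‖ := by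
    intro t ht m y
    induction m with
    | zero => simp
    | succ m ih =>
      rw [pow_succ', mul_apply_eq_comp]
      calc _ ≤ B * ‖T‖ * ‖(A t ^ m) y‖ := hAn t ht _
        _ ≤ B * ‖T‖ * ((B * ‖T‖) ^ m * ‖y‖) := by gcongr
        _ = _ := by ring
  have hev : ∀ᶠ t : ℝ in 𝓝[>] 0, 0 < t := self_mem_nhdsWithin
  have hDlim : ∀ x, Tendsto (fun t => diagOp (D t) x) (𝓝[>] 0) (𝓝 (diagOp D₀ x)) := fun x =>
    tendsto_diagOp hD₀ (hev.mono hbd) hlim x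
  -- the powers in between converge strongly
  have hAlim : ∀ m x, Tendsto (fun t => (A t ^ m) x) (𝓝[>] 0) (𝓝 ((A₀ ^ m) x)) := by
    intro m x
    induction m with
    | zero => simp
    | succ m ih =>
      simp only [pow_succ', mul_apply_eq_comp]
      exact tendsto_apply_of_strong (fun y => hDlim (T y)) (hev.mono hAn) ih
  set K := ‖T‖ * (B * ‖T‖) ^ n with hK
  refine ⟨∑' b, D₀ b * inner ℝ (diagOp D₀ (R (unitVec b)))
    (T ((A₀ ^ n) (diagOp D₀ (T (unitVec b))))), ?_⟩
  refine Tendsto.congr' (f₁ := fun t => ∑' b, D t b * inner ℝ (diagOp (D t) (R (unitVec b)))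
    (T ((A t ^ n) (diagOp (D t) (T (unitVec b)))))) ?_ ?_
  · filter_upwards [self_mem_nhdsWithin] with t ht
    rw [tsum_loop (hpos t ht) (hbd t ht) (hsum t ht)]
    exact tsum_congr fun b => (hform t ht b).symm
  · have hS1 := summable_mul_norm_sq hD₀0 hD₀ h3 T
    have hS2 := summable_mul_norm_sq hD₀0 hD₀ h3 R
    refine tendsto_tsum_of_dominated_convergence (bound := fun b =>
      K * (D₀ b * ‖diagOp D₀ (R (unitVec b))‖ ^ 2 + D₀ b * ‖diagOp D₀ (T (unitVec b))‖ ^ 2))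
      ((hS2.add hS1).mul_left K) (fun b => ?_) ?_
    · refine (hlim b).mul (Tendsto.inner (hDlim _) ?_)
      refine (T.continuous.tendsto _).comp ?_
      exact tendsto_apply_of_strong (hAlim n) (hev.mono fun t ht => hApow t ht n) (hDlim _)
    · filter_upwards [self_mem_nhdsWithin] with t ht b
      set p := ‖diagOp D₀ (R (unitVec b))‖
      set q := ‖diagOp D₀ (T (unitVec b))‖
      have hp : ‖diagOp (D t) (R (unitVec b))‖ ≤ p := norm_diagOp_apply_le (habs t ht) hD₀ _
      have hq : ‖diagOp (D t) (T (unitVec b))‖ ≤ q := norm_diagOp_apply_le (habs t ht) hD₀ _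
      have h1 : ‖T ((A t ^ n) (diagOp (D t) (T (unitVec b))))‖ ≤ K * q := by
        calc _ ≤ ‖T‖ * ‖(A t ^ n) (diagOp (D t) (T (unitVec b)))‖ := T.le_opNorm _
          _ ≤ ‖T‖ * ((B * ‖T‖) ^ n * q) := by
              gcongr
              exact (hApow t ht n _).trans (by gcongr)
          _ = _ := by rw [hK]; ring
      have hK0 : 0 ≤ K := by positivity
      have hp0 : 0 ≤ p := norm_nonneg _
      have hq0 : 0 ≤ q := norm_nonneg _
      rw [norm_mul, Real.norm_of_nonneg (hpos t ht b)]
      calc _ ≤ D₀ b * (p * (K * q)) := by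
            refine mul_le_mul (hle t ht b) ((norm_inner_le_norm _ _).trans ?_) (norm_nonneg _)
              (hD₀0 b)
            exact mul_le_mul hp h1 (norm_nonneg _) hp0
        _ = K * (D₀ b * (p * q)) := by ring
        _ ≤ K * (D₀ b * (p ^ 2 + q ^ 2)) := by
            have := hD₀0 b
            have : p * q ≤ p ^ 2 + q ^ 2 := by nlinarith [sq_nonneg (p - q)]
            gcongr
        _ = _ := by ring

end

section

/-! ### The second variation of the interaction -/

/-- The coefficient `⟨f, U_γ g⟩`. -/
noncomputable def latCoef (θ : ℝ) (f g : (Fin 2 → ℂ) → ℂ) (γ : Fin 2 → ℤ × ℤ) : ℂ :=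
  bargmannInner θ f (weyl θ (latticePoint θ γ) g)

variable {θ : ℝ} {f g h φ k ψ : (Fin 2 → ℂ) → ℂ}

lemma latCoef_neg (f g : (Fin 2 → ℂ) → ℂ) (γ : Fin 2 → ℤ × ℤ) :
    latCoef θ f g (-γ) = conj (latCoef θ g f γ) := by
  unfold latCoef
  rw [bargmannInner_conj, inner_weyl_left, latticePoint_neg]

lemma Smooth.summable_latCoef (hθ : 0 < θ) (hf : Smooth θ f) (hg : Smooth θ g) :
    Summable fun γ => ‖latCoef θ f g γ‖ := hf.summable_inner_lattice hθ hg

lemma real_smul_eq (t : ℝ) (f : (Fin 2 → ℂ) → ℂ) : t • f = fun z => (t : ℂ) * f z := by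
  funext z; simp

lemma Smooth.latCoef_add_left (hf : Smooth θ f) (hg : Smooth θ g) (hh : Smooth θ h)
    (γ : Fin 2 → ℤ × ℤ) : latCoef θ (f + g) h γ = latCoef θ f h γ + latCoef θ g h γ :=
  hf.inner_add_left hg (hh.map_weyl _)

lemma Smooth.latCoef_add_right (hf : Smooth θ f) (hg : Smooth θ g) (hh : Smooth θ h)
    (γ : Fin 2 → ℤ × ℤ) : latCoef θ f (g + h) γ = latCoef θ f g γ + latCoef θ f h γ := by
  unfold latCoef
  rw [weyl_add]
  exact hf.inner_add_right (hg.map_weyl _) (hh.map_weyl _)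

lemma latCoef_smul_left (t : ℝ) (f g : (Fin 2 → ℂ) → ℂ) (γ : Fin 2 → ℤ × ℤ) :
    latCoef θ (t • f) g γ = t * latCoef θ f g γ := by
  unfold latCoef
  rw [real_smul_eq, inner_const_mul_left, Complex.conj_ofReal]

lemma latCoef_smul_right (t : ℝ) (f g : (Fin 2 → ℂ) → ℂ) (γ : Fin 2 → ℤ × ℤ) :
    latCoef θ f (t • g) γ = t * latCoef θ f g γ := by
  unfold latCoef
  rw [real_smul_eq, weyl_const_mul, inner_const_mul_right]

/-- The trace picks the coefficient at `γ = 0`. -/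
lemma massTerm_eq (ψ : (Fin 2 → ℂ) → ℂ) : massTerm θ ψ = (bargmannInner θ ψ ψ).re := by
  simp only [massTerm, torusTrace, pairing, rightAct, neg_zero, latticePoint_zero, weyl_zero]

/-- The cocycle is trivial on the pairs `γ, -γ` that contribute to the trace. -/
lemma quarticTerm_eq (ψ : (Fin 2 → ℂ) → ℂ) : quarticTerm θ ψ = ∑' γ, ‖latCoef θ ψ ψ γ‖ ^ 2 := by
  unfold quarticTerm torusTrace torusMul
  have h : ∀ γ : Fin 2 → ℤ × ℤ, pairing θ ψ ψ γ * pairing θ ψ ψ (0 - γ) *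
      Complex.exp (-(Complex.I * Real.pi * thetaForm θ γ (0 - γ))) =
      ((‖latCoef θ ψ ψ γ‖ ^ 2 : ℝ) : ℂ) := by
    intro γ
    have h1 : thetaForm θ γ (0 - γ) = 0 := by
      simp [thetaForm]; right; ring
    have h2 : pairing θ ψ ψ γ = latCoef θ ψ ψ (-γ) := rfl
    have h3 : pairing θ ψ ψ (0 - γ) = latCoef θ ψ ψ γ := by
      rw [zero_sub]; unfold pairing rightAct latCoef; rw [neg_neg]
    rw [h1, h2, h3, latCoef_neg, Complex.conj_mul']
    simp
  rw [tsum_congr h, ← Complex.ofReal_tsum, Complex.ofReal_re]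

lemma hasDerivAt_tsum_polynomial {ι : Type*} {p₀ p₁ p₂ p₃ p₄ : ι → ℝ} (h₀ : Summable p₀)
    (h₁ : Summable p₁) (h₂ : Summable p₂) (h₃ : Summable p₃) (h₄ : Summable p₄) :
    HasDerivAt (fun t : ℝ => ∑' i, (p₀ i + t * p₁ i + t ^ 2 * p₂ i + t ^ 3 * p₃ i + t ^ 4 * p₄ i))
      (∑' i, p₁ i) 0 := by
  have h : (fun t : ℝ => ∑' i, (p₀ i + t * p₁ i + t ^ 2 * p₂ i + t ^ 3 * p₃ i + t ^ 4 * p₄ i)) =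
      fun t => ∑' i, p₀ i + t * ∑' i, p₁ i + t ^ 2 * ∑' i, p₂ i + t ^ 3 * ∑' i, p₃ i
        + t ^ 4 * ∑' i, p₄ i := by
    funext t
    have e1 := h₁.hasSum.mul_left t
    have e2 := h₂.hasSum.mul_left (t ^ 2)
    have e3 := h₃.hasSum.mul_left (t ^ 3)
    have e4 := h₄.hasSum.mul_left (t ^ 4)
    exact ((((h₀.hasSum.add e1).add e2).add e3).add e4).tsum_eq
  rw [h]
  have hd : HasDerivAt (fun t : ℝ => t) 1 0 := hasDerivAt_id 0
  have := (((((hasDerivAt_const (0 : ℝ) (∑' i, p₀ i)).add (hd.mul_const (∑' i, p₁ i))).add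
    ((hd.pow 2).mul_const (∑' i, p₂ i))).add ((hd.pow 3).mul_const (∑' i, p₃ i))).add
    ((hd.pow 4).mul_const (∑' i, p₄ i)))
  exact this.congr_deriv (by simp)

lemma summable_re_conj_mul {ι : Type*} {a b : ι → ℂ} (ha : Summable fun i => ‖a i‖)
    (hb : Summable fun i => ‖b i‖) : Summable fun i => (conj (a i) * b i).re := by
  have h : Summable fun i => ‖a i‖ * ‖b i‖ := by
    have hb' : ∀ i, ‖b i‖ ≤ ∑' j, ‖b j‖ := fun i => hb.le_tsum i fun j _ => norm_nonneg _
    exact Summable.of_nonneg_of_le (fun i => by positivity)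
      (fun i => mul_le_mul_of_nonneg_left (hb' i) (norm_nonneg _)) (ha.mul_right _)
  refine Summable.of_norm_bounded h fun i => ?_
  refine (Complex.abs_re_le_norm _).trans (le_of_eq ?_)
  rw [norm_mul, RCLike.norm_conj]

lemma hasDerivAt_tsum_norm_sq {ι : Type*} {a b c : ι → ℂ} (ha : Summable fun i => ‖a i‖)
    (hb : Summable fun i => ‖b i‖) (hc : Summable fun i => ‖c i‖) :
    HasDerivAt (fun t : ℝ => ∑' i, ‖a i + t * b i + (t : ℂ) ^ 2 * c i‖ ^ 2)
      (∑' i, 2 * (conj (a i) * b i).re) 0 := by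
  have h := hasDerivAt_tsum_polynomial (summable_re_conj_mul ha ha)
    ((summable_re_conj_mul ha hb).mul_left 2)
    ((summable_re_conj_mul hb hb).add ((summable_re_conj_mul ha hc).mul_left 2))
    ((summable_re_conj_mul hb hc).mul_left 2) (summable_re_conj_mul hc hc)
  refine h.congr_of_eventuallyEq (Eventually.of_forall fun t => tsum_congr fun i => ?_)
  simp only [← Complex.normSq_eq_norm_sq, Complex.normSq_apply, Complex.add_re, Complex.add_im,
    Complex.mul_re, Complex.mul_im, Complex.conj_re, Complex.conj_im, ← Complex.ofReal_pow,
    Complex.ofReal_re, Complex.ofReal_im]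
  ring

lemma hasDerivAt_tsum_re {ι : Type*} {a b c d e : ι → ℂ} (ha : Summable fun i => ‖a i‖)
    (hb : Summable fun i => ‖b i‖) (hc : Summable fun i => ‖c i‖) (hd : Summable fun i => ‖d i‖)
    (he : Summable fun i => ‖e i‖) :
    HasDerivAt (fun t : ℝ => ∑' i, 2 * (conj (a i + t * b i + (t : ℂ) ^ 2 * c i) *
      (d i + t * e i)).re)
      (∑' i, 2 * ((conj (b i) * d i).re + (conj (a i) * e i).re)) 0 := by
  have h := hasDerivAt_tsum_polynomial ((summable_re_conj_mul ha hd).mul_left 2)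
    (((summable_re_conj_mul hb hd).add (summable_re_conj_mul ha he)).mul_left 2)
    (((summable_re_conj_mul hc hd).add (summable_re_conj_mul hb he)).mul_left 2)
    ((summable_re_conj_mul hc he).mul_left 2) (summable_zero)
  refine h.congr_of_eventuallyEq (Eventually.of_forall fun t => tsum_congr fun i => ?_)
  simp only [Complex.add_re, Complex.add_im, map_add, map_mul, Complex.conj_ofReal,
    Complex.mul_re, Complex.mul_im, Complex.conj_re, Complex.conj_im, ← Complex.ofReal_pow,
    Complex.ofReal_re, Complex.ofReal_im]
  ring

lemma Smooth.latCoef_line (hψ : Smooth θ ψ) (hk : Smooth θ k) (t : ℝ) (γ : Fin 2 → ℤ × ℤ) :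
    latCoef θ (ψ + t • k) (ψ + t • k) γ = latCoef θ ψ ψ γ +
      t * (latCoef θ ψ k γ + latCoef θ k ψ γ) + (t : ℂ) ^ 2 * latCoef θ k k γ := by
  have htk := hk.smul t
  rw [hψ.latCoef_add_left htk (hψ.add htk), hψ.latCoef_add_right hψ htk,
    htk.latCoef_add_right hψ htk]
  simp only [latCoef_smul_left, latCoef_smul_right]
  ring

lemma Smooth.summable_latCoef_add (hθ : 0 < θ) (hψ : Smooth θ ψ) (hk : Smooth θ k) :
    Summable fun γ => ‖latCoef θ ψ k γ + latCoef θ k ψ γ‖ :=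
  Summable.of_nonneg_of_le (fun _ => norm_nonneg _) (fun _ => norm_add_le _ _)
    ((hψ.summable_latCoef hθ hk).add (hk.summable_latCoef hθ hψ))

lemma Smooth.hasDerivAt_quarticTerm (hθ : 0 < θ) (hψ : Smooth θ ψ) (hk : Smooth θ k) :
    HasDerivAt (fun t : ℝ => quarticTerm θ (ψ + t • k))
      (∑' γ, 2 * (conj (latCoef θ ψ ψ γ) * (latCoef θ ψ k γ + latCoef θ k ψ γ)).re) 0 := by
  simp only [quarticTerm_eq, hψ.latCoef_line hk]
  exact hasDerivAt_tsum_norm_sq (hψ.summable_latCoef hθ hψ) (hψ.summable_latCoef_add hθ hk)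
    (hk.summable_latCoef hθ hk)

lemma Smooth.massTerm_line (hψ : Smooth θ ψ) (hk : Smooth θ k) (t : ℝ) :
    massTerm θ (ψ + t • k) = massTerm θ ψ + t * (2 * (bargmannInner θ ψ k).re) +
      t ^ 2 * massTerm θ k := by
  have htk := hk.smul t
  simp only [massTerm_eq]
  rw [hψ.inner_add_left htk (hψ.add htk), hψ.inner_add_right hψ htk, htk.inner_add_right hψ htk,
    real_smul_eq]
  simp only [inner_const_mul_left, inner_const_mul_right]
  rw [← bargmannInner_conj ψ k]
  simp only [Complex.add_re, Complex.mul_re, Complex.conj_re, Complex.ofReal_re,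
    Complex.ofReal_im, Complex.conj_ofReal, Complex.mul_im]
  ring

lemma Smooth.hasDerivAt_massTerm (hψ : Smooth θ ψ) (hk : Smooth θ k) :
    HasDerivAt (fun t : ℝ => massTerm θ (ψ + t • k)) (2 * (bargmannInner θ ψ k).re) 0 := by
  simp only [hψ.massTerm_line hk]
  have hd : HasDerivAt (fun t : ℝ => t) 1 0 := hasDerivAt_id 0
  have := ((hasDerivAt_const (0 : ℝ) (massTerm θ ψ)).add
    (hd.mul_const (2 * (bargmannInner θ ψ k).re))).add ((hd.pow 2).mul_const (massTerm θ k))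
  exact this.congr_deriv (by simp)

lemma Smooth.deriv_interaction (hθ : 0 < θ) (lam lam' : ℝ) (hψ : Smooth θ ψ) (hk : Smooth θ k) :
    deriv (fun t : ℝ => interaction θ lam lam' (ψ + t • k)) 0 =
      lam / 2 * (∑' γ, 2 * (conj (latCoef θ ψ ψ γ) *
        (latCoef θ ψ k γ + latCoef θ k ψ γ)).re) +
      lam' / 2 * (2 * massTerm θ ψ * (2 * (bargmannInner θ ψ k).re)) := by
  have h1 := (hψ.hasDerivAt_quarticTerm hθ hk).const_mul (lam / 2)
  have h2 := ((hψ.hasDerivAt_massTerm hk).pow 2).const_mul (lam' / 2)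
  have h := (h1.add h2).deriv
  simp only [zero_smul, add_zero, Nat.cast_ofNat, pow_one, Nat.add_one_sub_one] at h
  exact h

lemma Smooth.hessian_interaction_aux (hθ : 0 < θ) (lam lam' : ℝ) (hφ : Smooth θ φ) (hh : Smooth θ h)
    (hk : Smooth θ k) :
    hessian (interaction θ lam lam') φ h k =
      lam / 2 * (∑' γ, 2 * ((conj (latCoef θ φ h γ + latCoef θ h φ γ) *
        (latCoef θ φ k γ + latCoef θ k φ γ)).re + (conj (latCoef θ φ φ γ) *
        (latCoef θ h k γ + latCoef θ k h γ)).re)) +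
      lam' / 2 * (4 * (2 * (bargmannInner θ φ h).re * (bargmannInner θ φ k).re +
        massTerm θ φ * (bargmannInner θ h k).re)) := by
  unfold hessian
  have e : (fun s : ℝ => deriv (fun t : ℝ => interaction θ lam lam' (φ + s • h + t • k)) 0) =
      fun s : ℝ => lam / 2 * (∑' γ, 2 * (conj (latCoef θ φ φ γ +
          s * (latCoef θ φ h γ + latCoef θ h φ γ) + (s : ℂ) ^ 2 * latCoef θ h h γ) *
        ((latCoef θ φ k γ + latCoef θ k φ γ) + s * (latCoef θ h k γ + latCoef θ k h γ))).re) +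
      lam' / 2 * (2 * massTerm θ (φ + s • h) *
        (2 * ((bargmannInner θ φ k).re + s * (bargmannInner θ h k).re))) := by
    funext s
    have hsh := hh.smul s
    rw [(hφ.add hsh).deriv_interaction hθ lam lam' hk]
    refine congrArg₂ (fun x y => lam / 2 * x + lam' / 2 * y) (tsum_congr fun γ => ?_) ?_
    · rw [hφ.latCoef_line hh, hφ.latCoef_add_left hsh hk, hk.latCoef_add_right hφ hsh]
      simp only [latCoef_smul_left, latCoef_smul_right]
      refine congrArg (fun x : ℂ => 2 * (conj (latCoef θ φ φ γ +
          s * (latCoef θ φ h γ + latCoef θ h φ γ) + (s : ℂ) ^ 2 * latCoef θ h h γ) * x).re) ?_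
      ring
    · rw [hφ.inner_add_left hsh hk, real_smul_eq, inner_const_mul_left, Complex.conj_ofReal]
      simp
  rw [e]
  have h1 := (hasDerivAt_tsum_re (hφ.summable_latCoef hθ hφ) (hφ.summable_latCoef_add hθ hh)
    (hh.summable_latCoef hθ hh) (hφ.summable_latCoef_add hθ hk)
    (hh.summable_latCoef_add hθ hk)).const_mul (lam / 2)
  have hd : HasDerivAt (fun t : ℝ => t) 1 0 := hasDerivAt_id 0
  have h2 := ((((hφ.hasDerivAt_massTerm hh).const_mul 2).mul
    ((((hasDerivAt_const (0 : ℝ) (bargmannInner θ φ k).re).add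
      (hd.mul_const (bargmannInner θ h k).re))).const_mul 2))).const_mul (lam' / 2)
  have h := (h1.add h2).deriv
  refine Eq.trans h ?_
  simp only [zero_smul, add_zero, Pi.add_apply]
  ring

/-- The part of the second variation that is complex linear in its second argument. -/
noncomputable def hessLin (θ lam lam' : ℝ) (φ h k : (Fin 2 → ℂ) → ℂ) : ℂ :=
  lam * (∑' γ, latCoef θ h φ γ * conj (latCoef θ k φ γ) +
    ∑' γ, conj (latCoef θ φ φ γ) * latCoef θ h k γ) +
  lam' * bargmannInner θ φ φ * bargmannInner θ h k

/-- The part of the second variation of the quartic term that is antilinear in both arguments. -/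
noncomputable def hessAnti (θ lam : ℝ) (φ h k : (Fin 2 → ℂ) → ℂ) : ℂ :=
  lam * ∑' γ, latCoef θ h φ γ * latCoef θ k φ (-γ)

/-- Half the second variation of the interaction. -/
noncomputable def hessForm (θ lam lam' : ℝ) (φ h k : (Fin 2 → ℂ) → ℂ) : ℝ :=
  (hessLin θ lam lam' φ h k).re + (hessAnti θ lam φ h k).re +
    2 * lam' * (bargmannInner θ φ h).re * (bargmannInner θ φ k).re

lemma summable_mul_of_norm {ι : Type*} {a b : ι → ℂ} (ha : Summable fun i => ‖a i‖)
    (hb : Summable fun i => ‖b i‖) : Summable fun i => ‖a i * b i‖ := by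
  have hb' : ∀ i, ‖b i‖ ≤ ∑' j, ‖b j‖ := fun i => hb.le_tsum i fun j _ => norm_nonneg _
  refine Summable.of_nonneg_of_le (fun i => by positivity)
    (fun i => ?_) (ha.mul_right (∑' j, ‖b j‖))
  rw [norm_mul]
  exact mul_le_mul_of_nonneg_left (hb' i) (norm_nonneg _)

lemma bargmannInner_self_im (f : (Fin 2 → ℂ) → ℂ) : (bargmannInner θ f f).im = 0 :=
  Complex.conj_eq_iff_im.1 (bargmannInner_conj f f)

/-- The second variation of the interaction splits into a linear part, an antilinear part and a rank
one term, collected in `hessForm`. -/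
lemma Smooth.hessian_interaction (hθ : 0 < θ) (lam lam' : ℝ) (hφ : Smooth θ φ) (hh : Smooth θ h)
    (hk : Smooth θ k) :
    hessian (interaction θ lam lam') φ h k = 2 * hessForm θ lam lam' φ h k := by
  rw [hφ.hessian_interaction_aux hθ lam lam' hh hk]
  set u : (Fin 2 → ℤ × ℤ) → ℂ := fun γ => latCoef θ h φ γ * conj (latCoef θ k φ γ) with hu
  set v : (Fin 2 → ℤ × ℤ) → ℂ := fun γ => conj (latCoef θ φ φ γ) * latCoef θ h k γ with hv
  set w : (Fin 2 → ℤ × ℤ) → ℂ := fun γ => latCoef θ h φ γ * latCoef θ k φ (-γ) with hw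
  have hneg : ∀ {F : (Fin 2 → ℤ × ℤ) → ℂ}, (Summable fun γ => ‖F γ‖) →
      Summable fun γ => ‖F (-γ)‖ := fun {F} hF =>
    (Equiv.neg (Fin 2 → ℤ × ℤ)).summable_iff (f := fun γ => ‖F γ‖) |>.2 hF
  have su : Summable u := (summable_mul_of_norm (hh.summable_latCoef hθ hφ)
    (by simpa only [RCLike.norm_conj] using hk.summable_latCoef hθ hφ)).of_norm
  have sv : Summable v := (summable_mul_of_norm
    (by simpa only [RCLike.norm_conj] using hφ.summable_latCoef hθ hφ)
    (hh.summable_latCoef hθ hk)).of_norm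
  have sw : Summable w := (summable_mul_of_norm (hh.summable_latCoef hθ hφ)
    (hneg (hk.summable_latCoef hθ hφ))).of_norm
  have hre : ∀ {F : (Fin 2 → ℤ × ℤ) → ℂ}, Summable F → HasSum (fun γ => (F γ).re) (∑' γ, F γ).re :=
    fun {F} hF => Complex.hasSum_re hF.hasSum
  have hre' : ∀ {F : (Fin 2 → ℤ × ℤ) → ℂ}, Summable F →
      HasSum (fun γ => (F (-γ)).re) (∑' γ, F γ).re := fun {F} hF =>
    (Equiv.neg (Fin 2 → ℤ × ℤ)).hasSum_iff (f := fun γ => (F γ).re) |>.2 (hre hF)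
  -- the reflection `γ ↦ -γ` identifies the terms with their complex conjugates
  have key : (∑' γ, 2 * ((conj (latCoef θ φ h γ + latCoef θ h φ γ) *
        (latCoef θ φ k γ + latCoef θ k φ γ)).re + (conj (latCoef θ φ φ γ) *
        (latCoef θ h k γ + latCoef θ k h γ)).re)) =
      4 * ((∑' γ, u γ).re + (∑' γ, w γ).re + (∑' γ, v γ).re) := by
    have h1 := ((((hre su).add (hre' su)).add ((hre sw).add (hre' sw))).add
      ((hre sv).add (hre' sv))).mul_left 2
    refine (Eq.trans (tsum_congr fun γ => ?_) h1.tsum_eq).trans (by ring)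
    simp only [hu, hv, hw, latCoef_neg, Complex.add_re, map_add, Complex.mul_re,
      Complex.add_im, Complex.conj_re, Complex.conj_im, Complex.conj_conj]
    ring
  rw [key]
  simp only [hessForm, hessLin, hessAnti, Complex.add_re, Complex.mul_re, Complex.ofReal_re,
    Complex.ofReal_im, massTerm_eq, bargmannInner_self_im, Complex.mul_im]
  ring

end

section

/-! ### Boundedness of the second variation -/

variable {θ : ℝ} {f g h φ k ψ : (Fin 2 → ℂ) → ℂ}

lemma summable_sq_of_norm {ι : Type*} {a : ι → ℂ} (ha : Summable fun i => ‖a i‖) :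
    Summable fun i => ‖a i‖ ^ 2 := by
  refine (summable_mul_of_norm ha ha).congr fun i => ?_
  rw [norm_mul, sq]

/-- The Cauchy-Schwarz inequality for series. -/
lemma tsum_norm_mul_le {ι : Type*} {a b : ι → ℂ} {A B : ℝ} (ha : Summable fun i => ‖a i‖)
    (hb : Summable fun i => ‖b i‖) (hA0 : 0 ≤ A) (hB0 : 0 ≤ B) (hA : ∑' i, ‖a i‖ ^ 2 ≤ A ^ 2)
    (hB : ∑' i, ‖b i‖ ^ 2 ≤ B ^ 2) : ∑' i, ‖a i * b i‖ ≤ A * B := by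
  have h1 := Real.inner_le_Lp_mul_Lq_tsum_of_nonneg (p := 2) (q := 2)
    Real.HolderConjugate.two_two (f := fun i => ‖a i‖) (g := fun i => ‖b i‖)
    (fun i => norm_nonneg _) (fun i => norm_nonneg _)
    (by simpa only [Real.rpow_two] using summable_sq_of_norm ha)
    (by simpa only [Real.rpow_two] using summable_sq_of_norm hb)
  simp only [Real.rpow_two, ← Real.sqrt_eq_rpow] at h1
  simp only [norm_mul]
  refine h1.trans (mul_le_mul ?_ ?_ (Real.sqrt_nonneg _) hA0)
  · exact Real.sqrt_le_iff.2 ⟨hA0, hA⟩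
  · exact Real.sqrt_le_iff.2 ⟨hB0, hB⟩

lemma norm_tsum_mul_le {ι : Type*} {a b : ι → ℂ} {A B : ℝ} (ha : Summable fun i => ‖a i‖)
    (hb : Summable fun i => ‖b i‖) (hA0 : 0 ≤ A) (hB0 : 0 ≤ B) (hA : ∑' i, ‖a i‖ ^ 2 ≤ A ^ 2)
    (hB : ∑' i, ‖b i‖ ^ 2 ≤ B ^ 2) : ‖∑' i, a i * b i‖ ≤ A * B :=
  (norm_tsum_le_tsum_norm (summable_mul_of_norm ha hb)).trans
    (tsum_norm_mul_le ha hb hA0 hB0 hA hB)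

lemma Smooth.norm_vec_sq (hf : Smooth θ f) : ‖hf.vec‖ ^ 2 = (bargmannInner θ f f).re := by
  rw [← hf.inner_vec hf, inner_self_eq_norm_sq_to_K]
  norm_cast

/-- The translates of a smooth vector by the lattice form a Bessel system. By Janssen's
representation the frame operator is an absolutely convergent series of unitaries. -/
lemma Smooth.exists_tsum_latCoef_sq_le (hθ : 0 < θ) (hφ : Smooth θ φ) : ∃ C : ℝ, 0 ≤ C ∧
    ∀ f, ∀ hf : Smooth θ f, ∑' γ, ‖latCoef θ f φ γ‖ ^ 2 ≤ (C * ‖hf.vec‖) ^ 2 := by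
  obtain ⟨c, hc⟩ := exists_janssen hθ
  have hs := hφ.summable_inner_dual hφ
  set D : ℝ := |c| * ∑' κ, ‖bargmannInner θ φ (weyl θ (dualPoint κ) φ)‖
  have hD : 0 ≤ D := mul_nonneg (abs_nonneg _) (tsum_nonneg fun κ => norm_nonneg _)
  refine ⟨√D, Real.sqrt_nonneg _, fun f hf => ?_⟩
  rw [mul_pow, Real.sq_sqrt hD]
  have h1 := hc φ f f hφ hf hf
  have h2 : ∀ γ, bargmannInner θ f (weyl θ (latticePoint θ γ) φ) *
      bargmannInner θ (weyl θ (latticePoint θ γ) φ) f =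
      ((‖latCoef θ f φ γ‖ ^ 2 : ℝ) : ℂ) := fun γ => by
    rw [← bargmannInner_conj f, Complex.mul_conj']
    rw [latCoef]; push_cast; rfl
  rw [tsum_congr h2, ← Complex.ofReal_tsum] at h1
  have h3 : ∑' γ, ‖latCoef θ f φ γ‖ ^ 2 = ‖((∑' γ, ‖latCoef θ f φ γ‖ ^ 2 : ℝ) : ℂ)‖ := by
    rw [Complex.norm_real, Real.norm_of_nonneg (tsum_nonneg fun γ => sq_nonneg _)]
  rw [h3, h1, norm_mul, Complex.norm_real, Real.norm_eq_abs, mul_assoc]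
  refine mul_le_mul_of_nonneg_left ?_ (abs_nonneg _)
  have h4 : ∀ κ, ‖bargmannInner θ (weyl θ (dualPoint κ) φ) φ *
      bargmannInner θ f (weyl θ (dualPoint κ) f)‖ ≤
      ‖bargmannInner θ φ (weyl θ (dualPoint κ) φ)‖ * ‖hf.vec‖ ^ 2 := fun κ => by
    rw [norm_mul, ← bargmannInner_conj φ, RCLike.norm_conj, sq]
    exact mul_le_mul_of_nonneg_left (hf.norm_inner_weyl_le hf _) (norm_nonneg _)
  exact (tsum_of_norm_bounded (hs.hasSum.mul_right _) h4)

/-- Real bilinearity on the smooth vectors. -/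
structure IsRealBilin (θ : ℝ) (G : ((Fin 2 → ℂ) → ℂ) → ((Fin 2 → ℂ) → ℂ) → ℝ) : Prop where
  add_left : ∀ {f g h}, Smooth θ f → Smooth θ g → Smooth θ h → G (f + g) h = G f h + G g h
  add_right : ∀ {f g h}, Smooth θ f → Smooth θ g → Smooth θ h → G f (g + h) = G f g + G f h
  smul_left : ∀ (t : ℝ) {f g}, Smooth θ f → Smooth θ g → G (t • f) g = t * G f g
  smul_right : ∀ (t : ℝ) {f g}, Smooth θ f → Smooth θ g → G f (t • g) = t * G f g

lemma isRealBilin_inner : IsRealBilin θ fun f g => (bargmannInner θ f g).re := by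
  refine ⟨fun hf hg hh => ?_, fun hf hg hh => ?_, fun t f g _ _ => ?_, fun t f g _ _ => ?_⟩
  · simp only [hf.inner_add_left hg hh, Complex.add_re]
  · simp only [hf.inner_add_right hg hh, Complex.add_re]
  · simp only [real_smul_eq, inner_const_mul_left, Complex.conj_ofReal, Complex.re_ofReal_mul]
  · simp only [real_smul_eq, inner_const_mul_right, Complex.re_ofReal_mul]

lemma smooth_zero : Smooth θ 0 :=
  ⟨differentiable_const 0, fun K => ⟨0, fun z => by simp [wt]⟩⟩

lemma smooth_sum {ι : Type*} {r : ι → (Fin 2 → ℂ) → ℂ} (hr : ∀ a, Smooth θ (r a)) (s : Finset ι)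
    (x : ι → ℝ) : Smooth θ (∑ a ∈ s, x a • r a) := by
  classical
  induction s using Finset.induction_on with
  | empty => simpa using smooth_zero
  | insert a s ha ih => rw [Finset.sum_insert ha]; exact ((hr a).smul _).add ih

lemma IsRealBilin.sum_left {G : ((Fin 2 → ℂ) → ℂ) → ((Fin 2 → ℂ) → ℂ) → ℝ} (hG : IsRealBilin θ G)
    {ι : Type*} {r : ι → (Fin 2 → ℂ) → ℂ} (hr : ∀ a, Smooth θ (r a)) (s : Finset ι)
    (x : ι → ℝ) (hg : Smooth θ g) : G (∑ a ∈ s, x a • r a) g = ∑ a ∈ s, x a * G (r a) g := by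
  classical
  induction s using Finset.induction_on with
  | empty => simpa using hG.smul_left 0 smooth_zero hg
  | insert a s ha ih =>
    rw [Finset.sum_insert ha, Finset.sum_insert ha, hG.add_left ((hr a).smul _) (smooth_sum hr s x) hg,
      ih, hG.smul_left _ (hr a) hg]

lemma IsRealBilin.sum_right {G : ((Fin 2 → ℂ) → ℂ) → ((Fin 2 → ℂ) → ℂ) → ℝ} (hG : IsRealBilin θ G)
    {ι : Type*} {r : ι → (Fin 2 → ℂ) → ℂ} (hr : ∀ a, Smooth θ (r a)) (s : Finset ι)
    (x : ι → ℝ) (hf : Smooth θ f) : G f (∑ a ∈ s, x a • r a) = ∑ a ∈ s, x a * G f (r a) :=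
  IsRealBilin.sum_left (G := fun a b => G b a) ⟨fun h1 h2 h3 => hG.add_right h3 h1 h2,
    fun h1 h2 h3 => hG.add_left h2 h3 h1, fun t _ _ h1 h2 => hG.smul_right t h2 h1,
    fun t _ _ h1 h2 => hG.smul_left t h2 h1⟩ hr s x hf

lemma IsRealBilin.sum_sum {G : ((Fin 2 → ℂ) → ℂ) → ((Fin 2 → ℂ) → ℂ) → ℝ} (hG : IsRealBilin θ G)
    {ι : Type*} {r : ι → (Fin 2 → ℂ) → ℂ} (hr : ∀ a, Smooth θ (r a)) (s t : Finset ι)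
    (x y : ι → ℝ) : G (∑ a ∈ s, x a • r a) (∑ b ∈ t, y b • r b) =
      ∑ a ∈ s, ∑ b ∈ t, x a * G (r a) (r b) * y b := by
  rw [hG.sum_left hr s x (smooth_sum hr t y)]
  refine Finset.sum_congr rfl fun a _ => ?_
  rw [hG.sum_right hr t y (hr a), Finset.mul_sum]
  exact Finset.sum_congr rfl fun b _ => by ring

lemma summable_conj_norm {ι : Type*} {a : ι → ℂ} (ha : Summable fun i => ‖a i‖) :
    Summable fun i => ‖conj (a i)‖ := by
  simpa only [RCLike.norm_conj] using ha

lemma summable_norm_neg {F : (Fin 2 → ℤ × ℤ) → ℂ} (hF : Summable fun γ => ‖F γ‖) :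
    Summable fun γ => ‖F (-γ)‖ :=
  (Equiv.neg (Fin 2 → ℤ × ℤ)).summable_iff (f := fun γ => ‖F γ‖) |>.2 hF

lemma Smooth.summable_hessLin₁ (hθ : 0 < θ) (hφ : Smooth θ φ) (hh : Smooth θ h) (hk : Smooth θ k) :
    Summable fun γ => latCoef θ h φ γ * conj (latCoef θ k φ γ) :=
  (summable_mul_of_norm (hh.summable_latCoef hθ hφ)
    (summable_conj_norm (hk.summable_latCoef hθ hφ))).of_norm

lemma Smooth.summable_hessLin₂ (hθ : 0 < θ) (hφ : Smooth θ φ) (hh : Smooth θ h) (hk : Smooth θ k) :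
    Summable fun γ => conj (latCoef θ φ φ γ) * latCoef θ h k γ :=
  (summable_mul_of_norm (summable_conj_norm (hφ.summable_latCoef hθ hφ))
    (hh.summable_latCoef hθ hk)).of_norm

lemma Smooth.summable_hessAnti (hθ : 0 < θ) (hφ : Smooth θ φ) (hh : Smooth θ h) (hk : Smooth θ k) :
    Summable fun γ => latCoef θ h φ γ * latCoef θ k φ (-γ) :=
  (summable_mul_of_norm (hh.summable_latCoef hθ hφ)
    (summable_norm_neg (hk.summable_latCoef hθ hφ))).of_norm

lemma Smooth.isRealBilin_hessForm (hθ : 0 < θ) (lam lam' : ℝ) (hφ : Smooth θ φ) :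
    IsRealBilin θ (hessForm θ lam lam' φ) := by
  refine ⟨fun {f g h} hf hg hh => ?_, fun {f g h} hf hg hh => ?_, fun t f g hf hg => ?_,
    fun t f g hf hg => ?_⟩
  · unfold hessForm hessLin hessAnti
    simp only [hf.latCoef_add_left hg hφ, hf.latCoef_add_left hg hh, add_mul, mul_add,
      hf.inner_add_left hg hh, hφ.inner_add_right hf hg]
    rw [(hφ.summable_hessLin₁ hθ hf hh).tsum_add (hφ.summable_hessLin₁ hθ hg hh),
      (hφ.summable_hessLin₂ hθ hf hh).tsum_add (hφ.summable_hessLin₂ hθ hg hh),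
      (hφ.summable_hessAnti hθ hf hh).tsum_add (hφ.summable_hessAnti hθ hg hh)]
    simp only [mul_add, Complex.add_re]
    ring
  · unfold hessForm hessLin hessAnti
    simp only [hg.latCoef_add_left hh hφ, hf.latCoef_add_right hg hh, mul_add, map_add,
      hf.inner_add_right hg hh, hφ.inner_add_right hg hh]
    rw [(hφ.summable_hessLin₁ hθ hf hg).tsum_add (hφ.summable_hessLin₁ hθ hf hh),
      (hφ.summable_hessLin₂ hθ hf hg).tsum_add (hφ.summable_hessLin₂ hθ hf hh),
      (hφ.summable_hessAnti hθ hf hg).tsum_add (hφ.summable_hessAnti hθ hf hh)]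
    simp only [mul_add, Complex.add_re]
    ring
  · unfold hessForm hessLin hessAnti
    simp only [latCoef_smul_left, mul_assoc, mul_left_comm _ (t : ℂ), tsum_mul_left]
    rw [real_smul_eq]
    simp only [inner_const_mul_left, inner_const_mul_right, Complex.conj_ofReal]
    simp only [mul_left_comm _ (t : ℂ), ← mul_add, Complex.re_ofReal_mul]
    ring
  · unfold hessForm hessLin hessAnti
    simp only [latCoef_smul_left, latCoef_smul_right, map_mul, Complex.conj_ofReal, mul_assoc,
      mul_left_comm _ (t : ℂ), tsum_mul_left]
    rw [real_smul_eq]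
    simp only [inner_const_mul_right]
    simp only [mul_left_comm _ (t : ℂ), ← mul_add, Complex.re_ofReal_mul]
    ring

/-- The second variation is a bounded form. -/
lemma Smooth.exists_abs_hessForm_le (hθ : 0 < θ) (lam lam' : ℝ) (hφ : Smooth θ φ) :
    ∃ C : ℝ, 0 ≤ C ∧ ∀ f g, ∀ (hf : Smooth θ f) (hg : Smooth θ g),
      |hessForm θ lam lam' φ f g| ≤ C * ‖hf.vec‖ * ‖hg.vec‖ := by
  obtain ⟨C, hC0, hC⟩ := hφ.exists_tsum_latCoef_sq_le hθ
  set S : ℝ := ∑' γ, ‖latCoef θ φ φ γ‖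
  have hS0 : 0 ≤ S := tsum_nonneg fun γ => norm_nonneg _
  refine ⟨|lam| * (C * C + S) + |lam'| * ‖hφ.vec‖ ^ 2 + |lam| * (C * C)
    + 2 * |lam'| * ‖hφ.vec‖ ^ 2, by positivity, fun f g hf hg => ?_⟩
  have b1 : ‖∑' γ, latCoef θ f φ γ * conj (latCoef θ g φ γ)‖ ≤ C * ‖hf.vec‖ * (C * ‖hg.vec‖) :=
    norm_tsum_mul_le (hf.summable_latCoef hθ hφ) (summable_conj_norm (hg.summable_latCoef hθ hφ))
      (by positivity) (by positivity) (hC f hf) (by simpa only [RCLike.norm_conj] using hC g hg)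
  have b2 : ‖∑' γ, conj (latCoef θ φ φ γ) * latCoef θ f g γ‖ ≤ S * (‖hf.vec‖ * ‖hg.vec‖) := by
    refine tsum_of_norm_bounded ((hφ.summable_latCoef hθ hφ).hasSum.mul_right _) fun γ => ?_
    rw [norm_mul, RCLike.norm_conj]
    exact mul_le_mul_of_nonneg_left (hf.norm_inner_weyl_le hg _) (norm_nonneg _)
  have b3 : ‖∑' γ, latCoef θ f φ γ * latCoef θ g φ (-γ)‖ ≤ C * ‖hf.vec‖ * (C * ‖hg.vec‖) := by
    refine norm_tsum_mul_le (hf.summable_latCoef hθ hφ)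
      (summable_norm_neg (hg.summable_latCoef hθ hφ))
      (by positivity) (by positivity) (hC f hf) ?_
    exact ((Equiv.neg (Fin 2 → ℤ × ℤ)).tsum_eq fun γ => ‖latCoef θ g φ γ‖ ^ 2).trans_le (hC g hg)
  have b4 := hf.norm_inner_le hg
  have b5 := hφ.norm_inner_le hφ
  have b6 := (Complex.abs_re_le_norm _).trans (hφ.norm_inner_le hf)
  have b7 := (Complex.abs_re_le_norm _).trans (hφ.norm_inner_le hg)
  have c1 : |(hessLin θ lam lam' φ f g).re| ≤ |lam| * (C * ‖hf.vec‖ * (C * ‖hg.vec‖) +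
      S * (‖hf.vec‖ * ‖hg.vec‖)) + |lam'| * (‖hφ.vec‖ * ‖hφ.vec‖) * (‖hf.vec‖ * ‖hg.vec‖) := by
    refine (Complex.abs_re_le_norm _).trans ((norm_add_le _ _).trans (add_le_add ?_ ?_))
    · rw [norm_mul, Complex.norm_real, Real.norm_eq_abs]
      exact mul_le_mul_of_nonneg_left ((norm_add_le _ _).trans (add_le_add b1 b2)) (abs_nonneg _)
    · rw [norm_mul, norm_mul, Complex.norm_real, Real.norm_eq_abs]
      exact mul_le_mul (mul_le_mul_of_nonneg_left b5 (abs_nonneg _)) b4 (norm_nonneg _)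
        (by positivity)
  have c2 : |(hessAnti θ lam φ f g).re| ≤ |lam| * (C * ‖hf.vec‖ * (C * ‖hg.vec‖)) := by
    refine (Complex.abs_re_le_norm _).trans ?_
    rw [hessAnti, norm_mul, Complex.norm_real, Real.norm_eq_abs]
    exact mul_le_mul_of_nonneg_left b3 (abs_nonneg _)
  have c3 : |2 * lam' * (bargmannInner θ φ f).re * (bargmannInner θ φ g).re| ≤
      2 * |lam'| * (‖hφ.vec‖ * ‖hf.vec‖) * (‖hφ.vec‖ * ‖hg.vec‖) := by
    rw [abs_mul, abs_mul, abs_mul, abs_two]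
    exact mul_le_mul (mul_le_mul_of_nonneg_left b6 (by positivity)) b7 (abs_nonneg _)
      (by positivity)
  unfold hessForm
  refine (abs_add_le _ _).trans ((add_le_add ((abs_add_le _ _).trans (add_le_add c1 c2)) c3).trans
    (le_of_eq (by ring)))

/-! ### Loops with at least three vertices -/

lemma smooth_realBasis (hθ : 0 < θ) (a : (Fin 2 → ℕ) × Bool) : Smooth θ (realBasis θ a) :=
  (smooth_fockBasis hθ a.1).const_mul _

lemma inner_realBasis (hθ : 0 < θ) (a b : (Fin 2 → ℕ) × Bool) :
    (bargmannInner θ (realBasis θ a) (realBasis θ b)).re = if a = b then 1 else 0 := by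
  unfold realBasis
  rw [inner_const_mul_left, inner_const_mul_right, inner_fockBasis hθ]
  obtain ⟨m, i⟩ := a
  obtain ⟨n, j⟩ := b
  by_cases hmn : m = n
  · cases i <;> cases j <;> simp [hmn]
  · simp [hmn]

lemma norm_vec_sum_realBasis (hθ : 0 < θ) (s : Finset ((Fin 2 → ℕ) × Bool))
    (x : (Fin 2 → ℕ) × Bool → ℝ) :
    ‖(smooth_sum (smooth_realBasis hθ) s x).vec‖ = √(∑ a ∈ s, x a ^ 2) := by
  rw [eq_comm, Real.sqrt_eq_iff_eq_sq (Finset.sum_nonneg fun a _ => sq_nonneg _) (norm_nonneg _),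
    Smooth.norm_vec_sq, isRealBilin_inner.sum_sum (smooth_realBasis hθ) s s x x]
  refine Finset.sum_congr rfl fun a ha => ?_
  simp only [inner_realBasis hθ, mul_ite, mul_one, mul_zero, ite_mul, zero_mul]
  rw [Finset.sum_ite_eq, if_pos ha, sq]

/-- The matrix of half the second variation in the real basis. -/
noncomputable def hessMat (θ lam lam' : ℝ) (φ : (Fin 2 → ℂ) → ℂ) (a b : (Fin 2 → ℕ) × Bool) : ℝ :=
  hessForm θ lam lam' φ (realBasis θ a) (realBasis θ b)

/-- The Hessian is a bounded operator on the real sequence space of the Fock basis. -/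
lemma Smooth.exists_hessOp (hθ : 0 < θ) (lam lam' : ℝ) (hφ : Smooth θ φ) :
    ∃ T : RealSeq ((Fin 2 → ℕ) × Bool) →L[ℝ] RealSeq ((Fin 2 → ℕ) × Bool),
      ∀ a b, T (unitVec b) a = hessMat θ lam lam' φ a b := by
  obtain ⟨C, hC0, hC⟩ := hφ.exists_abs_hessForm_le hθ lam lam'
  refine exists_operator hC0 fun s t x y => ?_
  have h := hC _ _ (smooth_sum (smooth_realBasis hθ) s x) (smooth_sum (smooth_realBasis hθ) t y)
  rwa [(hφ.isRealBilin_hessForm hθ lam lam').sum_sum (smooth_realBasis hθ) s t x y,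
    norm_vec_sum_realBasis hθ, norm_vec_sum_realBasis hθ] at h

/-- The factor `1 / 2` at each vertex cancels the `2` in `hessian_interaction`. -/
lemma Smooth.loopSummand_eq (hθ : 0 < θ) (μ₀ lam lam' ε : ℝ) (hφ : Smooth θ φ) (N : ℕ)
    (a : Fin N → (Fin 2 → ℕ) × Bool) : loopSummand θ μ₀ lam lam' ε φ N a =
      ∏ j, (propagator θ μ₀ ε (a j).1 * hessMat θ lam lam' φ (a j) (a (finRotate N j))) := by
  refine Finset.prod_congr rfl fun j _ => ?_
  rw [hφ.hessian_interaction hθ lam lam' (smooth_realBasis hθ _) (smooth_realBasis hθ _), hessMat]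
  ring

lemma summable_prod_bool {g : (Fin 2 → ℕ) → ℝ} (hg : Summable g) (h0 : ∀ n, 0 ≤ g n) :
    Summable fun a : (Fin 2 → ℕ) × Bool => g a.1 :=
  (summable_prod_of_nonneg fun a => h0 a.1).2 ⟨fun n => (hasSum_fintype _).summable, by
    simpa using hg.mul_left 2⟩

/-- With the cut-off the propagator is trace class, and the entries of the Hessian are bounded. -/
lemma Smooth.summable_loopSummand (hθ : 0 < θ) (μ₀ lam lam' : ℝ) {ε : ℝ} (hε : 0 < ε)
    (hφ : Smooth θ φ) {N : ℕ} (hN : 1 ≤ N) : Summable (loopSummand θ μ₀ lam lam' ε φ N) := by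
  obtain ⟨n, rfl⟩ : ∃ n, N = n + 1 := ⟨N - 1, by omega⟩
  obtain ⟨T, hT⟩ := hφ.exists_hessOp hθ lam lam'
  have h := summable_loop (D := fun a : (Fin 2 → ℕ) × Bool => propagator θ μ₀ ε a.1)
    (fun a => (propagator_pos hθ ε a.1).le)
    (summable_prod_bool (summable_propagator hθ hε) fun n => (propagator_pos hθ ε n).le)
    (M := hessMat θ lam lam' φ) (C := ‖T‖) (fun a b => by rw [← hT]; exact abs_entry_le T a b) n
  exact h.congr fun a => (hφ.loopSummand_eq hθ μ₀ lam lam' ε (n + 1) a).symm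

/-- Loops with at least three propagators converge without counterterms. -/
lemma Smooth.exists_tendsto_oneLoop (hθ : 0 < θ) (μ₀ lam lam' : ℝ) (hφ : Smooth θ φ) {N : ℕ}
    (hN : 3 ≤ N) : ∃ L : ℝ, Tendsto (fun ε => oneLoop θ μ₀ lam lam' ε N φ) (𝓝[>] 0) (𝓝 L) := by
  obtain ⟨n, rfl⟩ : ∃ n, N = n + 2 + 1 := ⟨N - 3, by omega⟩
  obtain ⟨T, hT⟩ := hφ.exists_hessOp hθ lam lam'
  obtain ⟨L, hL⟩ := exists_tendsto_tsum_loop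
    (D := fun ε (a : (Fin 2 → ℕ) × Bool) => propagator θ μ₀ ε a.1)
    (D₀ := fun a => propagator θ μ₀ 0 a.1) (B := (2 * freq θ)⁻¹)
    (fun a => by
      rw [abs_of_nonneg (propagator_pos hθ 0 a.1).le]; exact propagator_le_const hθ le_rfl a.1)
    (summable_prod_bool (summable_propagator_cube hθ) fun n =>
      pow_nonneg (propagator_pos hθ 0 n).le 3)
    (fun ε _ a => (propagator_pos hθ ε a.1).le) (fun ε hε a => propagator_le hθ hε.le a.1)
    (fun ε hε => summable_prod_bool (summable_propagator hθ hε) fun n =>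
      (propagator_pos hθ ε n).le) (fun a => tendsto_propagator hθ a.1) T n
  refine ⟨_, (hL.const_mul (1 / 2 * ((-1) ^ (n + 2 + 1 + 1) / ((n + 2 + 1 : ℕ) : ℝ)))).congr
    fun ε => ?_⟩
  unfold oneLoop
  refine congrArg _ (tsum_congr fun a => ?_)
  rw [hφ.loopSummand_eq hθ]
  exact Finset.prod_congr rfl fun j _ => by rw [hT]

end

section

/-! ### The linear part of the second variation as a series of Weyl operators -/

variable {θ : ℝ} {f g h φ k ψ : (Fin 2 → ℂ) → ℂ}

lemma latCoef_const_mul_left (c : ℂ) (f g : (Fin 2 → ℂ) → ℂ) (γ : Fin 2 → ℤ × ℤ) :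
    latCoef θ (fun z => c * f z) g γ = conj c * latCoef θ f g γ :=
  inner_const_mul_left c f _

lemma latCoef_const_mul_right (c : ℂ) (f g : (Fin 2 → ℂ) → ℂ) (γ : Fin 2 → ℤ × ℤ) :
    latCoef θ f (fun z => c * g z) γ = c * latCoef θ f g γ := by
  unfold latCoef
  rw [weyl_const_mul, inner_const_mul_right]

lemma hessLin_const_mul (lam lam' : ℝ) (c d : ℂ) (φ h k : (Fin 2 → ℂ) → ℂ) :
    hessLin θ lam lam' φ (fun z => c * h z) (fun z => d * k z) =
      conj c * d * hessLin θ lam lam' φ h k := by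
  unfold hessLin
  simp only [latCoef_const_mul_left, latCoef_const_mul_right, map_mul, Complex.conj_conj,
    inner_const_mul_left, inner_const_mul_right]
  have h1 : ∀ γ, conj c * latCoef θ h φ γ * (d * conj (latCoef θ k φ γ)) =
      conj c * d * (latCoef θ h φ γ * conj (latCoef θ k φ γ)) := fun γ => by ring
  have h2 : ∀ γ, conj (latCoef θ φ φ γ) * (d * (conj c * latCoef θ h k γ)) =
      conj c * d * (conj (latCoef θ φ φ γ) * latCoef θ h k γ) := fun γ => by ring
  simp only [h1, h2, tsum_mul_left]
  ring

lemma hessAnti_const_mul (lam : ℝ) (c d : ℂ) (φ h k : (Fin 2 → ℂ) → ℂ) :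
    hessAnti θ lam φ (fun z => c * h z) (fun z => d * k z) =
      conj c * conj d * hessAnti θ lam φ h k := by
  unfold hessAnti
  simp only [latCoef_const_mul_left]
  have h1 : ∀ γ, conj c * latCoef θ h φ γ * (conj d * latCoef θ k φ (-γ)) =
      conj c * conj d * (latCoef θ h φ γ * latCoef θ k φ (-γ)) := fun γ => by ring
  simp only [h1, tsum_mul_left]
  ring

/-- The matrix of the complex linear part of half the second variation. -/
noncomputable def linMat (θ lam lam' : ℝ) (φ : (Fin 2 → ℂ) → ℂ) (m n : Fin 2 → ℕ) : ℂ :=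
  hessLin θ lam lam' φ (fockBasis θ m) (fockBasis θ n)

/-- The matrix of the antilinear part of half the second variation. -/
noncomputable def antiMat (θ lam : ℝ) (φ : (Fin 2 → ℂ) → ℂ) (m n : Fin 2 → ℕ) : ℂ :=
  hessAnti θ lam φ (fockBasis θ m) (fockBasis θ n)

/-- The real coordinates of the external field. -/
noncomputable def realCoord (θ : ℝ) (φ : (Fin 2 → ℂ) → ℂ) (a : (Fin 2 → ℕ) × Bool) : ℝ :=
  (bargmannInner θ φ (realBasis θ a)).re

/-- The part of the matrix of the second variation that does not have finite rank. -/
noncomputable def mainMat (θ lam lam' : ℝ) (φ : (Fin 2 → ℂ) → ℂ) (a b : (Fin 2 → ℕ) × Bool) : ℝ :=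
  (conj (if a.2 then Complex.I else 1) * (if b.2 then Complex.I else 1) *
      linMat θ lam lam' φ a.1 b.1).re +
    (conj (if a.2 then Complex.I else 1) * conj (if b.2 then Complex.I else 1) *
      antiMat θ lam φ a.1 b.1).re

lemma realCoord_false (φ : (Fin 2 → ℂ) → ℂ) (n : Fin 2 → ℕ) :
    realCoord θ φ (n, false) = (bargmannInner θ φ (fockBasis θ n)).re := by
  have h : realBasis θ (n, false) = fun z => (1 : ℂ) * fockBasis θ n z := by
    funext z; simp [realBasis]
  rw [realCoord, h, inner_const_mul_right, one_mul]

lemma realCoord_true (φ : (Fin 2 → ℂ) → ℂ) (n : Fin 2 → ℕ) :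
    realCoord θ φ (n, true) = -(bargmannInner θ φ (fockBasis θ n)).im := by
  have h : realBasis θ (n, true) = fun z => Complex.I * fockBasis θ n z := by
    funext z; simp [realBasis]
  rw [realCoord, h, inner_const_mul_right, Complex.I_mul_re]

/-- The rank one term is split off. -/
lemma hessMat_eq (lam lam' : ℝ) (φ : (Fin 2 → ℂ) → ℂ) (a b : (Fin 2 → ℕ) × Bool) :
    hessMat θ lam lam' φ a b = mainMat θ lam lam' φ a b +
      2 * lam' * realCoord θ φ a * realCoord θ φ b := by
  unfold hessMat hessForm mainMat realCoord linMat antiMat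
  rw [← hessLin_const_mul, ← hessAnti_const_mul]
  rfl

/-- The indices of the Weyl operators in the linear part: the lattice and its dual. -/
abbrev SymbolIndex := (Fin 2 → ℤ × ℤ) ⊕ (Fin 2 → ℤ × ℤ)

/-- The position of a Weyl operator in the linear part. -/
def symbolPos : SymbolIndex → (Fin 2 → ℤ × ℤ) × (Fin 2 → ℤ × ℤ) :=
  Sum.elim (fun γ => (γ, 0)) (fun κ => (0, κ))

/-- The coefficients of the Weyl operators in the linear part, for a given constant `c` of Janssen's
representation. -/
noncomputable def symbolCoef (θ lam lam' c : ℝ) (φ : (Fin 2 → ℂ) → ℂ) : SymbolIndex → ℂ :=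
  Sum.elim
    (fun γ => lam * conj (latCoef θ φ φ γ) + if γ = 0 then lam' * bargmannInner θ φ φ else 0)
    (fun κ => lam * (c * bargmannInner θ (weyl θ (dualPoint κ) φ) φ))

lemma mixedPoint_symbolPos_inl (γ : Fin 2 → ℤ × ℤ) :
    mixedPoint θ (symbolPos (Sum.inl γ)) = latticePoint θ γ := by
  simp [mixedPoint, symbolPos, dualPoint_zero]

lemma mixedPoint_symbolPos_inr (κ : Fin 2 → ℤ × ℤ) :
    mixedPoint θ (symbolPos (Sum.inr κ)) = dualPoint κ := by
  simp [mixedPoint, symbolPos, latticePoint_zero]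

lemma summable_norm_lattice : Summable fun γ : Fin 2 → ℤ × ℤ => ((1 + ‖γ‖) ^ 9)⁻¹ * (1 + ‖γ‖) :=
  summable_lattice.congr fun γ => by
    have : (1 + ‖γ‖) ≠ 0 := by positivity
    field_simp

/-- The coefficients are summable, also with a linear weight. -/
lemma Smooth.summable_symbolCoef (hθ : 0 < θ) (lam lam' c : ℝ) (hφ : Smooth θ φ) :
    Summable fun i => ‖symbolCoef θ lam lam' c φ i‖ * (1 + ‖symbolPos i‖) := by
  refine Summable.sum _ ?_ ?_
  · obtain ⟨C, hC0, hC⟩ := hφ.inner_lattice_decay hθ hφ 9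
    have h1 := summable_norm_lattice.mul_left (|lam| * C)
    have h2 : Summable fun γ : Fin 2 → ℤ × ℤ =>
        if γ = 0 then |lam'| * ‖bargmannInner θ φ φ‖ else 0 :=
      summable_of_ne_finset_zero (s := {0}) fun γ hγ => if_neg (by simpa using hγ)
    refine Summable.of_nonneg_of_le (fun γ => ?_) (fun γ => ?_) (h1.add h2)
    · exact mul_nonneg (norm_nonneg _) (by positivity)
    · have hpos : ‖symbolPos (Sum.inl γ)‖ = ‖γ‖ := by simp [symbolPos]
      simp only [Function.comp, hpos, symbolCoef, Sum.elim_inl]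
      have e1 : ‖(lam : ℂ) * conj (latCoef θ φ φ γ)‖ ≤ |lam| * (C * ((1 + ‖γ‖) ^ 9)⁻¹) := by
        rw [norm_mul, RCLike.norm_conj, Complex.norm_real, Real.norm_eq_abs]
        exact mul_le_mul_of_nonneg_left (hC γ) (abs_nonneg _)
      have e2 : ‖(if γ = 0 then (lam' : ℂ) * bargmannInner θ φ φ else 0)‖ * (1 + ‖γ‖) =
          if γ = 0 then |lam'| * ‖bargmannInner θ φ φ‖ else 0 := by
        split_ifs with h0
        · rw [h0, norm_mul, Complex.norm_real, Real.norm_eq_abs, norm_zero]; ring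
        · simp
      rw [← e2]
      calc _ ≤ (|lam| * (C * ((1 + ‖γ‖) ^ 9)⁻¹) +
            ‖(if γ = 0 then (lam' : ℂ) * bargmannInner θ φ φ else 0)‖) * (1 + ‖γ‖) :=
            mul_le_mul_of_nonneg_right ((norm_add_le _ _).trans (add_le_add_left e1 _))
              (by positivity)
        _ = _ := by ring
  · obtain ⟨C, hC0, hC⟩ := hφ.inner_dual_decay hφ 9
    refine Summable.of_nonneg_of_le (fun κ => ?_) (fun κ => ?_)
      (summable_norm_lattice.mul_left (|lam| * (|c| * C)))
    · exact mul_nonneg (norm_nonneg _) (by positivity)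
    · have hpos : ‖symbolPos (Sum.inr κ)‖ = ‖κ‖ := by simp [symbolPos]
      simp only [Function.comp, hpos, symbolCoef, Sum.elim_inr]
      rw [norm_mul, norm_mul, Complex.norm_real, Real.norm_eq_abs, Complex.norm_real,
        Real.norm_eq_abs, ← bargmannInner_conj, RCLike.norm_conj]
      calc _ ≤ |lam| * (|c| * (C * ((1 + ‖κ‖) ^ 9)⁻¹)) * (1 + ‖κ‖) := by
            gcongr; exact hC κ
        _ = _ := by ring

lemma Smooth.summable_norm_symbolCoef (hθ : 0 < θ) (lam lam' c : ℝ) (hφ : Smooth θ φ) :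
    Summable fun i => ‖symbolCoef θ lam lam' c φ i‖ :=
  Summable.of_nonneg_of_le (fun _ => norm_nonneg _) (fun i => by
    have : 0 ≤ ‖symbolPos i‖ := norm_nonneg _
    exact le_mul_of_one_le_right (norm_nonneg _) (by linarith))
    (hφ.summable_symbolCoef hθ lam lam' c)

/-- The property of the constant `c` in Janssen's representation. -/
def IsJanssenConst (θ c : ℝ) : Prop := ∀ φ f k : (Fin 2 → ℂ) → ℂ, Smooth θ φ → Smooth θ f →
    Smooth θ k → ∑' γ, bargmannInner θ f (weyl θ (latticePoint θ γ) φ) *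
      bargmannInner θ (weyl θ (latticePoint θ γ) φ) k =
    c * ∑' κ, bargmannInner θ (weyl θ (dualPoint κ) φ) φ * bargmannInner θ f (weyl θ (dualPoint κ) k)

/-- The linear part as a series of Weyl operators; the Janssen representation rewrites the frame
operator of `φ` over the dual lattice. -/
lemma Smooth.hasSum_hessLin (hθ : 0 < θ) (lam lam' : ℝ) {c : ℝ} (hc : IsJanssenConst θ c)
    (hφ : Smooth θ φ) (hh : Smooth θ h) (hk : Smooth θ k) :
    HasSum (fun i => symbolCoef θ lam lam' c φ i *
      bargmannInner θ h (weyl θ (mixedPoint θ (symbolPos i)) k))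
      (hessLin θ lam lam' φ h k) := by
  have s2 := (hφ.summable_hessLin₂ hθ hh hk).hasSum.mul_left (lam : ℂ)
  have s3 : HasSum (fun γ : Fin 2 → ℤ × ℤ => if γ = 0 then
      lam' * bargmannInner θ φ φ * bargmannInner θ h k else 0)
      (lam' * bargmannInner θ φ φ * bargmannInner θ h k) := hasSum_ite_eq 0 _
  have s4 : Summable fun κ => bargmannInner θ (weyl θ (dualPoint κ) φ) φ *
      bargmannInner θ h (weyl θ (dualPoint κ) k) := by
    refine (summable_mul_of_norm ?_ (hh.summable_inner_dual hk)).of_norm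
    refine (hφ.summable_inner_dual hφ).congr fun κ => ?_
    rw [← bargmannInner_conj φ, RCLike.norm_conj]
  have s5 := (s4.hasSum.mul_left (c : ℂ)).mul_left (lam : ℂ)
  rw [← hc φ h k hφ hh hk] at s5
  have e1 : hessLin θ lam lam' φ h k =
      (lam * ∑' γ, conj (latCoef θ φ φ γ) * latCoef θ h k γ +
        lam' * bargmannInner θ φ φ * bargmannInner θ h k) +
      lam * ∑' γ, bargmannInner θ h (weyl θ (latticePoint θ γ) φ) *
        bargmannInner θ (weyl θ (latticePoint θ γ) φ) k := by
    unfold hessLin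
    have : ∀ γ, latCoef θ h φ γ * conj (latCoef θ k φ γ) =
        bargmannInner θ h (weyl θ (latticePoint θ γ) φ) *
        bargmannInner θ (weyl θ (latticePoint θ γ) φ) k := fun γ => by
      rw [latCoef, latCoef, bargmannInner_conj]
    rw [tsum_congr this]
    ring
  rw [e1]
  refine HasSum.sum ?_ ?_
  · refine Eq.mpr (congrArg (fun F => HasSum F _) (funext fun γ => ?_)) (s2.add s3)
    simp only [Function.comp, mixedPoint_symbolPos_inl, symbolCoef, Sum.elim_inl]
    rw [← latCoef]
    split_ifs with h0
    · rw [h0]; simp only [latCoef, latticePoint_zero, weyl_zero]; ring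
    · ring
  · refine Eq.mpr (congrArg (fun F => HasSum F _) (funext fun κ => ?_)) s5
    simp only [Function.comp, mixedPoint_symbolPos_inr, symbolCoef, Sum.elim_inr]
    ring

lemma symbolPos_eq_zero (i : SymbolIndex) :
    symbolPos i = 0 ↔ i = Sum.inl 0 ∨ i = Sum.inr 0 := by
  rcases i with γ | κ
  · simp [symbolPos, Prod.ext_iff]
  · simp [symbolPos, Prod.ext_iff]

lemma one_le_norm_lattice {γ : Fin 2 → ℤ × ℤ} (hγ : γ ≠ 0) : 1 ≤ ‖γ‖ := by
  have h1 : ∃ i, γ i ≠ 0 := by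
    by_contra hcon
    push Not at hcon
    exact hγ (funext hcon)
  obtain ⟨i, hi⟩ := h1
  refine le_trans ?_ (norm_le_pi_norm γ i)
  have h2 : (γ i).1 ≠ 0 ∨ (γ i).2 ≠ 0 := by
    by_contra hcon
    push Not at hcon
    exact hi (Prod.ext hcon.1 hcon.2)
  rcases h2 with h2 | h2
  · refine le_trans ?_ (norm_fst_le (γ i))
    rw [Int.norm_eq_abs]
    exact_mod_cast Int.one_le_abs h2
  · refine le_trans ?_ (norm_snd_le (γ i))
    rw [Int.norm_eq_abs]
    exact_mod_cast Int.one_le_abs h2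

lemma exists_propDensity_symbolPos_le (hθ : 0 < θ) (μ₀ : ℝ) : ∃ C : ℝ, 0 ≤ C ∧ ∀ ε, 0 ≤ ε →
    ∀ i, symbolPos i ≠ 0 → mixedPoint θ (symbolPos i) ≠ 0 ∧
      propDensity θ μ₀ ε (mixedPoint θ (symbolPos i)) ≤ C := by
  set d : ℝ := min (θ / √2) (1 / √2) with hd
  have hd0 : 0 < d := by positivity
  refine ⟨2 * (Real.pi ^ 2)⁻¹ * ((d ^ 2)⁻¹ * 1), by positivity, fun ε hε i hi => ?_⟩
  have h1 : d ≤ ‖mixedPoint θ (symbolPos i)‖ := by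
    rcases i with γ | κ
    · have hγ : γ ≠ 0 := fun h0 => hi (by rw [h0]; rfl)
      rw [mixedPoint_symbolPos_inl]
      refine le_trans ?_ (norm_le_norm_latticePoint hθ γ)
      exact (min_le_left _ _).trans (le_mul_of_one_le_right (by positivity) (one_le_norm_lattice hγ))
    · have hκ : κ ≠ 0 := fun h0 => hi (by rw [h0]; rfl)
      rw [mixedPoint_symbolPos_inr]
      refine le_trans ?_ (norm_le_norm_dualPoint κ)
      exact (min_le_right _ _).trans (le_mul_of_one_le_right (by positivity) (one_le_norm_lattice hκ))
  have h2 : mixedPoint θ (symbolPos i) ≠ 0 := norm_pos_iff.1 (hd0.trans_le h1)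
  refine ⟨h2, (propDensity_le hθ hε h2).trans ?_⟩
  unfold propBound
  have hω := freq_pos hθ
  have h3 : Real.exp (-(freq θ / 4) * ‖mixedPoint θ (symbolPos i)‖ ^ 2) ≤ 1 :=
    Real.exp_le_one_iff.2 (by nlinarith [sq_nonneg ‖mixedPoint θ (symbolPos i)‖])
  gcongr

/-! ### The two-point function -/

/-- The trace of the propagator with the linear part, evaluated term by term. -/
lemma Smooth.hasSum_propagator_linMat (hθ : 0 < θ) (μ₀ lam lam' : ℝ) {c ε : ℝ} (hε : 0 < ε)
    (hc : IsJanssenConst θ c) (hφ : Smooth θ φ) :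
    HasSum (fun n => (propagator θ μ₀ ε n : ℂ) * linMat θ lam lam' φ n n)
      (∑' i, symbolCoef θ lam lam' c φ i *
        (((Real.pi / freq θ) ^ 2 * propDensity θ μ₀ ε (mixedPoint θ (symbolPos i)) : ℝ) : ℂ)) := by
  have hx := fun n => hφ.hasSum_hessLin hθ lam lam' hc (smooth_fockBasis hθ n) (smooth_fockBasis hθ n)
  set F : (Fin 2 → ℕ) × SymbolIndex → ℂ := fun p => (propagator θ μ₀ ε p.1 : ℂ) *
    (symbolCoef θ lam lam' c φ p.2 * bargmannInner θ (fockBasis θ p.1)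
      (weyl θ (mixedPoint θ (symbolPos p.2)) (fockBasis θ p.1))) with hF
  have hFs : Summable F := by
    refine Summable.of_norm_bounded ((summable_propagator (μ₀ := μ₀) hθ hε).mul_of_nonneg
      (hφ.summable_norm_symbolCoef hθ lam lam' c) (fun n => (propagator_pos hθ ε n).le)
      (fun i => norm_nonneg _)) fun p => ?_
    rw [hF]
    simp only [norm_mul]
    rw [Complex.norm_real, Real.norm_of_nonneg (propagator_pos hθ ε p.1).le]
    refine mul_le_mul_of_nonneg_left (mul_le_of_le_one_right (norm_nonneg _) ?_)
      (propagator_pos hθ ε p.1).le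
    have := (smooth_fockBasis hθ p.1).norm_inner_weyl_le (smooth_fockBasis hθ p.1)
      (mixedPoint θ (symbolPos p.2))
    rwa [norm_vec_fockBasis hθ, one_mul] at this
  have h1 : ∑' p, F p = ∑' i, symbolCoef θ lam lam' c φ i *
      (((Real.pi / freq θ) ^ 2 * propDensity θ μ₀ ε (mixedPoint θ (symbolPos i)) : ℝ) : ℂ) := by
    rw [← (Equiv.prodComm _ _).tsum_eq F]
    have hs' := (Equiv.prodComm SymbolIndex (Fin 2 → ℕ)).summable_iff.2 hFs
    refine (Summable.tsum_prod hs').trans (tsum_congr fun i => ?_)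
    rw [← ((hasSum_trace_propagator (μ₀ := μ₀) hθ hε (mixedPoint θ (symbolPos i))).mul_left
      (symbolCoef θ lam lam' c φ i)).tsum_eq]
    refine tsum_congr fun n => ?_
    simp only [hF, Function.comp, Equiv.prodComm_apply, Prod.swap]
    ring
  rw [← h1]
  exact hFs.hasSum.prod_fiberwise fun n => (hx n).mul_left _

lemma summable_norm_inner_fockBasis_sq (hθ : 0 < θ) (hφ : Smooth θ φ) :
    Summable fun n => ‖bargmannInner θ φ (fockBasis θ n)‖ ^ 2 := by
  have h := (orthonormal_fockVec hθ).inner_products_summable hφ.vec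
  refine h.congr fun n => ?_
  rw [fockVec, Smooth.inner_vec, ← bargmannInner_conj φ, RCLike.norm_conj]

lemma tsum_prod_bool {F : (Fin 2 → ℕ) × Bool → ℝ} (hF : Summable F) :
    ∑' a, F a = ∑' n, (F (n, true) + F (n, false)) := by
  refine (Summable.tsum_prod hF).trans (tsum_congr fun n => ?_)
  rw [tsum_fintype]
  simp

/-- The two-point function diverges like the propagator density at the origin, with a coefficient
proportional to the mass term. -/
lemma Smooth.exists_tendsto_oneLoop_one (hθ : 0 < θ) (μ₀ lam lam' : ℝ) {c : ℝ}
    (hc : IsJanssenConst θ c) (hφ : Smooth θ φ) :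
    ∃ L : ℝ, Tendsto (fun ε => -((Real.pi / freq θ) ^ 2 * propDensity θ μ₀ ε 0 *
      (lam + lam' + lam * c)) * massTerm θ φ + oneLoop θ μ₀ lam lam' ε 1 φ) (𝓝[>] 0) (𝓝 L) := by
  set x := symbolCoef θ lam lam' c φ with hx
  set P : ℝ := (Real.pi / freq θ) ^ 2 with hP
  have hxs := hφ.summable_norm_symbolCoef hθ lam lam' c
  rw [← hx] at hxs
  obtain ⟨C, hC0, hC⟩ := exists_propDensity_symbolPos_le hθ μ₀
  -- the sum over the positions different from the origin converges
  have hreg : Tendsto (fun ε => ∑' i, x i * (((if symbolPos i = 0 then 0 else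
      propDensity θ μ₀ ε (mixedPoint θ (symbolPos i)) : ℝ)) : ℂ)) (𝓝[>] 0)
      (𝓝 (∑' i, x i * (((if symbolPos i = 0 then 0 else
      propDensity θ μ₀ 0 (mixedPoint θ (symbolPos i)) : ℝ)) : ℂ))) := by
    refine tendsto_tsum_of_dominated_convergence (bound := fun i => ‖x i‖ * C) (hxs.mul_right C)
      (fun i => ?_) ?_
    · by_cases h0 : symbolPos i = 0
      · simp [h0]
      · simp only [h0, if_false]
        exact ((Complex.continuous_ofReal.tendsto _).comp
          (tendsto_propDensity hθ (hC 0 le_rfl i h0).1)).const_mul _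
    · filter_upwards [self_mem_nhdsWithin] with ε hε i
      rw [norm_mul]
      refine mul_le_mul_of_nonneg_left ?_ (norm_nonneg _)
      rw [Complex.norm_real]
      by_cases h0 : symbolPos i = 0
      · simp [h0, hC0]
      · simp only [h0, if_false]
        rw [Real.norm_of_nonneg (propDensity_nonneg _ _)]
        exact (hC ε (le_of_lt hε) i h0).2
  -- the rank one part converges
  have hr := summable_norm_inner_fockBasis_sq hθ hφ
  have hrank : Tendsto (fun ε => ∑' n, propagator θ μ₀ ε n *
      ‖bargmannInner θ φ (fockBasis θ n)‖ ^ 2) (𝓝[>] 0)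
      (𝓝 (∑' n, propagator θ μ₀ 0 n * ‖bargmannInner θ φ (fockBasis θ n)‖ ^ 2)) := by
    refine tendsto_tsum_of_dominated_convergence
      (bound := fun n => (2 * freq θ)⁻¹ * ‖bargmannInner θ φ (fockBasis θ n)‖ ^ 2)
      (hr.mul_left _) (fun n => (tendsto_propagator hθ n).mul_const _) ?_
    filter_upwards [self_mem_nhdsWithin] with ε hε n
    rw [Real.norm_of_nonneg (mul_nonneg (propagator_pos hθ ε n).le (sq_nonneg _))]
    exact mul_le_mul_of_nonneg_right (propagator_le_const hθ (le_of_lt hε) n) (sq_nonneg _)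
  have hzero : ∑' i, x i * (((if symbolPos i = 0 then 1 else 0 : ℝ)) : ℂ) =
      (((lam + lam' + lam * c) * massTerm θ φ : ℝ) : ℂ) := by
    have hm : ((massTerm θ φ : ℝ) : ℂ) = bargmannInner θ φ φ := by
      rw [massTerm_eq]
      exact Complex.ext (by simp) (by simp [bargmannInner_self_im])
    rw [tsum_eq_sum (s := {Sum.inl 0, Sum.inr 0}) fun i hi => ?_, Finset.sum_pair (by simp)]
    · simp only [(symbolPos_eq_zero (Sum.inl 0)).2 (Or.inl rfl),
        (symbolPos_eq_zero (Sum.inr 0)).2 (Or.inr rfl), if_true, hx, symbolCoef, Sum.elim_inl,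
        Sum.elim_inr, latCoef, latticePoint_zero, dualPoint_zero, weyl_zero, bargmannInner_conj]
      push_cast
      rw [hm]; ring
    · have : symbolPos i ≠ 0 := fun h0 => hi (by simpa using (symbolPos_eq_zero i).1 h0)
      simp [this]
  have hmain : ∀ ε, 0 < ε → oneLoop θ μ₀ lam lam' ε 1 φ =
      P * propDensity θ μ₀ ε 0 * (lam + lam' + lam * c) * massTerm θ φ +
      (P * (∑' i, x i * (((if symbolPos i = 0 then 0 else
      propDensity θ μ₀ ε (mixedPoint θ (symbolPos i)) : ℝ)) : ℂ)).re +
      lam' * ∑' n, propagator θ μ₀ ε n * ‖bargmannInner θ φ (fockBasis θ n)‖ ^ 2) := by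
    intro ε hε
    have h1 := hφ.hasSum_propagator_linMat hθ μ₀ lam lam' hε hc
    have h2 := Complex.hasSum_re h1
    have h3 : Summable fun n => propagator θ μ₀ ε n *
        ‖bargmannInner θ φ (fockBasis θ n)‖ ^ 2 :=
      Summable.of_nonneg_of_le (fun n => mul_nonneg (propagator_pos hθ ε n).le (sq_nonneg _))
        (fun n => mul_le_mul_of_nonneg_right (propagator_le_const hθ hε.le n) (sq_nonneg _))
        (hr.mul_left _)
    have h4 := (h2.mul_left 2).add (h3.hasSum.mul_left (2 * lam'))
    have hs := hφ.summable_loopSummand hθ μ₀ lam lam' hε (le_refl 1)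
    rw [← (Equiv.funUnique (Fin 1) ((Fin 2 → ℕ) × Bool)).symm.summable_iff] at hs
    have h5 : ∑' a, loopSummand θ μ₀ lam lam' ε φ 1 a = 2 * (∑' i, x i *
        ((P * propDensity θ μ₀ ε (mixedPoint θ (symbolPos i)) : ℝ) : ℂ)).re +
        2 * lam' * ∑' n, propagator θ μ₀ ε n * ‖bargmannInner θ φ (fockBasis θ n)‖ ^ 2 := by
      rw [← (Equiv.funUnique (Fin 1) ((Fin 2 → ℕ) × Bool)).symm.tsum_eq]
      refine (tsum_prod_bool hs).trans (Eq.trans (tsum_congr fun n => ?_) h4.tsum_eq)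
      simp only [Function.comp, hφ.loopSummand_eq hθ, Fin.prod_univ_one, Equiv.funUnique_symm_apply,
        uniqueElim_const, hessMat_eq, mainMat, realCoord_true, realCoord_false,
        Bool.false_eq_true, if_true, if_false, one_mul, map_one, Complex.conj_I,
        ← Complex.normSq_eq_norm_sq, Complex.normSq_apply, Complex.mul_re, Complex.mul_im,
        Complex.I_re, Complex.I_im, Complex.neg_re, Complex.neg_im, Complex.ofReal_re,
        Complex.ofReal_im]
      ring
    have h6 : ∑' i, x i * ((P * propDensity θ μ₀ ε (mixedPoint θ (symbolPos i)) : ℝ) : ℂ) =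
        P * ((propDensity θ μ₀ ε 0 : ℝ) : ℂ) *
          (((lam + lam' + lam * c) * massTerm θ φ : ℝ) : ℂ) +
        P * (∑' i, x i * (((if symbolPos i = 0 then 0 else
          propDensity θ μ₀ ε (mixedPoint θ (symbolPos i)) : ℝ)) : ℂ)) := by
      have e1 : Summable fun i => x i * (((if symbolPos i = 0 then 0 else
          propDensity θ μ₀ ε (mixedPoint θ (symbolPos i)) : ℝ)) : ℂ) := by
        refine Summable.of_norm_bounded (hxs.mul_right C) fun i => ?_
        rw [norm_mul]
        refine mul_le_mul_of_nonneg_left ?_ (norm_nonneg _)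
        rw [Complex.norm_real]
        by_cases h0 : symbolPos i = 0
        · simp [h0, hC0]
        · simp only [h0, if_false]
          rw [Real.norm_of_nonneg (propDensity_nonneg _ _)]
          exact (hC ε hε.le i h0).2
      have e2 : Summable fun i => x i * (((if symbolPos i = 0 then 1 else 0 : ℝ)) : ℂ) := by
        refine Summable.of_norm_bounded hxs fun i => ?_
        split_ifs <;> simp
      rw [← hzero, ← tsum_mul_left, ← tsum_mul_left,
        ← (e2.mul_left _).tsum_add (e1.mul_left _)]
      refine tsum_congr fun i => ?_
      by_cases h0 : symbolPos i = 0
      · simp only [h0, if_true, mixedPoint_zero]; push_cast; ring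
      · simp only [h0, if_false]; push_cast; ring
    unfold oneLoop
    rw [h5, h6, Complex.add_re, ← Complex.ofReal_mul, ← Complex.ofReal_mul, Complex.ofReal_re,
      Complex.re_ofReal_mul]
    norm_num
    ring
  have hlim := (((Complex.continuous_re.tendsto _).comp hreg).const_mul P).add
    (hrank.const_mul lam')
  refine ⟨_, hlim.congr' ?_⟩
  filter_upwards [self_mem_nhdsWithin] with ε hε
  rw [hmain ε hε]
  simp only [Function.comp]
  ring

end

section

/-! ### The four-point function: reduction to the linear and antilinear parts -/

lemma summable_pair {ι E : Type*} [NormedAddCommGroup E] [CompleteSpace E] {D : ι → ℝ}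
    (hD : ∀ a, 0 ≤ D a) (hDs : Summable D) {F : ι × ι → E} {C : ℝ}
    (hF : ∀ p, ‖F p‖ ≤ D p.1 * D p.2 * C) : Summable F :=
  Summable.of_norm_bounded ((hDs.mul_of_nonneg hDs hD hD).mul_right C) hF

section

variable {ι : Type*} [DecidableEq ι]

/-- The effect of a rank one perturbation on the trace of `(D T)²`. -/
lemma tsum_pair_rankOne {D : ι → ℝ} {B : ℝ} (hD : ∀ a, 0 ≤ D a) (hB : ∀ a, |D a| ≤ B)
    (hDs : Summable D) (T : RealSeq ι →L[ℝ] RealSeq ι) (r : RealSeq ι) (s : ℝ) {K : ι → ι → ℝ}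
    (hK : ∀ a b, T (unitVec b) a = K a b + s * r a * r b) :
    Summable (fun p : ι × ι => D p.1 * D p.2 * (K p.1 p.2 * K p.2 p.1)) ∧
    ∑' p : ι × ι, D p.1 * D p.2 * (T (unitVec p.2) p.1 * T (unitVec p.1) p.2) =
      ∑' p : ι × ι, D p.1 * D p.2 * (K p.1 p.2 * K p.2 p.1) +
        (2 * s * inner ℝ (diagOp D r) (T (diagOp D r)) - s ^ 2 * inner ℝ r (diagOp D r) ^ 2) := by
  have hr : ∀ a, |r a| ≤ ‖r‖ := fun a => by
    have := sum_sq_le_norm r {a}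
    rw [Finset.sum_singleton] at this
    exact abs_le_of_sq_le_sq this (norm_nonneg _)
  have hy : ∀ a, diagOp D r a = D a * r a := diagOp_apply hB r
  have hDD : ∀ p : ι × ι, 0 ≤ D p.1 * D p.2 := fun p => mul_nonneg (hD _) (hD _)
  have s1 : Summable fun p : ι × ι =>
      diagOp D r p.1 * (T (unitVec p.2) p.1 * diagOp D r p.2) := by
    refine summable_pair hD hDs (C := ‖T‖ * (‖r‖ * ‖r‖)) fun p => ?_
    have e : diagOp D r p.1 * (T (unitVec p.2) p.1 * diagOp D r p.2) =
        D p.1 * D p.2 * (T (unitVec p.2) p.1 * (r p.1 * r p.2)) := by rw [hy, hy]; ring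
    rw [e, norm_mul, Real.norm_of_nonneg (hDD p), norm_mul, norm_mul]
    exact mul_le_mul_of_nonneg_left (mul_le_mul (abs_entry_le T _ _) (mul_le_mul (hr _) (hr _)
      (norm_nonneg _) (norm_nonneg _)) (by positivity) (norm_nonneg _)) (hDD p)
  have h1 : ∑' p : ι × ι, diagOp D r p.1 * (T (unitVec p.2) p.1 * diagOp D r p.2) =
      inner ℝ (diagOp D r) (T (diagOp D r)) := by
    refine (Summable.tsum_prod s1).trans ?_
    rw [← (hasSum_mul_inner (diagOp D r) (T (diagOp D r))).tsum_eq]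
    refine tsum_congr fun a => ?_
    rw [← (hasSum_apply T (diagOp D r) a).tsum_eq]
    exact tsum_mul_left (a := diagOp D r a)
      (f := fun b => T (unitVec b) a * diagOp D r b)
  have s2 := (Equiv.prodComm ι ι).summable_iff.2 s1
  have h2 := ((Equiv.prodComm ι ι).tsum_eq fun p : ι × ι =>
    diagOp D r p.1 * (T (unitVec p.2) p.1 * diagOp D r p.2)).trans h1
  have s3 : Summable fun p : ι × ι => (r p.1 * diagOp D r p.1) * (r p.2 * diagOp D r p.2) := by
    refine summable_pair hD hDs (C := ‖r‖ * ‖r‖ * (‖r‖ * ‖r‖)) fun p => ?_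
    have e : (r p.1 * diagOp D r p.1) * (r p.2 * diagOp D r p.2) =
        D p.1 * D p.2 * ((r p.1 * r p.1) * (r p.2 * r p.2)) := by rw [hy, hy]; ring
    rw [e, norm_mul, Real.norm_of_nonneg (hDD p), norm_mul, norm_mul, norm_mul]
    exact mul_le_mul_of_nonneg_left (mul_le_mul (mul_le_mul (hr _) (hr _) (norm_nonneg _)
      (norm_nonneg _)) (mul_le_mul (hr _) (hr _) (norm_nonneg _) (norm_nonneg _)) (by positivity)
      (by positivity)) (hDD p)
  have h3 : ∑' p : ι × ι, (r p.1 * diagOp D r p.1) * (r p.2 * diagOp D r p.2) =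
      inner ℝ r (diagOp D r) ^ 2 := by
    refine (Summable.tsum_prod s3).trans ?_
    rw [sq, ← (hasSum_mul_inner r (diagOp D r)).tsum_eq]
    refine (tsum_congr fun a => ?_).trans (tsum_mul_right (a := ∑' b, r b * diagOp D r b)
      (f := fun a => r a * diagOp D r a))
    exact tsum_mul_left (a := r a * diagOp D r a) (f := fun b => r b * diagOp D r b)
  have s0 : Summable fun p : ι × ι =>
      D p.1 * D p.2 * (T (unitVec p.2) p.1 * T (unitVec p.1) p.2) := by
    refine summable_pair hD hDs (C := ‖T‖ * ‖T‖) fun p => ?_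
    rw [norm_mul, Real.norm_of_nonneg (hDD p), norm_mul]
    exact mul_le_mul_of_nonneg_left (mul_le_mul (abs_entry_le T _ _) (abs_entry_le T _ _)
      (norm_nonneg _) (norm_nonneg _)) (hDD p)
  have hsum := ((s0.hasSum.sub (s1.hasSum.mul_left s)).sub (s2.hasSum.mul_left s)).add
    (s3.hasSum.mul_left (s ^ 2))
  -- the matrix is the full operator minus the rank one term
  have he : (fun p : ι × ι => D p.1 * D p.2 * (T (unitVec p.2) p.1 * T (unitVec p.1) p.2) -
      s * (diagOp D r p.1 * (T (unitVec p.2) p.1 * diagOp D r p.2)) -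
      s * ((fun p : ι × ι => diagOp D r p.1 * (T (unitVec p.2) p.1 * diagOp D r p.2)) ∘
        (Equiv.prodComm ι ι)) p +
      s ^ 2 * ((r p.1 * diagOp D r p.1) * (r p.2 * diagOp D r p.2))) =
      fun p : ι × ι => D p.1 * D p.2 * (K p.1 p.2 * K p.2 p.1) := by
    funext p
    simp only [Function.comp, Equiv.prodComm_apply, Prod.fst_swap, Prod.snd_swap]
    rw [hK p.1 p.2, hK p.2 p.1, hy, hy]
    ring
  rw [he] at hsum
  refine ⟨hsum.summable, ?_⟩
  rw [hsum.tsum_eq, h1, h3]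
  have h2' : ∑' p, ((fun p : ι × ι => diagOp D r p.1 * (T (unitVec p.2) p.1 * diagOp D r p.2)) ∘
        (Equiv.prodComm ι ι)) p = inner ℝ (diagOp D r) (T (diagOp D r)) := h2
  rw [h2']
  ring

end

variable {θ : ℝ} {f g h φ k ψ : (Fin 2 → ℂ) → ℂ}

lemma Smooth.exists_norm_linMat_le (hθ : 0 < θ) (lam lam' : ℝ) (hφ : Smooth θ φ) :
    ∃ C : ℝ, ∀ m n, ‖linMat θ lam lam' φ m n‖ ≤ C := by
  obtain ⟨c, hc⟩ := exists_janssen hθ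
  refine ⟨∑' i, ‖symbolCoef θ lam lam' c φ i‖, fun m n => ?_⟩
  have h1 := hφ.hasSum_hessLin hθ lam lam' hc (smooth_fockBasis hθ m) (smooth_fockBasis hθ n)
  rw [linMat, ← h1.tsum_eq]
  refine tsum_of_norm_bounded (hφ.summable_norm_symbolCoef hθ lam lam' c).hasSum fun i => ?_
  rw [norm_mul]
  refine mul_le_of_le_one_right (norm_nonneg _) ?_
  have := (smooth_fockBasis hθ m).norm_inner_weyl_le (smooth_fockBasis hθ n)
    (mixedPoint θ (symbolPos i))
  rwa [norm_vec_fockBasis hθ, norm_vec_fockBasis hθ, one_mul] at this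

lemma Smooth.exists_tsum_latCoef_fock_le (hθ : 0 < θ) (hφ : Smooth θ φ) : ∃ C : ℝ, 0 ≤ C ∧
    ∀ n, ∑' γ, ‖latCoef θ (fockBasis θ n) φ γ‖ ^ 2 ≤ C ^ 2 := by
  obtain ⟨C, hC0, hC⟩ := hφ.exists_tsum_latCoef_sq_le hθ
  refine ⟨C, hC0, fun n => ?_⟩
  have := hC _ (smooth_fockBasis hθ n)
  rwa [norm_vec_fockBasis hθ, mul_one] at this

lemma Smooth.exists_norm_antiMat_le (hθ : 0 < θ) (lam : ℝ) (hφ : Smooth θ φ) :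
    ∃ C : ℝ, ∀ m n, ‖antiMat θ lam φ m n‖ ≤ C := by
  obtain ⟨C, hC0, hC⟩ := hφ.exists_tsum_latCoef_fock_le hθ
  refine ⟨|lam| * (C * C), fun m n => ?_⟩
  rw [antiMat, hessAnti, norm_mul, Complex.norm_real, Real.norm_eq_abs]
  refine mul_le_mul_of_nonneg_left ?_ (abs_nonneg _)
  refine norm_tsum_mul_le ((smooth_fockBasis hθ m).summable_latCoef hθ hφ)
    (summable_norm_neg ((smooth_fockBasis hθ n).summable_latCoef hθ hφ)) hC0 hC0 (hC m) ?_
  exact ((Equiv.neg (Fin 2 → ℤ × ℤ)).tsum_eq fun γ =>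
    ‖latCoef θ (fockBasis θ n) φ γ‖ ^ 2).trans_le (hC n)

lemma Smooth.summable_propagator_linMat_sq (hθ : 0 < θ) (μ₀ lam lam' : ℝ) {ε : ℝ} (hε : 0 < ε)
    (hφ : Smooth θ φ) : Summable fun p : (Fin 2 → ℕ) × (Fin 2 → ℕ) =>
      (propagator θ μ₀ ε p.1 * propagator θ μ₀ ε p.2 : ℂ) *
        (linMat θ lam lam' φ p.1 p.2 * linMat θ lam lam' φ p.2 p.1) := by
  obtain ⟨C, hC⟩ := hφ.exists_norm_linMat_le hθ lam lam'
  refine summable_pair (D := propagator θ μ₀ ε) (fun n => (propagator_pos hθ ε n).le)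
    (summable_propagator hθ hε) (C := C * C) fun p => ?_
  rw [norm_mul, norm_mul, norm_mul, Complex.norm_real, Complex.norm_real,
    Real.norm_of_nonneg (propagator_pos hθ ε p.1).le,
    Real.norm_of_nonneg (propagator_pos hθ ε p.2).le]
  exact mul_le_mul_of_nonneg_left (mul_le_mul (hC _ _) (hC _ _) (norm_nonneg _)
    ((norm_nonneg _).trans (hC 0 0)))
    (mul_nonneg (propagator_pos hθ ε p.1).le (propagator_pos hθ ε p.2).le)

lemma Smooth.summable_propagator_antiMat_sq (hθ : 0 < θ) (μ₀ lam : ℝ) {ε : ℝ} (hε : 0 < ε)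
    (hφ : Smooth θ φ) : Summable fun p : (Fin 2 → ℕ) × (Fin 2 → ℕ) =>
      (propagator θ μ₀ ε p.1 * propagator θ μ₀ ε p.2 : ℂ) *
        (antiMat θ lam φ p.1 p.2 * conj (antiMat θ lam φ p.2 p.1)) := by
  obtain ⟨C, hC⟩ := hφ.exists_norm_antiMat_le hθ lam
  refine summable_pair (D := propagator θ μ₀ ε) (fun n => (propagator_pos hθ ε n).le)
    (summable_propagator hθ hε) (C := C * C) fun p => ?_
  rw [norm_mul, norm_mul, norm_mul, Complex.norm_real, Complex.norm_real, RCLike.norm_conj,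
    Real.norm_of_nonneg (propagator_pos hθ ε p.1).le,
    Real.norm_of_nonneg (propagator_pos hθ ε p.2).le]
  exact mul_le_mul_of_nonneg_left (mul_le_mul (hC _ _) (hC _ _) (norm_nonneg _)
    ((norm_nonneg _).trans (hC 0 0)))
    (mul_nonneg (propagator_pos hθ ε p.1).le (propagator_pos hθ ε p.2).le)

/-- In the sum over the real and imaginary directions the products of the linear with the
antilinear part cancel. -/
lemma tsum_mainMat_eq {μ₀ lam lam' ε : ℝ} (hθ : 0 < θ) (hε : 0 < ε) (hφ : Smooth θ φ)
    (hs : Summable fun p : ((Fin 2 → ℕ) × Bool) × ((Fin 2 → ℕ) × Bool) =>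
      propagator θ μ₀ ε p.1.1 * propagator θ μ₀ ε p.2.1 *
        (mainMat θ lam lam' φ p.1 p.2 * mainMat θ lam lam' φ p.2 p.1)) :
    ∑' p : ((Fin 2 → ℕ) × Bool) × ((Fin 2 → ℕ) × Bool),
      propagator θ μ₀ ε p.1.1 * propagator θ μ₀ ε p.2.1 *
        (mainMat θ lam lam' φ p.1 p.2 * mainMat θ lam lam' φ p.2 p.1) =
    2 * (∑' p : (Fin 2 → ℕ) × (Fin 2 → ℕ), (propagator θ μ₀ ε p.1 * propagator θ μ₀ ε p.2 : ℂ) *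
        (linMat θ lam lam' φ p.1 p.2 * linMat θ lam lam' φ p.2 p.1)).re +
    2 * (∑' p : (Fin 2 → ℕ) × (Fin 2 → ℕ), (propagator θ μ₀ ε p.1 * propagator θ μ₀ ε p.2 : ℂ) *
        (antiMat θ lam φ p.1 p.2 * conj (antiMat θ lam φ p.2 p.1))).re := by
  have h1 := Complex.hasSum_re (hφ.summable_propagator_linMat_sq hθ μ₀ lam lam' hε).hasSum
  have h2 := Complex.hasSum_re (hφ.summable_propagator_antiMat_sq hθ μ₀ lam hε).hasSum
  have h3 := ((h1.mul_left 2).add (h2.mul_left 2)).tsum_eq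
  rw [← h3]
  rw [← (Equiv.prodProdProdComm (Fin 2 → ℕ) Bool (Fin 2 → ℕ) Bool).symm.summable_iff] at hs
  rw [← (Equiv.prodProdProdComm (Fin 2 → ℕ) Bool (Fin 2 → ℕ) Bool).symm.tsum_eq]
  refine (Summable.tsum_prod hs).trans (tsum_congr fun p => ?_)
  obtain ⟨m, n⟩ := p
  rw [tsum_fintype, Fintype.sum_prod_type]
  simp only [Fintype.sum_bool, Function.comp, Equiv.prodProdProdComm_symm,
    Equiv.prodProdProdComm_apply, mainMat, Bool.false_eq_true, if_true, if_false, one_mul, mul_one,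
    Complex.mul_re, Complex.mul_im, Complex.conj_re, Complex.conj_im,
    Complex.I_re, Complex.I_im, Complex.one_re, Complex.one_im,
    Complex.ofReal_re, Complex.ofReal_im]
  ring

/-- The propagator as a diagonal matrix in the real basis. -/
noncomputable def realProp (θ μ₀ ε : ℝ) (a : (Fin 2 → ℕ) × Bool) : ℝ := propagator θ μ₀ ε a.1

lemma realProp_nonneg (hθ : 0 < θ) (μ₀ ε : ℝ) (a : (Fin 2 → ℕ) × Bool) :
    0 ≤ realProp θ μ₀ ε a := (propagator_pos hθ ε a.1).le

lemma abs_realProp_le (hθ : 0 < θ) (μ₀ : ℝ) {ε : ℝ} (hε : 0 ≤ ε) (a : (Fin 2 → ℕ) × Bool) :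
    |realProp θ μ₀ ε a| ≤ (2 * freq θ)⁻¹ := by
  rw [abs_of_nonneg (realProp_nonneg hθ μ₀ ε a)]
  exact propagator_le_const hθ hε a.1

lemma summable_realProp (hθ : 0 < θ) (μ₀ : ℝ) {ε : ℝ} (hε : 0 < ε) :
    Summable (realProp θ μ₀ ε) :=
  summable_prod_bool (summable_propagator hθ hε) fun n => (propagator_pos hθ ε n).le

lemma tendsto_diagOp_realProp (hθ : 0 < θ) (μ₀ : ℝ) (r : RealSeq ((Fin 2 → ℕ) × Bool)) :
    Tendsto (fun ε => diagOp (realProp θ μ₀ ε) r) (𝓝[>] 0) (𝓝 (diagOp (realProp θ μ₀ 0) r)) :=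
  tendsto_diagOp (abs_realProp_le hθ μ₀ le_rfl)
    (by filter_upwards [self_mem_nhdsWithin] with ε hε using abs_realProp_le hθ μ₀ (le_of_lt hε))
    (fun a => tendsto_propagator hθ a.1) r

lemma Smooth.tsum_loopSummand_two (hθ : 0 < θ) (μ₀ lam lam' ε : ℝ) (hφ : Smooth θ φ) :
    ∑' a, loopSummand θ μ₀ lam lam' ε φ 2 a =
      ∑' p : ((Fin 2 → ℕ) × Bool) × ((Fin 2 → ℕ) × Bool), realProp θ μ₀ ε p.1 *
        realProp θ μ₀ ε p.2 * (hessMat θ lam lam' φ p.1 p.2 * hessMat θ lam lam' φ p.2 p.1) := by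
  rw [← (finTwoArrowEquiv ((Fin 2 → ℕ) × Bool)).symm.tsum_eq]
  refine tsum_congr fun p => ?_
  have e0 : (finTwoArrowEquiv ((Fin 2 → ℕ) × Bool)).symm p 0 = p.1 := rfl
  have e1 : (finTwoArrowEquiv ((Fin 2 → ℕ) × Bool)).symm p 1 = p.2 := rfl
  have f0 : finRotate 2 0 = 1 := rfl
  have f1 : finRotate 2 1 = 0 := rfl
  rw [hφ.loopSummand_eq hθ, Fin.prod_univ_two, f0, f1, e0, e1, realProp, realProp]
  ring

lemma summable_realCoord_sq (hθ : 0 < θ) (hφ : Smooth θ φ) :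
    Summable fun a => realCoord θ φ a ^ 2 := by
  have h0 := summable_norm_inner_fockBasis_sq hθ hφ
  refine (summable_prod_of_nonneg fun a => sq_nonneg _).2
    ⟨fun n => (hasSum_fintype _).summable, h0.congr fun n => ?_⟩
  rw [tsum_fintype, Fintype.sum_bool, realCoord_true, realCoord_false,
    ← Complex.normSq_eq_norm_sq, Complex.normSq_apply]
  ring

/-- The rank one part of the second variation contributes a convergent term to the four-point
function. -/
lemma Smooth.exists_oneLoop_two_eq (hθ : 0 < θ) (μ₀ lam lam' : ℝ) (hφ : Smooth θ φ) :
    ∃ R : ℝ → ℝ, (∃ L, Tendsto R (𝓝[>] 0) (𝓝 L)) ∧ ∀ ε, 0 < ε →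
      oneLoop θ μ₀ lam lam' ε 2 φ = -(1 / 4) * (
        2 * (∑' p : (Fin 2 → ℕ) × (Fin 2 → ℕ),
          (propagator θ μ₀ ε p.1 * propagator θ μ₀ ε p.2 : ℂ) *
          (linMat θ lam lam' φ p.1 p.2 * linMat θ lam lam' φ p.2 p.1)).re +
        2 * (∑' p : (Fin 2 → ℕ) × (Fin 2 → ℕ),
          (propagator θ μ₀ ε p.1 * propagator θ μ₀ ε p.2 : ℂ) *
          (antiMat θ lam φ p.1 p.2 * conj (antiMat θ lam φ p.2 p.1))).re + R ε) := by
  obtain ⟨T, hT⟩ := hφ.exists_hessOp hθ lam lam'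
  have hr0 := summable_realCoord_sq hθ hφ
  obtain ⟨r, hr⟩ : ∃ r : RealSeq ((Fin 2 → ℕ) × Bool), ∀ a, r a = realCoord θ φ a :=
    ⟨⟨realCoord θ φ, memℓp_of_sum_le (C := ∑' a, realCoord θ φ a ^ 2) fun s =>
      hr0.sum_le_tsum s fun a _ => sq_nonneg _⟩, fun a => rfl⟩
  have hlim := tendsto_diagOp_realProp hθ μ₀ r
  have hlim2 := (T.continuous.tendsto _).comp hlim
  have hlim3 := ((hlim.inner (𝕜 := ℝ) hlim2).const_mul (2 * (2 * lam'))).sub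
    ((((tendsto_const_nhds (x := r)).inner (𝕜 := ℝ) hlim).pow 2).const_mul ((2 * lam') ^ 2))
  refine ⟨_, ⟨_, hlim3⟩, fun ε hε => ?_⟩
  have hK : ∀ a b, T (unitVec b) a = mainMat θ lam lam' φ a b + 2 * lam' * r a * r b :=
    fun a b => by rw [hT, hessMat_eq, hr, hr]
  obtain ⟨h1, h2⟩ := tsum_pair_rankOne (realProp_nonneg hθ μ₀ ε) (abs_realProp_le hθ μ₀ hε.le)
    (summable_realProp hθ μ₀ hε) T r (2 * lam') hK
  simp only [hT] at h2
  have h4 := tsum_mainMat_eq hθ hε hφ h1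
  unfold oneLoop
  rw [hφ.tsum_loopSummand_two hθ, h2]
  refine (congrArg (fun x => 1 / 2 * ((-1) ^ (2 + 1) / ((2 : ℕ) : ℝ)) * (x + _)) h4).trans ?_
  simp only [Function.comp]
  norm_num

end

section

/-! ### The linear part of the four-point function -/

variable {θ μ₀ ε : ℝ} {f g h φ k ψ : (Fin 2 → ℂ) → ℂ}

/-- The phase in `W_v W_ξ W_w = weylPhase W_{v + ξ + w}`. -/
noncomputable def weylPhase (θ : ℝ) (v w ξ : Fin 2 → ℂ) : ℂ :=
  Complex.exp (Complex.I * ((sig θ ξ w + sig θ v (ξ + w) : ℝ) : ℂ))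

lemma continuous_sig (v : Fin 2 → ℂ) : Continuous fun ξ => sig θ v ξ := by
  unfold sig; fun_prop

lemma continuous_sig_left (v : Fin 2 → ℂ) : Continuous fun ξ => sig θ ξ v := by
  unfold sig; fun_prop

lemma continuous_weylPhase (v w : Fin 2 → ℂ) : Continuous (weylPhase θ v w) := by
  have h1 := continuous_sig_left (θ := θ) w
  have h2 : Continuous fun ξ => sig θ v (ξ + w) :=
    (continuous_sig v).comp (continuous_id.add continuous_const)
  unfold weylPhase
  fun_prop

lemma norm_weylPhase (v w ξ : Fin 2 → ℂ) : ‖weylPhase θ v w ξ‖ = 1 := norm_exp_I_mul _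

lemma weyl_weyl_weyl (v w ξ : Fin 2 → ℂ) (f : (Fin 2 → ℂ) → ℂ) :
    weyl θ v (weyl θ ξ (weyl θ w f)) =
      fun z => weylPhase θ v w ξ * weyl θ (ξ + (v + w)) f z := by
  rw [weyl_weyl ξ w, weyl_const_mul, weyl_weyl]
  funext z
  rw [← mul_assoc, ← Complex.exp_add, weylPhase, add_left_comm v ξ w]
  push_cast
  rw [mul_add]

lemma hasSum_propagator_weyl (hθ : 0 < θ) (hε : 0 < ε) (v w : Fin 2 → ℂ) (m : Fin 2 → ℕ) :
    HasSum (fun n => (propagator θ μ₀ ε n : ℂ) *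
      (bargmannInner θ (fockBasis θ m) (weyl θ v (fockBasis θ n)) *
        bargmannInner θ (fockBasis θ n) (weyl θ w (fockBasis θ m))))
      (∫ ξ, (propDensity θ μ₀ ε ξ : ℂ) * (weylPhase θ v w ξ *
        bargmannInner θ (fockBasis θ m) (weyl θ (ξ + (v + w)) (fockBasis θ m)))) := by
  have h := ((smooth_fockBasis hθ m).map_weyl (-v)).hasSum_propagator (μ₀ := μ₀) hθ hε
    ((smooth_fockBasis hθ m).map_weyl w)
  simp only [inner_weyl_left, neg_neg, weyl_weyl_weyl, inner_const_mul_right] at h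
  exact h

lemma norm_inner_fock_weyl_le (hθ : 0 < θ) (m n : Fin 2 → ℕ) (v : Fin 2 → ℂ) :
    ‖bargmannInner θ (fockBasis θ m) (weyl θ v (fockBasis θ n))‖ ≤ 1 := by
  have := (smooth_fockBasis hθ m).norm_inner_weyl_le (smooth_fockBasis hθ n) v
  rwa [norm_vec_fockBasis hθ, norm_vec_fockBasis hθ, one_mul] at this

/-- The trace of `D W_v D W_w`. -/
lemma hasSum_propagator_weyl_propagator_weyl (hθ : 0 < θ) (hε : 0 < ε) (v w : Fin 2 → ℂ) :
    HasSum (fun m => (propagator θ μ₀ ε m : ℂ) * ∫ ξ, (propDensity θ μ₀ ε ξ : ℂ) *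
      (weylPhase θ v w ξ *
        bargmannInner θ (fockBasis θ m) (weyl θ (ξ + (v + w)) (fockBasis θ m))))
      (((Real.pi / freq θ) ^ 2 : ℝ) * overlap θ μ₀ ε (v + w) (weylPhase θ v w)) := by
  set F : (Fin 2 → ℕ) → (Fin 2 → ℂ) → ℂ := fun m ξ => (propagator θ μ₀ ε m : ℂ) *
    ((propDensity θ μ₀ ε ξ : ℂ) * (weylPhase θ v w ξ *
      bargmannInner θ (fockBasis θ m) (weyl θ (ξ + (v + w)) (fockBasis θ m)))) with hF
  have hρ := integrable_propDensity (μ₀ := μ₀) hθ hε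
  have hρc := continuous_propDensity (μ₀ := μ₀) hθ hε
  have hbd : ∀ m ξ, ‖F m ξ‖ ≤ propagator θ μ₀ ε m * propDensity θ μ₀ ε ξ := fun m ξ => by
    rw [hF]
    simp only [norm_mul, norm_weylPhase, one_mul, Complex.norm_real]
    rw [Real.norm_of_nonneg (propagator_pos hθ ε m).le,
      Real.norm_of_nonneg (propDensity_nonneg _ _)]
    exact mul_le_mul_of_nonneg_left (mul_le_of_le_one_right (propDensity_nonneg _ _)
      (norm_inner_fock_weyl_le hθ m m _)) (propagator_pos hθ ε m).le
  have hFi : ∀ m, Integrable (F m) := fun m => by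
    have hc1 : Continuous fun ξ => bargmannInner θ (fockBasis θ m)
        (weyl θ (ξ + (v + w)) (fockBasis θ m)) :=
      ((smooth_fockBasis hθ m).continuous_inner_weyl (smooth_fockBasis hθ m)).comp
        (continuous_id.add continuous_const)
    have hc2 := continuous_weylPhase (θ := θ) v w
    refine (hρ.const_mul (propagator θ μ₀ ε m)).mono' ?_ (Eventually.of_forall (hbd m))
    refine Continuous.aestronglyMeasurable ?_
    rw [hF]
    exact continuous_const.mul ((Complex.continuous_ofReal.comp hρc).mul (hc2.mul hc1))
  have hS : Summable fun m => ∫ ξ, ‖F m ξ‖ := by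
    refine Summable.of_nonneg_of_le (fun m => integral_nonneg fun ξ => norm_nonneg _)
      (fun m => ?_) ((summable_propagator (μ₀ := μ₀) hθ hε).mul_right
        (∫ ξ, propDensity θ μ₀ ε ξ))
    rw [← integral_const_mul]
    exact integral_mono (hFi m).norm (hρ.const_mul _) (hbd m)
  have h1 := hasSum_integral_of_summable_integral_norm hFi hS
  have h2 : (fun m => ∫ ξ, F m ξ) = fun m => (propagator θ μ₀ ε m : ℂ) *
      ∫ ξ, (propDensity θ μ₀ ε ξ : ℂ) * (weylPhase θ v w ξ *
        bargmannInner θ (fockBasis θ m) (weyl θ (ξ + (v + w)) (fockBasis θ m))) := by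
    funext m
    rw [hF]
    exact integral_const_mul _ _
  rw [h2] at h1
  refine hasSum_of_eq h1 ?_
  rw [overlap, ← integral_const_mul]
  refine integral_congr_ae (Eventually.of_forall fun ξ => ?_)
  have h3 := (hasSum_trace_propagator (μ₀ := μ₀) hθ hε (ξ + (v + w))).mul_left
    ((propDensity θ μ₀ ε ξ : ℂ) * weylPhase θ v w ξ)
  have h4 : ∑' m, F m ξ = (propDensity θ μ₀ ε ξ : ℂ) * weylPhase θ v w ξ *
      (((Real.pi / freq θ) ^ 2 * propDensity θ μ₀ ε (ξ + (v + w)) : ℝ) : ℂ) := by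
    rw [← h3.tsum_eq]
    refine tsum_congr fun m => ?_
    simp only [hF]
    ring
  beta_reduce
  rw [h4]
  push_cast
  ring

/-- Each pair of Weyl operators in the linear part contributes one overlap of two propagator
densities. -/
lemma Smooth.tsum_linMat_eq (hθ : 0 < θ) (hε : 0 < ε) (lam lam' : ℝ) {c : ℝ}
    (hc : IsJanssenConst θ c) (hφ : Smooth θ φ) :
    ∑' p : (Fin 2 → ℕ) × (Fin 2 → ℕ), (propagator θ μ₀ ε p.1 * propagator θ μ₀ ε p.2 : ℂ) *
        (linMat θ lam lam' φ p.1 p.2 * linMat θ lam lam' φ p.2 p.1) =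
      ((Real.pi / freq θ) ^ 2 : ℝ) * ∑' q : SymbolIndex × SymbolIndex,
        symbolCoef θ lam lam' c φ q.1 * symbolCoef θ lam lam' c φ q.2 *
          overlap θ μ₀ ε (mixedPoint θ (symbolPos q.1) + mixedPoint θ (symbolPos q.2))
            (weylPhase θ (mixedPoint θ (symbolPos q.1)) (mixedPoint θ (symbolPos q.2))) := by
  set x := symbolCoef θ lam lam' c φ with hx
  have hxs : Summable fun i => ‖x i‖ := hφ.summable_norm_symbolCoef hθ lam lam' c
  set e := fun (m n : Fin 2 → ℕ) (i : SymbolIndex) => bargmannInner θ (fockBasis θ m)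
    (weyl θ (mixedPoint θ (symbolPos i)) (fockBasis θ n)) with he
  have he1 : ∀ m n i, ‖e m n i‖ ≤ 1 := fun m n i => norm_inner_fock_weyl_le hθ m n _
  have hlin : ∀ m n, HasSum (fun i => x i * e m n i) (linMat θ lam lam' φ m n) := fun m n =>
    hφ.hasSum_hessLin hθ lam lam' hc (smooth_fockBasis hθ m) (smooth_fockBasis hθ n)
  set D := propagator θ μ₀ ε with hD
  have hD0 : ∀ n, 0 ≤ D n := fun n => (propagator_pos hθ ε n).le
  have hDs : Summable D := summable_propagator hθ hε
  set G : ((Fin 2 → ℕ) × (Fin 2 → ℕ)) × (SymbolIndex × SymbolIndex) → ℂ := fun t =>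
    (D t.1.1 * D t.1.2 : ℂ) * ((x t.2.1 * e t.1.1 t.1.2 t.2.1) * (x t.2.2 * e t.1.2 t.1.1 t.2.2))
    with hG
  have hDD := hDs.mul_of_nonneg hDs hD0 hD0
  have hxx := hxs.mul_of_nonneg hxs (fun i => norm_nonneg _) (fun i => norm_nonneg _)
  -- absolute convergence, to exchange the sums over the basis and over the Weyl operators
  have hGs : Summable G := by
    refine Summable.of_norm_bounded (hDD.mul_of_nonneg hxx (fun p => mul_nonneg (hD0 _) (hD0 _))
      (fun q => by positivity)) fun t => ?_
    rw [hG]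
    simp only [norm_mul, Complex.norm_real]
    rw [Real.norm_of_nonneg (hD0 _), Real.norm_of_nonneg (hD0 _)]
    refine mul_le_mul_of_nonneg_left ?_ (mul_nonneg (hD0 _) (hD0 _))
    exact mul_le_mul (mul_le_of_le_one_right (norm_nonneg _) (he1 _ _ _))
      (mul_le_of_le_one_right (norm_nonneg _) (he1 _ _ _)) (by positivity) (norm_nonneg _)
  have h1 : ∑' t, G t = ∑' p : (Fin 2 → ℕ) × (Fin 2 → ℕ), (D p.1 * D p.2 : ℂ) *
      (linMat θ lam lam' φ p.1 p.2 * linMat θ lam lam' φ p.2 p.1) := by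
    refine (Summable.tsum_prod hGs).trans (tsum_congr fun p => ?_)
    have hs : Summable fun q : SymbolIndex × SymbolIndex =>
        (x q.1 * e p.1 p.2 q.1) * (x q.2 * e p.2 p.1 q.2) := by
      refine Summable.of_norm_bounded hxx fun q => ?_
      simp only [norm_mul]
      exact mul_le_mul (mul_le_of_le_one_right (norm_nonneg _) (he1 _ _ _))
        (mul_le_of_le_one_right (norm_nonneg _) (he1 _ _ _)) (by positivity) (norm_nonneg _)
    exact (((hlin p.1 p.2).mul (hlin p.2 p.1) hs).mul_left (D p.1 * D p.2 : ℂ)).tsum_eq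
  have h2 : ∑' t, G t = ∑' q : SymbolIndex × SymbolIndex, x q.1 * x q.2 *
      (((Real.pi / freq θ) ^ 2 : ℝ) * overlap θ μ₀ ε (mixedPoint θ (symbolPos q.1) +
        mixedPoint θ (symbolPos q.2)) (weylPhase θ (mixedPoint θ (symbolPos q.1))
          (mixedPoint θ (symbolPos q.2)))) := by
    rw [← (Equiv.prodComm _ _).tsum_eq G]
    have hs' := (Equiv.prodComm (SymbolIndex × SymbolIndex)
      ((Fin 2 → ℕ) × (Fin 2 → ℕ))).summable_iff.2 hGs
    refine (Summable.tsum_prod hs').trans (tsum_congr fun q => ?_)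
    set v := mixedPoint θ (symbolPos q.1)
    set w := mixedPoint θ (symbolPos q.2)
    have hs2 : Summable fun p : (Fin 2 → ℕ) × (Fin 2 → ℕ) => (D p.1 * D p.2 : ℂ) *
        (e p.1 p.2 q.1 * e p.2 p.1 q.2) := by
      refine Summable.of_norm_bounded hDD fun p => ?_
      simp only [norm_mul, Complex.norm_real]
      rw [Real.norm_of_nonneg (hD0 _), Real.norm_of_nonneg (hD0 _)]
      exact mul_le_of_le_one_right (mul_nonneg (hD0 _) (hD0 _))
        (mul_le_one₀ (he1 _ _ _) (norm_nonneg _) (he1 _ _ _))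
    have h3 : ∑' p : (Fin 2 → ℕ) × (Fin 2 → ℕ), (D p.1 * D p.2 : ℂ) *
        (e p.1 p.2 q.1 * e p.2 p.1 q.2) =
        ((Real.pi / freq θ) ^ 2 : ℝ) * overlap θ μ₀ ε (v + w) (weylPhase θ v w) := by
      rw [← (hasSum_propagator_weyl_propagator_weyl (μ₀ := μ₀) hθ hε v w).tsum_eq]
      refine (Summable.tsum_prod hs2).trans (tsum_congr fun m => ?_)
      rw [← ((hasSum_propagator_weyl (μ₀ := μ₀) hθ hε v w m).mul_left (D m : ℂ)).tsum_eq]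
      refine tsum_congr fun n => ?_
      simp only [he, hD]
      ring
    rw [← h3, ← tsum_mul_left]
    refine tsum_congr fun p => ?_
    simp only [hG, Function.comp, Equiv.prodComm_apply, Prod.fst_swap, Prod.snd_swap]
    ring
  rw [← h1, h2, ← tsum_mul_left]
  refine tsum_congr fun q => ?_
  ring

lemma abs_sig_le (hθ : 0 < θ) (u v : Fin 2 → ℂ) : |sig θ u v| ≤ 2 * freq θ * ‖u‖ * ‖v‖ := by
  have hω := freq_pos hθ
  unfold sig
  rw [abs_mul, abs_of_pos hω, Fin.sum_univ_two]
  have h : ∀ i, |(conj (u i) * v i).im| ≤ ‖u‖ * ‖v‖ := fun i => by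
    refine (Complex.abs_im_le_norm _).trans ?_
    rw [norm_mul, RCLike.norm_conj]
    exact mul_le_mul (norm_le_pi_norm u i) (norm_le_pi_norm v i) (norm_nonneg _) (norm_nonneg _)
  calc _ ≤ freq θ * (‖u‖ * ‖v‖ + ‖u‖ * ‖v‖) :=
        mul_le_mul_of_nonneg_left ((abs_add_le _ _).trans (add_le_add (h 0) (h 1))) hω.le
    _ = _ := by ring

/-- The phase attached to opposite positions is Lipschitz at coinciding points. -/
lemma norm_weylPhase_sub_le (hθ : 0 < θ) (v ξ : Fin 2 → ℂ) :
    ‖weylPhase θ v (-v) ξ - weylPhase θ v (-v) 0‖ ≤ 4 * freq θ * ‖v‖ * ‖ξ‖ := by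
  have h1 : ∀ ξ, sig θ ξ (-v) + sig θ v (ξ + -v) = 2 * sig θ v ξ := fun ξ => by
    rw [sig_add_right, sig_neg_right, sig_neg_right, sig_self, sig_symm ξ v]; ring
  have h2 : sig θ v 0 = 0 := by simp [sig]
  unfold weylPhase
  rw [h1, h1, h2, mul_zero, Complex.ofReal_zero, mul_zero, Complex.exp_zero]
  refine (Real.norm_exp_I_mul_ofReal_sub_one_le).trans ?_
  rw [Real.norm_eq_abs, abs_mul, abs_two]
  have := abs_sig_le hθ v ξ
  linarith

lemma weylPhase_neg_zero (v : Fin 2 → ℂ) : weylPhase θ v (-v) 0 = 1 := by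
  have h : sig θ 0 (-v) = 0 := by simp [sig]
  rw [weylPhase, zero_add, sig_neg_right v v, sig_self, h]
  simp

lemma exists_norm_latticePoint_le (θ : ℝ) : ∃ C : ℝ, 0 ≤ C ∧ ∀ γ : Fin 2 → ℤ × ℤ,
    ‖latticePoint θ γ‖ ≤ C * ‖γ‖ := by
  refine ⟨|θ / √2| * 2, by positivity, fun γ => ?_⟩
  refine (pi_norm_le_iff_of_nonneg (by positivity)).2 fun i => ?_
  rw [latticePoint, norm_mul, Complex.norm_real, Real.norm_eq_abs, mul_assoc]
  refine mul_le_mul_of_nonneg_left ?_ (abs_nonneg _)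
  refine (norm_add_le _ _).trans ?_
  rw [norm_mul, Complex.norm_I, mul_one, Complex.norm_intCast, Complex.norm_intCast,
    ← Int.norm_eq_abs, ← Int.norm_eq_abs]
  have h1 := (norm_fst_le (γ i)).trans (norm_le_pi_norm γ i)
  have h2 := (norm_snd_le (γ i)).trans (norm_le_pi_norm γ i)
  linarith

lemma exists_norm_symbolPos_le (θ : ℝ) : ∃ C : ℝ, 0 ≤ C ∧ ∀ i : SymbolIndex,
    ‖mixedPoint θ (symbolPos i)‖ ≤ C * (1 + ‖symbolPos i‖) := by
  obtain ⟨C, hC0, hC⟩ := exists_norm_latticePoint_le θ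
  obtain ⟨C', hC0', hC'⟩ := exists_norm_latticePoint_le 1
  refine ⟨C + C', by positivity, fun i => ?_⟩
  have h1 : ‖(symbolPos i).1‖ ≤ ‖symbolPos i‖ := norm_fst_le _
  have h2 : ‖(symbolPos i).2‖ ≤ ‖symbolPos i‖ := norm_snd_le _
  have h3 : ‖dualPoint (symbolPos i).2‖ ≤ C' * ‖(symbolPos i).2‖ := hC' _
  calc _ ≤ C * ‖(symbolPos i).1‖ + C' * ‖(symbolPos i).2‖ :=
        (norm_add_le _ _).trans (add_le_add (hC _) h3)
    _ ≤ C * ‖symbolPos i‖ + C' * ‖symbolPos i‖ := by gcongr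
    _ ≤ _ := by nlinarith

/-- The divergent part of the overlap of two propagators joined by Weyl operators. -/
noncomputable def overlapDiv (θ μ₀ ε : ℝ) (q : SymbolIndex × SymbolIndex) : ℂ :=
  if symbolPos q.1 + symbolPos q.2 = 0 then (selfOverlap θ μ₀ ε : ℂ) else 0

/-- The overlaps of propagators joined by two Weyl operators diverge only if the positions of the
operators cancel. By the weak Diophantine condition, the others are bounded with
a linear weight. -/
lemma IsWeakDiophantine.exists_overlap_le (hd : IsWeakDiophantine θ) (hθ : 0 < θ) (μ₀ : ℝ) :
    ∃ C : ℝ, 0 ≤ C ∧ ∀ q : SymbolIndex × SymbolIndex,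
      (∀ ε, 0 < ε → ‖overlap θ μ₀ ε (mixedPoint θ (symbolPos q.1) + mixedPoint θ (symbolPos q.2))
            (weylPhase θ (mixedPoint θ (symbolPos q.1)) (mixedPoint θ (symbolPos q.2))) -
          overlapDiv θ μ₀ ε q‖ ≤ C * ((1 + ‖symbolPos q.1‖) * (1 + ‖symbolPos q.2‖))) ∧
      ∃ l, Tendsto (fun ε => overlap θ μ₀ ε (mixedPoint θ (symbolPos q.1) +
          mixedPoint θ (symbolPos q.2))
            (weylPhase θ (mixedPoint θ (symbolPos q.1)) (mixedPoint θ (symbolPos q.2))) -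
          overlapDiv θ μ₀ ε q) (𝓝[>] 0) (𝓝 l) := by
  have hω := freq_pos hθ
  obtain ⟨C₁, hC₁0, hC₁⟩ := exists_norm_overlap_le (μ₀ := μ₀) hθ 0
  obtain ⟨C₂, hC₂0, hC₂⟩ := exists_norm_overlap_zero_le (μ₀ := μ₀) hθ
  obtain ⟨C₃, hC₃0, hC₃⟩ := hd.exists_log_le
  obtain ⟨C₄, hC₄0, hC₄⟩ := exists_norm_symbolPos_le θ
  refine ⟨C₁ * C₃ + C₂ * (4 * freq θ * C₄), by positivity, fun q => ?_⟩
  set v := mixedPoint θ (symbolPos q.1) with hv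
  set w := mixedPoint θ (symbolPos q.2) with hw
  have hvw : v + w = mixedPoint θ (symbolPos q.1 + symbolPos q.2) := (mixedPoint_add _ _).symm
  have hn1 : 0 ≤ ‖symbolPos q.1‖ := norm_nonneg _
  have hn2 : 0 ≤ ‖symbolPos q.2‖ := norm_nonneg _
  have hcont := continuous_weylPhase (θ := θ) v w
  by_cases h0 : symbolPos q.1 + symbolPos q.2 = 0
  · have hvw0 : v + w = 0 := by rw [hvw, h0, mixedPoint_zero]
    have hwv : w = -v := (neg_eq_of_add_eq_zero_right hvw0).symm
    have hA : ∀ ξ, ‖weylPhase θ v w ξ - weylPhase θ v w 0‖ ≤ 4 * freq θ * ‖v‖ * ‖ξ‖ := fun ξ => by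
      rw [hwv]; exact norm_weylPhase_sub_le hθ v ξ
    obtain ⟨h1, h2⟩ := hC₂ _ _ hcont hA
    have h3 : weylPhase θ v w 0 = 1 := by rw [hwv]; exact weylPhase_neg_zero v
    rw [h3] at h1 h2
    simp only [mul_one] at h1 h2
    simp only [overlapDiv, h0, if_true, hvw0]
    refine ⟨fun ε hε => (h1 ε hε).trans ?_, h2⟩
    have h4 : ‖v‖ ≤ C₄ * ((1 + ‖symbolPos q.1‖) * (1 + ‖symbolPos q.2‖)) := by
      refine (hC₄ q.1).trans (mul_le_mul_of_nonneg_left ?_ hC₄0)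
      nlinarith
    calc C₂ * (4 * freq θ * ‖v‖) ≤ C₂ * (4 * freq θ *
          (C₄ * ((1 + ‖symbolPos q.1‖) * (1 + ‖symbolPos q.2‖)))) := by gcongr
      _ ≤ C₁ * C₃ * ((1 + ‖symbolPos q.1‖) * (1 + ‖symbolPos q.2‖)) + C₂ * (4 * freq θ *
          (C₄ * ((1 + ‖symbolPos q.1‖) * (1 + ‖symbolPos q.2‖)))) :=
          le_add_of_nonneg_left (by positivity)
      _ = _ := by ring
  · have hvw0 : v + w ≠ 0 := by rw [hvw]; exact hd.mixedPoint_ne_zero h0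
    have hA : ∀ ξ, ‖weylPhase θ v w ξ‖ ≤ 1 * (1 + ‖ξ‖) ^ 0 := fun ξ => by
      rw [norm_weylPhase]; simp
    simp only [overlapDiv, h0, if_false, sub_zero]
    refine ⟨fun ε hε => ?_, _, tendsto_overlap hθ hvw0 hcont zero_le_one hA⟩
    refine (hC₁ ε hε.le _ hvw0 _ _ zero_le_one hA).trans ?_
    have h4 := hC₃ _ h0
    rw [← hvw] at h4
    have h5 : ‖(symbolPos q.1 + symbolPos q.2).1‖ ≤ ‖symbolPos q.1‖ + ‖symbolPos q.2‖ :=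
      (norm_fst_le _).trans (norm_add_le _ _)
    have h6 : 1 + ‖(symbolPos q.1 + symbolPos q.2).1‖ ≤
        (1 + ‖symbolPos q.1‖) * (1 + ‖symbolPos q.2‖) := by nlinarith
    calc C₁ * 1 * (1 + Real.log (1 + 4 / ‖v + w‖ ^ 2)) ≤
          C₁ * 1 * (C₃ * ((1 + ‖symbolPos q.1‖) * (1 + ‖symbolPos q.2‖))) := by
            gcongr; exact h4.trans (mul_le_mul_of_nonneg_left h6 hC₃0)
      _ ≤ C₁ * 1 * (C₃ * ((1 + ‖symbolPos q.1‖) * (1 + ‖symbolPos q.2‖))) + C₂ * (4 * freq θ *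
          (C₄ * ((1 + ‖symbolPos q.1‖) * (1 + ‖symbolPos q.2‖)))) :=
          le_add_of_nonneg_right (by positivity)
      _ = _ := by ring

/-- The linear part of the four-point function diverges like the self-overlap of the propagator
density. -/
lemma Smooth.exists_tendsto_linPart (hd : IsWeakDiophantine θ) (hθ : 0 < θ) (μ₀ lam lam' : ℝ) {c : ℝ}
    (hc : IsJanssenConst θ c) (hφ : Smooth θ φ) : ∃ L, Tendsto (fun ε =>
      ∑' p : (Fin 2 → ℕ) × (Fin 2 → ℕ), (propagator θ μ₀ ε p.1 * propagator θ μ₀ ε p.2 : ℂ) *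
        (linMat θ lam lam' φ p.1 p.2 * linMat θ lam lam' φ p.2 p.1) -
      ((Real.pi / freq θ) ^ 2 : ℝ) * (selfOverlap θ μ₀ ε * ∑' q : SymbolIndex × SymbolIndex,
        if symbolPos q.1 + symbolPos q.2 = 0 then
          symbolCoef θ lam lam' c φ q.1 * symbolCoef θ lam lam' c φ q.2 else 0))
      (𝓝[>] 0) (𝓝 L) := by
  obtain ⟨C, hC0, hC⟩ := hd.exists_overlap_le hθ μ₀
  choose hC l hl using hC
  set x := symbolCoef θ lam lam' c φ with hx
  set A : ℝ → SymbolIndex × SymbolIndex → ℂ := fun ε q =>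
    overlap θ μ₀ ε (mixedPoint θ (symbolPos q.1) + mixedPoint θ (symbolPos q.2))
      (weylPhase θ (mixedPoint θ (symbolPos q.1)) (mixedPoint θ (symbolPos q.2))) with hA
  have hw := hφ.summable_symbolCoef hθ lam lam' c
  have hw0 : ∀ i, 0 ≤ ‖symbolCoef θ lam lam' c φ i‖ * (1 + ‖symbolPos i‖) := fun i =>
    mul_nonneg (norm_nonneg _) (by positivity)
  have hbs := (hw.mul_of_nonneg hw hw0 hw0).mul_left C
  rw [← hx] at hbs
  have hxs := hφ.summable_norm_symbolCoef hθ lam lam' c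
  have hxx := hxs.mul_of_nonneg hxs (fun i => norm_nonneg _) (fun i => norm_nonneg _)
  rw [← hx] at hxx
  have hbd : ∀ ε, 0 < ε → ∀ q, ‖x q.1 * x q.2 * (A ε q - overlapDiv θ μ₀ ε q)‖ ≤
      C * (‖x q.1‖ * (1 + ‖symbolPos q.1‖) * (‖x q.2‖ * (1 + ‖symbolPos q.2‖))) := by
    intro ε hε q
    rw [norm_mul, norm_mul]
    calc _ ≤ ‖x q.1‖ * ‖x q.2‖ * (C * ((1 + ‖symbolPos q.1‖) * (1 + ‖symbolPos q.2‖))) :=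
          mul_le_mul_of_nonneg_left (hC q ε hε) (by positivity)
      _ = _ := by ring
  have hlim : Tendsto (fun ε => ∑' q, x q.1 * x q.2 * (A ε q - overlapDiv θ μ₀ ε q)) (𝓝[>] 0)
      (𝓝 (∑' q : SymbolIndex × SymbolIndex, x q.1 * x q.2 * l q)) := by
    refine tendsto_tsum_of_dominated_convergence hbs (fun q => (hl q).const_mul _) ?_
    filter_upwards [self_mem_nhdsWithin] with ε hε q using hbd ε hε q
  refine ⟨_, (hlim.const_mul (((Real.pi / freq θ) ^ 2 : ℝ) : ℂ)).congr' ?_⟩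
  filter_upwards [self_mem_nhdsWithin] with ε hε
  rw [hφ.tsum_linMat_eq hθ hε lam lam' hc, ← mul_sub]
  congr 1
  have s1 : Summable fun q : SymbolIndex × SymbolIndex =>
      x q.1 * x q.2 * (A ε q - overlapDiv θ μ₀ ε q) := Summable.of_norm_bounded hbs (hbd ε hε)
  have s2 : Summable fun q : SymbolIndex × SymbolIndex =>
      if symbolPos q.1 + symbolPos q.2 = 0 then x q.1 * x q.2 else 0 := by
    refine Summable.of_norm_bounded hxx fun q => ?_
    split_ifs
    · exact (norm_mul _ _).le
    · rw [norm_zero]; positivity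
  have h3 := s1.hasSum.add (s2.hasSum.mul_left (selfOverlap θ μ₀ ε : ℂ))
  rw [eq_sub_iff_add_eq, ← h3.tsum_eq]
  refine tsum_congr fun q => ?_
  simp only [overlapDiv, hA]
  split_ifs <;> ring

end

section

/-! ### The divergent coefficient of the linear part -/

variable {θ μ₀ ε : ℝ} {f g h φ k ψ : (Fin 2 → ℂ) → ℂ}

lemma ofReal_massTerm (φ : (Fin 2 → ℂ) → ℂ) : ((massTerm θ φ : ℝ) : ℂ) = bargmannInner θ φ φ := by
  rw [massTerm_eq]
  exact Complex.ext (by simp) (by simp [bargmannInner_self_im])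

lemma symbolCoef_inl_neg (lam lam' c : ℝ) (φ : (Fin 2 → ℂ) → ℂ) (γ : Fin 2 → ℤ × ℤ) :
    symbolCoef θ lam lam' c φ (Sum.inl (-γ)) =
      lam * latCoef θ φ φ γ + if γ = 0 then lam' * bargmannInner θ φ φ else 0 := by
  simp [symbolCoef, latCoef_neg]

lemma symbolCoef_inr_neg (lam lam' c : ℝ) (φ : (Fin 2 → ℂ) → ℂ) (κ : Fin 2 → ℤ × ℤ) :
    symbolCoef θ lam lam' c φ (Sum.inr (-κ)) =
      lam * (c * bargmannInner θ φ (weyl θ (dualPoint κ) φ)) := by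
  simp [symbolCoef, dualPoint_neg, inner_weyl_left]

/-- For a given position, the weights of the opposite positions. -/
lemma tsum_symbol_opposite (x : SymbolIndex → ℂ) (i : SymbolIndex) :
    ∑' j, (if symbolPos i + symbolPos j = 0 then x i * x j else 0) =
      Sum.elim
        (fun γ => x (Sum.inl γ) * (x (Sum.inl (-γ)) + if γ = 0 then x (Sum.inr 0) else 0))
        (fun κ => x (Sum.inr κ) * (x (Sum.inr (-κ)) + if κ = 0 then x (Sum.inl 0) else 0)) i := by
  rcases i with γ | κ
  · have h1 : HasSum (fun γ' => if symbolPos (Sum.inl γ) + symbolPos (Sum.inl γ') = 0 then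
        x (Sum.inl γ) * x (Sum.inl γ') else 0) (x (Sum.inl γ) * x (Sum.inl (-γ))) := by
      have h := hasSum_ite_eq (-γ) (x (Sum.inl γ) * x (Sum.inl (-γ)))
      refine Eq.mpr (congrArg (fun F => HasSum F _) (funext fun γ' => ?_)) h
      by_cases e : γ' = -γ
      · rw [if_pos e, if_pos (by simp [symbolPos, e]), e]
      · rw [if_neg e, if_neg]
        intro h0
        have h0' : γ + γ' = 0 := congrArg Prod.fst h0
        exact e (neg_eq_of_add_eq_zero_right h0').symm
    have h2 : HasSum (fun κ => if symbolPos (Sum.inl γ) + symbolPos (Sum.inr κ) = 0 then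
        x (Sum.inl γ) * x (Sum.inr κ) else 0)
        (x (Sum.inl γ) * if γ = 0 then x (Sum.inr 0) else 0) := by
      have h := hasSum_ite_eq (0 : Fin 2 → ℤ × ℤ) (x (Sum.inl γ) * if γ = 0 then x (Sum.inr 0) else 0)
      refine Eq.mpr (congrArg (fun F => HasSum F _) (funext fun κ => ?_)) h
      by_cases e : κ = 0 <;> by_cases e' : γ = 0 <;> simp [symbolPos, e, e']
    have h3 := (HasSum.sum (f := fun j => if symbolPos (Sum.inl γ) + symbolPos j = 0 then
      x (Sum.inl γ) * x j else 0) h1 h2).tsum_eq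
    rw [Sum.elim_inl, mul_add]
    exact h3
  · have h1 : HasSum (fun γ => if symbolPos (Sum.inr κ) + symbolPos (Sum.inl γ) = 0 then
        x (Sum.inr κ) * x (Sum.inl γ) else 0)
        (x (Sum.inr κ) * if κ = 0 then x (Sum.inl 0) else 0) := by
      have h := hasSum_ite_eq (0 : Fin 2 → ℤ × ℤ) (x (Sum.inr κ) * if κ = 0 then x (Sum.inl 0) else 0)
      refine Eq.mpr (congrArg (fun F => HasSum F _) (funext fun γ => ?_)) h
      by_cases e : κ = 0 <;> by_cases e' : γ = 0 <;> simp [symbolPos, e, e']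
    have h2 : HasSum (fun κ' => if symbolPos (Sum.inr κ) + symbolPos (Sum.inr κ') = 0 then
        x (Sum.inr κ) * x (Sum.inr κ') else 0) (x (Sum.inr κ) * x (Sum.inr (-κ))) := by
      have h := hasSum_ite_eq (-κ) (x (Sum.inr κ) * x (Sum.inr (-κ)))
      refine Eq.mpr (congrArg (fun F => HasSum F _) (funext fun κ' => ?_)) h
      by_cases e : κ' = -κ
      · rw [if_pos e, if_pos (by simp [symbolPos, e]), e]
      · rw [if_neg e, if_neg]
        intro h0
        have h0' : κ + κ' = 0 := congrArg Prod.snd h0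
        exact e (neg_eq_of_add_eq_zero_right h0').symm
    have h3 := (HasSum.sum (f := fun j => if symbolPos (Sum.inr κ) + symbolPos j = 0 then
      x (Sum.inr κ) * x j else 0) h1 h2).tsum_eq
    rw [Sum.elim_inr, mul_add, add_comm]
    exact h3

/-- The divergent coefficient of the linear part is a combination of the quartic and the double
trace term. -/
lemma Smooth.tsum_symbolCoef_opposite (hθ : 0 < θ) (lam lam' : ℝ) {c : ℝ} (hc : IsJanssenConst θ c)
    (hφ : Smooth θ φ) :
    ∑' q : SymbolIndex × SymbolIndex, (if symbolPos q.1 + symbolPos q.2 = 0 then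
      symbolCoef θ lam lam' c φ q.1 * symbolCoef θ lam lam' c φ q.2 else 0) =
    ((lam ^ 2 * (1 + c) * quarticTerm θ φ + (2 * lam * lam' + lam' ^ 2 + 2 * lam * (lam + lam') * c) *
      doubleTraceTerm θ φ : ℝ) : ℂ) := by
  set x := symbolCoef θ lam lam' c φ with hx
  have hxs := hφ.summable_norm_symbolCoef hθ lam lam' c
  have hxx := hxs.mul_of_nonneg hxs (fun i => norm_nonneg _) (fun i => norm_nonneg _)
  rw [← hx] at hxx
  have s2 : Summable fun q : SymbolIndex × SymbolIndex =>
      if symbolPos q.1 + symbolPos q.2 = 0 then x q.1 * x q.2 else 0 := by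
    refine Summable.of_norm_bounded hxx fun q => ?_
    split_ifs
    · exact (norm_mul _ _).le
    · rw [norm_zero]; positivity
  set m := bargmannInner θ φ φ with hm
  have hA := summable_sq_of_norm (hφ.summable_latCoef hθ hφ)
  have hB0 := hφ.summable_inner_dual hφ
  have hB := summable_sq_of_norm hB0
  -- the lattice
  have g1 : HasSum (fun γ => x (Sum.inl γ) * (x (Sum.inl (-γ)) + if γ = 0 then x (Sum.inr 0) else 0))
      ((lam : ℂ) ^ 2 * ((∑' γ, ‖latCoef θ φ φ γ‖ ^ 2 : ℝ) : ℂ) +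
        m ^ 2 * (2 * lam * lam' + lam ^ 2 * c + lam' ^ 2 + lam * lam' * c)) := by
    have h1 := (Complex.hasSum_ofReal.2 hA.hasSum).mul_left ((lam : ℂ) ^ 2)
    have h2 := hasSum_ite_eq (0 : Fin 2 → ℤ × ℤ)
      (m ^ 2 * (2 * lam * lam' + lam ^ 2 * c + lam' ^ 2 + lam * lam' * c : ℂ))
    refine Eq.mpr (congrArg (fun F => HasSum F _) (funext fun γ => ?_)) (h1.add h2)
    rw [hx, symbolCoef_inl_neg]
    simp only [symbolCoef, Sum.elim_inl, Sum.elim_inr, dualPoint_zero, weyl_zero, ← hm]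
    push_cast
    rw [← Complex.conj_mul']
    by_cases e : γ = 0
    · have e1 : latCoef θ φ φ 0 = m := by rw [latCoef, latticePoint_zero, weyl_zero]
      have e2 : conj m = m := bargmannInner_conj φ φ
      simp only [e, if_true, e1, e2]
      ring
    · simp only [e, if_false]
      ring
  -- the dual lattice
  have g2 : HasSum (fun κ => x (Sum.inr κ) * (x (Sum.inr (-κ)) + if κ = 0 then x (Sum.inl 0) else 0))
      ((lam : ℂ) ^ 2 * c ^ 2 * ((∑' κ, ‖bargmannInner θ φ
        (weyl θ (dualPoint κ) φ)‖ ^ 2 : ℝ) : ℂ) +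
        m ^ 2 * (lam * c * (lam + lam'))) := by
    have h1 := (Complex.hasSum_ofReal.2 hB.hasSum).mul_left ((lam : ℂ) ^ 2 * c ^ 2)
    have h2 := hasSum_ite_eq (0 : Fin 2 → ℤ × ℤ) (m ^ 2 * (lam * c * (lam + lam') : ℂ))
    refine Eq.mpr (congrArg (fun F => HasSum F _) (funext fun κ => ?_)) (h1.add h2)
    rw [hx, symbolCoef_inr_neg]
    simp only [symbolCoef, Sum.elim_inl, Sum.elim_inr, ← hm]
    push_cast
    rw [← Complex.conj_mul', bargmannInner_conj]
    by_cases e : κ = 0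
    · have e2 : conj m = m := bargmannInner_conj φ φ
      simp only [e, if_true, dualPoint_zero, weyl_zero, ← hm, latCoef, latticePoint_zero, e2]
      ring
    · simp only [e, if_false]
      ring
  -- the Janssen representation turns the sum over the dual lattice into the quartic term
  have hQ := hc φ φ φ hφ hφ hφ
  have e1 : ∀ γ, bargmannInner θ φ (weyl θ (latticePoint θ γ) φ) *
      bargmannInner θ (weyl θ (latticePoint θ γ) φ) φ =
      ((‖latCoef θ φ φ γ‖ ^ 2 : ℝ) : ℂ) := fun γ => by
    rw [← bargmannInner_conj φ, Complex.mul_conj', latCoef]; push_cast; rfl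
  have e2 : ∀ κ, bargmannInner θ (weyl θ (dualPoint κ) φ) φ *
      bargmannInner θ φ (weyl θ (dualPoint κ) φ) =
      ((‖bargmannInner θ φ (weyl θ (dualPoint κ) φ)‖ ^ 2 : ℝ) : ℂ) := fun κ => by
    rw [← bargmannInner_conj φ, Complex.conj_mul']; push_cast; rfl
  rw [tsum_congr e1, tsum_congr e2, ← Complex.ofReal_tsum, ← Complex.ofReal_tsum] at hQ
  have hm' : m = ((massTerm θ φ : ℝ) : ℂ) := (ofReal_massTerm φ).symm
  have h := (HasSum.sum (f := Sum.elim
    (fun γ => x (Sum.inl γ) * (x (Sum.inl (-γ)) + if γ = 0 then x (Sum.inr 0) else 0))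
    (fun κ => x (Sum.inr κ) * (x (Sum.inr (-κ)) + if κ = 0 then x (Sum.inl 0) else 0)))
    g1 g2).tsum_eq
  refine (Summable.tsum_prod s2).trans ((tsum_congr fun i => tsum_symbol_opposite x i).trans
    (h.trans ?_))
  rw [quarticTerm_eq, doubleTraceTerm, hm']
  push_cast
  push_cast at hQ
  linear_combination (-((lam : ℂ) ^ 2 * c)) * hQ

end

section

/-! ### The antilinear part of the four-point function -/

variable {θ μ₀ ε : ℝ} {f g h φ k ψ : (Fin 2 → ℂ) → ℂ}

/-- The sesquilinear form of the regularized propagator. -/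
noncomputable def propForm (θ μ₀ ε : ℝ) (f g : (Fin 2 → ℂ) → ℂ) : ℂ :=
  ∫ η, (propDensity θ μ₀ ε η : ℂ) * bargmannInner θ f (weyl θ η g)

/-- The trace of the square of the antilinear part, as a double sum over the lattice. -/
lemma Smooth.tsum_antiMat_eq (hθ : 0 < θ) (hε : 0 < ε) (lam : ℝ) (hφ : Smooth θ φ) :
    (Summable fun q : (Fin 2 → ℤ × ℤ) × (Fin 2 → ℤ × ℤ) =>
      propForm θ μ₀ ε (weyl θ (latticePoint θ (-q.2)) φ)
        (weyl θ (latticePoint θ q.1) φ) *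
      propForm θ μ₀ ε (weyl θ (latticePoint θ q.2) φ)
        (weyl θ (latticePoint θ (-q.1)) φ)) ∧
    ∑' p : (Fin 2 → ℕ) × (Fin 2 → ℕ), (propagator θ μ₀ ε p.1 * propagator θ μ₀ ε p.2 : ℂ) *
        (antiMat θ lam φ p.1 p.2 * conj (antiMat θ lam φ p.2 p.1)) =
      (lam : ℂ) ^ 2 * ∑' q : (Fin 2 → ℤ × ℤ) × (Fin 2 → ℤ × ℤ),
        propForm θ μ₀ ε (weyl θ (latticePoint θ (-q.2)) φ)
          (weyl θ (latticePoint θ q.1) φ) *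
        propForm θ μ₀ ε (weyl θ (latticePoint θ q.2) φ)
          (weyl θ (latticePoint θ (-q.1)) φ) := by
  obtain ⟨C, hC0, hC⟩ := hφ.exists_tsum_latCoef_fock_le hθ
  set b := fun (n : Fin 2 → ℕ) (γ : Fin 2 → ℤ × ℤ) => latCoef θ (fockBasis θ n) φ γ with hb
  have hbs : ∀ n, Summable fun γ => ‖b n γ‖ := fun n =>
    (smooth_fockBasis hθ n).summable_latCoef hθ hφ
  have hbs' : ∀ n, Summable fun γ => ‖b n (-γ)‖ := fun n => summable_norm_neg (hbs n)
  have hC' : ∀ n, ∑' γ, ‖b n (-γ)‖ ^ 2 ≤ C ^ 2 := fun n =>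
    ((Equiv.neg (Fin 2 → ℤ × ℤ)).tsum_eq fun γ => ‖b n γ‖ ^ 2).trans_le (hC n)
  set D := propagator θ μ₀ ε with hD
  have hD0 : ∀ n, 0 ≤ D n := fun n => (propagator_pos hθ ε n).le
  have hDs : Summable D := summable_propagator hθ hε
  have hDD := hDs.mul_of_nonneg hDs hD0 hD0
  -- the products of two coefficients and their sums
  set u := fun (m n : Fin 2 → ℕ) (γ : Fin 2 → ℤ × ℤ) => b m γ * b n (-γ) with hu
  have hus : ∀ m n, Summable fun γ => ‖u m n γ‖ := fun m n => summable_mul_of_norm (hbs m) (hbs' n)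
  have huC : ∀ m n, ∑' γ, ‖u m n γ‖ ≤ C * C := fun m n =>
    tsum_norm_mul_le (hbs m) (hbs' n) hC0 hC0 (hC m) (hC' n)
  set G : ((Fin 2 → ℕ) × (Fin 2 → ℕ)) × ((Fin 2 → ℤ × ℤ) × (Fin 2 → ℤ × ℤ)) → ℂ := fun t =>
    (D t.1.1 * D t.1.2 : ℂ) * (u t.1.1 t.1.2 t.2.1 * conj (u t.1.2 t.1.1 t.2.2)) with hG
  have hGn : ∀ t, ‖G t‖ = D t.1.1 * D t.1.2 * (‖u t.1.1 t.1.2 t.2.1‖ * ‖u t.1.2 t.1.1 t.2.2‖) := by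
    intro t
    rw [hG]
    simp only [norm_mul, Complex.norm_real, RCLike.norm_conj]
    rw [Real.norm_of_nonneg (hD0 _), Real.norm_of_nonneg (hD0 _)]
  have huu : ∀ p : (Fin 2 → ℕ) × (Fin 2 → ℕ), Summable fun q : (Fin 2 → ℤ × ℤ) × (Fin 2 → ℤ × ℤ) =>
      ‖u p.1 p.2 q.1‖ * ‖u p.2 p.1 q.2‖ := fun p =>
    (hus p.1 p.2).mul_of_nonneg (hus p.2 p.1) (fun _ => norm_nonneg _) (fun _ => norm_nonneg _)
  have hGs : Summable G := by
    refine Summable.of_norm ?_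
    refine (summable_prod_of_nonneg fun t => norm_nonneg _).2 ⟨fun p => ?_, ?_⟩
    · simp only [hGn]
      exact (huu p).mul_left _
    · refine Summable.of_nonneg_of_le (fun p => tsum_nonneg fun q => norm_nonneg _) (fun p => ?_)
        (hDD.mul_right (C * C * (C * C)))
      simp only [hGn]
      rw [tsum_mul_left]
      refine mul_le_mul_of_nonneg_left ?_ (mul_nonneg (hD0 _) (hD0 _))
      rw [((hus p.1 p.2).hasSum.mul (hus p.2 p.1).hasSum (huu p)).tsum_eq]
      exact mul_le_mul (huC _ _) (huC _ _) (tsum_nonneg fun _ => norm_nonneg _) (by positivity)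
  have h1 : (lam : ℂ) ^ 2 * ∑' t, G t = ∑' p : (Fin 2 → ℕ) × (Fin 2 → ℕ), (D p.1 * D p.2 : ℂ) *
      (antiMat θ lam φ p.1 p.2 * conj (antiMat θ lam φ p.2 p.1)) := by
    rw [← tsum_mul_left]
    refine (Summable.tsum_prod (hGs.mul_left _)).trans (tsum_congr fun p => ?_)
    have e1 : (∑' γ, conj (u p.2 p.1 γ)) = conj (∑' γ, u p.2 p.1 γ) := (Complex.conj_tsum _).symm
    have e2 := (hus p.1 p.2).of_norm.hasSum.mul
      (summable_conj_norm (hus p.2 p.1)).of_norm.hasSum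
      (Summable.of_norm (by simpa only [norm_mul, RCLike.norm_conj] using huu p))
    rw [e1] at e2
    have e3 := ((e2.mul_left (D p.1 * D p.2 : ℂ)).mul_left ((lam : ℂ) ^ 2)).tsum_eq
    refine Eq.trans e3 ?_
    rw [antiMat, antiMat, hessAnti, hessAnti, map_mul, Complex.conj_ofReal]
    ring
  have h2 : ∀ q : (Fin 2 → ℤ × ℤ) × (Fin 2 → ℤ × ℤ), ∑' p, G (p, q) =
      propForm θ μ₀ ε (weyl θ (latticePoint θ (-q.2)) φ)
          (weyl θ (latticePoint θ q.1) φ) *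
        propForm θ μ₀ ε (weyl θ (latticePoint θ q.2) φ)
          (weyl θ (latticePoint θ (-q.1)) φ) := by
    intro q
    have k1 := (hφ.map_weyl (latticePoint θ (-q.2))).hasSum_propagator (μ₀ := μ₀) hθ hε
      (hφ.map_weyl (latticePoint θ q.1))
    have k2 := (hφ.map_weyl (latticePoint θ q.2)).hasSum_propagator (μ₀ := μ₀) hθ hε
      (hφ.map_weyl (latticePoint θ (-q.1)))
    have hs := (Equiv.prodComm _ _).summable_iff.2 hGs
    have hsq : Summable fun p => G (p, q) := hs.prod_factor q
    have e : (fun p : (Fin 2 → ℕ) × (Fin 2 → ℕ) => G (p, q)) = fun p =>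
        ((propagator θ μ₀ ε p.1 : ℂ) *
          (bargmannInner θ (weyl θ (latticePoint θ (-q.2)) φ) (fockBasis θ p.1) *
            bargmannInner θ (fockBasis θ p.1) (weyl θ (latticePoint θ q.1) φ))) *
        ((propagator θ μ₀ ε p.2 : ℂ) *
          (bargmannInner θ (weyl θ (latticePoint θ q.2) φ) (fockBasis θ p.2) *
            bargmannInner θ (fockBasis θ p.2)
              (weyl θ (latticePoint θ (-q.1)) φ))) := by
      funext p
      simp only [hG, hu, hb, hD, latCoef, map_mul, bargmannInner_conj]
      ring
    rw [e] at hsq ⊢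
    exact (k1.mul k2 hsq).tsum_eq
  have hs' := (Equiv.prodComm ((Fin 2 → ℤ × ℤ) × (Fin 2 → ℤ × ℤ))
    ((Fin 2 → ℕ) × (Fin 2 → ℕ))).summable_iff.2 hGs
  have h3 : (fun q : (Fin 2 → ℤ × ℤ) × (Fin 2 → ℤ × ℤ) => ∑' p, G (p, q)) = _ := funext h2
  refine ⟨?_, ?_⟩
  · rw [← h3]
    exact hs'.prod
  · rw [← h1, ← h3]
    refine congrArg _ ?_
    rw [← (Equiv.prodComm _ _).tsum_eq G]
    exact Summable.tsum_prod hs'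

/-- The matrix coefficient of a translate of a lattice translate. -/
noncomputable def latTrans (θ : ℝ) (φ : (Fin 2 → ℂ) → ℂ) (δ : Fin 2 → ℤ × ℤ) (η : Fin 2 → ℂ) : ℂ :=
  bargmannInner θ φ (weyl θ (latticePoint θ δ) (weyl θ η φ))

lemma norm_latTrans (φ : (Fin 2 → ℂ) → ℂ) (δ : Fin 2 → ℤ × ℤ) (η : Fin 2 → ℂ) :
    ‖latTrans θ φ δ η‖ = ‖bargmannInner θ φ (weyl θ (latticePoint θ δ + η) φ)‖ := by
  rw [latTrans, inner_weyl_weyl', norm_mul, norm_exp_I_mul, one_mul]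

lemma Smooth.continuous_latTrans (hφ : Smooth θ φ) (δ : Fin 2 → ℤ × ℤ) :
    Continuous (latTrans θ φ δ) := by
  have h1 : latTrans θ φ δ = fun η => Complex.exp (Complex.I * sig θ (latticePoint θ δ) η) *
      bargmannInner θ φ (weyl θ (latticePoint θ δ + η) φ) := by
    funext η; exact inner_weyl_weyl' _ _ _ _
  have h2 : Continuous fun η => bargmannInner θ φ
      (weyl θ (latticePoint θ δ + η) φ) :=
    (hφ.continuous_inner_weyl hφ).comp (continuous_const.add continuous_id)
  have h3 := continuous_sig (θ := θ) (latticePoint θ δ)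
  rw [h1]
  fun_prop

/-- Up to a phase, the propagator between two lattice translates of `φ` is a Fourier coefficient of
a function that depends only on the sum of the two lattice points. -/
lemma propForm_lattice_eq (φ : (Fin 2 → ℂ) → ℂ) (γ γ' : Fin 2 → ℤ × ℤ) :
    propForm θ μ₀ ε (weyl θ (latticePoint θ (-γ')) φ) (weyl θ (latticePoint θ γ) φ) =
      Complex.exp (Complex.I * sig θ (latticePoint θ γ') (latticePoint θ γ)) *
        ∫ η, (propDensity θ μ₀ ε η : ℂ) * latTrans θ φ (γ' + γ) η *
          Complex.exp (Complex.I * ((2 * sig θ η (latticePoint θ γ) : ℝ) : ℂ)) := by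
  rw [propForm, ← integral_const_mul]
  congr 1
  funext η
  rw [latticePoint_neg, inner_weyl_left, neg_neg, weyl_comm η, weyl_const_mul,
    inner_const_mul_right, inner_weyl_weyl', latTrans, latticePoint_add]
  ring

/-- The Fourier transform of a correlation. -/
lemma integral_correlation {F G : (Fin 2 → ℂ) → ℂ} (hF : Continuous F) (hG : Continuous G)
    {A B : ℝ} (hFA : ∀ x, ‖F x‖ ≤ A * ((1 + ‖x‖) ^ 13)⁻¹)
    (hGB : ∀ x, ‖G x‖ ≤ B * ((1 + ‖x‖) ^ 8)⁻¹) :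
    Continuous (fun ζ => ∫ ξ, G (ζ + ξ) * F ξ) ∧ HasDecay (fun ζ => ∫ ξ, G (ζ + ξ) * F ξ) ∧
    ∀ v : Fin 2 → ℂ, ∫ ζ, (∫ ξ, G (ζ + ξ) * F ξ) *
        Complex.exp (Complex.I * ((2 * sig θ ζ v : ℝ) : ℂ)) =
      (∫ η, G η * Complex.exp (Complex.I * ((2 * sig θ η v : ℝ) : ℂ))) *
        ∫ ξ, F ξ * Complex.exp (Complex.I * ((2 * sig θ ξ (-v) : ℝ) : ℂ)) := by
  have hA0 : 0 ≤ A := by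
    have := (norm_nonneg _).trans (hFA 0)
    simpa using this
  have hB0 : 0 ≤ B := by
    have := (norm_nonneg _).trans (hGB 0)
    simpa using this
  -- the excess decay of `F` pays for moving the decay of `G` from `ζ + ξ` to `ζ`
  have hbd : ∀ ζ ξ, ‖G (ζ + ξ) * F ξ‖ ≤ B * A * (((1 + ‖ζ‖) ^ 8)⁻¹ * ((1 + ‖ξ‖) ^ 5)⁻¹) := by
    intro ζ ξ
    have h1 := hGB (ζ + ξ)
    have h2 := inv_pow_add_le ξ ζ 8
    rw [add_comm ξ ζ] at h2
    have h3 : (1 + ‖ξ‖) ^ 8 * ((1 + ‖ξ‖) ^ 13)⁻¹ = ((1 + ‖ξ‖) ^ 5)⁻¹ := by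
      have : 1 + ‖ξ‖ ≠ 0 := by positivity
      field_simp
    rw [norm_mul]
    calc _ ≤ (B * ((1 + ‖ξ‖) ^ 8 * ((1 + ‖ζ‖) ^ 8)⁻¹)) * (A * ((1 + ‖ξ‖) ^ 13)⁻¹) :=
          mul_le_mul (h1.trans (mul_le_mul_of_nonneg_left h2 hB0)) (hFA ξ) (norm_nonneg _)
            (by positivity)
      _ = B * A * (((1 + ‖ζ‖) ^ 8)⁻¹ * ((1 + ‖ξ‖) ^ 8 * ((1 + ‖ξ‖) ^ 13)⁻¹)) := by ring
      _ = _ := by rw [h3]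
  have hle1 : ∀ (x : Fin 2 → ℂ) (K : ℕ), ((1 + ‖x‖) ^ K)⁻¹ ≤ 1 := fun x K =>
    inv_le_one_of_one_le₀ (one_le_pow₀ (by linarith [norm_nonneg x]))
  have hcH : Continuous (fun ζ => ∫ ξ, G (ζ + ξ) * F ξ) := by
    refine continuous_of_dominated (bound := fun ξ => B * A * ((1 + ‖ξ‖) ^ 5)⁻¹)
      (fun ζ => by fun_prop) (fun ζ => Eventually.of_forall fun ξ => (hbd ζ ξ).trans ?_)
      (integrable_inv_pow.const_mul _) (Eventually.of_forall fun ξ => by fun_prop)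
    refine mul_le_mul_of_nonneg_left ?_ (by positivity)
    exact mul_le_of_le_one_left (by positivity) (hle1 ζ 8)
  set J : ℝ := ∫ ξ : Fin 2 → ℂ, ((1 + ‖ξ‖) ^ 5)⁻¹
  have hJ0 : 0 ≤ J := integral_nonneg fun ξ => by positivity
  refine ⟨hcH, ⟨B * A * J, by positivity, fun ζ => ?_⟩, fun v => ?_⟩
  · refine (norm_integral_le_integral_norm _).trans ?_
    calc ∫ ξ, ‖G (ζ + ξ) * F ξ‖ ≤ ∫ ξ, B * A * ((1 + ‖ζ‖) ^ 8)⁻¹ * ((1 + ‖ξ‖) ^ 5)⁻¹ := by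
          refine integral_mono_of_nonneg (Eventually.of_forall fun ξ => norm_nonneg _)
            (integrable_inv_pow.const_mul _) (Eventually.of_forall fun ξ => ?_)
          exact (hbd ζ ξ).trans (le_of_eq (by ring))
      _ = _ := by rw [integral_const_mul]; ring
  · set e : (Fin 2 → ℂ) → ℂ := fun ζ => Complex.exp (Complex.I * ((2 * sig θ ζ v : ℝ) : ℂ)) with he
    have hec : Continuous e := by
      have := continuous_sig_left (θ := θ) v
      rw [he]; fun_prop
    have hen : ∀ ζ, ‖e ζ‖ = 1 := fun ζ => norm_exp_I_mul _
    have hi8 : Integrable fun x : Fin 2 → ℂ => ((1 + ‖x‖) ^ 8)⁻¹ := by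
      refine integrable_inv_pow.mono' (Continuous.aestronglyMeasurable
        (Continuous.inv₀ (by fun_prop) fun x => by positivity))
        (Eventually.of_forall fun x => ?_)
      rw [Real.norm_of_nonneg (by positivity)]
      exact inv_anti₀ (by positivity) (pow_le_pow_right₀ (by linarith [norm_nonneg x]) (by norm_num))
    have hint : Integrable (Function.uncurry fun ζ ξ => G (ζ + ξ) * F ξ * e ζ)
        ((volume : Measure (Fin 2 → ℂ)).prod volume) := by
      refine ((hi8.mul_prod integrable_inv_pow).const_mul (B * A)).mono'
        (Continuous.aestronglyMeasurable (by fun_prop)) (Eventually.of_forall fun p => ?_)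
      simp only [Function.uncurry]
      rw [norm_mul, hen, mul_one]
      exact hbd p.1 p.2
    have h1 : ∀ ζ, (∫ ξ, G (ζ + ξ) * F ξ) * e ζ = ∫ ξ, G (ζ + ξ) * F ξ * e ζ := fun ζ =>
      (integral_mul_const _ _).symm
    refine (integral_congr_ae (Eventually.of_forall h1)).trans ?_
    rw [integral_integral_swap hint, ← integral_const_mul]
    refine integral_congr_ae (Eventually.of_forall fun ξ => ?_)
    have h2 : ∀ ζ, G (ζ + ξ) * F ξ * e ζ = (fun x => G x * e x *
        (F ξ * Complex.exp (Complex.I * ((2 * sig θ ξ (-v) : ℝ) : ℂ)))) (ζ + ξ) := by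
      intro ζ
      have h3 : e ζ = e (ζ + ξ) * Complex.exp (Complex.I * ((2 * sig θ ξ (-v) : ℝ) : ℂ)) := by
        rw [he]
        beta_reduce
        rw [← Complex.exp_add, sig_add_left, sig_neg_right]
        congr 1
        push_cast
        ring
      beta_reduce
      rw [h3]
      ring
    beta_reduce
    simp only [h2]
    rw [integral_add_right_eq_self (μ := volume) (fun x => G x * e x *
        (F ξ * Complex.exp (Complex.I * ((2 * sig θ ξ (-v) : ℝ) : ℂ)))) ξ]
    exact integral_mul_const _ _

/-- The property of the constant `c` in the Poisson summation formula. -/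
def IsPoissonConst (θ c : ℝ) : Prop := ∀ F : (Fin 2 → ℂ) → ℂ, Continuous F → HasDecay F →
  Summable (fun γ => ∫ x, F x *
    Complex.exp (Complex.I * ((-(2 * sig θ x (latticePoint θ γ)) : ℝ) : ℂ))) →
  ∑' γ, ∫ x, F x * Complex.exp (Complex.I * ((-(2 * sig θ x (latticePoint θ γ)) : ℝ) : ℂ)) =
    c * ∑' κ, F (dualPoint κ)

lemma Smooth.exists_latTrans_le (hφ : Smooth θ φ) (K : ℕ) : ∃ C : ℝ, 0 ≤ C ∧ ∀ δ η,
    ‖latTrans θ φ δ η‖ ≤ C * ((1 + ‖latticePoint θ δ + η‖) ^ K)⁻¹ := by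
  obtain ⟨C, hC0, hC⟩ := hφ.inner_weyl_decay hφ K
  exact ⟨C, hC0, fun δ η => by rw [norm_latTrans]; exact hC _⟩

lemma Smooth.exists_propDensity_latTrans_le (hθ : 0 < θ) (hε : 0 < ε) (hφ : Smooth θ φ)
    (δ : Fin 2 → ℤ × ℤ) (w : Fin 2 → ℂ) (K : ℕ) : ∃ C : ℝ, ∀ x,
      ‖(propDensity θ μ₀ ε (x + w) : ℂ) * latTrans θ φ δ (x + w)‖ ≤ C * ((1 + ‖x‖) ^ K)⁻¹ := by
  obtain ⟨C, hC0, hC⟩ := hφ.exists_latTrans_le K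
  obtain ⟨D, hD0, hD⟩ := exists_propDensity_le (μ₀ := μ₀) hθ hε
  have hω := freq_pos hθ
  refine ⟨D * (C * (1 + ‖latticePoint θ δ + w‖) ^ K), fun x => ?_⟩
  have h1 : propDensity θ μ₀ ε (x + w) ≤ D := (hD _).trans (mul_le_of_le_one_right hD0
    (Real.exp_le_one_iff.2 (by nlinarith [sq_nonneg ‖x + w‖])))
  have h2 := inv_pow_add_le (latticePoint θ δ + w) x K
  rw [add_assoc, add_comm w x] at h2
  rw [norm_mul, Complex.norm_real, Real.norm_of_nonneg (propDensity_nonneg _ _), mul_assoc,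
    mul_assoc]
  refine mul_le_mul h1 ((hC δ (x + w)).trans (mul_le_mul_of_nonneg_left h2 hC0)) (norm_nonneg _) hD0

/-- The weight in the overlap attached to a pair of a lattice point and a dual lattice point. -/
noncomputable def antiWeight (θ : ℝ) (φ : (Fin 2 → ℂ) → ℂ)
    (p : (Fin 2 → ℤ × ℤ) × (Fin 2 → ℤ × ℤ)) (ξ : Fin 2 → ℂ) : ℂ :=
  latTrans θ φ p.1 (ξ + mixedPoint θ (-p.1, p.2)) * latTrans θ φ (-p.1) ξ

/-- Poisson summation over the lattice at fixed sum `δ` of the two lattice indices. -/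
lemma Smooth.tsum_propForm_eq (hθ : 0 < θ) (hε : 0 < ε) {c : ℝ} (hc : IsPoissonConst θ c)
    (hφ : Smooth θ φ) (δ : Fin 2 → ℤ × ℤ)
    (hs : Summable fun γ => propForm θ μ₀ ε (weyl θ (latticePoint θ (-(δ - γ))) φ)
        (weyl θ (latticePoint θ γ) φ) *
      propForm θ μ₀ ε (weyl θ (latticePoint θ (δ - γ)) φ)
        (weyl θ (latticePoint θ (-γ)) φ)) :
    ∑' γ, propForm θ μ₀ ε (weyl θ (latticePoint θ (-(δ - γ))) φ)
        (weyl θ (latticePoint θ γ) φ) *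
      propForm θ μ₀ ε (weyl θ (latticePoint θ (δ - γ)) φ)
        (weyl θ (latticePoint θ (-γ)) φ) =
      c * ∑' κ, overlap θ μ₀ ε (mixedPoint θ (-δ, κ)) (antiWeight θ φ (δ, κ)) := by
  have hρc := continuous_propDensity (μ₀ := μ₀) hθ hε
  set F : (Fin 2 → ℂ) → ℂ := fun ξ => (propDensity θ μ₀ ε ξ : ℂ) * latTrans θ φ (-δ) ξ with hF
  set G : (Fin 2 → ℂ) → ℂ := fun x => (propDensity θ μ₀ ε (x + -latticePoint θ δ) : ℂ) *
    latTrans θ φ δ (x + -latticePoint θ δ) with hG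
  have hFc : Continuous F :=
    (Complex.continuous_ofReal.comp hρc).mul (hφ.continuous_latTrans (-δ))
  have hGc : Continuous G := by
    have hcc : Continuous fun x : Fin 2 → ℂ => x + -latticePoint θ δ :=
      continuous_id.add continuous_const
    exact (Complex.continuous_ofReal.comp (hρc.comp hcc)).mul ((hφ.continuous_latTrans δ).comp hcc)
  obtain ⟨A, hA⟩ := hφ.exists_propDensity_latTrans_le (μ₀ := μ₀) hθ hε (-δ) 0 13
  obtain ⟨B, hB⟩ := hφ.exists_propDensity_latTrans_le (μ₀ := μ₀) hθ hε δ (-latticePoint θ δ) 8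
  simp only [add_zero] at hA
  obtain ⟨h1, h2, h3⟩ := integral_correlation (θ := θ) hFc hGc hA hB
  -- the summand is a Fourier coefficient of a correlation; translating `G` by the lattice point of
  -- `δ` absorbs the phases
  have key : ∀ γ, propForm θ μ₀ ε (weyl θ (latticePoint θ (-(δ - γ))) φ)
        (weyl θ (latticePoint θ γ) φ) *
      propForm θ μ₀ ε (weyl θ (latticePoint θ (δ - γ)) φ)
        (weyl θ (latticePoint θ (-γ)) φ) =
      ∫ ζ, (∫ ξ, G (ζ + ξ) * F ξ) *
        Complex.exp (Complex.I * ((2 * sig θ ζ (latticePoint θ γ) : ℝ) : ℂ)) := by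
    intro γ
    have k1 := propForm_lattice_eq (θ := θ) (μ₀ := μ₀) (ε := ε) φ γ (δ - γ)
    have k2 := propForm_lattice_eq (θ := θ) (μ₀ := μ₀) (ε := ε) φ (-γ) (-(δ - γ))
    have d1 : δ - γ + γ = δ := sub_add_cancel δ γ
    have d2 : -(δ - γ) + -γ = -δ := by abel
    have d3 : sig θ (latticePoint θ (δ - γ)) (latticePoint θ γ) =
        sig θ (latticePoint θ δ) (latticePoint θ γ) := by
      rw [sub_eq_add_neg, latticePoint_add, latticePoint_neg, sig_add_left, sig_neg_left, sig_self]
      ring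
    have d4 : sig θ (latticePoint θ (-(δ - γ))) (latticePoint θ (-γ)) =
        sig θ (latticePoint θ δ) (latticePoint θ γ) := by
      rw [latticePoint_neg, latticePoint_neg, sig_neg_left, sig_neg_right, neg_neg, d3]
    rw [d1, d3] at k1
    rw [neg_neg, d2, d4, latticePoint_neg γ] at k2
    have k3 : ∫ η, G η * Complex.exp (Complex.I * ((2 * sig θ η (latticePoint θ γ) : ℝ) : ℂ)) =
        Complex.exp (Complex.I * ((2 * sig θ (latticePoint θ δ) (latticePoint θ γ) : ℝ) : ℂ)) *
        ∫ η, (propDensity θ μ₀ ε η : ℂ) * latTrans θ φ δ η *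
          Complex.exp (Complex.I * ((2 * sig θ η (latticePoint θ γ) : ℝ) : ℂ)) := by
      rw [← integral_const_mul, ← integral_add_right_eq_self (μ := volume) (fun η =>
        Complex.exp (Complex.I * ((2 * sig θ (latticePoint θ δ) (latticePoint θ γ) : ℝ) : ℂ)) *
        ((propDensity θ μ₀ ε η : ℂ) * latTrans θ φ δ η *
          Complex.exp (Complex.I * ((2 * sig θ η (latticePoint θ γ) : ℝ) : ℂ))))
        (-latticePoint θ δ)]
      refine integral_congr_ae (Eventually.of_forall fun η => ?_)
      have k4 : Complex.exp (Complex.I * ((2 * sig θ η (latticePoint θ γ) : ℝ) : ℂ)) =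
          Complex.exp (Complex.I * ((2 * sig θ (latticePoint θ δ) (latticePoint θ γ) : ℝ) : ℂ)) *
          Complex.exp (Complex.I * ((2 * sig θ (η + -latticePoint θ δ)
            (latticePoint θ γ) : ℝ) : ℂ)) := by
        rw [← Complex.exp_add, sig_add_left, sig_neg_left]
        congr 1
        push_cast
        ring
      simp only [hG]
      rw [k4]
      ring
    have k5 : Complex.exp (Complex.I * ((2 * sig θ (latticePoint θ δ) (latticePoint θ γ) : ℝ) : ℂ)) =
        Complex.exp (Complex.I * sig θ (latticePoint θ δ) (latticePoint θ γ)) *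
        Complex.exp (Complex.I * sig θ (latticePoint θ δ) (latticePoint θ γ)) := by
      rw [← Complex.exp_add]
      congr 1
      push_cast
      ring
    rw [h3 (latticePoint θ γ), k3, k5, k1, latticePoint_neg γ, k2]
    ring
  have key2 : ∀ γ, ∫ ζ, (∫ ξ, G (ζ + ξ) * F ξ) *
        Complex.exp (Complex.I * ((2 * sig θ ζ (latticePoint θ (-γ)) : ℝ) : ℂ)) =
      ∫ ζ, (∫ ξ, G (ζ + ξ) * F ξ) *
        Complex.exp (Complex.I * ((-(2 * sig θ ζ (latticePoint θ γ)) : ℝ) : ℂ)) := by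
    intro γ
    rw [latticePoint_neg]
    simp only [sig_neg_right, mul_neg]
  simp only [key] at hs ⊢
  have hs2 := (Equiv.neg (Fin 2 → ℤ × ℤ)).summable_iff.2 hs
  have ht := (Equiv.neg (Fin 2 → ℤ × ℤ)).tsum_eq fun γ => ∫ ζ, (∫ ξ, G (ζ + ξ) * F ξ) *
        Complex.exp (Complex.I * ((2 * sig θ ζ (latticePoint θ γ) : ℝ) : ℂ))
  have hs3 : Summable fun γ => ∫ ζ, (∫ ξ, G (ζ + ξ) * F ξ) *
        Complex.exp (Complex.I * ((-(2 * sig θ ζ (latticePoint θ γ)) : ℝ) : ℂ)) :=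
    hs2.congr fun γ => key2 γ
  rw [← ht]
  refine (tsum_congr fun γ => key2 γ).trans ((hc _ h1 h2 hs3).trans ?_)
  refine congrArg _ (tsum_congr fun κ => ?_)
  rw [overlap]
  refine integral_congr_ae (Eventually.of_forall fun ξ => ?_)
  have k6 : dualPoint κ + ξ + -latticePoint θ δ = ξ + mixedPoint θ (-δ, κ) := by
    rw [mixedPoint, latticePoint_neg]; abel
  simp only [hF, hG, antiWeight, k6]
  push_cast
  ring

end

section

variable {θ μ₀ ε : ℝ} {φ : (Fin 2 → ℂ) → ℂ}

/-! ### Convergence of the antilinear part -/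

/-- The divergent part of the overlaps after Poisson summation: it sits at the origin of the lattice
and of the dual lattice. -/
noncomputable def antiDiv (θ μ₀ ε : ℝ) (φ : (Fin 2 → ℂ) → ℂ)
    (p : (Fin 2 → ℤ × ℤ) × (Fin 2 → ℤ × ℤ)) : ℂ :=
  if p = 0 then selfOverlap θ μ₀ ε * bargmannInner θ φ φ ^ 2 else 0

lemma Smooth.exists_antiWeight_le (hθ : 0 < θ) (hφ : Smooth θ φ) : ∃ C : ℝ, 0 ≤ C ∧ ∀ p ξ,
    ‖antiWeight θ φ p ξ‖ ≤
      C * (((1 + ‖p.1‖) ^ 9)⁻¹ * ((1 + ‖p.2‖) ^ 9)⁻¹) * (1 + ‖ξ‖) ^ 18 := by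
  obtain ⟨C, hC0, hC⟩ := hφ.exists_latTrans_le 9
  obtain ⟨C₁, hC₁0, hC₁⟩ := exists_inv_pow_le (c := θ / √2) (by positivity) 9
  obtain ⟨C₂, hC₂0, hC₂⟩ := exists_inv_pow_le (c := 1 / √2) (by positivity) 9
  refine ⟨C * C₂ * (C * C₁), by positivity, fun p ξ => ?_⟩
  obtain ⟨δ, κ⟩ := p
  have h1 : ‖latTrans θ φ δ (ξ + mixedPoint θ (-δ, κ))‖ ≤
      C * ((1 + ‖ξ‖) ^ 9 * (C₂ * ((1 + ‖κ‖) ^ 9)⁻¹)) := by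
    have e : latticePoint θ δ + (ξ + mixedPoint θ (-δ, κ)) = ξ + dualPoint κ := by
      rw [mixedPoint, latticePoint_neg]; abel
    have := hC δ (ξ + mixedPoint θ (-δ, κ))
    rw [e] at this
    refine this.trans (mul_le_mul_of_nonneg_left ((inv_pow_add_le _ _ _).trans ?_) hC0)
    exact mul_le_mul_of_nonneg_left (hC₂ _ _ (norm_nonneg _) (norm_le_norm_dualPoint κ))
      (by positivity)
  have h2 : ‖latTrans θ φ (-δ) ξ‖ ≤ C * ((1 + ‖ξ‖) ^ 9 * (C₁ * ((1 + ‖δ‖) ^ 9)⁻¹)) := by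
    have := hC (-δ) ξ
    rw [add_comm (latticePoint θ (-δ)) ξ] at this
    refine this.trans (mul_le_mul_of_nonneg_left ((inv_pow_add_le _ _ _).trans ?_) hC0)
    refine mul_le_mul_of_nonneg_left (hC₁ _ _ (norm_nonneg _) ?_) (by positivity)
    rw [latticePoint_neg, norm_neg]
    exact norm_le_norm_latticePoint hθ δ
  rw [antiWeight, norm_mul]
  refine (mul_le_mul h1 h2 (norm_nonneg _) (by positivity)).trans (le_of_eq ?_)
  ring

lemma Smooth.continuous_antiWeight (hφ : Smooth θ φ) (p : (Fin 2 → ℤ × ℤ) × (Fin 2 → ℤ × ℤ)) :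
    Continuous (antiWeight θ φ p) :=
  ((hφ.continuous_latTrans p.1).comp (continuous_id.add continuous_const)).mul
    (hφ.continuous_latTrans (-p.1))

lemma antiWeight_zero (φ : (Fin 2 → ℂ) → ℂ) (ξ : Fin 2 → ℂ) :
    antiWeight θ φ 0 ξ = bargmannInner θ φ (weyl θ ξ φ) ^ 2 := by
  have h0 : mixedPoint θ (0, 0) = 0 := mixedPoint_zero
  simp only [antiWeight, Prod.fst_zero, Prod.snd_zero, neg_zero, h0, add_zero, latTrans,
    latticePoint_zero, weyl_zero]
  ring

/-- The overlaps converge after subtraction of the divergent part, with summable bounds: the small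
denominators enter only under a logarithm. -/
lemma Smooth.exists_overlap_antiWeight_le (hd : IsWeakDiophantine θ) (hθ : 0 < θ) (μ₀ : ℝ)
    (hφ : Smooth θ φ) : ∃ C : ℝ, 0 ≤ C ∧ ∀ p : (Fin 2 → ℤ × ℤ) × (Fin 2 → ℤ × ℤ),
      (∀ ε, 0 < ε → ‖overlap θ μ₀ ε (mixedPoint θ (-p.1, p.2)) (antiWeight θ φ p) -
        antiDiv θ μ₀ ε φ p‖ ≤ C * (((1 + ‖p.1‖) ^ 8)⁻¹ * ((1 + ‖p.2‖) ^ 8)⁻¹)) ∧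
      ∃ l, Tendsto (fun ε => overlap θ μ₀ ε (mixedPoint θ (-p.1, p.2)) (antiWeight θ φ p) -
        antiDiv θ μ₀ ε φ p) (𝓝[>] 0) (𝓝 l) := by
  obtain ⟨C₁, hC₁0, hC₁⟩ := exists_norm_overlap_le (μ₀ := μ₀) hθ 18
  obtain ⟨C₂, hC₂0, hC₂⟩ := exists_norm_overlap_zero_le (μ₀ := μ₀) hθ
  obtain ⟨C₃, hC₃0, hC₃⟩ := hd.exists_log_le
  obtain ⟨B, hB0, hB⟩ := hφ.exists_antiWeight_le hθ
  obtain ⟨D, hD0, hD⟩ := hφ.exists_inner_weyl_sub_le hθ hφ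
  set V := ‖hφ.vec‖ * ‖hφ.vec‖ with hV
  have hV0 : 0 ≤ V := by positivity
  refine ⟨C₁ * B * C₃ + C₂ * (D * (V + V)), by positivity, fun p => ?_⟩
  have hcont := hφ.continuous_antiWeight p
  -- the origin carries the divergence; at all other indices the position does not vanish
  by_cases h0 : p = 0
  · have hA : ∀ ξ, ‖antiWeight θ φ 0 ξ - antiWeight θ φ 0 0‖ ≤ D * (V + V) * ‖ξ‖ := by
      intro ξ
      rw [antiWeight_zero, antiWeight_zero, weyl_zero, sq_sub_sq, norm_mul, mul_comm]
      have h1 := hφ.norm_inner_weyl_le hφ ξ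
      have h2 := hφ.norm_inner_le hφ
      calc _ ≤ D * ‖ξ‖ * (V + V) :=
            mul_le_mul (hD ξ) ((norm_add_le _ _).trans (add_le_add h1 h2)) (norm_nonneg _)
              (by positivity)
        _ = _ := by ring
    rw [h0] at hcont
    obtain ⟨h1, h2⟩ := hC₂ _ _ hcont hA
    have h3 : antiWeight θ φ 0 0 = bargmannInner θ φ φ ^ 2 := by rw [antiWeight_zero, weyl_zero]
    have h4 : mixedPoint θ (0, 0) = 0 := mixedPoint_zero
    rw [h3] at h1 h2
    simp only [antiDiv, h0, if_true, Prod.fst_zero, Prod.snd_zero, neg_zero, h4]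
    refine ⟨fun ε hε => (h1 ε hε).trans ?_, h2⟩
    simp only [norm_zero, add_zero, one_pow, inv_one, mul_one]
    exact le_add_of_nonneg_left (by positivity)
  · have hq : ((-p.1, p.2) : (Fin 2 → ℤ × ℤ) × (Fin 2 → ℤ × ℤ)) ≠ 0 := by
      intro h
      rw [Prod.mk_eq_zero, neg_eq_zero] at h
      exact h0 (Prod.ext h.1 h.2)
    have hu := hd.mixedPoint_ne_zero hq
    have hB' : 0 ≤ B * (((1 + ‖p.1‖) ^ 9)⁻¹ * ((1 + ‖p.2‖) ^ 9)⁻¹) := by positivity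
    simp only [antiDiv, h0, if_false, sub_zero]
    refine ⟨fun ε hε => ?_, _, tendsto_overlap hθ hu hcont hB' (hB p)⟩
    refine (hC₁ ε hε.le _ hu _ _ hB' (hB p)).trans ?_
    have h4 := hC₃ _ hq
    simp only [norm_neg] at h4
    have h5 : ((1 + ‖p.1‖) ^ 9)⁻¹ * (1 + ‖p.1‖) = ((1 + ‖p.1‖) ^ 8)⁻¹ := by
      have : 1 + ‖p.1‖ ≠ 0 := by positivity
      field_simp
    have h6 : ((1 + ‖p.2‖) ^ 9)⁻¹ ≤ ((1 + ‖p.2‖) ^ 8)⁻¹ :=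
      inv_anti₀ (by positivity)
        (pow_le_pow_right₀ (by linarith [norm_nonneg p.2]) (by norm_num))
    calc _ ≤ C₁ * (B * (((1 + ‖p.1‖) ^ 9)⁻¹ * ((1 + ‖p.2‖) ^ 9)⁻¹)) * (C₃ * (1 + ‖p.1‖)) := by
          gcongr
      _ = C₁ * B * C₃ * ((((1 + ‖p.1‖) ^ 9)⁻¹ * (1 + ‖p.1‖)) * ((1 + ‖p.2‖) ^ 9)⁻¹) := by ring
      _ ≤ C₁ * B * C₃ * (((1 + ‖p.1‖) ^ 8)⁻¹ * ((1 + ‖p.2‖) ^ 8)⁻¹) := by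
          rw [h5]; gcongr
      _ ≤ _ := mul_le_mul_of_nonneg_right (le_add_of_nonneg_right (by positivity))
          (by positivity)

/-- The divergence of the antilinear part of the four-point function is a multiple of
`(Tr (φ, φ))²`. -/
lemma Smooth.exists_tendsto_antiPart (hd : IsWeakDiophantine θ) (hθ : 0 < θ) (μ₀ lam : ℝ) {c : ℝ}
    (hc : IsPoissonConst θ c) (hφ : Smooth θ φ) : ∃ L, Tendsto (fun ε =>
      ∑' p : (Fin 2 → ℕ) × (Fin 2 → ℕ), (propagator θ μ₀ ε p.1 * propagator θ μ₀ ε p.2 : ℂ) *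
        (antiMat θ lam φ p.1 p.2 * conj (antiMat θ lam φ p.2 p.1)) -
      (lam : ℂ) ^ 2 * (c * (selfOverlap θ μ₀ ε * bargmannInner θ φ φ ^ 2)))
      (𝓝[>] 0) (𝓝 L) := by
  obtain ⟨C, hC0, hC⟩ := hφ.exists_overlap_antiWeight_le hd hθ μ₀
  choose hC l hl using hC
  set O : ℝ → (Fin 2 → ℤ × ℤ) × (Fin 2 → ℤ × ℤ) → ℂ := fun ε p =>
    overlap θ μ₀ ε (mixedPoint θ (-p.1, p.2)) (antiWeight θ φ p) with hO
  have hbs : Summable fun p : (Fin 2 → ℤ × ℤ) × (Fin 2 → ℤ × ℤ) =>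
      C * (((1 + ‖p.1‖) ^ 8)⁻¹ * ((1 + ‖p.2‖) ^ 8)⁻¹) :=
    (summable_lattice.mul_of_nonneg summable_lattice (fun _ => by positivity)
      (fun _ => by positivity)).mul_left C
  have hlim : Tendsto (fun ε => ∑' p, (O ε p - antiDiv θ μ₀ ε φ p)) (𝓝[>] 0) (𝓝 (∑' p, l p)) := by
    refine tendsto_tsum_of_dominated_convergence hbs hl ?_
    filter_upwards [self_mem_nhdsWithin] with ε hε p using hC p ε hε
  refine ⟨_, ((hlim.const_mul (c : ℂ)).const_mul ((lam : ℂ) ^ 2)).congr' ?_⟩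
  filter_upwards [self_mem_nhdsWithin] with ε hε
  have hε' : 0 < ε := hε
  -- the sum over the lattice and its dual
  have s1 : Summable fun p => O ε p - antiDiv θ μ₀ ε φ p :=
    Summable.of_norm_bounded hbs fun p => hC p ε hε'
  have s2 : HasSum (antiDiv θ μ₀ ε φ) (selfOverlap θ μ₀ ε * bargmannInner θ φ φ ^ 2) :=
    hasSum_ite_eq 0 _
  have s3 : HasSum (O ε) (∑' p, (O ε p - antiDiv θ μ₀ ε φ p) +
      selfOverlap θ μ₀ ε * bargmannInner θ φ φ ^ 2) :=
    Eq.mpr (congrArg (fun F => HasSum F _) (funext fun p => by ring)) (s1.hasSum.add s2)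
  obtain ⟨hTs, hT⟩ := hφ.tsum_antiMat_eq (μ₀ := μ₀) hθ hε' lam
  -- the pairs of lattice points by their sum
  set e : (Fin 2 → ℤ × ℤ) × (Fin 2 → ℤ × ℤ) ≃ (Fin 2 → ℤ × ℤ) × (Fin 2 → ℤ × ℤ) :=
    { toFun := fun p => (p.2, p.1 - p.2)
      invFun := fun q => (q.1 + q.2, q.1)
      left_inv := fun p => Prod.ext (add_sub_cancel p.2 p.1) rfl
      right_inv := fun q => Prod.ext rfl (add_sub_cancel_left q.1 q.2) } with he
  have hTe := e.summable_iff.2 hTs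
  have h1 : ∑' q : (Fin 2 → ℤ × ℤ) × (Fin 2 → ℤ × ℤ),
        propForm θ μ₀ ε (weyl θ (latticePoint θ (-q.2)) φ)
          (weyl θ (latticePoint θ q.1) φ) *
        propForm θ μ₀ ε (weyl θ (latticePoint θ q.2) φ)
          (weyl θ (latticePoint θ (-q.1)) φ) = c * ∑' p, O ε p := by
    rw [← e.tsum_eq, s3.summable.tsum_prod, ← tsum_mul_left]
    refine (Summable.tsum_prod hTe).trans (tsum_congr fun δ => ?_)
    exact hφ.tsum_propForm_eq hθ hε' hc δ (hTe.prod_factor δ)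
  rw [hT, h1, s3.tsum_eq]
  ring

end

section

variable {θ : ℝ} {φ : (Fin 2 → ℂ) → ℂ}

/-! ### The four-point function -/

/-- The four-point function converges after shifts of both quartic couplings. -/
lemma Smooth.exists_tendsto_oneLoop_two (hd : IsWeakDiophantine θ) (hθ : 0 < θ) (μ₀ lam lam' : ℝ)
    {c d : ℝ} (hc : IsJanssenConst θ c) (hP : IsPoissonConst θ d) (hφ : Smooth θ φ) :
    ∃ L : ℝ, Tendsto (fun ε =>
      (Real.pi / freq θ) ^ 2 * (lam ^ 2 * (1 + c)) * selfOverlap θ μ₀ ε / 2 * quarticTerm θ φ +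
      ((Real.pi / freq θ) ^ 2 * (2 * lam * lam' + lam' ^ 2 + 2 * lam * (lam + lam') * c) +
        lam ^ 2 * d) * selfOverlap θ μ₀ ε / 2 * doubleTraceTerm θ φ +
      oneLoop θ μ₀ lam lam' ε 2 φ) (𝓝[>] 0) (𝓝 L) := by
  obtain ⟨R, ⟨L₀, hR⟩, hE⟩ := hφ.exists_oneLoop_two_eq hθ μ₀ lam lam'
  obtain ⟨L₁, h1⟩ := hφ.exists_tendsto_linPart hd hθ μ₀ lam lam' hc
  obtain ⟨L₂, h2⟩ := hφ.exists_tendsto_antiPart hd hθ μ₀ lam hP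
  rw [hφ.tsum_symbolCoef_opposite hθ lam lam' hc] at h1
  rw [← ofReal_massTerm] at h2
  have k1 := (Complex.continuous_re.tendsto _).comp h1
  have k2 := (Complex.continuous_re.tendsto _).comp h2
  refine ⟨_, ((((k1.const_mul 2).add (k2.const_mul 2)).add hR).const_mul (-(1 / 4))).congr' ?_⟩
  filter_upwards [self_mem_nhdsWithin] with ε hε
  rw [hE ε hε]
  simp only [Function.comp, Complex.sub_re, ← Complex.ofReal_mul, ← Complex.ofReal_pow,
    Complex.ofReal_re, doubleTraceTerm]
  ring

end

end HeisenbergModel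

theorem mainTheorem7 (θ : ℝ) (hθ : 0 < θ) (hdioph : HeisenbergModel.IsWeakDiophantine θ)
    (μ₀ lam lam' : ℝ) :
    -- the regularized one-loop functions are given by absolutely convergent sums
    (∀ φ ∈ HeisenbergModel.smoothModule θ, ∀ ε : ℝ, 0 < ε → ∀ N : ℕ, 1 ≤ N →
      Summable (HeisenbergModel.loopSummand θ μ₀ lam lam' ε φ N)) ∧
    -- cut-off dependent shifts of `μ₀²`, `λ` and `λ'`, the same for all external fields
    ∃ δμ δlam δlam' : ℝ → ℝ, ∀ φ ∈ HeisenbergModel.smoothModule θ,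
      (∃ L : ℝ, Tendsto (fun ε => δμ ε * HeisenbergModel.massTerm θ φ
          + HeisenbergModel.oneLoop θ μ₀ lam lam' ε 1 φ) (𝓝[>] 0) (𝓝 L)) ∧
      (∃ L : ℝ, Tendsto (fun ε => δlam ε / 2 * HeisenbergModel.quarticTerm θ φ
          + δlam' ε / 2 * HeisenbergModel.doubleTraceTerm θ φ
          + HeisenbergModel.oneLoop θ μ₀ lam lam' ε 2 φ) (𝓝[>] 0) (𝓝 L)) ∧
      (∀ N : ℕ, 3 ≤ N → ∃ L : ℝ, Tendsto (fun ε => HeisenbergModel.oneLoop θ μ₀ lam lam' ε N φ)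
          (𝓝[>] 0) (𝓝 L)) := by
  obtain ⟨c, hc⟩ := HeisenbergModel.exists_janssen hθ
  obtain ⟨d, hd⟩ := HeisenbergModel.exists_poisson hθ
  refine ⟨fun φ hφ ε hε N hN => (HeisenbergModel.smooth_of_mem_smoothModule hθ
      hφ).summable_loopSummand hθ μ₀ lam lam' hε hN,
    fun ε => -((Real.pi / HeisenbergModel.freq θ) ^ 2 *
      HeisenbergModel.propDensity θ μ₀ ε 0 * (lam + lam' + lam * c)),
    fun ε => (Real.pi / HeisenbergModel.freq θ) ^ 2 * (lam ^ 2 * (1 + c)) *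
      HeisenbergModel.selfOverlap θ μ₀ ε,
    fun ε => ((Real.pi / HeisenbergModel.freq θ) ^ 2 *
      (2 * lam * lam' + lam' ^ 2 + 2 * lam * (lam + lam') * c) + lam ^ 2 * d) *
      HeisenbergModel.selfOverlap θ μ₀ ε, fun φ hφ => ?_⟩
  replace hφ := HeisenbergModel.smooth_of_mem_smoothModule hθ hφ
  exact ⟨hφ.exists_tendsto_oneLoop_one hθ μ₀ lam lam' hc,
    hφ.exists_tendsto_oneLoop_two hdioph hθ μ₀ lam lam' hc hd,
    fun N hN => hφ.exists_tendsto_oneLoop hθ μ₀ lam lam' hN⟩
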